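/- **Setting.** Fix constants $\kappa,c_s,C_s>0$ and $\mu_p$ ($p\in\mathbb N$, $p\ge1$), and exponents $\varepsilon_*,\varepsilon^*$ with $0<\varepsilon^*\le\varepsilon_*/20$. For integers $1\le W\le N$, index $N\times N$ matrices by $\mathbb Z_N=\mathbb Z/N\mathbb Z$, let $|x|$ be the absolute value of the representative of $x\in\mathbb Z_N$ in $(-N/2,N/2]$, and let $B=\{1,\dots,W\}\subset\mathbb Z_N$. Let $f:\mathbb Z_N\to[0,\infty)$ be symmetric with $\sum_x f(x)=1$ and $$c_sW^{-1}\mathbf 1_{|x|\le W}\le f(x)\le C_sW^{-1}\mathbf 1_{|x|\le C_sW},$$ and for $\zeta\ge0$ let $$S_{ij}=f(i-j)-\frac{\zeta(1+\delta_{ij})}{W}\mathbf 1_{i,j\in B}.$$ Let $H=(H_{ij})$ be a real symmetric random matrix whose entries are centered, independent up to $H_{ij}=H_{ji}$, have variances $\mathbb E|H_{ij}|^2=S_{ij}$, and satisfy $(\mathbb E|H_{ij}|^p)^{1/p}\le\mu_p\,(\operatorname{Var}H_{ij})^{1/2}$ for all integers $p\ge1$. For $g\in\mathbb R^{\mathbb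 Z_N}$ and $z,\widetilde z$ with positive imaginary parts put $z_i=z$ for $i\in B$, $z_i=\widetilde z$ for $i\notin B$, and $$G=\big(H-\operatorname{diag}(g_i)-\operatorname{diag}(z_i)\big)^{-1},\qquad T_{ij}=\sum_kS_{ik}|G_{kj}|^2 .$$ Let $M=\operatorname{diag}(M_i)$, where $(M_i)$ is the solution of $$M_i^{-1}=-z_i-g_i-\sum_jS_{ij}M_j,\qquad i\in\mathbb Z_N,$$ with $\max_i|M_i-m_{\rm sc}(\widetilde z)|\le c$. Here $m_{\rm sc}(w)=\frac12\big(-w+\sqrt{w^2-4}\big)$ is the Stieltjes transform of the semicircle law, and $c>0$ is a constant depending only on $\kappa,c_s,C_s$; that such a $c$ can be chosen so that the solution exists and is unique under the assumptions below (for large $N$) is part of the claim. Write $\|X\|_{\max}=\max_{i,j}|X_{ij}|$. **Assumptions.** All data, including $W$, $f$, $\zeta$, $g$, $e$, $z$, $\widetilde z$, are deterministic apart from $H$, may depend on $N$, and satisfy $$|e|<2-\kappa,\quad |\operatorname{Re}z-e|\le N^{-\varepsilon_*+3\varepsilon^*},\quad N^{-\varepsilon_*}\le\operatorname{Im}z\le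 N^{-\varepsilon^*},\quad 0\le\zeta\le N^{-\varepsilon_*+\varepsilon^*},\quad \|g\|_\infty\le W^{-3/4},$$ $$\log_NW\ge\max\{\tfrac34+\varepsilon^*,\ \tfrac12+\varepsilon_*+\varepsilon^*\},\qquad \operatorname{Re}\widetilde z=e,\quad N^{-10}\le\operatorname{Im}\widetilde z\le\operatorname{Im}z .$$ **Lemma 2.7 (Weak $T$-equation estimate).** There is $\varepsilon_0>0$, depending only on $\kappa,c_s,C_s,(\mu_p)$, such that the following holds if $\varepsilon_*\le\varepsilon_0$. For all constants $\delta,\tau,D>0$ there are constants $\tau',D'>0$ and $N_0$, depending only on $\delta,\tau,D$ and on $\kappa,c_s,C_s,(\mu_p),\varepsilon_*,\varepsilon^*$, such that for all $N\ge N_0$, all data as above and every deterministic $\Phi>0$ with $W^{-1}\le\Phi^2\le N^{-\delta}$: if $$\mathbb P\big(\|G-M\|_{\max}\ge N^{\tau'}\Phi\big)\le N^{-D'},$$ then $$\mathbb P\Big(\|T\|_{\max}\ge N^{\tau}\Big(\frac{N}{W\operatorname{Im}z}+\frac{N^2}{W^2}\Big)\big(\Phi^3+N^{-1}\big)\Big)\le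 N^{-D}.$$ If moreover $$\Phi\le\min\Big\{\frac{W}{N^{1+\varepsilon_*+\varepsilon^*}},\ \frac{W^2}{N^{2+\varepsilon^*}}\Big\},$$ then with probability at least $1-N^{-D}$, $$\|G-M\|_{\max}\le\Phi N^{-\varepsilon^*/3}+N^{\tau}\Big(\frac1{\sqrt{W\operatorname{Im}z}}+\frac{N^{1/2}}{W}\Big).$$ -/

import Mathlib

open MeasureTheory ProbabilityTheory

noncomputable section

namespace BandMatrix

/-- The distance of `x` to `0` on the discrete circle, i.e. `|x|` for the representative of `x` in
`(-N/2, N/2]`. -/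
def cycAbs {N : ℕ} (x : ZMod N) : ℝ := (x.valMinAbs.natAbs : ℝ)

/-- The index block `{1, …, W}` in `ℤ / N`. -/
def block (N W : ℕ) : Set (ZMod N) := {i | ∃ k : ℕ, 1 ≤ k ∧ k ≤ W ∧ (k : ZMod N) = i}

/-- The variance profile functions `f` on `ℤ / N` of band matrices with band width `W` and
constants `cs`, `Cs`; the variances of the band matrix are `s i j = f (i - j)`. -/
structure IsBandProfile (cs Cs : ℝ) (N W : ℕ) [NeZero N] (f : ZMod N → ℝ) : Prop where
  nonneg : ∀ x, 0 ≤ f x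
  symm : ∀ x, f (-x) = f x
  sum_eq_one : ∑ x, f x = 1
  lower : ∀ x, cycAbs x ≤ W → cs / W ≤ f x
  upper : ∀ x, cycAbs x ≤ Cs * W → f x ≤ Cs / W
  supp : ∀ x, Cs * W < cycAbs x → f x = 0

open scoped Classical in
/-- The matrix `Σ`, with entries `(1 + δ_ij) / W` for `i, j` in the block and `0` elsewhere. -/
def sigmaMat (N W : ℕ) : Matrix (ZMod N) (ZMod N) ℝ := fun i j =>
  if i ∈ block N W ∧ j ∈ block N W then (1 + if i = j then 1 else 0) / (W : ℝ) else 0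

/-- The matrix of variances `S_ζ = S_0 - ζ Σ`, where `(S_0)_ij = f (i - j)`. -/
def varMat {N : ℕ} (W : ℕ) (f : ZMod N → ℝ) (ζ : ℝ) : Matrix (ZMod N) (ZMod N) ℝ := fun i j =>
  f (i - j) - ζ * sigmaMat N W i j

/-- `H` is a real symmetric `N × N` random matrix whose entries are centered, independent up to
the symmetry, have the variances `S i j`, and satisfy `(E |H_ij|^p)^(1/p) ≤ μ_p (Var H_ij)^(1/2)`
for every integer `p ≥ 1`. -/
structure IsSymmEnsemble {N : ℕ} {Ω : Type*} [MeasurableSpace Ω] (P : Measure Ω) (μ : ℕ → ℝ)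
    (S : Matrix (ZMod N) (ZMod N) ℝ) (H : Ω → Matrix (ZMod N) (ZMod N) ℝ) : Prop where
  measurable : ∀ i j, Measurable fun ω => H ω i j
  symm : ∀ ω i j, H ω i j = H ω j i
  indep : iIndepFun (fun (p : {p : ZMod N × ZMod N // p.1.val ≤ p.2.val}) (ω : Ω) =>
    H ω p.1.1 p.1.2) P
  integrable : ∀ i j, ∀ p : ℕ, 1 ≤ p → Integrable (fun ω => |H ω i j| ^ p) P
  centered : ∀ i j, ∫ ω, H ω i j ∂P = 0
  variance : ∀ i j, ∫ ω, H ω i j ^ 2 ∂P = S i j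
  moments : ∀ i j, ∀ p : ℕ, 1 ≤ p →
    (∫ ω, |H ω i j| ^ p ∂P) ^ (1 / (p : ℝ)) ≤ μ p * √(S i j)

open scoped Classical in
/-- The diagonal of the matrix of spectral parameters: `z` on the block, `z'` elsewhere. -/
def specParam {N : ℕ} (W : ℕ) (z z' : ℂ) (i : ZMod N) : ℂ :=
  if i ∈ block N W then z else z'

/-- The generalized resolvent `(H - diag g - Z)⁻¹` of a real matrix `H`, where `Z` is the diagonal
matrix with entry `z` on the block and `z'` elsewhere. -/
def resolvent {N : ℕ} [NeZero N] (W : ℕ) (g : ZMod N → ℝ) (z z' : ℂ)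
    (H : Matrix (ZMod N) (ZMod N) ℝ) : Matrix (ZMod N) (ZMod N) ℂ :=
  (H.map (fun x : ℝ => (x : ℂ)) - Matrix.diagonal (fun i => (g i : ℂ))
    - Matrix.diagonal (specParam W z z'))⁻¹

/-- The Stieltjes transform of the semicircle law, `(-z + √(z² - 4)) / 2`, on the upper half plane.
There the product of the principal roots of `z - 2` and `z + 2` is the branch of `√(z² - 4)` that
is asymptotic to `z` at infinity. -/
def mSc (z : ℂ) : ℂ := (-z + (z - 2) ^ (1 / 2 : ℂ) * (z + 2) ^ (1 / 2 : ℂ)) / 2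

/-- The vector `M` solves the self-consistent equations with data `S`, `g`, `z`, `z'`. -/
def SolvesSCE {N : ℕ} [NeZero N] (W : ℕ) (S : Matrix (ZMod N) (ZMod N) ℝ) (g : ZMod N → ℝ)
    (z z' : ℂ) (M : ZMod N → ℂ) : Prop :=
  ∀ i, M i ≠ 0 ∧ (M i)⁻¹ = -specParam W z z' i - (g i : ℂ) - ∑ j, (S i j : ℂ) * M j

/-- `M` solves the self-consistent equations and lies within `c` of `m_sc(z')` in the maximum
norm; for small `c` this singles out the branch that starts from `m_sc(z')`. -/
def IsSCESolutionNear {N : ℕ} [NeZero N] (c : ℝ) (W : ℕ) (S : Matrix (ZMod N) (ZMod N) ℝ)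
    (g : ZMod N → ℝ) (z z' : ℂ) (M : ZMod N → ℂ) : Prop :=
  SolvesSCE W S g z z' M ∧ ∀ i, ‖M i - mSc z'‖ ≤ c

/-- The `T` matrix, `T_ij = ∑_k S_ik |G_kj|²`. -/
def tMat {N : ℕ} [NeZero N] (S : Matrix (ZMod N) (ZMod N) ℝ) (G : Matrix (ZMod N) (ZMod N) ℂ) :
    Matrix (ZMod N) (ZMod N) ℝ := fun i j => ∑ k, S i k * ‖G k j‖ ^ 2

/-- The max norm of a matrix, the largest absolute value of its entries. -/
def maxNorm {N : ℕ} {𝕜 : Type*} [Norm 𝕜] (X : Matrix (ZMod N) (ZMod N) 𝕜) : ℝ :=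
  ⨆ p : ZMod N × ZMod N, ‖X p.1 p.2‖

end BandMatrix

end

set_option linter.unusedSectionVars false

noncomputable section

/-! Write G for the resolvent, φ for the a priori bound on |G - M|, and η for Im z. For l ≠ j one
has G_lj = -G_ll h_lj, where h_lj (`rowMinor`) is linear in row l with coefficients from the
resolvent of the matrix without that row, hence independent of the row. So |G_lj|² is |M_l|² times
the conditional variance of h_lj, up to a fluctuation, and the conditional variance is T_lj up to
O(φ³). Summation against S_il gives the T-equation T = S|M|²T + (a multiple of S_ij) + error, the
error being O(φ³) plus an averaged fluctuation (`GoodResolvent.T_equation`).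

The averaged fluctuation X_jk is O(φ³) as well, one order better than its summands. In a high moment
of X_jk the summand at l has mean zero given the other rows, so only the dependence of the remaining
factors on row l matters. Removing row m changes X_jk by at most Cφ(|X_mk| + |X_jm| + |X_mm| + φ³)
(`exists_fluctSum_sub_le`). The family of all X_jk is thus closed under this operation, and its
largest moment is bounded by half of itself plus a power of φ³ (`fluct_moment_le`). The trivial
bound |G| ≤ N^10 pays for the exceptional event.

To invert 1 - S|M|², take imaginary parts in the self-consistent equation: u = Im M/|M|² is positive
and solves u = Im z_i + S|M|²u (`im_sce_identity`). The substitution T = uy turns the quadratic form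
into the Dirichlet form of a walk of range W on the circle, killed at rate at least of order η on
the block. Effective resistances bound its Green function: 1/(Wη) for leaving through the block and
N/W² for reaching the block in N/W jumps (`exists_sq_smooth_le`, `exists_T_solver`). N sources of
size φ³ and one source of bounded total mass give the bound on T.

For G - M, Schur's formula minus the self-consistent equation reads (1 - M²S)(G_ii - M_i) = error.
In the bulk m_sc² stays away from 1, and the spectrum of S stays away from -1, so 1 - m_sc²S has a
bounded inverse in ℓ², and by a weighted estimate also in the maximum norm
(`exists_linfty_stability`). The same bound and a contraction argument produce M
(`exists_sce_solution`). The errors are linear and quadratic forms in one row, of size about √T by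
moment estimates for martingales (`moment_chain_le`). Hence |G - M| is at most √T + W^(-1/2) up to
small powers of N, and the extra upper bound on Φ makes the part of √T coming from Φ³ a small
multiple of Φ. -/

namespace BandMatrix

/-! ### Resolvents of real symmetric matrices: Ward identity, minors, Schur's formula. -/

section Resolvent

variable {ι : Type*} [DecidableEq ι]

/-- The matrix `H - diag w`. -/
def shifted (w : ι → ℂ) (H : Matrix ι ι ℝ) : Matrix ι ι ℂ :=
  H.map (fun x : ℝ => (x : ℂ)) - Matrix.diagonal w

/-- The matrix `H` with the row and the column `l` replaced by zero. -/
def del (l : ι) (H : Matrix ι ι ℝ) : Matrix ι ι ℝ := fun i j => if i = l ∨ j = l then 0 else H i j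

theorem del_symm {H : Matrix ι ι ℝ} (hH : ∀ i j, H i j = H j i) (l : ι) (i j : ι) :
    del l H i j = del l H j i := by
  simp only [del, hH i j, or_comm]

theorem del_row (H : Matrix ι ι ℝ) (l j : ι) : del l H l j = 0 := by simp [del]

theorem del_of_ne (H : Matrix ι ι ℝ) {l i j : ι} (hi : i ≠ l) (hj : j ≠ l) :
    del l H i j = H i j := by simp [del, hi, hj]

theorem abs_del_le (H : Matrix ι ι ℝ) (l i j : ι) : |del l H i j| ≤ |H i j| := by
  unfold del; split_ifs <;> simp

theorem del_comm (H : Matrix ι ι ℝ) (l m : ι) : del l (del m H) = del m (del l H) := by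
  ext i j; simp only [del]; split_ifs <;> rfl

theorem shifted_symm (w : ι → ℂ) {H : Matrix ι ι ℝ} (hH : ∀ i j, H i j = H j i) :
    (shifted w H).transpose = shifted w H := by
  ext i j
  simp only [shifted, Matrix.transpose_apply, Matrix.sub_apply, Matrix.map_apply, hH j i]
  congr 1
  by_cases h : i = j
  · subst h; rfl
  · rw [Matrix.diagonal_apply_ne _ h, Matrix.diagonal_apply_ne _ (Ne.symm h)]

variable [Fintype ι]

/-- The resolvent `(H - diag w)⁻¹`. -/
def res (w : ι → ℂ) (H : Matrix ι ι ℝ) : Matrix ι ι ℂ := (shifted w H)⁻¹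

theorem shifted_mulVec (w : ι → ℂ) (H : Matrix ι ι ℝ) (v : ι → ℂ) (i : ι) :
    (shifted w H).mulVec v i = ∑ j, (H i j : ℂ) * v j - w i * v i := by
  simp only [shifted, Matrix.sub_mulVec, Pi.sub_apply, Matrix.mulVec_diagonal]
  simp [Matrix.mulVec, dotProduct]

/-- The imaginary part of the quadratic form of `H - diag w`. -/
theorem im_quadratic_shifted (w : ι → ℂ) {H : Matrix ι ι ℝ} (hH : ∀ i j, H i j = H j i)
    (v : ι → ℂ) :
    (∑ i, (starRingEnd ℂ) (v i) * (shifted w H).mulVec v i).im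
      = -∑ i, (w i).im * ‖v i‖ ^ 2 := by
  have h1 : (∑ i, ∑ j, (starRingEnd ℂ) (v i) * ((H i j : ℂ) * v j)).im = 0 := by
    rw [← Complex.conj_eq_iff_im, map_sum]
    simp only [map_sum, map_mul, Complex.conj_conj, Complex.conj_ofReal]
    rw [Finset.sum_comm]
    refine Finset.sum_congr rfl fun i _ => Finset.sum_congr rfl fun j _ => ?_
    rw [hH j i]; ring
  have h2 : ∑ i, (starRingEnd ℂ) (v i) * (shifted w H).mulVec v i
      = ∑ i, ∑ j, (starRingEnd ℂ) (v i) * ((H i j : ℂ) * v j)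
        - ∑ i, w i * ((‖v i‖ ^ 2 : ℝ) : ℂ) := by
    rw [← Finset.sum_sub_distrib]
    refine Finset.sum_congr rfl fun i _ => ?_
    rw [shifted_mulVec, mul_sub, Finset.mul_sum]
    congr 1
    rw [Complex.ofReal_pow, ← Complex.mul_conj']
    ring
  rw [h2, Complex.sub_im, h1, Complex.im_sum, zero_sub]
  simp only [Complex.im_mul_ofReal]

/-- At a kernel vector the imaginary part of the quadratic form is zero, but it is also minus a sum
with strictly positive weights. -/
theorem shifted_mulVec_injective {w : ι → ℂ} (hw : ∀ i, 0 < (w i).im) {H : Matrix ι ι ℝ}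
    (hH : ∀ i j, H i j = H j i) : Function.Injective (shifted w H).mulVec := by
  intro v v' h
  have h0 : (shifted w H).mulVec (v - v') = 0 := by rw [Matrix.mulVec_sub, h, sub_self]
  have h1 := im_quadratic_shifted w hH (v - v')
  simp only [h0, Pi.zero_apply, mul_zero, Finset.sum_const_zero, Complex.zero_im] at h1
  have h2 : ∑ i, (w i).im * ‖(v - v') i‖ ^ 2 = 0 := by linarith
  rw [Finset.sum_eq_zero_iff_of_nonneg (fun i _ => mul_nonneg (hw i).le (sq_nonneg _))] at h2
  ext i
  have h3 := h2 i (Finset.mem_univ i)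
  rcases mul_eq_zero.mp h3 with h4 | h4
  · exact absurd h4 (hw i).ne'
  · have : (v - v') i = 0 := by simpa using h4
    simpa [sub_eq_zero] using this

theorem isUnit_shifted {w : ι → ℂ} (hw : ∀ i, 0 < (w i).im) {H : Matrix ι ι ℝ}
    (hH : ∀ i j, H i j = H j i) : IsUnit (shifted w H) :=
  Matrix.mulVec_injective_iff_isUnit.mp (shifted_mulVec_injective hw hH)

theorem shifted_mul_res {w : ι → ℂ} (hw : ∀ i, 0 < (w i).im) {H : Matrix ι ι ℝ}
    (hH : ∀ i j, H i j = H j i) : shifted w H * res w H = 1 :=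
  Matrix.mul_nonsing_inv _ ((Matrix.isUnit_iff_isUnit_det _).mp (isUnit_shifted hw hH))

theorem shifted_mulVec_res {w : ι → ℂ} (hw : ∀ i, 0 < (w i).im) {H : Matrix ι ι ℝ}
    (hH : ∀ i j, H i j = H j i) (j : ι) :
    (shifted w H).mulVec (fun x => res w H x j) = Pi.single j 1 := by
  ext i
  have h1 := congrFun (congrFun (shifted_mul_res hw hH) i) j
  rw [Matrix.mul_apply] at h1
  simp only [Matrix.mulVec, dotProduct]
  rw [h1, Matrix.one_apply, Pi.single_apply]

/-- Formulas for resolvents of minors are proved by checking that the proposed column solves the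
linear system. -/
theorem res_col_unique {w : ι → ℂ} (hw : ∀ i, 0 < (w i).im) {H : Matrix ι ι ℝ}
    (hH : ∀ i j, H i j = H j i) {j : ι} {v : ι → ℂ}
    (hv : (shifted w H).mulVec v = Pi.single j 1) (x : ι) : v x = res w H x j :=
  congrFun (shifted_mulVec_injective hw hH (hv.trans (shifted_mulVec_res hw hH j).symm)) x

theorem res_symm (w : ι → ℂ) {H : Matrix ι ι ℝ} (hH : ∀ i j, H i j = H j i) (i j : ι) :
    res w H i j = res w H j i := by
  have : (res w H).transpose = res w H := by
    rw [res, Matrix.transpose_nonsing_inv, shifted_symm w hH]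
  exact congrFun (congrFun this j) i

/-- The Ward identity `∑ₓ Im wₓ |G_xj|² = Im G_jj`. -/
theorem ward {w : ι → ℂ} (hw : ∀ i, 0 < (w i).im) {H : Matrix ι ι ℝ}
    (hH : ∀ i j, H i j = H j i) (j : ι) :
    ∑ x, (w x).im * ‖res w H x j‖ ^ 2 = (res w H j j).im := by
  have h := im_quadratic_shifted w hH (fun x => res w H x j)
  rw [shifted_mulVec_res hw hH] at h
  simp only [Pi.single_apply, mul_ite, mul_one, mul_zero, Finset.sum_ite_eq', Finset.mem_univ,
    if_true, Complex.conj_im] at h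
  linarith

/-- By the Ward identity a vanishing diagonal entry forces the whole column to vanish, which
contradicts its equation. All divisions by G_jj rest on this. -/
theorem res_diag_ne_zero {w : ι → ℂ} (hw : ∀ i, 0 < (w i).im) {H : Matrix ι ι ℝ}
    (hH : ∀ i j, H i j = H j i) (j : ι) : res w H j j ≠ 0 := by
  intro h0
  have h := ward hw hH j
  rw [h0, Complex.zero_im,
    Finset.sum_eq_zero_iff_of_nonneg (fun i _ => mul_nonneg (hw i).le (sq_nonneg _))] at h
  have h1 : (fun x => res w H x j) = 0 := by
    ext x
    rcases mul_eq_zero.mp (h x (Finset.mem_univ x)) with h4 | h4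
    · exact absurd h4 (hw x).ne'
    · simpa using h4
  have h2 := congrFun (shifted_mulVec_res hw hH j) j
  rw [h1] at h2
  simp at h2

/-- One summand of the Ward identity gives η|G_jj|² ≤ |G_jj|, so |G_jj| ≤ 1/η; another summand gives
η|G_ij|² ≤ 1/η. -/
theorem norm_res_le {w : ι → ℂ} {η : ℝ} (hη : 0 < η) (hw : ∀ i, η ≤ (w i).im)
    {H : Matrix ι ι ℝ} (hH : ∀ i j, H i j = H j i) (i j : ι) : ‖res w H i j‖ ≤ 1 / η := by
  have hw' : ∀ i, 0 < (w i).im := fun i => hη.trans_le (hw i)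
  have h := ward hw' hH j
  have h1 : ∀ x, η * ‖res w H x j‖ ^ 2 ≤ ‖res w H j j‖ := fun x => by
    calc η * ‖res w H x j‖ ^ 2 ≤ (w x).im * ‖res w H x j‖ ^ 2 := by gcongr; exact hw x
      _ ≤ ∑ x, (w x).im * ‖res w H x j‖ ^ 2 :=
        Finset.single_le_sum (f := fun x => (w x).im * ‖res w H x j‖ ^ 2)
          (fun i _ => mul_nonneg (hw' i).le (sq_nonneg _)) (Finset.mem_univ x)
      _ = (res w H j j).im := h
      _ ≤ ‖res w H j j‖ := (le_abs_self _).trans (Complex.abs_im_le_norm _)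
  have h2 : ‖res w H j j‖ ≤ 1 / η := by
    rw [le_div_iff₀ hη]
    by_contra hc
    push Not at hc
    have hp : 0 < ‖res w H j j‖ := norm_pos_iff.mpr (res_diag_ne_zero hw' hH j)
    nlinarith [h1 j]
  have h3 : ‖res w H i j‖ ^ 2 ≤ (1 / η) ^ 2 := by
    have := (h1 i).trans h2
    rw [le_div_iff₀ hη] at this
    rw [div_pow, one_pow, le_div_iff₀ (by positivity)]
    nlinarith
  exact (sq_le_sq₀ (norm_nonneg _) (by positivity)).mp h3

/-- The columns of the resolvent of the minor: for `j ≠ m` they are the vectors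
`G_xj - G_xm G_mj / G_mm`. -/
theorem shifted_mulVec_minor {w : ι → ℂ} (hw : ∀ i, 0 < (w i).im) {H : Matrix ι ι ℝ}
    (hH : ∀ i j, H i j = H j i) {m j : ι} (x : ι) :
    (shifted w H).mulVec
      (fun x => res w H x j - res w H x m * (res w H m j / res w H m m)) x
      = Pi.single (M := fun _ => ℂ) j 1 x
        - Pi.single (M := fun _ => ℂ) m 1 x * (res w H m j / res w H m m) := by
  have h1 : (fun x => res w H x j - res w H x m * (res w H m j / res w H m m))
      = (fun x => res w H x j) - (res w H m j / res w H m m) • (fun x => res w H x m) := by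
    ext x; simp [mul_comm]
  rw [h1, Matrix.mulVec_sub, Matrix.mulVec_smul, shifted_mulVec_res hw hH,
    shifted_mulVec_res hw hH]
  simp [mul_comm]

/-- `del` keeps the index set and only zeroes a row and a column. The right side vanishes at `x =
m`, and on vectors vanishing there `H` and `del m H` act alike away from row `m`. -/
theorem res_del {w : ι → ℂ} (hw : ∀ i, 0 < (w i).im) {H : Matrix ι ι ℝ}
    (hH : ∀ i j, H i j = H j i) {m j : ι} (hj : j ≠ m) (x : ι) :
    res w (del m H) x j = res w H x j - res w H x m * (res w H m j / res w H m m) := by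
  symm
  refine res_col_unique hw (del_symm hH m) (v := fun x => res w H x j
    - res w H x m * (res w H m j / res w H m m)) ?_ x
  ext y
  have h0 : res w H m j - res w H m m * (res w H m j / res w H m m) = 0 := by
    rw [mul_div_cancel₀ _ (res_diag_ne_zero hw hH m), sub_self]
  have hA := shifted_mulVec_minor hw hH (m := m) (j := j) y
  rw [shifted_mulVec] at hA ⊢
  by_cases hy : y = m
  · subst hy
    simp only [del_row, Complex.ofReal_zero, zero_mul, Finset.sum_const_zero, h0, mul_zero,
      sub_zero]
    rw [Pi.single_eq_of_ne (Ne.symm hj)]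
  · rw [Pi.single_eq_of_ne (i := m) hy, zero_mul, sub_zero] at hA
    rw [← hA]
    congr 1
    refine Finset.sum_congr rfl fun k _ => ?_
    by_cases hk : k = m
    · subst hk; rw [h0]; simp
    · rw [del_of_ne H hy hk]

theorem res_del_row {w : ι → ℂ} (hw : ∀ i, 0 < (w i).im) {H : Matrix ι ι ℝ}
    (hH : ∀ i j, H i j = H j i) {m j : ι} (hj : j ≠ m) : res w (del m H) m j = 0 := by
  rw [res_del hw hH hj, mul_div_cancel₀ _ (res_diag_ne_zero hw hH m), sub_self]

/-- `∑ₓ H_lx G⁽ˡ⁾_xj = - G_lj / G_ll`. -/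
theorem row_mul_minor {w : ι → ℂ} (hw : ∀ i, 0 < (w i).im) {H : Matrix ι ι ℝ}
    (hH : ∀ i j, H i j = H j i) {l j : ι} (hj : j ≠ l) :
    ∑ x, (H l x : ℂ) * res w (del l H) x j = -(res w H l j / res w H l l) := by
  have hA := shifted_mulVec_minor hw hH (m := l) (j := j) l
  rw [shifted_mulVec, mul_div_cancel₀ _ (res_diag_ne_zero hw hH l), sub_self, mul_zero, sub_zero,
    Pi.single_eq_of_ne (Ne.symm hj), Pi.single_eq_same, one_mul, zero_sub] at hA
  rw [← hA]
  exact Finset.sum_congr rfl fun x _ => by rw [res_del hw hH hj]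

/-- Schur's complement formula. -/
theorem inv_res_diag {w : ι → ℂ} (hw : ∀ i, 0 < (w i).im) {H : Matrix ι ι ℝ}
    (hH : ∀ i j, H i j = H j i) (l : ι) :
    (res w H l l)⁻¹ = H l l - w l
      - ∑ x ∈ Finset.univ.erase l, ∑ y ∈ Finset.univ.erase l,
          (H l x : ℂ) * res w (del l H) x y * H l y := by
  have h := congrFun (shifted_mulVec_res hw hH l) l
  rw [shifted_mulVec, Pi.single_eq_same] at h
  have hne := res_diag_ne_zero hw hH l
  -- In the `l`-th equation for column `l`, each off-diagonal entry is expanded by `row_mul_minor`;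
  -- a common factor G_ll comes out.
  have h2 : ∑ x, (H l x : ℂ) * res w H x l = H l l * res w H l l
      - res w H l l * ∑ x ∈ Finset.univ.erase l, ∑ y ∈ Finset.univ.erase l,
          (H l x : ℂ) * res w (del l H) x y * H l y := by
    rw [← Finset.add_sum_erase _ _ (Finset.mem_univ l), sub_eq_add_neg, Finset.mul_sum,
      ← Finset.sum_neg_distrib]
    congr 1
    refine Finset.sum_congr rfl fun x hx => ?_
    have hx' : x ≠ l := Finset.ne_of_mem_erase hx
    have h3 := row_mul_minor hw hH hx'
    rw [← Finset.add_sum_erase _ _ (Finset.mem_univ l), res_del_row hw hH hx', mul_zero,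
      zero_add] at h3
    have h4 : res w H x l = -(res w H l l * ∑ y ∈ Finset.univ.erase l,
        (H l y : ℂ) * res w (del l H) y x) := by
      rw [h3, res_symm w hH x l]; field_simp
    rw [h4, Finset.mul_sum, Finset.mul_sum, ← Finset.sum_neg_distrib, Finset.mul_sum,
      ← Finset.sum_neg_distrib]
    refine Finset.sum_congr rfl fun y _ => ?_
    rw [res_symm w (del_symm hH l) x y]; ring
  rw [h2] at h
  symm
  apply eq_inv_of_mul_eq_one_left
  linear_combination h

end Resolvent

/-! ### The Stieltjes transform of the semicircle law in the bulk. -/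

section Semicircle

theorem cpow_half_sq (x : ℂ) : (x ^ (1 / 2 : ℂ)) ^ 2 = x := by
  simp

theorem cpow_half_re_im_pos {x : ℂ} (hx : 0 < x.im) :
    0 < (x ^ (1 / 2 : ℂ)).re ∧ 0 < (x ^ (1 / 2 : ℂ)).im := by
  have hx0 : x ≠ 0 := by rintro rfl; simp at hx
  have harg0 : 0 < x.arg := by
    refine lt_of_le_of_ne (Complex.arg_nonneg_iff.mpr hx.le) fun h => ?_
    have := (Complex.arg_eq_zero_iff.mp h.symm).2
    exact hx.ne' this
  have hargpi : x.arg ≤ Real.pi := Complex.arg_le_pi x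
  have hpi := Real.pi_pos
  have him : (Complex.log x * (1 / 2)).im = x.arg / 2 := by
    rw [show (1 / 2 : ℂ) = ((1 / 2 : ℝ) : ℂ) by norm_num, Complex.im_mul_ofReal, Complex.log_im]
    ring
  have hargpi' : x.arg < Real.pi := by
    refine lt_of_le_of_ne hargpi fun h => ?_
    have := (Complex.arg_eq_pi_iff.mp h).2
    exact hx.ne' this
  rw [Complex.cpow_def_of_ne_zero hx0, Complex.exp_re, Complex.exp_im, him]
  exact ⟨mul_pos (Real.exp_pos _) (Real.cos_pos_of_mem_Ioo ⟨by linarith, by linarith⟩),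
    mul_pos (Real.exp_pos _) (Real.sin_pos_of_pos_of_lt_pi (by linarith) (by linarith))⟩

theorem mSc_quadratic (z : ℂ) : mSc z ^ 2 + z * mSc z + 1 = 0 := by
  have h1 := cpow_half_sq (z - 2)
  have h2 := cpow_half_sq (z + 2)
  unfold mSc
  linear_combination (1 / 4 : ℂ) * (z - 2) * h2
    + (1 / 4 : ℂ) * ((z + 2) ^ (1 / 2 : ℂ)) ^ 2 * h1

/-- Let s, t be the roots of z - 2 and z + 2, both in the open first quadrant. Then Im z = 2 Re s Im
s = 2 Re t Im t, so (Im st)² - (Im z)² = (Re s Im t - Im s Re t)². If this were zero, then s = t,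
which is absurd. -/
theorem mSc_im_pos {z : ℂ} (hz : 0 < z.im) : 0 < (mSc z).im := by
  obtain ⟨ha, hb⟩ := cpow_half_re_im_pos (x := z - 2) (by simpa using hz)
  obtain ⟨hc, hd⟩ := cpow_half_re_im_pos (x := z + 2) (by simpa using hz)
  have h1 := cpow_half_sq (z - 2)
  have h2 := cpow_half_sq (z + 2)
  set s := (z - 2) ^ (1 / 2 : ℂ)
  set t := (z + 2) ^ (1 / 2 : ℂ)
  have e1 := congrArg Complex.im h1
  have e2 := congrArg Complex.im h2
  have e3 := congrArg Complex.re h1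
  have e4 := congrArg Complex.re h2
  simp only [pow_two, Complex.mul_im, Complex.mul_re, Complex.sub_im, Complex.add_im,
    Complex.sub_re, Complex.add_re, Complex.re_ofNat, Complex.im_ofNat, sub_zero, add_zero]
    at e1 e2 e3 e4
  have h3 : (mSc z).im = (-z.im + (s.re * t.im + s.im * t.re)) / 2 := by
    have : mSc z = (((1 / 2 : ℝ) : ℂ)) * (-z + s * t) := by
      unfold mSc; push_cast; ring
    rw [this, Complex.im_ofReal_mul, Complex.add_im, Complex.mul_im, Complex.neg_im]
    ring
  rw [h3]
  have key : z.im < s.re * t.im + s.im * t.re := by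
    have hab : s.re * s.im = t.re * t.im := by linarith
    have hpos : 0 < s.re * t.im + s.im * t.re := by positivity
    have hne : s.re * t.im ≠ s.im * t.re := by
      intro h
      have hca : t.re ^ 2 = s.re ^ 2 := by
        have : s.re ^ 2 * s.im * t.im = t.re ^ 2 * s.im * t.im := by
          linear_combination t.im * s.re * hab + t.im * t.re * h
        have h5 : (s.re ^ 2 - t.re ^ 2) * (s.im * t.im) = 0 := by linear_combination this
        rcases mul_eq_zero.mp h5 with h6 | h6
        · linarith
        · exact absurd h6 (mul_pos hb hd).ne'
      have h6 : t.re = s.re := by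
        exact (pow_left_inj₀ hc.le ha.le two_ne_zero).mp hca
      rw [h6] at h
      have h7 : t.im = s.im := by
        have : s.re * (t.im - s.im) = 0 := by linear_combination h
        rcases mul_eq_zero.mp this with h8 | h8
        · exact absurd h8 ha.ne'
        · linarith
      rw [h6, h7] at e4
      linarith
    have hsq : 0 < (s.re * t.im - s.im * t.re) ^ 2 := by
      have : s.re * t.im - s.im * t.re ≠ 0 := sub_ne_zero.mpr hne
      positivity
    have h8 : z.im ^ 2 < (s.re * t.im + s.im * t.re) ^ 2 := by
      have h9 : z.im ^ 2 = 4 * (s.re * s.im) * (t.re * t.im) := by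
        rw [show z.im ^ 2 = z.im * z.im by ring]
        nth_rewrite 1 [← e1]
        rw [← e2]; ring
      rw [h9]
      linarith [show (s.re * t.im + s.im * t.re) ^ 2 - 4 * (s.re * s.im) * (t.re * t.im)
        = (s.re * t.im - s.im * t.re) ^ 2 by ring]
    exact lt_of_pow_lt_pow_left₀ 2 hpos.le h8
  linarith

theorem mSc_ne_zero (z : ℂ) : mSc z ≠ 0 := by
  intro h
  have := mSc_quadratic z
  simp [h] at this

theorem mSc_inv (z : ℂ) : (mSc z)⁻¹ = -z - mSc z := by
  have h := mSc_quadratic z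
  have h0 := mSc_ne_zero z
  field_simp
  linear_combination h

/-- `|m|² (Im m + Im z) = Im m`. -/
theorem mSc_normSq (z : ℂ) :
    ‖mSc z‖ ^ 2 * ((mSc z).im + z.im) = (mSc z).im := by
  have h := congrArg Complex.im (mSc_inv z)
  have h0 : ‖mSc z‖ ^ 2 ≠ 0 := by
    have := mSc_ne_zero z
    positivity
  rw [Complex.inv_im, Complex.normSq_eq_norm_sq] at h
  simp only [Complex.sub_im, Complex.neg_im] at h
  have h1 : (mSc z).im / ‖mSc z‖ ^ 2 = (mSc z).im + z.im := by
    rw [neg_div] at h; linarith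
  rw [div_eq_iff h0] at h1
  linarith

theorem norm_mSc_le_one {z : ℂ} (hz : 0 < z.im) : ‖mSc z‖ ≤ 1 := by
  have h := mSc_normSq z
  have h1 := mSc_im_pos hz
  have h2 : ‖mSc z‖ ^ 2 ≤ 1 := by
    by_contra hc
    push Not at hc
    nlinarith
  nlinarith [norm_nonneg (mSc z)]

theorem norm_mSc_ge {z : ℂ} (hz : 0 < z.im) (h3 : ‖z‖ ≤ 3) : 1 / 4 ≤ ‖mSc z‖ := by
  have h := congrArg norm (mSc_inv z)
  rw [norm_inv] at h
  have h1 : ‖-z - mSc z‖ ≤ 4 := by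
    calc ‖-z - mSc z‖ ≤ ‖-z‖ + ‖mSc z‖ := norm_sub_le _ _
      _ ≤ 4 := by rw [norm_neg]; linarith [norm_mSc_le_one hz]
  have h0 : 0 < ‖mSc z‖ := norm_pos_iff.mpr (mSc_ne_zero z)
  rw [← h, inv_le_comm₀ h0 (by norm_num)] at h1
  linarith

/-- Put q = |m|². The real part of 1/m = -z - m reads (1 + q) Re m = -q Re z, and 4q ≤ (1 + q)²
gives (Re m)² ≤ (1 - κ/2)² q. Hence (Im m)² ≥ q (1 - (1 - κ/2)²), where q ≥ 1/16. -/
theorem mSc_im_sq_ge {κ : ℝ} (hκ : 0 < κ) {z : ℂ} (hz : 0 < z.im) (hz1 : z.im ≤ 1)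
    (hre : |z.re| ≤ 2 - κ) : κ / 32 ≤ (mSc z).im ^ 2 := by
  have hκ2 : κ ≤ 2 := by linarith [abs_nonneg z.re]
  have h3 : ‖z‖ ≤ 3 := by
    calc ‖z‖ ≤ |z.re| + |z.im| := Complex.norm_le_abs_re_add_abs_im z
      _ ≤ 3 := by rw [abs_of_pos hz]; linarith
  set q := ‖mSc z‖ ^ 2 with hq
  have hq1 : q ≤ 1 := by
    have := norm_mSc_le_one hz
    have h0 := norm_nonneg (mSc z)
    rw [hq]; nlinarith
  have hq2 : 1 / 16 ≤ q := by
    have := norm_mSc_ge hz h3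
    rw [hq]; nlinarith
  have hqs : q = (mSc z).re ^ 2 + (mSc z).im ^ 2 := by
    rw [hq, ← Complex.normSq_eq_norm_sq, Complex.normSq_apply]; ring
  have hx : (mSc z).re * (1 + q) = -z.re * q := by
    have h := congrArg Complex.re (mSc_inv z)
    rw [Complex.inv_re, Complex.normSq_eq_norm_sq, ← hq] at h
    simp only [Complex.sub_re, Complex.neg_re] at h
    have : q ≠ 0 := by linarith
    field_simp at h
    linarith
  have hx2 : (mSc z).re ^ 2 * (1 + q) ^ 2 ≤ (2 - κ) ^ 2 * q ^ 2 := by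
    have : (mSc z).re ^ 2 * (1 + q) ^ 2 = z.re ^ 2 * q ^ 2 := by
      linear_combination ((mSc z).re * (1 + q) - z.re * q) * hx
    rw [this]
    have : z.re ^ 2 ≤ (2 - κ) ^ 2 := sq_le_sq' (by linarith [(abs_le.mp hre).1]) (abs_le.mp hre).2
    gcongr
  have hx3 : (mSc z).re ^ 2 ≤ (1 - κ / 2) ^ 2 * q := by
    have h4 : (2 - κ) ^ 2 * q ^ 2 ≤ ((1 - κ / 2) ^ 2 * q) * (1 + q) ^ 2 := by
      have : ((1 - κ / 2) ^ 2 * q) * (1 + q) ^ 2 - (2 - κ) ^ 2 * q ^ 2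
          = (1 - κ / 2) ^ 2 * q * (1 - q) ^ 2 := by ring
      have h5 : 0 ≤ (1 - κ / 2) ^ 2 * q * (1 - q) ^ 2 := by positivity
      linarith
    have h6 : 0 < (1 + q) ^ 2 := by positivity
    exact le_of_mul_le_mul_right (hx2.trans h4) h6
  have h7 : κ / 2 ≤ 1 - (1 - κ / 2) ^ 2 := by nlinarith
  have h8 : 1 / 16 * (κ / 2) ≤ q * (1 - (1 - κ / 2) ^ 2) := by gcongr
  linarith

end Semicircle

/-! ### Sums over the discrete circle and the spectral gap at -1. -/

section Circle

variable {N : ℕ} [NeZero N]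

theorem cycAbs_nonneg (x : ZMod N) : 0 ≤ cycAbs x := Nat.cast_nonneg _

theorem cycAbs_natCast_le (n : ℕ) : cycAbs (n : ZMod N) ≤ n := by
  unfold cycAbs
  rw [ZMod.valMinAbs_natAbs_eq_min]
  exact_mod_cast (min_le_left _ _).trans (by rw [ZMod.val_natCast]; exact Nat.mod_le _ _)

theorem cycAbs_neg (x : ZMod N) : cycAbs (-x) = cycAbs x := by
  unfold cycAbs; rw [ZMod.natAbs_valMinAbs_neg]

theorem cycAbs_add_le (x y : ZMod N) : cycAbs (x + y) ≤ cycAbs x + cycAbs y := by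
  unfold cycAbs
  exact_mod_cast (ZMod.natAbs_valMinAbs_add_le x y).trans (Int.natAbs_add_le _ _)

theorem abs_cycAbs_sub_le (i₀ i j : ZMod N) :
    |cycAbs (i₀ - i) - cycAbs (i₀ - j)| ≤ cycAbs (i - j) := by
  have h1 := cycAbs_add_le (i₀ - i) (i - j)
  have h2 := cycAbs_add_le (i₀ - j) (j - i)
  rw [show i₀ - i + (i - j) = i₀ - j by ring] at h1
  rw [show i₀ - j + (j - i) = i₀ - i by ring, ← cycAbs_neg (j - i), neg_sub] at h2
  rw [abs_le]; constructor <;> linarith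

theorem natCast_injOn_range : Set.InjOn (fun t : ℕ => (t : ZMod N)) (Finset.range N) := by
  intro a ha b hb h
  simp only [Finset.coe_range, Set.mem_Iio] at ha hb
  have := (ZMod.natCast_eq_natCast_iff' a b N).mp h
  rwa [Nat.mod_eq_of_lt ha, Nat.mod_eq_of_lt hb] at this

theorem sum_range_eq_sum_univ {M : Type*} [AddCommMonoid M] (F : ZMod N → M) :
    ∑ t ∈ Finset.range N, F (t : ZMod N) = ∑ x, F x := by
  refine Finset.sum_nbij (fun t : ℕ => (t : ZMod N)) (fun _ _ => Finset.mem_univ _)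
    natCast_injOn_range ?_ (fun _ _ => rfl)
  intro x _
  exact ⟨x.val, by simpa using ZMod.val_lt x, by simp⟩

theorem sum_shift_range {M : Type*} [AddCommMonoid M] (F : ZMod N → M) (j : ZMod N) :
    ∑ t ∈ Finset.range N, F (j + (t : ZMod N)) = ∑ x, F x := by
  rw [sum_range_eq_sum_univ (fun x => F (j + x))]
  exact Fintype.sum_equiv (Equiv.addLeft j) _ _ (fun _ => rfl)

theorem sum_Icc_le_sum_univ {F : ZMod N → ℝ} (hF : ∀ x, 0 ≤ F x) {W : ℕ} (hW : W ≤ N)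
    (j : ZMod N) : ∑ t ∈ Finset.Icc 1 W, F (j + (t : ZMod N)) ≤ ∑ x, F x := by
  rw [← sum_shift_range F (j + 1)]
  have : ∑ t ∈ Finset.Icc 1 W, F (j + (t : ZMod N))
      = ∑ t ∈ Finset.range W, F (j + 1 + (t : ZMod N)) := by
    rw [Finset.range_eq_Ico, Finset.sum_Ico_eq_sum_range, ← Finset.Ico_succ_right_eq_Icc,
      Finset.sum_Ico_eq_sum_range]
    simp only [Nat.succ_eq_succ, Nat.succ_sub_one]
    refine Finset.sum_congr (by simp) fun t _ => ?_
    congr 1; push_cast; ring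
  rw [this]
  exact Finset.sum_le_sum_of_subset_of_nonneg (Finset.range_mono hW) (fun _ _ _ => hF _)

/-- A summable weight of width `W` on the circle. -/
theorem sum_cycAbs_weight_le {W : ℕ} (hW : 1 ≤ W) (i₀ : ZMod N) :
    ∑ j, (W : ℝ) ^ 2 / ((W : ℝ) ^ 2 + cycAbs (i₀ - j) ^ 2) ≤ 8 * W := by
  have hW' : (1 : ℝ) ≤ W := by exact_mod_cast hW
  have e1 : ∑ j, (W : ℝ) ^ 2 / ((W : ℝ) ^ 2 + cycAbs (i₀ - j) ^ 2)
      = ∑ x : ZMod N, (W : ℝ) ^ 2 / ((W : ℝ) ^ 2 + cycAbs x ^ 2) :=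
    Fintype.sum_equiv (Equiv.subLeft i₀) _ _ (fun _ => rfl)
  set g : ℕ → ℝ := fun t => (W : ℝ) ^ 2 / ((W : ℝ) ^ 2 + (t : ℝ) ^ 2) with hg
  have hg0 : ∀ t, 0 ≤ g t := fun t => by positivity
  -- The bound telescopes: (W + n)(W + n + 1) ≤ 2(W² + (n + 1)²), so the new summand is at most the
  -- drop of 2W²/(W + n).
  have hgle : ∀ n : ℕ, ∑ t ∈ Finset.range (n + 1), g t ≤ 1 + 2 * (W : ℝ) - 2 * W ^ 2 / (W + n) := by
    intro n
    induction n with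
    | zero =>
      simp only [zero_add, Finset.sum_range_one, hg]
      have : (2 : ℝ) * W ^ 2 / (W + (0 : ℕ)) = 2 * W := by
        field_simp; simp
      rw [this]
      have : (W : ℝ) ^ 2 / (W ^ 2 + ((0 : ℕ) : ℝ) ^ 2) = 1 := by
        field_simp; simp
      rw [this]; linarith
    | succ n ih =>
      rw [Finset.sum_range_succ]
      have : g (n + 1) ≤ 2 * (W : ℝ) ^ 2 / (W + n) - 2 * W ^ 2 / (W + (n + 1 : ℕ)) := by
        rw [div_sub_div _ _ (by positivity) (by positivity), hg]
        rw [div_le_div_iff₀ (by positivity) (by positivity)]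
        push_cast
        have hn : (0 : ℝ) ≤ n := Nat.cast_nonneg n
        have : 0 ≤ (W : ℝ) ^ 2 * ((W - (n + 1)) ^ 2 + (W + n + 1)) := by positivity
        nlinarith
      linarith
  rw [e1, ← sum_range_eq_sum_univ]
  -- The distance of `t` to 0 is `t` or `N - t`; both branches are summed.
  calc ∑ t ∈ Finset.range N, (W : ℝ) ^ 2 / ((W : ℝ) ^ 2 + cycAbs (t : ZMod N) ^ 2)
      ≤ ∑ t ∈ Finset.range N, (g t + g (N - t)) := by
        refine Finset.sum_le_sum fun t ht => ?_
        have hv : (t : ZMod N).val = t := by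
          rw [ZMod.val_natCast, Nat.mod_eq_of_lt (Finset.mem_range.mp ht)]
        unfold cycAbs
        rw [ZMod.valMinAbs_natAbs_eq_min, hv]
        rcases min_choice t (N - t) with h | h
        · rw [h]; linarith [hg0 (N - t), show g t = (W : ℝ) ^ 2 / ((W : ℝ) ^ 2 + (t : ℝ) ^ 2) from rfl]
        · rw [h]; linarith [hg0 t, show g (N - t)
            = (W : ℝ) ^ 2 / ((W : ℝ) ^ 2 + ((N - t : ℕ) : ℝ) ^ 2) from rfl]
    _ = ∑ t ∈ Finset.range N, g t + ∑ t ∈ Finset.range N, g (N - t) := Finset.sum_add_distrib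
    _ ≤ ∑ t ∈ Finset.range (N + 1), g t + ∑ t ∈ Finset.range (N + 1), g t := by
        have h1 : ∑ t ∈ Finset.range N, g t ≤ ∑ t ∈ Finset.range (N + 1), g t :=
          Finset.sum_le_sum_of_subset_of_nonneg (Finset.range_mono (Nat.le_succ N))
            (fun _ _ _ => hg0 _)
        have h2 : ∑ t ∈ Finset.range (N + 1), g (N - t) = ∑ t ∈ Finset.range (N + 1), g t := by
          rw [← Finset.sum_range_reflect g (N + 1)]
          exact Finset.sum_congr rfl fun t _ => by simp
        have h3 : ∑ t ∈ Finset.range N, g (N - t) ≤ ∑ t ∈ Finset.range (N + 1), g (N - t) :=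
          Finset.sum_le_sum_of_subset_of_nonneg (Finset.range_mono (Nat.le_succ N))
            (fun _ _ _ => hg0 _)
        linarith
    _ ≤ 8 * W := by
        have := hgle N
        have h4 : 0 ≤ 2 * (W : ℝ) ^ 2 / (W + N) := by positivity
        linarith

/-- Comparison of a kernel bounded below on `|i - j| ≤ W` with the uniform kernel. -/
theorem sum_stencil_le {S : Matrix (ZMod N) (ZMod N) ℝ} {W : ℕ} (hWN : W ≤ N) {c : ℝ}
    (hS : ∀ i j, 0 ≤ S i j)
    (hlow : ∀ (i : ZMod N) (t : ℕ), 1 ≤ t → t ≤ W → c ≤ S i (i + (t : ZMod N)))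
    {φ : ZMod N → ZMod N → ℝ} (hφ : ∀ i j, 0 ≤ φ i j) :
    c * ∑ i, ∑ t ∈ Finset.Icc 1 W, φ i (i + (t : ZMod N)) ≤ ∑ i, ∑ j, S i j * φ i j := by
  rw [Finset.mul_sum]
  refine Finset.sum_le_sum fun i _ => ?_
  rw [Finset.mul_sum]
  refine le_trans (Finset.sum_le_sum fun t ht => ?_)
    (sum_Icc_le_sum_univ (F := fun j => S i j * φ i j)
      (fun j => mul_nonneg (hS i j) (hφ i j)) hWN i)
  rw [Finset.mem_Icc] at ht
  exact mul_le_mul_of_nonneg_right (hlow i t ht.1 ht.2) (hφ _ _)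

theorem sum_add_le_sum_Icc {g : ℕ → ℝ} (hg : ∀ t, 0 ≤ g t) {L W a : ℕ} (h : a + L ≤ W) :
    ∑ b ∈ Finset.Icc 1 L, g (a + b) ≤ ∑ t ∈ Finset.Icc 1 W, g t := by
  have : ∑ b ∈ Finset.Icc 1 L, g (a + b) = ∑ t ∈ (Finset.Icc 1 L).image (fun b => a + b), g t :=
    (Finset.sum_image (fun x _ y _ hxy => by simpa using hxy)).symm
  rw [this]
  refine Finset.sum_le_sum_of_subset_of_nonneg (fun t ht => ?_) (fun _ _ _ => hg _)
  obtain ⟨b, hb, rfl⟩ := Finset.mem_image.mp ht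
  rw [Finset.mem_Icc] at hb ⊢
  omega

/-- Kernels bounded below on `|i - j| ≤ W` have spectrum away from `-1`. -/
theorem sum_sq_le_sum_add_sq {W : ℕ} (hW : 2 ≤ W) (v : ZMod N → ℝ) :
    4 * W * ∑ i, v i ^ 2
      ≤ 27 * ∑ i, ∑ t ∈ Finset.Icc 1 W, (v i + v (i + (t : ZMod N))) ^ 2 := by
  -- For a, b ≤ L the points i, i + a, i + a + b form a triangle with sides at most W. An odd cycle
  -- does not allow a sign change along every edge: 2v = (v + p) - (p + q) + (v + q).
  set L := W / 2 with hL
  have hL1 : 1 ≤ L := by omega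
  have hL2 : 2 * L ≤ W := by omega
  have hL3 : W ≤ 3 * L := by omega
  set E := ∑ i, ∑ t ∈ Finset.Icc 1 W, (v i + v (i + (t : ZMod N))) ^ 2 with hE
  have hE0 : 0 ≤ E := Finset.sum_nonneg fun _ _ => Finset.sum_nonneg fun _ _ => sq_nonneg _
  have hsub : ∀ i : ZMod N, ∀ a : ℕ, a + L ≤ W →
      ∑ b ∈ Finset.Icc 1 L, (v i + v (i + ((a + b : ℕ) : ZMod N))) ^ 2
        ≤ ∑ t ∈ Finset.Icc 1 W, (v i + v (i + (t : ZMod N))) ^ 2 := fun i a ha =>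
    sum_add_le_sum_Icc (g := fun t => (v i + v (i + (t : ZMod N))) ^ 2) (fun _ => sq_nonneg _) ha
  have hA : ∑ a ∈ Finset.Icc 1 L, ∑ b ∈ Finset.Icc 1 L, ∑ i, (v i + v (i + (a : ZMod N))) ^ 2
      ≤ L * E := by
    simp only [Finset.sum_const, Nat.card_Icc, Nat.add_sub_cancel, nsmul_eq_mul,
      ← Finset.mul_sum]
    gcongr
    rw [Finset.sum_comm]
    refine Finset.sum_le_sum fun i _ => ?_
    have := hsub i 0 (by omega)
    simpa using this
  have hB : ∑ a ∈ Finset.Icc 1 L, ∑ b ∈ Finset.Icc 1 L,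
      ∑ i, (v (i + (a : ZMod N)) + v (i + (a : ZMod N) + (b : ZMod N))) ^ 2 ≤ L * E := by
    have h1 : ∀ a ∈ Finset.Icc 1 L, ∑ b ∈ Finset.Icc 1 L,
        ∑ i, (v (i + (a : ZMod N)) + v (i + (a : ZMod N) + (b : ZMod N))) ^ 2 ≤ E := by
      intro a _
      have h2 : ∀ b : ℕ, ∑ i, (v (i + (a : ZMod N)) + v (i + (a : ZMod N) + (b : ZMod N))) ^ 2
          = ∑ i, (v i + v (i + (b : ZMod N))) ^ 2 := fun b =>
        Fintype.sum_equiv (Equiv.addRight (a : ZMod N)) _ _ (fun _ => rfl)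
      simp only [h2]
      rw [Finset.sum_comm]
      refine Finset.sum_le_sum fun i _ => ?_
      have := hsub i 0 (by omega)
      simpa using this
    refine (Finset.sum_le_sum h1).trans ?_
    simp
  have hC : ∑ a ∈ Finset.Icc 1 L, ∑ b ∈ Finset.Icc 1 L,
      ∑ i, (v i + v (i + ((a + b : ℕ) : ZMod N))) ^ 2 ≤ L * E := by
    have h1 : ∀ a ∈ Finset.Icc 1 L, ∑ b ∈ Finset.Icc 1 L,
        ∑ i, (v i + v (i + ((a + b : ℕ) : ZMod N))) ^ 2 ≤ E := by
      intro a ha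
      rw [Finset.mem_Icc] at ha
      rw [Finset.sum_comm]
      exact Finset.sum_le_sum fun i _ => hsub i a (by omega)
    refine (Finset.sum_le_sum h1).trans ?_
    simp
  have hmain : (L : ℝ) * (L * (4 * ∑ i, v i ^ 2)) ≤ 3 * (L * E) + 3 * (L * E) + 3 * (L * E) := by
    have h0 : (L : ℝ) * (L * (4 * ∑ i, v i ^ 2))
        = ∑ a ∈ Finset.Icc 1 L, ∑ b ∈ Finset.Icc 1 L, ∑ i, 4 * v i ^ 2 := by
      simp [Finset.mul_sum]
    have h1 : ∑ a ∈ Finset.Icc 1 L, ∑ b ∈ Finset.Icc 1 L, ∑ i, 4 * v i ^ 2 ≤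
        ∑ a ∈ Finset.Icc 1 L, ∑ b ∈ Finset.Icc 1 L, ∑ i,
          (3 * (v i + v (i + (a : ZMod N))) ^ 2
          + 3 * (v (i + (a : ZMod N)) + v (i + (a : ZMod N) + (b : ZMod N))) ^ 2
          + 3 * (v i + v (i + ((a + b : ℕ) : ZMod N))) ^ 2) := by
      refine Finset.sum_le_sum fun a _ => Finset.sum_le_sum fun b _ =>
        Finset.sum_le_sum fun i _ => ?_
      rw [Nat.cast_add, ← add_assoc]
      set p := v (i + (a : ZMod N))
      set q := v (i + (a : ZMod N) + (b : ZMod N))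
      nlinarith [sq_nonneg ((v i + p) + (p + q)), sq_nonneg ((v i + p) - (v i + q)),
        sq_nonneg ((p + q) + (v i + q))]
    rw [h0]
    refine h1.trans ?_
    simp only [Finset.sum_add_distrib, ← Finset.mul_sum]
    linarith
  have hLpos : (0 : ℝ) < L := by exact_mod_cast hL1
  have h5 : (L : ℝ) * (4 * ∑ i, v i ^ 2) ≤ 9 * E := by
    have : (L : ℝ) * (L * (4 * ∑ i, v i ^ 2)) ≤ L * (9 * E) := by linarith
    exact le_of_mul_le_mul_left this hLpos
  have hWL : (W : ℝ) ≤ 3 * L := by exact_mod_cast hL3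
  have hv0 : 0 ≤ ∑ i, v i ^ 2 := Finset.sum_nonneg fun _ _ => sq_nonneg _
  nlinarith

end Circle

/-! ### Stability of 1 - uS in ℓ² and in the maximum norm. -/

section Stability

variable {N : ℕ} [NeZero N]

theorem IsBandProfile.le_div {cs Cs : ℝ} {W : ℕ} {f : ZMod N → ℝ} (hf : IsBandProfile cs Cs N W f)
    (hCs : 0 ≤ Cs) (x : ZMod N) : f x ≤ Cs / W := by
  rcases le_or_gt (cycAbs x) (Cs * W) with h | h
  · exact hf.upper x h
  · rw [hf.supp x h]; positivity

theorem IsBandProfile.sum_row {cs Cs : ℝ} {W : ℕ} {f : ZMod N → ℝ}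
    (hf : IsBandProfile cs Cs N W f) (i : ZMod N) : ∑ j, f (i - j) = 1 := by
  rw [← hf.sum_eq_one]
  exact Fintype.sum_equiv (Equiv.subLeft i) _ _ (fun _ => rfl)

theorem IsBandProfile.symm_sub {cs Cs : ℝ} {W : ℕ} {f : ZMod N → ℝ}
    (hf : IsBandProfile cs Cs N W f) (i j : ZMod N) : f (i - j) = f (j - i) := by
  rw [← hf.symm, neg_sub]

theorem IsBandProfile.lower_shift {cs Cs : ℝ} {W : ℕ} {f : ZMod N → ℝ}
    (hf : IsBandProfile cs Cs N W f) (i : ZMod N) (t : ℕ) (_ : 1 ≤ t) (ht : t ≤ W) :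
    cs / W ≤ f (i - (i + (t : ZMod N))) := by
  refine hf.lower _ ?_
  rw [sub_add_cancel_left, cycAbs_neg]
  exact (cycAbs_natCast_le t).trans (by exact_mod_cast ht)

/-- Jensen's inequality for a substochastic row. -/
theorem sq_sum_mul_le {ι : Type*} {s : Finset ι} {p : ι → ℝ} (hp : ∀ j ∈ s, 0 ≤ p j)
    (hp1 : ∑ j ∈ s, p j ≤ 1) (x : ι → ℝ) : (∑ j ∈ s, p j * x j) ^ 2 ≤ ∑ j ∈ s, p j * x j ^ 2 := by
  have h := Finset.sum_mul_sq_le_sq_mul_sq s (fun j => √(p j)) (fun j => √(p j) * x j)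
  have e1 : ∑ j ∈ s, √(p j) * (√(p j) * x j) = ∑ j ∈ s, p j * x j :=
    Finset.sum_congr rfl fun j hj => by rw [← mul_assoc, Real.mul_self_sqrt (hp j hj)]
  have e2 : ∑ j ∈ s, √(p j) ^ 2 = ∑ j ∈ s, p j :=
    Finset.sum_congr rfl fun j hj => Real.sq_sqrt (hp j hj)
  have e3 : ∑ j ∈ s, (√(p j) * x j) ^ 2 = ∑ j ∈ s, p j * x j ^ 2 :=
    Finset.sum_congr rfl fun j hj => by rw [mul_pow, Real.sq_sqrt (hp j hj)]
  rw [e1, e2, e3] at h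
  have h0 : 0 ≤ ∑ j ∈ s, p j * x j ^ 2 :=
    Finset.sum_nonneg fun j hj => mul_nonneg (hp j hj) (sq_nonneg _)
  nlinarith

/-- A symmetric substochastic matrix contracts the `ℓ²` norm. -/
theorem sum_sq_mulVec_le {S : Matrix (ZMod N) (ZMod N) ℝ} (hS : ∀ i j, 0 ≤ S i j)
    (hsymm : ∀ i j, S i j = S j i) (hrow : ∀ i, ∑ j, S i j ≤ 1) (x : ZMod N → ℝ) :
    ∑ i, (∑ j, S i j * x j) ^ 2 ≤ ∑ j, x j ^ 2 := by
  calc ∑ i, (∑ j, S i j * x j) ^ 2 ≤ ∑ i, ∑ j, S i j * x j ^ 2 :=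
        Finset.sum_le_sum fun i _ => sq_sum_mul_le (fun j _ => hS i j) (hrow i) x
    _ = ∑ j, (∑ i, S j i) * x j ^ 2 := by
        rw [Finset.sum_comm]
        refine Finset.sum_congr rfl fun j _ => ?_
        rw [Finset.sum_mul]
        exact Finset.sum_congr rfl fun i _ => by rw [hsymm]
    _ ≤ ∑ j, x j ^ 2 := by
        refine Finset.sum_le_sum fun j _ => ?_
        nlinarith [hrow j, sq_nonneg (x j)]

/-- Lower bound on the quadratic form of a band matrix, on real vectors. -/
theorem quadratic_lower {S : Matrix (ZMod N) (ZMod N) ℝ} {W : ℕ} {c : ℝ} (hW : 2 ≤ W)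
    (hWN : W ≤ N) (hc : 0 ≤ c) (hS : ∀ i j, 0 ≤ S i j)
    (hsymm : ∀ i j, S i j = S j i) (hrow : ∀ i, ∑ j, S i j ≤ 1)
    (hlow : ∀ (i : ZMod N) (t : ℕ), 1 ≤ t → t ≤ W → c / W ≤ S i (i + (t : ZMod N)))
    (x : ZMod N → ℝ) :
    -(1 - 2 * c / 27) * ∑ i, x i ^ 2 ≤ ∑ i, ∑ j, S i j * (x i * x j) := by
  have h1 := sum_stencil_le hWN hS hlow (φ := fun i j => (x i + x j) ^ 2) (fun _ _ => sq_nonneg _)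
  have h2 := sum_sq_le_sum_add_sq hW x
  -- Twice the quadratic form is the energy of x_i + x_j, bounded below by `sum_sq_le_sum_add_sq`,
  -- minus the row sum terms.
  have h3 : ∑ i, ∑ j, S i j * (x i + x j) ^ 2
      = ∑ i, (∑ j, S i j) * x i ^ 2 + ∑ i, (∑ j, S i j) * x i ^ 2
        + 2 * ∑ i, ∑ j, S i j * (x i * x j) := by
    have e : ∑ i, (∑ j, S i j) * x i ^ 2 = ∑ i, ∑ j, S i j * x j ^ 2 := by
      rw [Finset.sum_comm]
      refine Finset.sum_congr rfl fun i _ => ?_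
      rw [Finset.sum_mul]
      exact Finset.sum_congr rfl fun j _ => by rw [hsymm]
    nth_rewrite 2 [e]
    simp only [Finset.sum_mul, Finset.mul_sum, ← Finset.sum_add_distrib]
    exact Finset.sum_congr rfl fun i _ => Finset.sum_congr rfl fun j _ => by ring
  have h4 : ∑ i, (∑ j, S i j) * x i ^ 2 ≤ ∑ i, x i ^ 2 :=
    Finset.sum_le_sum fun i _ => by nlinarith [hrow i, sq_nonneg (x i)]
  have hW0 : (0 : ℝ) < W := by positivity
  have h5 : 4 * c / 27 * ∑ i, x i ^ 2
      ≤ c / W * ∑ i, ∑ t ∈ Finset.Icc 1 W, (x i + x (i + (t : ZMod N))) ^ 2 := by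
    have : 4 * c / 27 * ∑ i, x i ^ 2 = c / (27 * W) * (4 * W * ∑ i, x i ^ 2) := by
      field_simp
    rw [this]
    calc _ ≤ c / (27 * W) * (27 * ∑ i, ∑ t ∈ Finset.Icc 1 W, (x i + x (i + (t : ZMod N))) ^ 2) := by
          gcongr
      _ = _ := by field_simp
  linarith

theorem quadratic_upper {S : Matrix (ZMod N) (ZMod N) ℝ} (hS : ∀ i j, 0 ≤ S i j)
    (hsymm : ∀ i j, S i j = S j i) (hrow : ∀ i, ∑ j, S i j ≤ 1) (x : ZMod N → ℝ) :
    ∑ i, ∑ j, S i j * (x i * x j) ≤ ∑ i, x i ^ 2 := by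
  have e : ∑ i, ∑ j, S i j * x j ^ 2 = ∑ i, (∑ j, S i j) * x i ^ 2 := by
    rw [Finset.sum_comm]
    refine Finset.sum_congr rfl fun i _ => ?_
    rw [Finset.sum_mul]
    exact Finset.sum_congr rfl fun j _ => by rw [hsymm]
  have h1 : ∑ i, ∑ j, S i j * (x i * x j)
      ≤ ∑ i, ∑ j, (S i j * x i ^ 2 / 2 + S i j * x j ^ 2 / 2) := by
    refine Finset.sum_le_sum fun i _ => Finset.sum_le_sum fun j _ => ?_
    nlinarith [mul_nonneg (hS i j) (sq_nonneg (x i - x j))]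
  have h2 : ∑ i, ∑ j, (S i j * x i ^ 2 / 2 + S i j * x j ^ 2 / 2)
      = ∑ i, (∑ j, S i j) * x i ^ 2 := by
    simp only [Finset.sum_add_distrib, ← Finset.sum_div, e]
    simp only [Finset.sum_mul]
    ring
  rw [h2] at h1
  refine h1.trans (Finset.sum_le_sum fun i _ => ?_)
  nlinarith [hrow i, sq_nonneg (x i)]

/-- `ℓ²` coercivity of `1 - u S`. -/
theorem l2_stability {S : Matrix (ZMod N) (ZMod N) ℝ} {W : ℕ} {c θ : ℝ} (hW : 2 ≤ W)
    (hWN : W ≤ N) (hc : 0 < c) (hθ : 0 < θ) (hS : ∀ i j, 0 ≤ S i j)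
    (hsymm : ∀ i j, S i j = S j i) (hrow : ∀ i, ∑ j, S i j ≤ 1)
    (hlow : ∀ (i : ZMod N) (t : ℕ), 1 ≤ t → t ≤ W → c / W ≤ S i (i + (t : ZMod N)))
    {u : ℂ} (hu : ‖u‖ ≤ 1) (hure : u.re ≤ 1 - θ) (v : ZMod N → ℂ) :
    (min (min θ 1) (2 * c / 27)) ^ 2 * ∑ i, ‖v i‖ ^ 2
      ≤ ∑ i, ‖v i - u * ∑ j, (S i j : ℂ) * v j‖ ^ 2 := by
  set β := min (min θ 1) (2 * c / 27) with hβ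
  have hβ0 : 0 < β := by positivity
  set n := ∑ i, ‖v i‖ ^ 2 with hn
  have hn0 : 0 ≤ n := Finset.sum_nonneg fun _ _ => sq_nonneg _
  set q : ℝ := ∑ i, ∑ j, S i j * ((v i).re * (v j).re) + ∑ i, ∑ j, S i j * ((v i).im * (v j).im)
    with hq
  have hnn : n = ∑ i, (v i).re ^ 2 + ∑ i, (v i).im ^ 2 := by
    rw [hn, ← Finset.sum_add_distrib]
    refine Finset.sum_congr rfl fun i _ => ?_
    rw [← Complex.normSq_eq_norm_sq, Complex.normSq_apply]; ring
  have hq1 : q ≤ n := by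
    rw [hnn]
    exact add_le_add (quadratic_upper hS hsymm hrow _) (quadratic_upper hS hsymm hrow _)
  have hq2 : -(1 - 2 * c / 27) * n ≤ q := by
    rw [hnn, mul_add]
    exact add_le_add (quadratic_lower hW hWN hc.le hS hsymm hrow hlow _)
      (quadratic_lower hW hWN hc.le hS hsymm hrow hlow _)
  have hform : ∑ i, (starRingEnd ℂ) (v i) * (v i - u * ∑ j, (S i j : ℂ) * v j) = n - u * q := by
    have e1 : ∑ i, (starRingEnd ℂ) (v i) * v i = (n : ℂ) := by
      rw [hn]; push_cast
      exact Finset.sum_congr rfl fun i _ => by rw [mul_comm, Complex.mul_conj']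
    have e2 : ∑ i, ∑ j, (S i j : ℂ) * ((starRingEnd ℂ) (v i) * v j) = (q : ℂ) := by
      apply Complex.ext
      · simp only [Complex.re_sum, Complex.re_ofReal_mul]
        simp only [Complex.mul_re, Complex.conj_re,
          Complex.conj_im, Complex.ofReal_re, hq, ← Finset.sum_add_distrib]
        exact Finset.sum_congr rfl fun i _ => Finset.sum_congr rfl fun j _ => by ring
      · simp only [Complex.im_sum, Complex.im_ofReal_mul]
        simp only [Complex.mul_im, Complex.conj_re, Complex.conj_im, Complex.ofReal_im]
        have : ∑ i, ∑ j, S i j * ((v i).re * (v j).im)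
            = ∑ i, ∑ j, S i j * ((v i).im * (v j).re) := by
          rw [Finset.sum_comm]
          exact Finset.sum_congr rfl fun i _ => Finset.sum_congr rfl fun j _ => by
            rw [hsymm j i]; ring
        simp only [mul_add, Finset.sum_add_distrib, this, neg_mul, mul_neg,
          Finset.sum_neg_distrib]
        ring
    rw [← e1, ← e2, Finset.mul_sum, ← Finset.sum_sub_distrib]
    refine Finset.sum_congr rfl fun i _ => ?_
    rw [mul_sub, Finset.mul_sum, Finset.mul_sum, Finset.mul_sum]
    congr 1
    exact Finset.sum_congr rfl fun j _ => by ring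
  have hlower : β * n ≤ ‖(n : ℂ) - u * q‖ := by
    -- For q ≥ 0 the real part is enough, by Re u ≤ 1 - θ. For q < 0 the phase of u could be
    -- harmful, and the gap of S at -1 is used with |u| ≤ 1.
    rcases le_or_gt 0 q with h0 | h0
    · have h1 : n - u.re * q ≤ ‖(n : ℂ) - u * q‖ := by
        refine le_trans (le_of_eq ?_) (Complex.re_le_norm _)
        simp
      have hb : β ≤ θ := (min_le_left _ _).trans (min_le_left _ _)
      have hb1 : β ≤ 1 := (min_le_left _ _).trans (min_le_right _ _)
      rcases le_or_gt u.re 0 with h2 | h2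
      · nlinarith
      · nlinarith
    · have h1 : n - ‖u * (q : ℂ)‖ ≤ ‖(n : ℂ) - u * q‖ := by
        have := norm_sub_norm_le (n : ℂ) (u * q)
        rwa [Complex.norm_real, Real.norm_of_nonneg hn0] at this
      have h2 : ‖u * (q : ℂ)‖ ≤ -q := by
        rw [norm_mul, Complex.norm_real, Real.norm_of_nonpos h0.le]
        nlinarith [norm_nonneg u]
      have hb : β ≤ 2 * c / 27 := min_le_right _ _
      nlinarith
  set R := ∑ i, ‖v i - u * ∑ j, (S i j : ℂ) * v j‖ ^ 2 with hR
  have hCS : ‖(n : ℂ) - u * q‖ ^ 2 ≤ n * R := by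
    rw [← hform]
    calc _ ≤ (∑ i, ‖v i‖ * ‖v i - u * ∑ j, (S i j : ℂ) * v j‖) ^ 2 := by
          gcongr
          refine (norm_sum_le _ _).trans (le_of_eq ?_)
          exact Finset.sum_congr rfl fun i _ => by rw [norm_mul, RCLike.norm_conj]
      _ ≤ _ := Finset.sum_mul_sq_le_sq_mul_sq _ _ _
  have h6 : (β * n) ^ 2 ≤ n * R := (pow_le_pow_left₀ (by positivity) hlower 2).trans hCS
  rcases hn0.eq_or_lt with h7 | h7
  · rw [← h7, mul_zero]; exact Finset.sum_nonneg fun _ _ => sq_nonneg _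
  · have : n * (β ^ 2 * n) ≤ n * R := by linarith [show (β * n) ^ 2 = n * (β ^ 2 * n) by ring]
    exact le_of_mul_le_mul_left this h7

/-- `1 - u S` as a matrix. -/
def oneSub (u : ℂ) (S : Matrix (ZMod N) (ZMod N) ℝ) : Matrix (ZMod N) (ZMod N) ℂ :=
  1 - u • S.map (fun x : ℝ => (x : ℂ))

theorem oneSub_mulVec (u : ℂ) (S : Matrix (ZMod N) (ZMod N) ℝ) (v : ZMod N → ℂ) (i : ZMod N) :
    (oneSub u S).mulVec v i = v i - u * ∑ j, (S i j : ℂ) * v j := by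
  rw [oneSub, Matrix.sub_mulVec, Matrix.one_mulVec, Matrix.smul_mulVec]
  simp [Matrix.mulVec, dotProduct]

/-- The inverse of `1 - u S` is bounded in the maximum norm, uniformly in `N` and `W`. -/
theorem exists_linfty_stability (cs Cs θ : ℝ) (hcs : 0 < cs) (hCs : 0 < Cs) (hθ : 0 < θ) :
    ∃ C : ℝ, 1 ≤ C ∧ ∀ (N : ℕ) [NeZero N] (W : ℕ), 2 ≤ W → W ≤ N →
      ∀ f : ZMod N → ℝ, IsBandProfile cs Cs N W f →
      ∀ u : ℂ, ‖u‖ ≤ 1 → u.re ≤ 1 - θ →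
      ∀ (v : ZMod N → ℂ) (R : ℝ), (∀ i, ‖v i - u * ∑ j, (f (i - j) : ℂ) * v j‖ ≤ R) →
      ∀ i, ‖v i‖ ≤ C * R := by
  set β := min (min θ 1) (2 * cs / 27) with hβ
  have hβ0 : 0 < β := by positivity
  set A₁ := (β ^ 2)⁻¹ * Cs with hA₁
  set A₂ := (β ^ 2)⁻¹ * (2 * Cs ^ 2 * (Cs + A₁)) with hA₂
  have hA₁0 : 0 < A₁ := by positivity
  have hA₂0 : 0 < A₂ := by positivity
  refine ⟨1 + √(8 * (A₁ + A₂)), by linarith [Real.sqrt_nonneg (8 * (A₁ + A₂))], ?_⟩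
  intro N _ W hW hWN f hf u hu hure v R hv i₀
  set S : Matrix (ZMod N) (ZMod N) ℝ := fun i j => f (i - j) with hSdef
  have hS0 : ∀ i j, 0 ≤ S i j := fun i j => hf.nonneg _
  have hsymm : ∀ i j, S i j = S j i := hf.symm_sub
  have hrow : ∀ i, ∑ j, S i j ≤ 1 := fun i => (hf.sum_row i).le
  have hlow : ∀ (i : ZMod N) (t : ℕ), 1 ≤ t → t ≤ W → cs / W ≤ S i (i + (t : ZMod N)) :=
    hf.lower_shift
  have hl2 := fun v => l2_stability hW hWN hcs hθ hS0 hsymm hrow hlow hu hure v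
  rw [← hβ] at hl2
  have hW0 : (0 : ℝ) < W := by positivity
  have hinj : Function.Injective (oneSub u S).mulVec := by
    intro x y hxy
    have h0 : (oneSub u S).mulVec (x - y) = 0 := by rw [Matrix.mulVec_sub, hxy, sub_self]
    have h1 := hl2 (x - y)
    have h2 : ∀ i, ‖(x - y) i - u * ∑ j, (S i j : ℂ) * (x - y) j‖ ^ 2 = 0 := fun i => by
      rw [← oneSub_mulVec, h0]; simp
    simp only [h2, Finset.sum_const_zero] at h1
    have h3 : ∑ i, ‖(x - y) i‖ ^ 2 ≤ 0 := by
      by_contra hc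
      push Not at hc
      have := mul_pos (pow_pos hβ0 2) hc
      linarith
    have h4 : ∑ i, ‖(x - y) i‖ ^ 2 = 0 :=
      le_antisymm h3 (Finset.sum_nonneg fun _ _ => sq_nonneg _)
    rw [Finset.sum_eq_zero_iff_of_nonneg (fun _ _ => sq_nonneg _)] at h4
    ext i
    have := h4 i (Finset.mem_univ i)
    simpa [sub_eq_zero] using this
  have hunit := Matrix.mulVec_injective_iff_isUnit.mp hinj
  -- By symmetry of S, `k` is the kernel at `i₀` of S(1 - uS)⁻¹; its ℓ¹ norm controls the maximum
  -- norm.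
  obtain ⟨k, hk⟩ := (Matrix.mulVec_surjective_iff_isUnit.mpr hunit) (fun j => (S i₀ j : ℂ))
  have hk' : ∀ i, k i - u * ∑ j, (S i j : ℂ) * k j = (S i₀ i : ℂ) := fun i => by
    rw [← oneSub_mulVec, hk]
  set ρ : ZMod N → ℝ := fun i => cycAbs (i₀ - i) with hρ
  have hs2 : ∑ i, S i₀ i ^ 2 ≤ Cs / W := by
    calc ∑ i, S i₀ i ^ 2 ≤ ∑ i, Cs / W * S i₀ i := Finset.sum_le_sum fun i _ => by
          rw [pow_two]; exact mul_le_mul_of_nonneg_right (hf.le_div hCs.le _) (hS0 _ _)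
      _ ≤ Cs / W := by
          rw [← Finset.mul_sum]
          exact mul_le_of_le_one_right (by positivity) (hrow i₀)
  have hk2 : ∑ i, ‖k i‖ ^ 2 ≤ A₁ / W := by
    have h := hl2 k
    simp only [hk', Complex.norm_real, Real.norm_eq_abs, sq_abs] at h
    have h2 : β ^ 2 * (A₁ / W) = Cs / W := by rw [hA₁]; field_simp
    exact le_of_mul_le_mul_left (h2 ▸ h.trans hs2) (by positivity)
  -- S has range Cs W, so its commutator with the distance ρ to `i₀` costs one factor of W.
  have hband : ∀ i j, S i j * |ρ i - ρ j| ≤ Cs * W * S i j := by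
    intro i j
    rcases le_or_gt (cycAbs (i - j)) (Cs * W) with h | h
    · rw [mul_comm]
      exact mul_le_mul_of_nonneg_right ((abs_cycAbs_sub_le i₀ i j).trans h) (hS0 i j)
    · have : S i j = 0 := hf.supp _ h
      rw [this]; simp
  have hρk : ∑ i, ‖(ρ i : ℂ) * k i‖ ^ 2 ≤ A₂ * W := by
    have h := hl2 (fun i => (ρ i : ℂ) * k i)
    have e : ∀ i, (ρ i : ℂ) * k i - u * ∑ j, (S i j : ℂ) * ((ρ j : ℂ) * k j)
        = (ρ i : ℂ) * (S i₀ i : ℂ) + u * ∑ j, ((S i j * (ρ i - ρ j) : ℝ) : ℂ) * k j := by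
      intro i
      have e0 : ∑ j, ((S i j * (ρ i - ρ j) : ℝ) : ℂ) * k j
          = ρ i * ∑ j, (S i j : ℂ) * k j - ∑ j, (S i j : ℂ) * ((ρ j : ℂ) * k j) := by
        rw [Finset.mul_sum, ← Finset.sum_sub_distrib]
        exact Finset.sum_congr rfl fun j _ => by push_cast; ring
      rw [e0, ← hk' i]
      ring
    have hb : ∀ i, ‖(ρ i : ℂ) * k i - u * ∑ j, (S i j : ℂ) * ((ρ j : ℂ) * k j)‖ ^ 2
        ≤ 2 * (Cs * W) ^ 2 * (S i₀ i ^ 2 + (∑ j, S i j * ‖k j‖) ^ 2) := by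
      intro i
      rw [e]
      have h1 : ‖(ρ i : ℂ) * (S i₀ i : ℂ)‖ ≤ Cs * W * S i₀ i := by
        rw [← Complex.ofReal_mul, Complex.norm_real, Real.norm_of_nonneg
          (mul_nonneg (cycAbs_nonneg _) (hS0 _ _))]
        have := hband i₀ i
        have h0 : ρ i₀ = 0 := by simp [hρ, cycAbs]
        rw [h0, zero_sub, abs_neg, abs_of_nonneg (cycAbs_nonneg _ : 0 ≤ ρ i)] at this
        linarith
      have h2 : ‖u * ∑ j, ((S i j * (ρ i - ρ j) : ℝ) : ℂ) * k j‖
          ≤ Cs * W * ∑ j, S i j * ‖k j‖ := by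
        rw [norm_mul]
        refine (mul_le_of_le_one_left (norm_nonneg _) hu).trans ?_
        refine (norm_sum_le _ _).trans ?_
        rw [Finset.mul_sum]
        refine Finset.sum_le_sum fun j _ => ?_
        rw [norm_mul, Complex.norm_real, Real.norm_eq_abs, abs_mul, abs_of_nonneg (hS0 i j),
          ← mul_assoc]
        exact mul_le_mul_of_nonneg_right (hband i j) (norm_nonneg _)
      have h3 := (norm_add_le ((ρ i : ℂ) * (S i₀ i : ℂ))
        (u * ∑ j, ((S i j * (ρ i - ρ j) : ℝ) : ℂ) * k j)).trans (add_le_add h1 h2)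
      calc _ ≤ (Cs * W * S i₀ i + Cs * W * ∑ j, S i j * ‖k j‖) ^ 2 := by gcongr
        _ ≤ _ := by nlinarith [sq_nonneg (Cs * W * S i₀ i - Cs * W * ∑ j, S i j * ‖k j‖)]
    have h1 := h.trans (Finset.sum_le_sum fun i _ => hb i)
    rw [← Finset.mul_sum, Finset.sum_add_distrib] at h1
    have h2 := sum_sq_mulVec_le hS0 hsymm hrow (fun j => ‖k j‖)
    have h3 : 2 * (Cs * W) ^ 2 * (∑ i, S i₀ i ^ 2 + ∑ i, (∑ j, S i j * ‖k j‖) ^ 2)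
        ≤ 2 * (Cs * W) ^ 2 * (Cs / W + A₁ / W) := by
      gcongr
      exact h2.trans hk2
    have h4 : 2 * (Cs * W) ^ 2 * (Cs / W + A₁ / W) = β ^ 2 * (A₂ * W) := by
      rw [hA₂]; field_simp
    exact le_of_mul_le_mul_left (h4 ▸ h1.trans h3) (by positivity)
  -- Cauchy–Schwarz with the weight W²/(W² + ρ²), of total mass at most 8W. It combines ‖k‖² ≤ A₁/W
  -- and ‖ρk‖² ≤ A₂W so that all powers of W cancel.
  have hl1 : (∑ i, ‖k i‖) ^ 2 ≤ 8 * (A₁ + A₂) := by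
    have hw0 : ∀ i, 0 < (W : ℝ) ^ 2 + ρ i ^ 2 := fun i => by positivity
    have h := Finset.sum_mul_sq_le_sq_mul_sq Finset.univ
      (fun i => √((W : ℝ) ^ 2 / ((W : ℝ) ^ 2 + ρ i ^ 2)))
      (fun i => √(((W : ℝ) ^ 2 + ρ i ^ 2) / (W : ℝ) ^ 2) * ‖k i‖)
    have e1 : ∀ i, √((W : ℝ) ^ 2 / ((W : ℝ) ^ 2 + ρ i ^ 2))
        * (√(((W : ℝ) ^ 2 + ρ i ^ 2) / (W : ℝ) ^ 2) * ‖k i‖) = ‖k i‖ := fun i => by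
      have := (hw0 i).ne'
      have e : (W : ℝ) ^ 2 / ((W : ℝ) ^ 2 + ρ i ^ 2) * (((W : ℝ) ^ 2 + ρ i ^ 2) / (W : ℝ) ^ 2)
          = 1 := by field_simp
      rw [← mul_assoc, ← Real.sqrt_mul (by positivity), e, Real.sqrt_one, one_mul]
    have e2 : ∀ i, √((W : ℝ) ^ 2 / ((W : ℝ) ^ 2 + ρ i ^ 2)) ^ 2
        = (W : ℝ) ^ 2 / ((W : ℝ) ^ 2 + ρ i ^ 2) := fun i => Real.sq_sqrt (by positivity)
    have e3 : ∀ i, (√(((W : ℝ) ^ 2 + ρ i ^ 2) / (W : ℝ) ^ 2) * ‖k i‖) ^ 2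
        = ‖k i‖ ^ 2 + ‖(ρ i : ℂ) * k i‖ ^ 2 / (W : ℝ) ^ 2 := fun i => by
      rw [mul_pow, Real.sq_sqrt (by positivity), norm_mul, Complex.norm_real, mul_pow,
        Real.norm_eq_abs, sq_abs]
      field_simp
    simp only [e1, e2, e3] at h
    refine h.trans ?_
    have h1 := sum_cycAbs_weight_le (N := N) (W := W) (by omega) i₀
    rw [Finset.sum_add_distrib, ← Finset.sum_div]
    have h2 : ∑ i, ‖k i‖ ^ 2 + (∑ i, ‖(ρ i : ℂ) * k i‖ ^ 2) / (W : ℝ) ^ 2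
        ≤ A₁ / W + A₂ * W / (W : ℝ) ^ 2 := by gcongr
    have h3 : A₁ / W + A₂ * W / (W : ℝ) ^ 2 = (A₁ + A₂) / W := by field_simp
    rw [h3] at h2
    calc _ ≤ 8 * (W : ℝ) * ((A₁ + A₂) / W) := by
          refine mul_le_mul h1 h2 (by positivity) (by positivity)
      _ = 8 * (A₁ + A₂) := by field_simp
  have hdual : ∑ j, (S i₀ j : ℂ) * v j = ∑ i, k i * (v i - u * ∑ j, (S i j : ℂ) * v j) := by
    have e1 : ∑ i, (k i - u * ∑ j, (S i j : ℂ) * k j) * v i = ∑ j, (S i₀ j : ℂ) * v j :=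
      Finset.sum_congr rfl fun i _ => by rw [hk' i]
    rw [← e1]
    simp only [sub_mul, mul_sub, Finset.sum_sub_distrib, Finset.mul_sum, Finset.sum_mul]
    congr 1
    rw [Finset.sum_comm]
    exact Finset.sum_congr rfl fun i _ => Finset.sum_congr rfl fun j _ => by
      rw [hsymm j i]; ring
  have hR0 : 0 ≤ R := (norm_nonneg _).trans (hv i₀)
  have hSv : ‖∑ j, (S i₀ j : ℂ) * v j‖ ≤ √(8 * (A₁ + A₂)) * R := by
    rw [hdual]
    calc _ ≤ ∑ i, ‖k i‖ * R := by
          refine (norm_sum_le _ _).trans (Finset.sum_le_sum fun i _ => ?_)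
          rw [norm_mul]; exact mul_le_mul_of_nonneg_left (hv i) (norm_nonneg _)
      _ = (∑ i, ‖k i‖) * R := by rw [Finset.sum_mul]
      _ ≤ _ := by
          gcongr
          exact Real.le_sqrt_of_sq_le hl1
  have := norm_add_le (v i₀ - u * ∑ j, (S i₀ j : ℂ) * v j) (u * ∑ j, (S i₀ j : ℂ) * v j)
  rw [sub_add_cancel, norm_mul] at this
  have h1 := hv i₀
  have h2 : ‖u‖ * ‖∑ j, (S i₀ j : ℂ) * v j‖ ≤ √(8 * (A₁ + A₂)) * R :=
    (mul_le_of_le_one_left (norm_nonneg _) hu).trans hSv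
  calc ‖v i₀‖ ≤ R + √(8 * (A₁ + A₂)) * R := by linarith
    _ = _ := by ring

end Stability

/-! ### Lower bounds in the maximum norm and small solutions of a quadratic equation. -/

section SelfConsistent

/-- `A` is bounded below by `1 / C` in the maximum norm. -/
def SupStable {ι : Type*} [Fintype ι] (C : ℝ) (A : Matrix ι ι ℂ) : Prop :=
  ∀ v : ι → ℂ, ‖v‖ ≤ C * ‖A.mulVec v‖

/-- The perturbation contributes at most Cε‖v‖ ≤ ‖v‖/2, which is absorbed on the left. -/
theorem SupStable.perturb {ι : Type*} [Fintype ι] {C ε : ℝ} {A B : Matrix ι ι ℂ}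
    (hA : SupStable C A) (hC : 0 ≤ C) (hAB : ∀ v, ‖A.mulVec v - B.mulVec v‖ ≤ ε * ‖v‖)
    (hε : C * ε ≤ 1 / 2) : SupStable (2 * C) B := by
  intro v
  have h1 := hA v
  have h2 : ‖A.mulVec v‖ ≤ ‖A.mulVec v - B.mulVec v‖ + ‖B.mulVec v‖ := norm_le_norm_sub_add _ _
  have h3 := hAB v
  have h4 : C * ‖A.mulVec v‖ ≤ C * (ε * ‖v‖ + ‖B.mulVec v‖) := by gcongr; linarith
  nlinarith [norm_nonneg v]

variable {ι : Type*} [Fintype ι] [DecidableEq ι]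

/-- In finite dimension the lower bound gives injectivity, hence surjectivity. -/
theorem SupStable.exists_preimage {C : ℝ} {A : Matrix ι ι ℂ} (hA : SupStable C A) (r : ι → ℂ) :
    ∃ v, A.mulVec v = r := by
  have hinj : Function.Injective A.mulVec := by
    intro x y hxy
    have := hA (x - y)
    rw [Matrix.mulVec_sub, hxy, sub_self, norm_zero, mul_zero] at this
    exact sub_eq_zero.mp (norm_le_zero_iff.mp this)
  exact Matrix.mulVec_surjective_iff_isUnit.mpr (Matrix.mulVec_injective_iff_isUnit.mp hinj) r

theorem norm_sum_mul_le_of_row {S : Matrix ι ι ℝ} (hS : ∀ i j, 0 ≤ S i j)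
    (hrow : ∀ i, ∑ j, S i j ≤ 1) (v : ι → ℂ) (i : ι) : ‖∑ j, (S i j : ℂ) * v j‖ ≤ ‖v‖ := by
  calc ‖∑ j, (S i j : ℂ) * v j‖ ≤ ∑ j, S i j * ‖v‖ := by
        refine (norm_sum_le _ _).trans (Finset.sum_le_sum fun j _ => ?_)
        rw [norm_mul, Complex.norm_real, Real.norm_of_nonneg (hS i j)]
        exact mul_le_mul_of_nonneg_left (norm_le_pi_norm v j) (hS i j)
    _ ≤ ‖v‖ := by
        rw [← Finset.sum_mul]
        exact mul_le_of_le_one_left (norm_nonneg _) (hrow i)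

/-- The right-hand side of the equation for `v = M - m`. -/
def quadErr (m : ℂ) (S : Matrix ι ι ℝ) (d v : ι → ℂ) : ι → ℂ := fun i =>
  m ^ 2 * d i + m * v i * (∑ j, (S i j : ℂ) * v j + d i)

/-- The Lipschitz constant is proportional to the radius and to the size of the data, so the inverse
of `A` turns `quadErr` into a contraction on small balls. -/
theorem norm_quadErr_sub_le {m : ℂ} (hm : ‖m‖ ≤ 1) {S : Matrix ι ι ℝ} (hS : ∀ i j, 0 ≤ S i j)
    (hrow : ∀ i, ∑ j, S i j ≤ 1) {d : ι → ℂ} {c D : ℝ} (hd : ‖d‖ ≤ D) {v v' : ι → ℂ}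
    (hv : ‖v‖ ≤ c) (hv' : ‖v'‖ ≤ c) :
    ‖quadErr m S d v - quadErr m S d v'‖ ≤ (2 * c + D) * ‖v - v'‖ := by
  have hc : 0 ≤ c := (norm_nonneg _).trans hv
  have hD : 0 ≤ D := (norm_nonneg _).trans hd
  rw [pi_norm_le_iff_of_nonneg (by positivity)]
  intro i
  have e : (quadErr m S d v - quadErr m S d v') i
      = m * ((v - v') i * (∑ j, (S i j : ℂ) * v j + d i)
        + v' i * ∑ j, (S i j : ℂ) * (v - v') j) := by
    simp only [quadErr, Pi.sub_apply, mul_sub, Finset.sum_sub_distrib]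
    ring
  rw [e, norm_mul]
  refine (mul_le_of_le_one_left (norm_nonneg _) hm).trans ((norm_add_le _ _).trans ?_)
  rw [norm_mul, norm_mul]
  have h1 := norm_le_pi_norm (v - v') i
  have h2 : ‖∑ j, (S i j : ℂ) * v j + d i‖ ≤ c + D :=
    (norm_add_le _ _).trans (add_le_add ((norm_sum_mul_le_of_row hS hrow v i).trans hv)
      ((norm_le_pi_norm d i).trans hd))
  have h3 : ‖v' i‖ ≤ c := (norm_le_pi_norm v' i).trans hv'
  have h4 := norm_sum_mul_le_of_row hS hrow (v - v') i
  calc _ ≤ ‖v - v'‖ * (c + D) + c * ‖v - v'‖ := by gcongr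
    _ = _ := by ring

theorem quadErr_zero (m : ℂ) (S : Matrix ι ι ℝ) (d : ι → ℂ) :
    quadErr m S d 0 = m ^ 2 • d := by
  ext i; simp [quadErr]

theorem norm_quadErr_le {m : ℂ} (hm : ‖m‖ ≤ 1) {S : Matrix ι ι ℝ} (hS : ∀ i j, 0 ≤ S i j)
    (hrow : ∀ i, ∑ j, S i j ≤ 1) {d : ι → ℂ} {c D : ℝ} (hd : ‖d‖ ≤ D) {v : ι → ℂ}
    (hv : ‖v‖ ≤ c) : ‖quadErr m S d v‖ ≤ D + (2 * c + D) * ‖v‖ := by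
  have h1 := norm_quadErr_sub_le hm hS hrow hd hv (v' := 0)
    (by simpa using (norm_nonneg _).trans hv)
  rw [quadErr_zero, sub_zero] at h1
  have h2 : ‖m ^ 2 • d‖ ≤ D := by
    rw [norm_smul, norm_pow]
    exact (mul_le_of_le_one_left (norm_nonneg _) (pow_le_one₀ (norm_nonneg _) hm)).trans hd
  have h3 := norm_le_norm_sub_add (quadErr m S d v) (m ^ 2 • d)
  linarith

/-- Existence, uniqueness and size of the small solution of `A v = quadErr v`. -/
theorem existsUnique_small_solution {m : ℂ} (hm : ‖m‖ ≤ 1) {S : Matrix ι ι ℝ}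
    (hS : ∀ i j, 0 ≤ S i j) (hrow : ∀ i, ∑ j, S i j ≤ 1) {A : Matrix ι ι ℂ} {C : ℝ} (hC : 0 < C)
    (hA : SupStable C A) {d : ι → ℂ} {c D : ℝ} (hd : ‖d‖ ≤ D) (hc : 0 < c)
    (hcC : C * (2 * c + D) ≤ 1 / 2) (hDc : C * D ≤ c / 2) :
    (∃ v, A.mulVec v = quadErr m S d v ∧ ‖v‖ ≤ c) ∧
    (∀ v v', A.mulVec v = quadErr m S d v → ‖v‖ ≤ c → A.mulVec v' = quadErr m S d v' →
      ‖v'‖ ≤ c → v = v') ∧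
    ∀ v, A.mulVec v = quadErr m S d v → ‖v‖ ≤ c → ‖v‖ ≤ 2 * C * D := by
  have hD : 0 ≤ D := (norm_nonneg _).trans hd
  refine ⟨?_, ?_, ?_⟩
  · choose B hB using hA.exists_preimage
    have hBl : ∀ r r', ‖B r - B r'‖ ≤ C * ‖r - r'‖ := fun r r' => by
      have := hA (B r - B r')
      rwa [Matrix.mulVec_sub, hB, hB] at this
    have hB0 : ∀ r, ‖B r‖ ≤ C * ‖r‖ := fun r => by
      have := hA (B r)
      rwa [hB] at this
    -- Solutions are the fixed points of A⁻¹ ∘ `quadErr`, with `B` in the role of A⁻¹.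
    set T : (ι → ℂ) → (ι → ℂ) := fun v => B (quadErr m S d v) with hT
    set s : Set (ι → ℂ) := Metric.closedBall 0 c with hs
    have hmaps : Set.MapsTo T s s := by
      intro v hv
      rw [hs, mem_closedBall_zero_iff] at hv ⊢
      have h1 := norm_quadErr_le hm hS hrow hd hv
      have h2 := hB0 (quadErr m S d v)
      have h3 : C * ‖quadErr m S d v‖ ≤ C * (D + (2 * c + D) * c) := by
        gcongr; refine h1.trans ?_; gcongr
      have h4 : C * (2 * c + D) * c ≤ 1 / 2 * c := by gcongr
      calc ‖T v‖ ≤ C * (D + (2 * c + D) * c) := h2.trans h3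
        _ ≤ c := by linarith
    have hcontr : ContractingWith (1 / 2 : NNReal) (hmaps.restrict T s s) := by
      refine ⟨by
        rw [← NNReal.coe_lt_coe]; norm_num, ?_⟩
      refine LipschitzWith.of_dist_le_mul fun x y => ?_
      have hx : ‖(x : ι → ℂ)‖ ≤ c := mem_closedBall_zero_iff.mp x.2
      have hy : ‖(y : ι → ℂ)‖ ≤ c := mem_closedBall_zero_iff.mp y.2
      rw [Subtype.dist_eq, Subtype.dist_eq, dist_eq_norm, dist_eq_norm]
      simp only [Set.MapsTo.val_restrict_apply]
      have h1 := norm_quadErr_sub_le hm hS hrow hd hx hy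
      calc ‖T x - T y‖ ≤ C * ((2 * c + D) * ‖(x : ι → ℂ) - y‖) :=
            (hBl _ _).trans (by gcongr)
        _ = (C * (2 * c + D)) * ‖(x : ι → ℂ) - y‖ := by ring
        _ ≤ 1 / 2 * ‖(x : ι → ℂ) - y‖ := by gcongr
        _ = _ := by norm_num
    obtain ⟨v, hvs, hfix, -⟩ := hcontr.exists_fixedPoint'
      (Metric.isClosed_closedBall.isComplete) hmaps (x := 0)
      (by rw [hs, mem_closedBall_zero_iff, norm_zero]; exact hc.le) (edist_ne_top _ _)
    refine ⟨v, ?_, mem_closedBall_zero_iff.mp hvs⟩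
    have : T v = v := hfix
    rw [← hB (quadErr m S d v)]
    exact congrArg _ this.symm
  · intro v v' hv hvc hv' hvc'
    have h1 := hA (v - v')
    rw [Matrix.mulVec_sub, hv, hv'] at h1
    have h2 := norm_quadErr_sub_le hm hS hrow hd hvc hvc'
    have h3 : C * ‖quadErr m S d v - quadErr m S d v'‖ ≤ C * (2 * c + D) * ‖v - v'‖ := by
      rw [mul_assoc]; gcongr
    have h4 : ‖v - v'‖ ≤ 0 := by nlinarith [norm_nonneg (v - v')]
    exact sub_eq_zero.mp (norm_le_zero_iff.mp h4)
  · intro v hv hvc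
    have h1 := hA v
    rw [hv] at h1
    have h2 := norm_quadErr_le hm hS hrow hd hvc
    have h3 : C * ‖quadErr m S d v‖ ≤ C * (D + (2 * c + D) * ‖v‖) := by gcongr
    nlinarith [norm_nonneg v]

end SelfConsistent

/-! ### The variance matrix S_ζ and the self-consistent equations. -/

section VarMat

variable {N : ℕ} [NeZero N]

open scoped Classical in
theorem card_block_le (W : ℕ) : (Finset.univ.filter (fun i : ZMod N => i ∈ block N W)).card ≤ W := by
  have : Finset.univ.filter (fun i : ZMod N => i ∈ block N W)
      ⊆ (Finset.Icc 1 W).image (fun k : ℕ => (k : ZMod N)) := by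
    intro i hi
    obtain ⟨k, h1, h2, h3⟩ := (Finset.mem_filter.mp hi).2
    exact Finset.mem_image.mpr ⟨k, Finset.mem_Icc.mpr ⟨h1, h2⟩, h3⟩
  refine (Finset.card_le_card this).trans (Finset.card_image_le.trans ?_)
  simp

theorem sigmaMat_nonneg (W : ℕ) (i j : ZMod N) : 0 ≤ sigmaMat N W i j := by
  unfold sigmaMat; split_ifs <;> positivity

theorem sigmaMat_le (W : ℕ) (i j : ZMod N) : sigmaMat N W i j ≤ 2 / W := by
  unfold sigmaMat
  split_ifs
  · gcongr; norm_num
  · gcongr; norm_num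
  · positivity

theorem sigmaMat_symm (W : ℕ) (i j : ZMod N) : sigmaMat N W i j = sigmaMat N W j i := by
  unfold sigmaMat
  by_cases hi : i ∈ block N W <;> by_cases hj : j ∈ block N W <;>
    simp [hi, hj, eq_comm (a := i)]

theorem sum_sigmaMat_le {W : ℕ} (hW : 1 ≤ W) (i : ZMod N) : ∑ j, sigmaMat N W i j ≤ 2 := by
  classical
  have hW0 : (0 : ℝ) < W := by positivity
  calc ∑ j, sigmaMat N W i j
      ≤ ∑ j, if j ∈ block N W then 2 / (W : ℝ) else 0 := by
        refine Finset.sum_le_sum fun j _ => ?_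
        by_cases hj : j ∈ block N W
        · rw [if_pos hj]; exact sigmaMat_le W i j
        · rw [if_neg hj]; simp [sigmaMat, hj]
    _ = (Finset.univ.filter (fun i : ZMod N => i ∈ block N W)).card * (2 / (W : ℝ)) := by
        rw [← Finset.sum_filter, Finset.sum_const, nsmul_eq_mul]
    _ ≤ W * (2 / (W : ℝ)) := by
        gcongr; exact card_block_le W
    _ = 2 := by field_simp

variable {cs Cs ζ : ℝ} {W : ℕ} {f : ZMod N → ℝ}

theorem varMat_symm (hf : IsBandProfile cs Cs N W f) (i j : ZMod N) :
    varMat W f ζ i j = varMat W f ζ j i := by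
  unfold varMat; rw [hf.symm_sub, sigmaMat_symm]

theorem varMat_le (hζ : 0 ≤ ζ) (i j : ZMod N) : varMat W f ζ i j ≤ f (i - j) := by
  unfold varMat; linarith [mul_nonneg hζ (sigmaMat_nonneg W i j)]

theorem sum_varMat_le (hf : IsBandProfile cs Cs N W f) (hζ : 0 ≤ ζ) (i : ZMod N) :
    ∑ j, varMat W f ζ i j ≤ 1 :=
  (Finset.sum_le_sum fun j _ => varMat_le hζ i j).trans (hf.sum_row i).le

theorem varMat_le_div (hf : IsBandProfile cs Cs N W f) (hCs : 0 ≤ Cs) (hζ : 0 ≤ ζ) (i j : ZMod N) :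
    varMat W f ζ i j ≤ Cs / W := (varMat_le hζ i j).trans (hf.le_div hCs _)

/-- The entries of ζΣ are at most 2ζ/W ≤ cs/(2W), so half of the lower bound on `f` survives. -/
theorem varMat_lower (hf : IsBandProfile cs Cs N W f) (hζ : 0 ≤ ζ) (hζ1 : ζ ≤ cs / 4)
    (i : ZMod N) (t : ℕ) (h1 : 1 ≤ t) (h2 : t ≤ W) :
    cs / 2 / W ≤ varMat W f ζ i (i + (t : ZMod N)) := by
  have hW0 : (0 : ℝ) < W := by exact_mod_cast (h1.trans h2)
  have h3 := hf.lower_shift i t h1 h2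
  have h4 := mul_le_mul_of_nonneg_left (sigmaMat_le W i (i + (t : ZMod N))) hζ
  unfold varMat
  have h5 : ζ * (2 / (W : ℝ)) ≤ cs / 4 * (2 / (W : ℝ)) := by gcongr
  have h6 : cs / 2 / (W : ℝ) = cs / W - cs / 4 * (2 / (W : ℝ)) := by field_simp; ring
  linarith

theorem norm_sigma_mulVec_le {W : ℕ} (hW : 1 ≤ W) (v : ZMod N → ℂ) (i : ZMod N) :
    ‖∑ j, (sigmaMat N W i j : ℂ) * v j‖ ≤ 2 * ‖v‖ := by
  calc ‖∑ j, (sigmaMat N W i j : ℂ) * v j‖ ≤ ∑ j, sigmaMat N W i j * ‖v‖ := by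
        refine (norm_sum_le _ _).trans (Finset.sum_le_sum fun j _ => ?_)
        rw [norm_mul, Complex.norm_real, Real.norm_of_nonneg (sigmaMat_nonneg W i j)]
        exact mul_le_mul_of_nonneg_left (norm_le_pi_norm v j) (sigmaMat_nonneg W i j)
    _ ≤ 2 * ‖v‖ := by
        rw [← Finset.sum_mul]
        exact mul_le_mul_of_nonneg_right (sum_sigmaMat_le hW i) (norm_nonneg _)

/-- `1 - diag (M²) S` as a matrix. -/
def oneSubDiag (M : ZMod N → ℂ) (S : Matrix (ZMod N) (ZMod N) ℝ) :
    Matrix (ZMod N) (ZMod N) ℂ :=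
  1 - Matrix.diagonal (fun i => M i ^ 2) * S.map (fun x : ℝ => (x : ℂ))

theorem oneSubDiag_mulVec (M : ZMod N → ℂ) (S : Matrix (ZMod N) (ZMod N) ℝ) (v : ZMod N → ℂ)
    (i : ZMod N) :
    (oneSubDiag M S).mulVec v i = v i - M i ^ 2 * ∑ j, (S i j : ℂ) * v j := by
  rw [oneSubDiag, Matrix.sub_mulVec, Matrix.one_mulVec, ← Matrix.mulVec_mulVec]
  rw [Pi.sub_apply, Matrix.mulVec_diagonal]
  simp [Matrix.mulVec, dotProduct]

/-- Multiply the equation by m M_i and use m² + z'm + 1 = 0. The linear part is 1 - m²S with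
constant m; the change of spectral parameter, the field `g` and the defect of the row sums of S form
one small vector. -/
theorem solvesSCE_iff {z z' : ℂ} {g : ZMod N → ℝ} {S : Matrix (ZMod N) (ZMod N) ℝ}
    {M : ZMod N → ℂ} (hM : ∀ i, M i ≠ 0) :
    SolvesSCE W S g z z' M ↔
      (oneSub (mSc z' ^ 2) S).mulVec (fun i => M i - mSc z')
        = quadErr (mSc z') S (fun i => specParam W z z' i - z' + g i
            + (∑ j, (S i j : ℂ)) * mSc z' - mSc z') (fun i => M i - mSc z') := by
  have hm0 := mSc_ne_zero z'
  have hmi := mSc_quadratic z'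
  unfold SolvesSCE
  rw [funext_iff]
  refine forall_congr' fun i => ?_
  rw [oneSub_mulVec]
  simp only [hM i, ne_eq, not_false_eq_true, true_and, quadErr, mul_sub,
    Finset.sum_sub_distrib, ← Finset.sum_mul]
  set s := ∑ j, (S i j : ℂ) * M j
  set r := ∑ j, (S i j : ℂ)
  set m := mSc z'
  have hMi := hM i
  constructor
  · intro h
    have h1 : 1 = M i * (-specParam W z z' i - g i - s) := by rw [← h, mul_inv_cancel₀ hMi]
    linear_combination -m * h1 + M i * hmi
  · intro h
    rw [inv_eq_iff_eq_inv, ← mul_eq_one_iff_eq_inv₀]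
    · have h2 : m * (M i * (-specParam W z z' i - g i - s)) = m * 1 := by
        linear_combination h - M i * hmi
      exact mul_left_cancel₀ hm0 h2
    · intro h0
      have h2 : m * (M i * (-specParam W z z' i - g i - s)) = m * 1 := by
        linear_combination h - M i * hmi
      rw [h0, mul_zero, mul_zero, mul_one] at h2
      exact hm0 h2.symm

/-- The self-consistent equation has a unique solution near `m_sc`, and it is stable. -/
theorem exists_sce_solution (κ cs Cs : ℝ) (hκ : 0 < κ) (hcs : 0 < cs) (hCs : 0 < Cs) :
    ∃ c C ε : ℝ, 0 < c ∧ 1 ≤ C ∧ 0 < ε ∧ ∀ (N : ℕ) [NeZero N] (W : ℕ), 2 ≤ W → W ≤ N →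
      ∀ f : ZMod N → ℝ, IsBandProfile cs Cs N W f → ∀ ζ : ℝ, 0 ≤ ζ →
      (∀ i j, 0 ≤ varMat W f ζ i j) →
      ∀ (g : ZMod N → ℝ) (z z' : ℂ), 0 < z'.im → z'.im ≤ 1 → |z'.re| ≤ 2 - κ →
      ∀ D : ℝ, D ≤ ε → ζ ≤ D → (∀ i, |g i| ≤ D) → ‖z - z'‖ ≤ D →
      (∃! M : ZMod N → ℂ, IsSCESolutionNear c W (varMat W f ζ) g z z' M) ∧
      ∀ M : ZMod N → ℂ, IsSCESolutionNear c W (varMat W f ζ) g z z' M →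
        (∀ i, ‖M i - mSc z'‖ ≤ C * D) ∧ SupStable C (oneSubDiag M (varMat W f ζ)) := by
  obtain ⟨C, hC1, hC⟩ := exists_linfty_stability cs Cs (κ / 16) hcs hCs (by positivity)
  have hC0 : 0 < C := by linarith
  set c := 1 / (32 * C) with hcdef
  have hc0 : 0 < c := by positivity
  have hc8 : c ≤ 1 / 8 := by
    rw [hcdef, div_le_div_iff₀ (by positivity) (by norm_num)]; linarith
  -- `16 * C` covers both the closeness bound 2·(2C)·(4D) and the stability constant 4C reached
  -- after two perturbations, each of which doubles the constant.
  refine ⟨c, 16 * C, 1 / (2000 * C ^ 2), hc0, by linarith, by positivity, ?_⟩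
  intro N _ W hW hWN f hf ζ hζ hS g z z' hz' hz1 hre D hDε hζD hgD hzD
  set S := varMat W f ζ with hSdef
  set m := mSc z' with hm
  have hm1 : ‖m‖ ≤ 1 := norm_mSc_le_one hz'
  have hz3 : ‖z'‖ ≤ 3 := by
    calc ‖z'‖ ≤ |z'.re| + |z'.im| := Complex.norm_le_abs_re_add_abs_im z'
      _ ≤ 3 := by rw [abs_of_pos hz']; linarith
  have hm4 : 1 / 4 ≤ ‖m‖ := norm_mSc_ge hz' hz3
  have hD0 : 0 ≤ D := (norm_nonneg _).trans hzD
  have hCD : 2000 * (C ^ 2 * D) ≤ 1 := by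
    rw [le_div_iff₀ (by positivity)] at hDε; linarith
  have hCD' : C * D ≤ C ^ 2 * D := by
    gcongr; nlinarith
  have hDCD : D ≤ C * D := by nlinarith
  have hrow : ∀ i, ∑ j, S i j ≤ 1 := sum_varMat_le hf hζ
  have hure : (m ^ 2).re ≤ 1 - κ / 16 := by
    have h1 := mSc_im_sq_ge hκ hz' hz1 hre
    have h2 : ‖m‖ ^ 2 = m.re ^ 2 + m.im ^ 2 := by
      rw [← Complex.normSq_eq_norm_sq, Complex.normSq_apply]; ring
    have h3 : ‖m‖ ^ 2 ≤ 1 := pow_le_one₀ (norm_nonneg _) hm1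
    have h4 : (m ^ 2).re = m.re ^ 2 - m.im ^ 2 := by rw [pow_two, Complex.mul_re]; ring
    rw [h4]; linarith
  have hu1 : ‖m ^ 2‖ ≤ 1 := by rw [norm_pow]; exact pow_le_one₀ (norm_nonneg _) hm1
  set S₀ : Matrix (ZMod N) (ZMod N) ℝ := fun i j => f (i - j) with hS₀
  have hstab0 : SupStable C (oneSub (m ^ 2) S₀) := by
    intro v
    rw [pi_norm_le_iff_of_nonneg (by positivity)]
    refine hC N W hW hWN f hf (m ^ 2) hu1 hure v _ fun i => ?_
    have := norm_le_pi_norm ((oneSub (m ^ 2) S₀).mulVec v) i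
    rwa [oneSub_mulVec] at this
  -- Passing from S₀ to S_ζ changes the operator by m²ζΣ, of norm at most 2ζ.
  have hstab : SupStable (2 * C) (oneSub (m ^ 2) S) := by
    refine hstab0.perturb (ε := 2 * D) hC0.le (fun v => ?_) (by linarith)
    rw [pi_norm_le_iff_of_nonneg (by positivity)]
    intro i
    rw [Pi.sub_apply, oneSub_mulVec, oneSub_mulVec]
    have e : v i - m ^ 2 * ∑ j, (S₀ i j : ℂ) * v j
        - (v i - m ^ 2 * ∑ j, (S i j : ℂ) * v j)
        = -(m ^ 2 * (ζ * ∑ j, (sigmaMat N W i j : ℂ) * v j)) := by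
      have : ∑ j, (S i j : ℂ) * v j = ∑ j, (S₀ i j : ℂ) * v j
          - ζ * ∑ j, (sigmaMat N W i j : ℂ) * v j := by
        rw [Finset.mul_sum, ← Finset.sum_sub_distrib]
        exact Finset.sum_congr rfl fun j _ => by
          rw [hSdef, hS₀]; unfold varMat; push_cast; ring
      rw [this]; ring
    rw [e, norm_neg, norm_mul, norm_mul, Complex.norm_real, Real.norm_of_nonneg hζ]
    have h1 := norm_sigma_mulVec_le (by omega : 1 ≤ W) v i
    calc _ ≤ 1 * (D * (2 * ‖v‖)) := by gcongr
      _ = _ := by ring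
  set d : ZMod N → ℂ := fun i => specParam W z z' i - z' + g i + (∑ j, (S i j : ℂ)) * m - m with hd
  have hdD : ‖d‖ ≤ 4 * D := by
    rw [pi_norm_le_iff_of_nonneg (by positivity)]
    intro i
    have h1 : ‖specParam W z z' i - z'‖ ≤ D := by
      unfold specParam
      split_ifs
      · exact hzD
      · simpa using hD0
    have h2 : ‖(∑ j, (S i j : ℂ)) * m - m‖ ≤ 2 * D := by
      have e : (∑ j, (S i j : ℂ)) * m - m = -((ζ * ∑ j, sigmaMat N W i j : ℝ) : ℂ) * m := by
        have : (∑ j, (S i j : ℂ)) = ((1 - ζ * ∑ j, sigmaMat N W i j : ℝ) : ℂ) := by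
          rw [← hf.sum_row i, ← Complex.ofReal_sum, Finset.mul_sum, ← Finset.sum_sub_distrib]
          rfl
        rw [this]; push_cast; ring
      rw [e, norm_mul, norm_neg, Complex.norm_real, Real.norm_of_nonneg
        (mul_nonneg hζ (Finset.sum_nonneg fun j _ => sigmaMat_nonneg W i j))]
      have := sum_sigmaMat_le (N := N) (by omega : 1 ≤ W) i
      have h0 : 0 ≤ ∑ j, sigmaMat N W i j := Finset.sum_nonneg fun j _ => sigmaMat_nonneg W i j
      calc _ ≤ D * 2 * 1 := by gcongr
        _ = _ := by ring
    have h3 : ‖(g i : ℂ)‖ ≤ D := by rw [Complex.norm_real]; exact hgD i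
    have e : d i = (specParam W z z' i - z') + g i + ((∑ j, (S i j : ℂ)) * m - m) := by
      rw [hd]; ring
    rw [e]
    linarith [norm_add₃_le (a := specParam W z z' i - z') (b := (g i : ℂ))
      (c := (∑ j, (S i j : ℂ)) * m - m)]
  have h2c : 2 * C * (2 * c) = 1 / 8 := by rw [hcdef]; field_simp; norm_num
  have hDc : 2 * C * (4 * D) ≤ c / 2 := by
    rw [hcdef, div_div, le_div_iff₀ (by positivity)]
    nlinarith
  obtain ⟨hex, huniq, hsize⟩ := existsUnique_small_solution hm1 hS hrow (by positivity) hstab hdD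
    hc0 (by nlinarith) hDc
  have hne : ∀ M : ZMod N → ℂ, (∀ i, ‖M i - m‖ ≤ c) → ∀ i, M i ≠ 0 := by
    intro M hM i h0
    have := hM i
    rw [h0, zero_sub, norm_neg] at this
    linarith
  have hiff : ∀ M : ZMod N → ℂ, IsSCESolutionNear c W S g z z' M ↔
      (oneSub (m ^ 2) S).mulVec (fun i => M i - m) = quadErr m S d (fun i => M i - m)
        ∧ ‖fun i => M i - m‖ ≤ c := by
    intro M
    unfold IsSCESolutionNear
    rw [pi_norm_le_iff_of_nonneg hc0.le]
    constructor
    · rintro ⟨h1, h2⟩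
      exact ⟨(solvesSCE_iff (hne M h2)).mp h1, h2⟩
    · rintro ⟨h1, h2⟩
      exact ⟨(solvesSCE_iff (hne M h2)).mpr h1, h2⟩
  refine ⟨?_, ?_⟩
  · obtain ⟨v, hv, hvc⟩ := hex
    refine ⟨fun i => m + v i, ?_, ?_⟩
    · simp only [hiff, add_sub_cancel_left]
      exact ⟨hv, hvc⟩
    · intro M hM
      obtain ⟨h1, h2⟩ := (hiff M).mp hM
      have := huniq _ v h1 h2 hv hvc
      ext i
      have h3 := congrFun this i
      linear_combination h3
  · intro M hM
    obtain ⟨h1, h2⟩ := (hiff M).mp hM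
    have h3 := hsize _ h1 h2
    have h4 : ∀ i, ‖M i - m‖ ≤ 16 * C * D := fun i => by
      have := (norm_le_pi_norm (fun i => M i - m) i).trans h3
      linarith
    refine ⟨h4, ?_⟩
    -- M is within O(D) of the constant m, so m² may be replaced by the diagonal matrix M².
    have h5 : SupStable (2 * (2 * C)) (oneSubDiag M S) := by
      refine hstab.perturb (ε := 60 * C * D) (by positivity) (fun v => ?_) (by nlinarith)
      rw [pi_norm_le_iff_of_nonneg (by positivity)]
      intro i
      rw [Pi.sub_apply, oneSub_mulVec, oneSubDiag_mulVec]
      have e : v i - m ^ 2 * ∑ j, (S i j : ℂ) * v j - (v i - M i ^ 2 * ∑ j, (S i j : ℂ) * v j)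
          = (M i - m) * (M i - m + 2 * m) * ∑ j, (S i j : ℂ) * v j := by ring
      rw [e, norm_mul, norm_mul]
      have h6 : ‖M i - m + 2 * m‖ ≤ 3 := by
        refine (norm_add_le _ _).trans ?_
        rw [norm_mul, Complex.norm_ofNat]
        have := (hM.2 i)
        linarith
      have h7 := norm_sum_mul_le_of_row hS hrow v i
      calc _ ≤ (16 * C * D) * 3 * ‖v‖ := by gcongr; exact h4 i
        _ ≤ _ := by nlinarith [norm_nonneg v, mul_nonneg (mul_nonneg hC0.le hD0) (norm_nonneg v)]
    intro v
    exact (h5 v).trans (mul_le_mul_of_nonneg_right (by linarith) (norm_nonneg _))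

end VarMat

/-! ### Green function bound for the T-equation: a walk killed on the block. -/

section TSolver

variable {N : ℕ} [NeZero N]

theorem sum_range_add_le_sum_Icc {g : ℕ → ℝ} (hg : ∀ t, 0 ≤ g t) {L W c : ℕ} (hc : 1 ≤ c)
    (h : c + L ≤ W + 1) :
    ∑ b ∈ Finset.range L, g (c + b) ≤ ∑ t ∈ Finset.Icc 1 W, g t := by
  have : ∑ b ∈ Finset.range L, g (c + b) = ∑ t ∈ (Finset.range L).image (fun b => c + b), g t :=
    (Finset.sum_image (fun x _ y _ hxy => by simpa using hxy)).symm
  rw [this]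
  refine Finset.sum_le_sum_of_subset_of_nonneg (fun t ht => ?_) (fun _ _ _ => hg _)
  obtain ⟨b, hb, rfl⟩ := Finset.mem_image.mp ht
  rw [Finset.mem_range] at hb
  rw [Finset.mem_Icc]
  omega

theorem sum_range_range_mul (g : ℕ → ℝ) (n L : ℕ) :
    ∑ k ∈ Finset.range n, ∑ a ∈ Finset.range L, g (k * L + a)
      = ∑ t ∈ Finset.range (n * L), g t := by
  induction n with
  | zero => simp
  | succ n ih => rw [Finset.sum_range_succ, ih, Nat.succ_mul, Finset.sum_range_add]

/-- The average of `y` over `j, …, j + L - 1`. -/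
def localAvg (L : ℕ) (y : ZMod N → ℝ) (j : ZMod N) : ℝ :=
  (∑ a ∈ Finset.range L, y (j + (a : ZMod N))) / L

/-- The local energy of `y` at `i` on scale `W`. -/
def localEnergy (W : ℕ) (y : ZMod N → ℝ) (i : ZMod N) : ℝ :=
  ∑ t ∈ Finset.Icc 1 W, (y i - y (i + (t : ZMod N))) ^ 2

theorem localEnergy_nonneg (W : ℕ) (y : ZMod N → ℝ) (i : ZMod N) : 0 ≤ localEnergy W y i :=
  Finset.sum_nonneg fun _ _ => sq_nonneg _

theorem sq_avg_le {ι : Type*} (s : Finset ι) {L : ℕ} (hs : s.card = L) (hL : 1 ≤ L) (x : ι → ℝ) :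
    ((∑ a ∈ s, x a) / L) ^ 2 ≤ (∑ a ∈ s, x a ^ 2) / L := by
  have h := sq_sum_le_card_mul_sum_sq (s := s) (f := x)
  have hL0 : (0 : ℝ) < L := by exact_mod_cast hL
  rw [hs] at h
  rw [div_pow, div_le_div_iff₀ (by positivity) hL0]
  nlinarith

/-- Jensen over the L differences; the one at a = 0 vanishes and the others occur in the local
energy, since L ≤ W. -/
theorem sq_sub_localAvg_le {W L : ℕ} (hL : 1 ≤ L) (hLW : L ≤ W) (y : ZMod N → ℝ) (j : ZMod N) :
    (y j - localAvg L y j) ^ 2 ≤ localEnergy W y j / L := by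
  have hL0 : (0 : ℝ) < L := by exact_mod_cast hL
  have e : y j - localAvg L y j = (∑ a ∈ Finset.range L, (y j - y (j + (a : ZMod N)))) / L := by
    rw [localAvg, Finset.sum_sub_distrib, sub_div]
    simp only [Finset.sum_const, Finset.card_range, nsmul_eq_mul]
    field_simp
  rw [e]
  refine (sq_avg_le _ (Finset.card_range L) hL _).trans ?_
  gcongr
  obtain ⟨L', rfl⟩ : ∃ L', L = L' + 1 := ⟨L - 1, by omega⟩
  rw [Finset.sum_range_succ']
  simp only [Nat.cast_zero, add_zero, sub_self, ne_eq, OfNat.ofNat_ne_zero, not_false_eq_true,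
    zero_pow]
  have := sum_range_add_le_sum_Icc (g := fun t => (y j - y (j + (t : ZMod N))) ^ 2)
    (fun _ => sq_nonneg _) (L := L') (W := W) (c := 1) le_rfl (by omega)
  simp only [add_comm 1] at this
  exact this

/-- The difference of adjacent averages is a double average of y(x + a) - y(x + L + b). These sites
are L - a + b apart, which lies between 1 and 2L - 1 < W. -/
theorem sq_localAvg_step_le {W L : ℕ} (hL : 1 ≤ L) (hLW : 2 * L ≤ W) (y : ZMod N → ℝ)
    (x : ZMod N) :
    (localAvg L y x - localAvg L y (x + (L : ZMod N))) ^ 2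
      ≤ (∑ a ∈ Finset.range L, localEnergy W y (x + (a : ZMod N))) / L ^ 2 := by
  have hL0 : (0 : ℝ) < L := by exact_mod_cast hL
  have e : localAvg L y x - localAvg L y (x + (L : ZMod N))
      = (∑ a ∈ Finset.range L, (∑ b ∈ Finset.range L,
          (y (x + (a : ZMod N)) - y (x + (L : ZMod N) + (b : ZMod N)))) / L) / L := by
    simp only [localAvg, Finset.sum_sub_distrib, ← Finset.sum_div, Finset.sum_const,
      Finset.card_range, nsmul_eq_mul, ← Finset.mul_sum]
    field_simp
  rw [e]
  refine (sq_avg_le _ (Finset.card_range L) hL _).trans ?_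
  rw [pow_two, ← div_div]
  gcongr
  rw [Finset.sum_div]
  refine Finset.sum_le_sum fun a ha => ?_
  refine (sq_avg_le _ (Finset.card_range L) hL _).trans ?_
  gcongr
  rw [Finset.mem_range] at ha
  have := sum_range_add_le_sum_Icc
    (g := fun t => (y (x + (a : ZMod N)) - y (x + (a : ZMod N) + (t : ZMod N))) ^ 2)
    (fun _ => sq_nonneg _) (L := L) (W := W) (c := L - a) (by omega) (by omega)
  refine le_trans (le_of_eq (Finset.sum_congr rfl fun b _ => ?_)) this
  have : (x + (a : ZMod N) + ((L - a + b : ℕ) : ZMod N)) = x + (L : ZMod N) + (b : ZMod N) := by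
    rw [Nat.cast_add, Nat.cast_sub ha.le]; ring
  simp only [this]

open scoped Classical in
/-- Local averages are controlled by the energy and the values on the block. -/
theorem sq_localAvg_le {W L : ℕ} (hL : 1 ≤ L) (hLW : 2 * L ≤ W) (hWN : W ≤ N)
    (y : ZMod N → ℝ) (j : ZMod N) :
    localAvg L y j ^ 2 ≤ 2 / L * (∑ x, if x ∈ block N W then y x ^ 2 else 0)
      + 8 * N / L ^ 3 * ∑ i, localEnergy W y i := by
  have hL0 : (0 : ℝ) < L := by exact_mod_cast hL
  -- After `n` steps of length L from `j` the walk has just passed 0 and stands at a site in [1, L],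
  -- so the last interval lies inside the block because 2L ≤ W. Since nL ≤ 2N, every site is visited
  -- at most twice.
  set n := (N - j.val) / L + 1 with hn
  have hjN : j.val < N := ZMod.val_lt j
  have hn1 : N - j.val < n * L := by
    rw [hn, Nat.succ_mul]
    have := Nat.div_add_mod (N - j.val) L
    have := Nat.mod_lt (N - j.val) (by omega : 0 < L)
    nlinarith
  have hn2 : n * L ≤ N - j.val + L := by
    rw [hn, Nat.succ_mul]
    have := Nat.div_mul_le_self (N - j.val) L
    omega
  set A : ℕ → ℝ := fun k => localAvg L y (j + ((k * L : ℕ) : ZMod N)) with hA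
  set E := ∑ i, localEnergy W y i with hE
  have hE0 : 0 ≤ E := Finset.sum_nonneg fun i _ => localEnergy_nonneg W y i
  have hstep : ∑ k ∈ Finset.range n, (A k - A (k + 1)) ^ 2 ≤ 2 * E / L ^ 2 := by
    have h1 : ∀ k ∈ Finset.range n, (A k - A (k + 1)) ^ 2
        ≤ (∑ a ∈ Finset.range L, localEnergy W y (j + ((k * L + a : ℕ) : ZMod N))) / L ^ 2 := by
      intro k _
      have h2 := sq_localAvg_step_le hL hLW y (j + ((k * L : ℕ) : ZMod N))
      have e1 : j + ((k * L : ℕ) : ZMod N) + (L : ZMod N) = j + (((k + 1) * L : ℕ) : ZMod N) := by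
        push_cast; ring
      rw [e1] at h2
      refine h2.trans (le_of_eq ?_)
      congr 1
      refine Finset.sum_congr rfl fun a _ => ?_
      congr 1; push_cast; ring
    refine (Finset.sum_le_sum h1).trans ?_
    rw [← Finset.sum_div]
    gcongr
    rw [sum_range_range_mul (fun t => localEnergy W y (j + (t : ZMod N)))]
    calc ∑ t ∈ Finset.range (n * L), localEnergy W y (j + (t : ZMod N))
        ≤ ∑ t ∈ Finset.range (N + N), localEnergy W y (j + (t : ZMod N)) :=
          Finset.sum_le_sum_of_subset_of_nonneg (Finset.range_mono (by omega))
            (fun _ _ _ => localEnergy_nonneg W y _)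
      _ = 2 * E := by
          rw [Finset.sum_range_add, sum_shift_range (localEnergy W y) j]
          have : ∀ t : ℕ, ((N + t : ℕ) : ZMod N) = (t : ZMod N) := fun t => by simp
          simp only [this]
          rw [sum_shift_range (localEnergy W y) j]
          ring
  have htel : (A 0 - A n) ^ 2 ≤ n * (2 * E / L ^ 2) := by
    rw [← Finset.sum_range_sub' A n]
    have h := sq_sum_le_card_mul_sum_sq (s := Finset.range n) (f := fun k => A k - A (k + 1))
    rw [Finset.card_range] at h
    refine h.trans ?_
    gcongr
  have hend : A n ^ 2 ≤ (∑ x, if x ∈ block N W then y x ^ 2 else 0) / L := by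
    refine (sq_avg_le _ (Finset.card_range L) hL _).trans ?_
    gcongr
    set F : ZMod N → ℝ := fun x => if x ∈ block N W then y x ^ 2 else 0 with hF
    have hF0 : ∀ x, 0 ≤ F x := fun x => by rw [hF]; positivity
    rw [← sum_shift_range F (j + ((n * L : ℕ) : ZMod N))]
    refine le_trans (Finset.sum_le_sum fun a ha => ?_)
      (Finset.sum_le_sum_of_subset_of_nonneg (Finset.range_mono (by omega : L ≤ N))
        (fun _ _ _ => hF0 _))
    rw [Finset.mem_range] at ha
    have hmem : j + ((n * L : ℕ) : ZMod N) + (a : ZMod N) ∈ block N W := by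
      refine ⟨j.val + n * L - N + a, by omega, by omega, ?_⟩
      rw [Nat.cast_add, Nat.cast_sub (by omega), Nat.cast_add, ZMod.natCast_self, sub_zero,
        ZMod.natCast_zmod_val]
    rw [hF]
    simp only [hmem, if_true]
    exact le_rfl
  have hA0 : A 0 = localAvg L y j := by simp [hA]
  have hn3 : (n : ℝ) ≤ 2 * N / L := by
    rw [le_div_iff₀ hL0]
    exact_mod_cast (by omega : n * L ≤ 2 * N)
  have hn4 : n * (2 * E / L ^ 2) ≤ 2 * N / L * (2 * E / (L : ℝ) ^ 2) := by gcongr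
  rw [← hA0]
  have e : 2 * (2 * N / L * (2 * E / (L : ℝ) ^ 2)) = 8 * N / L ^ 3 * E := by
    field_simp; ring
  have e2 : ∀ B : ℝ, 2 / (L : ℝ) * B = 2 * (B / L) := fun B => by ring
  rw [e2]
  nlinarith [sq_nonneg (A 0 - 2 * A n)]

open scoped Classical in
/-- Smoothed values are controlled by the Dirichlet form with killing on the block. -/
theorem exists_sq_smooth_le (cs Cs c₁ : ℝ) (hcs : 0 < cs) (hCs : 0 < Cs) (hc₁ : 0 < c₁) :
    ∃ C : ℝ, 0 < C ∧ ∀ (N : ℕ) [NeZero N] (W : ℕ), 2 ≤ W → W ≤ N →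
      ∀ S : Matrix (ZMod N) (ZMod N) ℝ, (∀ i j, 0 ≤ S i j) →
      (∀ i, ∑ j, S i j ≤ 1) → (∀ i j, S i j ≤ Cs / W) →
      (∀ (i : ZMod N) (t : ℕ), 1 ≤ t → t ≤ W → cs / W ≤ S i (i + (t : ZMod N))) →
      ∀ (η : ℝ) (ηs p y : ZMod N → ℝ), 0 < η → (∀ i, 0 ≤ ηs i) → (∀ i ∈ block N W, η ≤ ηs i) →
      (∀ i, c₁ ≤ p i) → (∀ i, p i ≤ 2) → ∀ i,
      (∑ j, S i j * (p j * y j)) ^ 2 ≤ C * (1 / (W * η) + N / (W : ℝ) ^ 2) *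
        (∑ i, p i * ηs i * y i ^ 2
          + (∑ i, ∑ j, S i j * (p i * p j * (y i - y j) ^ 2)) / 2) := by
  refine ⟨48 / c₁ + 8 * 432 / (c₁ ^ 2 * cs) + 48 * Cs / (c₁ ^ 2 * cs), by positivity, ?_⟩
  intro N _ W hW hWN S hS0 hrow hup hlow η ηs p y hη hηs hηB hp hp2 i
  set L := W / 2 with hL
  have hL1 : 1 ≤ L := by omega
  have hL2 : 2 * L ≤ W := by omega
  have hL3 : W ≤ 3 * L := by omega
  have hL0 : (0 : ℝ) < L := by exact_mod_cast hL1
  have hW0 : (0 : ℝ) < W := by positivity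
  have hWL : (W : ℝ) / 3 ≤ L := by
    have : (W : ℝ) ≤ 3 * L := by exact_mod_cast hL3
    linarith
  set F := ∑ x, if x ∈ block N W then y x ^ 2 else 0 with hF
  set E₂ := ∑ i, localEnergy W y i with hE₂
  set 𝓔 := ∑ i, p i * ηs i * y i ^ 2 + (∑ i, ∑ j, S i j * (p i * p j * (y i - y j) ^ 2)) / 2
    with h𝓔
  have hE₂0 : 0 ≤ E₂ := Finset.sum_nonneg fun i _ => localEnergy_nonneg W y i
  have hF0 : 0 ≤ F := Finset.sum_nonneg fun i _ => by positivity
  have hp0 : ∀ i, 0 < p i := fun i => hc₁.trans_le (hp i)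
  have hA1 : c₁ * η * F ≤ ∑ i, p i * ηs i * y i ^ 2 := by
    rw [hF, Finset.mul_sum]
    refine Finset.sum_le_sum fun i _ => ?_
    split_ifs with h
    · exact mul_le_mul_of_nonneg_right (mul_le_mul (hp i) (hηB i h) hη.le (hp0 i).le)
        (sq_nonneg _)
    · have := hηs i
      have := (hp0 i).le
      simp only [mul_zero]; positivity
  have hA2 : c₁ ^ 2 * (cs / W * E₂) ≤ ∑ i, ∑ j, S i j * (p i * p j * (y i - y j) ^ 2) := by
    have h1 := sum_stencil_le hWN hS0 hlow (φ := fun i j => (y i - y j) ^ 2)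
      (fun _ _ => sq_nonneg _)
    have h2 : c₁ ^ 2 * ∑ i, ∑ j, S i j * (y i - y j) ^ 2
        ≤ ∑ i, ∑ j, S i j * (p i * p j * (y i - y j) ^ 2) := by
      rw [Finset.mul_sum]
      refine Finset.sum_le_sum fun i _ => ?_
      rw [Finset.mul_sum]
      refine Finset.sum_le_sum fun j _ => ?_
      have h3 : c₁ ^ 2 ≤ p i * p j := by
        rw [pow_two]; exact mul_le_mul (hp i) (hp j) hc₁.le (hp0 i).le
      calc c₁ ^ 2 * (S i j * (y i - y j) ^ 2) = S i j * (c₁ ^ 2 * (y i - y j) ^ 2) := by ring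
        _ ≤ _ := by have := hS0 i j; gcongr
    refine le_trans ?_ h2
    gcongr
    exact h1
  have h𝓔0 : 0 ≤ 𝓔 := by
    have : 0 ≤ c₁ ^ 2 * (cs / W * E₂) := by positivity
    have : 0 ≤ c₁ * η * F := by positivity
    linarith
  have hFE : F ≤ 𝓔 / (c₁ * η) := by
    rw [le_div_iff₀ (by positivity)]
    have : 0 ≤ c₁ ^ 2 * (cs / W * E₂) := by positivity
    linarith
  have hE₂E : E₂ ≤ 2 * W / (c₁ ^ 2 * cs) * 𝓔 := by
    have h1 : c₁ ^ 2 * (cs / W * E₂) ≤ 2 * 𝓔 := by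
      have : 0 ≤ c₁ * η * F := by positivity
      linarith
    have h2 : E₂ = W / (c₁ ^ 2 * cs) * (c₁ ^ 2 * (cs / W * E₂)) := by field_simp
    rw [h2]
    calc _ ≤ W / (c₁ ^ 2 * cs) * (2 * 𝓔) := by gcongr
      _ = _ := by ring
  have havg : ∀ j, localAvg L y j ^ 2
      ≤ (6 / c₁ * (1 / (W * η)) + 432 / (c₁ ^ 2 * cs) * (N / (W : ℝ) ^ 2)) * 𝓔 := by
    intro j
    refine (sq_localAvg_le hL1 hL2 hWN y j).trans ?_
    calc 2 / (L : ℝ) * F + 8 * N / (L : ℝ) ^ 3 * E₂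
        ≤ 2 / ((W : ℝ) / 3) * (𝓔 / (c₁ * η))
          + 8 * N / ((W : ℝ) / 3) ^ 3 * (2 * W / (c₁ ^ 2 * cs) * 𝓔) := by gcongr
      _ = _ := by field_simp; ring
  have hjen : (∑ j, S i j * (p j * y j)) ^ 2 ≤ 4 * ∑ j, S i j * y j ^ 2 := by
    refine (sq_sum_mul_le (fun j _ => hS0 i j) (hrow i) _).trans ?_
    rw [Finset.mul_sum]
    refine Finset.sum_le_sum fun j _ => ?_
    have h1 : (p j * y j) ^ 2 ≤ 4 * y j ^ 2 := by
      rw [mul_pow]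
      have : p j ^ 2 ≤ 4 := by nlinarith [hp0 j, hp2 j]
      gcongr
    calc S i j * (p j * y j) ^ 2 ≤ S i j * (4 * y j ^ 2) :=
          mul_le_mul_of_nonneg_left h1 (hS0 i j)
      _ = _ := by ring
  -- After smoothing by S the deviation of `y` from its local average is summed with weights at most
  -- Cs/W and is controlled by the total energy.
  have hsplit : ∑ j, S i j * y j ^ 2 ≤ 2 * (Cs / W * (3 / W * E₂))
      + 2 * ((6 / c₁ * (1 / (W * η)) + 432 / (c₁ ^ 2 * cs) * (N / (W : ℝ) ^ 2)) * 𝓔) := by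
    set B := (6 / c₁ * (1 / (W * η)) + 432 / (c₁ ^ 2 * cs) * (N / (W : ℝ) ^ 2)) * 𝓔
    have hB0 : 0 ≤ B := (sq_nonneg _).trans (havg i)
    have h1 : ∀ j, S i j * y j ^ 2
        ≤ 2 * (Cs / W * (3 / W * localEnergy W y j)) + 2 * (S i j * B) := by
      intro j
      have h2 : y j ^ 2 ≤ 2 * (y j - localAvg L y j) ^ 2 + 2 * localAvg L y j ^ 2 := by
        nlinarith [sq_nonneg (y j - 2 * localAvg L y j)]
      have h3 := sq_sub_localAvg_le hL1 (by omega : L ≤ W) y j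
      have h4 : localEnergy W y j / L ≤ 3 / W * localEnergy W y j := by
        have := localEnergy_nonneg W y j
        calc localEnergy W y j / L ≤ localEnergy W y j / ((W : ℝ) / 3) := by gcongr
          _ = _ := by field_simp
      have h5 : S i j * (y j - localAvg L y j) ^ 2 ≤ Cs / W * (3 / W * localEnergy W y j) :=
        mul_le_mul (hup i j) (h3.trans h4) (sq_nonneg _) (by positivity)
      have h6 : S i j * localAvg L y j ^ 2 ≤ S i j * B :=
        mul_le_mul_of_nonneg_left (havg j) (hS0 i j)
      have h7 := mul_le_mul_of_nonneg_left h2 (hS0 i j)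
      linarith
    refine (Finset.sum_le_sum fun j _ => h1 j).trans ?_
    rw [Finset.sum_add_distrib, ← Finset.mul_sum, ← Finset.mul_sum, ← Finset.mul_sum,
      ← Finset.mul_sum, ← Finset.sum_mul]
    have : (∑ j, S i j) * B ≤ B := mul_le_of_le_one_left hB0 (hrow i)
    linarith
  have hlast : 2 * (Cs / W * (3 / W * E₂)) ≤ 12 * Cs / (c₁ ^ 2 * cs) * (N / (W : ℝ) ^ 2) * 𝓔 := by
    have hWN' : (W : ℝ) ≤ N := by exact_mod_cast hWN
    calc 2 * (Cs / W * (3 / W * E₂)) ≤ 2 * (Cs / W * (3 / W * (2 * W / (c₁ ^ 2 * cs) * 𝓔))) := by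
          gcongr
      _ = 12 * Cs / (c₁ ^ 2 * cs) * (W / (W : ℝ) ^ 2) * 𝓔 := by field_simp; ring
      _ ≤ _ := by gcongr
  have hx : 0 ≤ 1 / (W * η) * 𝓔 := by positivity
  have hz : 0 ≤ N / (W : ℝ) ^ 2 * 𝓔 := by positivity
  set X := 1 / (W * η) * 𝓔
  set Z := N / (W : ℝ) ^ 2 * 𝓔
  have h8 : (∑ j, S i j * (p j * y j)) ^ 2 ≤ 48 / c₁ * X + 8 * 432 / (c₁ ^ 2 * cs) * Z
      + 48 * Cs / (c₁ ^ 2 * cs) * Z := by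
    have e1 : 2 * ((6 / c₁ * (1 / (W * η)) + 432 / (c₁ ^ 2 * cs) * (N / (W : ℝ) ^ 2)) * 𝓔)
        = 12 / c₁ * X + 2 * 432 / (c₁ ^ 2 * cs) * Z := by simp only [X, Z]; ring
    have e2 : 12 * Cs / (c₁ ^ 2 * cs) * (N / (W : ℝ) ^ 2) * 𝓔 = 12 * Cs / (c₁ ^ 2 * cs) * Z := by
      simp only [Z]; ring
    rw [e1] at hsplit
    rw [e2] at hlast
    calc _ ≤ 4 * (12 * Cs / (c₁ ^ 2 * cs) * Z
        + (12 / c₁ * X + 2 * 432 / (c₁ ^ 2 * cs) * Z)) := by linarith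
      _ = _ := by ring
  have e3 : (48 / c₁ + 8 * 432 / (c₁ ^ 2 * cs) + 48 * Cs / (c₁ ^ 2 * cs))
      * (1 / (W * η) + N / (W : ℝ) ^ 2) * 𝓔
      = (48 / c₁ + 8 * 432 / (c₁ ^ 2 * cs) + 48 * Cs / (c₁ ^ 2 * cs)) * (X + Z) := by
    simp only [X, Z]; ring
  rw [e3]
  refine h8.trans ?_
  have q1 : 0 ≤ 48 / c₁ * Z := by positivity
  have q2 : 0 ≤ 8 * 432 / (c₁ ^ 2 * cs) * X := by positivity
  have q3 : 0 ≤ 48 * Cs / (c₁ ^ 2 * cs) * X := by positivity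
  calc _ ≤ _ + (48 / c₁ * Z + 8 * 432 / (c₁ ^ 2 * cs) * X + 48 * Cs / (c₁ ^ 2 * cs) * X) :=
        le_add_of_nonneg_right (by linarith)
    _ = _ := by ring

/-- The resolvent of the `T`-equation. -/
theorem exists_T_solver (cs Cs c₁ : ℝ) (hcs : 0 < cs) (hCs : 0 < Cs) (hc₁ : 0 < c₁) :
    ∃ C : ℝ, 0 < C ∧ ∀ (N : ℕ) [NeZero N] (W : ℕ), 2 ≤ W → W ≤ N →
      ∀ S : Matrix (ZMod N) (ZMod N) ℝ, (∀ i j, 0 ≤ S i j) → (∀ i j, S i j = S j i) →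
      (∀ i, ∑ j, S i j ≤ 1) → (∀ i j, S i j ≤ Cs / W) →
      (∀ (i : ZMod N) (t : ℕ), 1 ≤ t → t ≤ W → cs / W ≤ S i (i + (t : ZMod N))) →
      ∀ (η : ℝ) (ηs D u : ZMod N → ℝ), 0 < η → (∀ i, 0 ≤ ηs i) → (∀ i ∈ block N W, η ≤ ηs i) →
      (∀ i, 0 < u i) → (∀ i, D i ≤ 4) →
      (∀ i, c₁ ≤ D i * u i) → (∀ i, D i * u i ≤ 2) → (∀ i, u i = ηs i + ∑ j, S i j * (D j * u j)) →
      ∀ (τ r : ZMod N → ℝ) (j : ZMod N) (R k : ℝ), (∀ i, |r i| ≤ R) →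
      (∀ i, τ i = ∑ l, S i l * (D l * τ l) + r i + k * S i j) →
      ∀ i, |τ i| ≤ C * ((1 / (W * η) + N / (W : ℝ) ^ 2) * (N * R + |k|)) := by
  classical
  obtain ⟨C, hC, hsm⟩ := exists_sq_smooth_le cs Cs c₁ hcs hCs hc₁
  refine ⟨1 + Cs + 4 * (Cs + C) + C, by positivity, ?_⟩
  intro N _ W hW hWN S hS0 hsymm hrow hup hlow η ηs D u hη hηs hηB hu hD4 hp hp2 hue τ r j R k hr hτ
  set K := 1 / (W * η) + N / (W : ℝ) ^ 2 with hK
  have hW0 : (0 : ℝ) < W := by positivity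
  have hWN' : (W : ℝ) ≤ N := by exact_mod_cast hWN
  have hN0 : (0 : ℝ) < N := hW0.trans_le hWN'
  have hKW : 1 / (W : ℝ) ≤ K := by
    have h1 : 1 / (W : ℝ) ≤ N / (W : ℝ) ^ 2 := by
      rw [div_le_div_iff₀ hW0 (by positivity)]; nlinarith
    have h2 : 0 ≤ 1 / (W * η) := by positivity
    linarith
  have hK0 : 0 < K := lt_of_lt_of_le (by positivity) hKW
  have hNK : 1 ≤ N * K := by
    calc 1 ≤ (N : ℝ) * (1 / W) := by
          rw [mul_one_div, le_div_iff₀ hW0]; linarith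
      _ ≤ N * K := by gcongr
  have hD0 : ∀ i, 0 < D i := fun i => by
    by_contra h
    push Not at h
    have := hp i
    nlinarith [hu i]
  have hsymmD : ∀ s t : ZMod N → ℝ, ∑ i, D i * s i * (t i - ∑ l, S i l * (D l * t l))
      = ∑ i, D i * t i * (s i - ∑ l, S i l * (D l * s l)) := by
    intro s t
    simp only [mul_sub, Finset.sum_sub_distrib, Finset.mul_sum]
    congr 1
    · exact Finset.sum_congr rfl fun i _ => by ring
    · rw [Finset.sum_comm]
      exact Finset.sum_congr rfl fun i _ => Finset.sum_congr rfl fun l _ => by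
        rw [hsymm l i]; ring
  -- Ground state transform: for t = uy, the form ∑ D t (t - SDt) is the Dirichlet energy of y with
  -- conductances p_i p_l S_il, where p = Du, plus the killing term p ηs y². The equation u = ηs +
  -- SDu makes the diagonal terms match.
  have henergy : ∀ t : ZMod N → ℝ, ∀ i, (∑ l, S i l * (D l * t l)) ^ 2
      ≤ C * K * ∑ i, D i * t i * (t i - ∑ l, S i l * (D l * t l)) := by
    intro t i
    have h := hsm N W hW hWN S hS0 hrow hup hlow η ηs (fun i => D i * u i) (fun i => t i / u i)
      hη hηs hηB hp hp2 i
    have e1 : ∀ l, D l * u l * (t l / u l) = D l * t l := fun l => by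
      have := (hu l).ne'
      field_simp
    simp only [e1] at h
    refine h.trans (le_of_eq ?_)
    congr 1
    have e2 : ∀ i, D i * u i * ηs i * (t i / u i) ^ 2
        = D i * t i * t i - ∑ l, S i l * (D i * u i * (D l * u l)) * (t i / u i) ^ 2 := by
      intro i
      have h1 : D i * t i * t i = D i * u i * u i * (t i / u i) ^ 2 := by
        have := (hu i).ne'
        field_simp
      have h2 : ∑ l, S i l * (D i * u i * (D l * u l)) * (t i / u i) ^ 2
          = D i * u i * (t i / u i) ^ 2 * ∑ l, S i l * (D l * u l) := by
        rw [Finset.mul_sum]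
        exact Finset.sum_congr rfl fun l _ => by ring
      have h3 : ηs i = u i - ∑ l, S i l * (D l * u l) := by linarith [hue i]
      rw [h1, h2, h3]; ring
    have e3 : ∑ i, ∑ l, S i l * (D i * u i * (D l * u l)) * (t l / u l) ^ 2
        = ∑ i, ∑ l, S i l * (D i * u i * (D l * u l)) * (t i / u i) ^ 2 := by
      rw [Finset.sum_comm]
      exact Finset.sum_congr rfl fun i _ => Finset.sum_congr rfl fun l _ => by
        rw [hsymm l i]; ring
    have e4 : ∀ i l, S i l * (D i * u i * (D l * u l) * (t i / u i - t l / u l) ^ 2)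
        = S i l * (D i * u i * (D l * u l)) * (t i / u i) ^ 2
          + S i l * (D i * u i * (D l * u l)) * (t l / u l) ^ 2
          - 2 * (D i * t i * (S i l * (D l * t l))) := by
      intro i l
      rw [← e1 i, ← e1 l]; ring
    simp only [e2, e4, Finset.sum_sub_distrib, Finset.sum_add_distrib, e3, mul_sub,
      ← Finset.mul_sum]
    ring
  have hinj : Function.Injective (1 - S * Matrix.diagonal D).mulVec := by
    have hmv : ∀ t i, (1 - S * Matrix.diagonal D).mulVec t i
        = t i - ∑ l, S i l * (D l * t l) := by
      intro t i
      rw [Matrix.sub_mulVec, Matrix.one_mulVec, ← Matrix.mulVec_mulVec, Pi.sub_apply]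
      simp only [Matrix.mulVec, dotProduct, Matrix.diagonal_apply, ite_mul, zero_mul,
        Finset.sum_ite_eq, Finset.mem_univ, if_true]
    intro x y hxy
    have h0 : (1 - S * Matrix.diagonal D).mulVec (x - y) = 0 := by
      rw [Matrix.mulVec_sub, hxy, sub_self]
    have h1 : ∀ i, (x - y) i - ∑ l, S i l * (D l * (x - y) l) = 0 := fun i => by
      rw [← hmv, h0]; rfl
    ext i
    have h2 := henergy (x - y) i
    simp only [h1, mul_zero, Finset.sum_const_zero] at h2
    have h3 : ∑ l, S i l * (D l * (x - y) l) = 0 := by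
      have := le_antisymm h2 (sq_nonneg _)
      exact pow_eq_zero_iff two_ne_zero |>.mp this
    have h4 := h1 i
    rw [h3, sub_zero] at h4
    exact sub_eq_zero.mp h4
  intro i
  -- `t` is column `i` of the Green function (1 - SD)⁻¹S.
  obtain ⟨t, ht⟩ := (Matrix.mulVec_surjective_iff_isUnit.mpr
    (Matrix.mulVec_injective_iff_isUnit.mp hinj)) (fun l => S i l)
  have ht' : ∀ x, t x - ∑ l, S x l * (D l * t l) = S i x := by
    intro x
    rw [← congrFun ht x, Matrix.sub_mulVec, Matrix.one_mulVec, ← Matrix.mulVec_mulVec,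
      Pi.sub_apply]
    simp only [Matrix.mulVec, dotProduct, Matrix.diagonal_apply, ite_mul, zero_mul,
      Finset.sum_ite_eq, Finset.mem_univ, if_true]
  have hpair : ∀ s : ZMod N → ℝ, ∑ l, S i l * (D l * s l)
      = ∑ l, D l * t l * (s l - ∑ x, S l x * (D x * s x)) := by
    intro s
    rw [hsymmD t s]
    exact Finset.sum_congr rfl fun l _ => by rw [ht' l]; ring
  -- Paired with its own equation, `t` has energy equal to the value a of SDt at `i`. So a² ≤ CKa,
  -- whence a ≤ CK, and then every value of SDt is at most CK.
  have hE := fun x => henergy t x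
  rw [← hpair t] at hE
  set a := ∑ l, S i l * (D l * t l) with ha
  have ha0 : 0 ≤ a := by
    by_contra hc
    push Not at hc
    have := hE i
    nlinarith [mul_pos hC hK0]
  have haK : a ≤ C * K := by
    by_contra hc
    push Not at hc
    have h1 := hE i
    rw [← ha] at h1
    have h2 : 0 < a := lt_of_le_of_lt (by positivity) hc
    nlinarith
  have hst : ∀ x, |∑ l, S x l * (D l * t l)| ≤ C * K := by
    intro x
    refine abs_le_of_sq_le_sq ((hE x).trans ?_) (by positivity)
    rw [pow_two]
    gcongr
  have htK : ∀ x, |t x| ≤ (Cs + C) * K := by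
    intro x
    have h1 : t x = S i x + ∑ l, S x l * (D l * t l) := by linarith [ht' x]
    rw [h1]
    have h2 : |S i x| ≤ Cs * K := by
      rw [abs_of_nonneg (hS0 i x)]
      refine (hup i x).trans ?_
      rw [div_eq_mul_one_div]
      gcongr
    calc _ ≤ |S i x| + |∑ l, S x l * (D l * t l)| := abs_add_le _ _
      _ ≤ _ := by linarith [hst x]
  have hR0 : 0 ≤ R := (abs_nonneg _).trans (hr i)
  -- By symmetry SDτ at `i` is the pairing of `t` with the source of τ: N values of size R, and k
  -- times column `j` of S.
  have hmain : |∑ l, S i l * (D l * τ l)| ≤ 4 * (Cs + C) * K * (N * R) + |k| * (C * K) := by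
    rw [hpair τ]
    have e1 : ∀ l, D l * t l * (τ l - ∑ x, S l x * (D x * τ x))
        = D l * t l * r l + k * (S j l * (D l * t l)) := fun l => by
      have : τ l - ∑ x, S l x * (D x * τ x) = r l + k * S l j := by linarith [hτ l]
      rw [this, hsymm l j]; ring
    simp only [e1, Finset.sum_add_distrib, ← Finset.mul_sum]
    refine (abs_add_le _ _).trans (add_le_add ?_ ?_)
    · refine (Finset.abs_sum_le_sum_abs _ _).trans ?_
      calc ∑ l, |D l * t l * r l| ≤ ∑ _l : ZMod N, 4 * ((Cs + C) * K) * R := by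
            refine Finset.sum_le_sum fun l _ => ?_
            rw [abs_mul, abs_mul, abs_of_pos (hD0 l)]
            have := htK l
            have := hr l
            have := hD4 l
            gcongr
        _ = _ := by
            rw [Finset.sum_const, Finset.card_univ, ZMod.card, nsmul_eq_mul]; ring
    · rw [abs_mul]
      gcongr
      exact hst j
  rw [hτ i]
  have h1 : |r i| ≤ K * (N * R) := by
    calc |r i| ≤ 1 * R := by rw [one_mul]; exact hr i
      _ ≤ N * K * R := by gcongr
      _ = _ := by ring
  have h2 : |k * S i j| ≤ |k| * (Cs * K) := by
    rw [abs_mul, abs_of_nonneg (hS0 i j)]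
    gcongr
    refine (hup i j).trans ?_
    rw [div_eq_mul_one_div]
    gcongr
  have hX : 0 ≤ K * (N * R) := by positivity
  have hY : 0 ≤ K * |k| := by positivity
  calc _ ≤ |∑ l, S i l * (D l * τ l)| + |r i| + |k * S i j| := abs_add_three _ _ _
    _ ≤ 4 * (Cs + C) * K * (N * R) + |k| * (C * K) + K * (N * R) + |k| * (Cs * K) := by linarith
    _ = (1 + 4 * (Cs + C)) * (K * (N * R)) + (Cs + C) * (K * |k|) := by ring
    _ ≤ (1 + Cs + 4 * (Cs + C) + C) * (K * (N * R))
        + (1 + Cs + 4 * (Cs + C) + C) * (K * |k|) :=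
        add_le_add (mul_le_mul_of_nonneg_right (by linarith) hX)
          (mul_le_mul_of_nonneg_right (by linarith) hY)
    _ = _ := by ring

end TSolver

/-! ### Row fluctuations and their dependence on another row. -/

section Fluctuation

variable {ι : Type*} [Fintype ι] [DecidableEq ι]

/-- `h_lj = ∑ₓ H_lx G⁽ˡ⁾_xj`. -/
def rowMinor (w : ι → ℂ) (l j : ι) (H : Matrix ι ι ℝ) : ℂ :=
  ∑ x, (H l x : ℂ) * res w (del l H) x j

/-- The conditional expectation of `h_lj * conj h_lk` given the minor. -/
def rowCov (w : ι → ℂ) (S : Matrix ι ι ℝ) (l j k : ι) (H : Matrix ι ι ℝ) : ℂ :=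
  ∑ x, (S l x : ℂ) * (res w (del l H) x j * (starRingEnd ℂ) (res w (del l H) x k))

/-- The fluctuation of `h_lj * conj h_lk` with respect to the row `l`. -/
def fluct (w : ι → ℂ) (S : Matrix ι ι ℝ) (l j k : ι) (H : Matrix ι ι ℝ) : ℂ :=
  rowMinor w l j H * (starRingEnd ℂ) (rowMinor w l k H) - rowCov w S l j k H

/-- The averaged fluctuation. -/
def fluctSum (w : ι → ℂ) (S : Matrix ι ι ℝ) (b : ι → ℝ) (j k : ι) (H : Matrix ι ι ℝ) : ℂ :=
  ∑ l ∈ Finset.univ.filter (fun l => l ≠ j ∧ l ≠ k), (b l : ℂ) * fluct w S l j k H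

/-- The version of the averaged fluctuation that does not depend on the row `m`. -/
def fluctSumDel (w : ι → ℂ) (S : Matrix ι ι ℝ) (b : ι → ℝ) (m j k : ι) (H : Matrix ι ι ℝ) : ℂ :=
  ∑ l ∈ Finset.univ.filter (fun l => (l ≠ j ∧ l ≠ k) ∧ l ≠ m),
    (b l : ℂ) * fluct w S l j k (del m H)

/-- The ratio `G⁽ˡ⁾_mj / G⁽ˡ⁾_mm`. -/
def minorRatio (w : ι → ℂ) (l m j : ι) (H : Matrix ι ι ℝ) : ℂ :=
  res w (del l H) m j / res w (del l H) m m

section Algebra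

variable {w : ι → ℂ} (hw : ∀ i, 0 < (w i).im) {H : Matrix ι ι ℝ} (hH : ∀ i j, H i j = H j i)
include hw hH

theorem res_del_del {l m j : ι} (hjm : j ≠ m) (x : ι) :
    res w (del l (del m H)) x j
      = res w (del l H) x j - res w (del l H) x m * minorRatio w l m j H := by
  rw [del_comm, res_del hw (del_symm hH l) hjm]
  rfl

theorem rowMinor_del {l m j : ι} (hlm : l ≠ m) (hjm : j ≠ m) :
    rowMinor w l j (del m H) = rowMinor w l j H - minorRatio w l m j H * rowMinor w l m H := by
  have h1 : rowMinor w l j (del m H) = ∑ x, (H l x : ℂ) * res w (del l (del m H)) x j := by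
    unfold rowMinor
    refine Finset.sum_congr rfl fun x _ => ?_
    by_cases hx : x = m
    · subst hx
      rw [del_comm, res_del_row hw (del_symm hH l) hjm]; simp
    · rw [del_of_ne H hlm hx]
  rw [h1, rowMinor, rowMinor, Finset.mul_sum, ← Finset.sum_sub_distrib]
  refine Finset.sum_congr rfl fun x _ => ?_
  rw [res_del_del hw hH hjm]; ring

theorem rowCov_del (S : Matrix ι ι ℝ) {l m j k : ι} (hjm : j ≠ m) (hkm : k ≠ m) :
    rowCov w S l j k (del m H) = rowCov w S l j k H
      - minorRatio w l m j H * rowCov w S l m k H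
      - (starRingEnd ℂ) (minorRatio w l m k H) * rowCov w S l j m H
      + minorRatio w l m j H * (starRingEnd ℂ) (minorRatio w l m k H) * rowCov w S l m m H := by
  simp only [rowCov, Finset.mul_sum, ← Finset.sum_sub_distrib, ← Finset.sum_add_distrib]
  refine Finset.sum_congr rfl fun x _ => ?_
  rw [res_del_del hw hH hjm, res_del_del hw hH hkm, map_sub, map_mul]
  ring

/-- Exact effect of removing the row `m` on the fluctuations. -/
theorem fluct_sub_del (S : Matrix ι ι ℝ) {l m j k : ι} (hlm : l ≠ m) (hjm : j ≠ m) (hkm : k ≠ m) :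
    fluct w S l j k H - fluct w S l j k (del m H)
      = minorRatio w l m j H * fluct w S l m k H
        + (starRingEnd ℂ) (minorRatio w l m k H) * fluct w S l j m H
        - minorRatio w l m j H * (starRingEnd ℂ) (minorRatio w l m k H) * fluct w S l m m H := by
  simp only [fluct]
  rw [rowCov_del hw hH S hjm hkm, rowMinor_del hw hH hlm hjm, rowMinor_del hw hH hlm hkm, map_sub,
    map_mul]
  ring

end Algebra

/-- The coefficients γ_l are constant up to ε, so γ₀ leaves the sum and the full sum over `U`, again
an averaged fluctuation, appears. The at most two extra indices cost 2βK. -/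
theorem norm_sum_weight_le {T U : Finset ι} {b : ι → ℝ} {γ F : ι → ℂ} {γ₀ : ℂ} {ε β K B : ℝ}
    (hTU : T ⊆ U) (hcard : (U \ T).card ≤ 2) (hb : ∀ l, 0 ≤ b l) (hbβ : ∀ l, b l ≤ β)
    (hbB : ∑ l, b l ≤ B) (hε : ∀ l ∈ T, ‖γ l - γ₀‖ ≤ ε) (hF : ∀ l ∈ U, ‖F l‖ ≤ K) (hK : 0 ≤ K)
    (hε0 : 0 ≤ ε) (hβ : 0 ≤ β) :
    ‖∑ l ∈ T, (b l : ℂ) * (γ l * F l)‖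
      ≤ ‖γ₀‖ * (‖∑ l ∈ U, (b l : ℂ) * F l‖ + 2 * (β * K)) + ε * K * B := by
  have e : ∑ l ∈ T, (b l : ℂ) * (γ l * F l)
      = γ₀ * (∑ l ∈ U, (b l : ℂ) * F l - ∑ l ∈ U \ T, (b l : ℂ) * F l)
        + ∑ l ∈ T, (b l : ℂ) * ((γ l - γ₀) * F l) := by
    rw [← Finset.sum_sdiff hTU, add_sub_cancel_left, Finset.mul_sum, ← Finset.sum_add_distrib]
    exact Finset.sum_congr rfl fun l _ => by ring
  rw [e]
  refine (norm_add_le _ _).trans (add_le_add ?_ ?_)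
  · rw [norm_mul]
    gcongr
    refine (norm_sub_le _ _).trans ?_
    gcongr
    calc ‖∑ l ∈ U \ T, (b l : ℂ) * F l‖ ≤ ∑ l ∈ U \ T, β * K := by
          refine (norm_sum_le _ _).trans (Finset.sum_le_sum fun l hl => ?_)
          rw [norm_mul, Complex.norm_real, Real.norm_of_nonneg (hb l)]
          exact mul_le_mul (hbβ l) (hF l (Finset.sdiff_subset hl)) (norm_nonneg _) hβ
      _ = (U \ T).card * (β * K) := by rw [Finset.sum_const, nsmul_eq_mul]
      _ ≤ 2 * (β * K) := by gcongr; exact_mod_cast hcard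
  · calc ‖∑ l ∈ T, (b l : ℂ) * ((γ l - γ₀) * F l)‖ ≤ ∑ l ∈ T, b l * (ε * K) := by
          refine (norm_sum_le _ _).trans (Finset.sum_le_sum fun l hl => ?_)
          rw [norm_mul, Complex.norm_real, Real.norm_of_nonneg (hb l), norm_mul]
          exact mul_le_mul_of_nonneg_left
            (mul_le_mul (hε l hl) (hF l (hTU hl)) (norm_nonneg _) hε0) (hb l)
      _ ≤ ∑ l, b l * (ε * K) := Finset.sum_le_sum_of_subset_of_nonneg (Finset.subset_univ T)
            (fun l _ _ => mul_nonneg (hb l) (mul_nonneg hε0 hK))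
      _ = (∑ l, b l) * (ε * K) := by rw [Finset.sum_mul]
      _ ≤ B * (ε * K) := mul_le_mul_of_nonneg_right hbB (mul_nonneg hε0 hK)
      _ = _ := by ring

/-- Bookkeeping for `exists_fluctSum_sub_le`: all terms without a factor X are O(φ⁴). -/
theorem fluct_arith {F₀ A C₂ B φ X1 X2 X3 n₀ n₁ n₂ n₃ : ℝ} (hF₀ : 0 < F₀) (hA0 : 0 < A)
    (hC₂0 : 0 < C₂) (hB : 0 < B) (h0 : 0 < φ) (hφ1 : φ ≤ 1) (hX10 : 0 ≤ X1) (hX20 : 0 ≤ X2)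
    (hX30 : 0 ≤ X3) (b0 : n₀ ≤ B * φ ^ 2 * (F₀ * φ ^ 2))
    (c1 : n₁ ≤ A * φ * (X1 + 2 * (B * φ ^ 2 * (F₀ * φ ^ 2))) + C₂ * φ ^ 2 * (F₀ * φ ^ 2) * B)
    (c2 : n₂ ≤ A * φ * (X2 + 2 * (B * φ ^ 2 * (F₀ * φ ^ 2))) + C₂ * φ ^ 2 * (F₀ * φ ^ 2) * B)
    (c3 : n₃ ≤ A ^ 2 * φ * (X3 + 2 * (B * φ ^ 2 * (F₀ * φ ^ 2)))
      + 2 * C₂ * A * φ ^ 2 * (F₀ * φ ^ 2) * B) :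
    n₀ + n₁ + n₂ + n₃ ≤ (F₀ + A + A ^ 2 + B * F₀ + 6 * (A + A ^ 2) * (B * F₀)
      + 3 * (C₂ + 2 * C₂ * A) * F₀ * B) * φ * (X1 + X2 + X3 + φ ^ 3) := by
  have hφ4 : φ * (φ ^ 2 * φ ^ 2) ≤ φ ^ 4 := by
    calc φ * (φ ^ 2 * φ ^ 2) = φ * φ ^ 4 := by ring
      _ ≤ 1 * φ ^ 4 := by gcongr
      _ = _ := one_mul _
  have hbig : 0 ≤ A * (B * F₀) := by positivity
  have hbig2 : 0 ≤ A ^ 2 * (B * F₀) := by positivity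
  have k1 : A * φ * (2 * (B * φ ^ 2 * (F₀ * φ ^ 2))) ≤ 2 * (A * (B * F₀)) * φ ^ 4 := by
    calc _ = 2 * (A * (B * F₀)) * (φ * (φ ^ 2 * φ ^ 2)) := by ring
      _ ≤ _ := by gcongr
  have k2 : A ^ 2 * φ * (2 * (B * φ ^ 2 * (F₀ * φ ^ 2))) ≤ 2 * (A ^ 2 * (B * F₀)) * φ ^ 4 := by
    calc _ = 2 * (A ^ 2 * (B * F₀)) * (φ * (φ ^ 2 * φ ^ 2)) := by ring
      _ ≤ _ := by gcongr
  set C := F₀ + A + A ^ 2 + B * F₀ + 6 * (A + A ^ 2) * (B * F₀)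
    + 3 * (C₂ + 2 * C₂ * A) * F₀ * B with hC
  have hCA : A ≤ C := by
    have : 0 ≤ F₀ + A ^ 2 + B * F₀ + 6 * (A + A ^ 2) * (B * F₀)
      + 3 * (C₂ + 2 * C₂ * A) * F₀ * B := by positivity
    linarith
  have hCA2 : A ^ 2 ≤ C := by
    have : 0 ≤ F₀ + A + B * F₀ + 6 * (A + A ^ 2) * (B * F₀)
      + 3 * (C₂ + 2 * C₂ * A) * F₀ * B := by positivity
    linarith
  have hCr : B * F₀ + 4 * (A * (B * F₀)) + 2 * (A ^ 2 * (B * F₀)) + 2 * (C₂ * F₀ * B)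
      + 2 * C₂ * A * F₀ * B ≤ C := by
    have : 0 ≤ F₀ + A + A ^ 2 + 2 * (A * (B * F₀)) + 4 * (A ^ 2 * (B * F₀)) + C₂ * F₀ * B
        + 4 * (C₂ * A * F₀ * B) := by positivity
    rw [hC]
    linarith
  have m1 : A * φ * X1 ≤ C * φ * X1 := by gcongr
  have m2 : A * φ * X2 ≤ C * φ * X2 := by gcongr
  have m3 : A ^ 2 * φ * X3 ≤ C * φ * X3 := by gcongr
  have m4 : (B * F₀ + 4 * (A * (B * F₀)) + 2 * (A ^ 2 * (B * F₀)) + 2 * (C₂ * F₀ * B)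
      + 2 * C₂ * A * F₀ * B) * φ ^ 4 ≤ C * φ ^ 4 := by gcongr
  linarith

/-- The matrix `H` is such that its resolvent is close to `diag M`. -/
structure GoodResolvent (w : ι → ℂ) (M : ι → ℂ) (c₀ φ : ℝ) (H : Matrix ι ι ℝ) : Prop where
  im_pos : ∀ i, 0 < (w i).im
  symm : ∀ i j, H i j = H j i
  c₀_pos : 0 < c₀
  c₀_le : c₀ ≤ 1
  φ_pos : 0 < φ
  φ_le : φ ≤ c₀ ^ 2 / 8
  lower : ∀ i, c₀ ≤ ‖M i‖
  upper : ∀ i, ‖M i‖ ≤ 2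
  close : ∀ i j, ‖(res w H - Matrix.diagonal M) i j‖ ≤ φ

namespace GoodResolvent

variable {w M : ι → ℂ} {c₀ φ : ℝ} {H : Matrix ι ι ℝ} (h : GoodResolvent w M c₀ φ H)
include h

theorem φ_le_one : φ ≤ 1 / 8 := by
  have h1 := h.φ_le
  have h2 := h.c₀_le
  have h3 := h.c₀_pos
  nlinarith

theorem off {x y : ι} (hxy : x ≠ y) : ‖res w H x y‖ ≤ φ := by
  have := h.close x y
  rwa [Matrix.sub_apply, Matrix.diagonal_apply_ne _ hxy, sub_zero] at this

theorem diag_sub (x : ι) : ‖res w H x x - M x‖ ≤ φ := by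
  have := h.close x x
  rwa [Matrix.sub_apply, Matrix.diagonal_apply_eq] at this

theorem diag_lower (x : ι) : c₀ - φ ≤ ‖res w H x x‖ := by
  have h1 := h.diag_sub x
  have h2 := h.lower x
  have h3 := norm_sub_norm_le (M x) (res w H x x)
  rw [norm_sub_rev] at h3
  linarith

theorem diag_lower' (x : ι) : c₀ / 2 ≤ ‖res w H x x‖ := by
  have h1 := h.diag_lower x
  have h2 := h.φ_le
  have h3 := h.c₀_pos
  have h4 := h.c₀_le
  nlinarith

theorem diag_upper (x : ι) : ‖res w H x x‖ ≤ 3 := by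
  have h1 := h.diag_sub x
  have h2 := h.upper x
  have h3 := norm_le_norm_sub_add (res w H x x) (M x)
  linarith [h.φ_le_one]

theorem upper_all (x y : ι) : ‖res w H x y‖ ≤ 3 := by
  by_cases hxy : x = y
  · subst hxy; exact h.diag_upper x
  · linarith [h.off hxy, h.φ_le_one]

theorem norm_div_diag_le {a : ℂ} {t : ℝ} (l : ι) (ha : ‖a‖ ≤ t) :
    ‖a / res w H l l‖ ≤ 2 / c₀ * t := by
  have h1 := h.diag_lower' l
  have h3 := h.c₀_pos
  have ht : 0 ≤ t := (norm_nonneg a).trans ha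
  rw [norm_div]
  calc ‖a‖ / ‖res w H l l‖ ≤ t / (c₀ / 2) := by gcongr
    _ = _ := by field_simp

theorem rowMinor_le {l j : ι} (hj : j ≠ l) : ‖rowMinor w l j H‖ ≤ 2 / c₀ * φ := by
  rw [rowMinor, row_mul_minor h.im_pos h.symm hj, norm_neg]
  exact h.norm_div_diag_le l (h.off hj.symm)

/-- The correction G_xl G_lj / G_ll contains two off-diagonal entries. -/
theorem minor_sub_le {l j x : ι} (hj : j ≠ l) (hx : x ≠ l) :
    ‖res w (del l H) x j - res w H x j‖ ≤ 2 / c₀ * φ ^ 2 := by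
  rw [res_del h.im_pos h.symm hj, sub_sub_cancel_left, norm_neg, mul_div_assoc']
  refine h.norm_div_diag_le l ?_
  rw [norm_mul, pow_two]
  exact mul_le_mul (h.off hx) (h.off hj.symm) (norm_nonneg _) h.φ_pos.le

theorem minor_off_le {l j x : ι} (hj : j ≠ l) (hxj : x ≠ j) :
    ‖res w (del l H) x j‖ ≤ (1 + 2 / c₀) * φ := by
  have h0 := h.φ_pos
  have h3 := h.c₀_pos
  by_cases hx : x = l
  · subst hx
    rw [res_del_row h.im_pos h.symm hj, norm_zero]; positivity
  · have h1 := h.minor_sub_le hj hx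
    have h2 := h.off hxj
    have h4 := norm_le_norm_sub_add (res w (del l H) x j) (res w H x j)
    have h5 : 2 / c₀ * φ ^ 2 ≤ 2 / c₀ * φ := by
      gcongr; nlinarith [h.φ_le_one]
    linarith

theorem minor_upper_le {l j : ι} (hj : j ≠ l) (x : ι) :
    ‖res w (del l H) x j‖ ≤ 3 + 2 / c₀ := by
  have h0 := h.φ_pos
  have h3 := h.c₀_pos
  by_cases hx : x = l
  · subst hx
    rw [res_del_row h.im_pos h.symm hj, norm_zero]; positivity
  · have h1 := h.minor_sub_le hj hx
    have h2 := h.upper_all x j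
    have h4 := norm_le_norm_sub_add (res w (del l H) x j) (res w H x j)
    have h5 : 2 / c₀ * φ ^ 2 ≤ 2 / c₀ * 1 := by
      gcongr; nlinarith [h.φ_le_one]
    linarith

/-- The requirement φ ≤ c₀²/8 leaves room for two corrections, from M to G and from G to its minor.
-/
theorem minor_diag_lower {l m : ι} (hm : m ≠ l) : c₀ / 2 ≤ ‖res w (del l H) m m‖ := by
  have h1 := h.minor_sub_le hm hm
  have h2 := h.diag_lower m
  have h3 := norm_sub_norm_le (res w H m m) (res w (del l H) m m)
  rw [norm_sub_rev] at h3
  have h4 := h.φ_le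
  have h5 := h.c₀_pos
  have h6 := h.c₀_le
  have h7 := h.φ_pos
  have h8 : 2 / c₀ * φ ^ 2 ≤ φ / 4 := by
    calc 2 / c₀ * φ ^ 2 = 2 / c₀ * φ * φ := by ring
      _ ≤ 2 / c₀ * φ * (c₀ ^ 2 / 8) := by gcongr
      _ = c₀ * φ / 4 := by field_simp; ring
      _ ≤ φ / 4 := by nlinarith
  nlinarith

theorem minorRatio_le {l m j : ι} (hj : j ≠ l) (hm : m ≠ l) (hmj : m ≠ j) :
    ‖minorRatio w l m j H‖ ≤ 2 / c₀ * ((1 + 2 / c₀) * φ) := by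
  have h1 := h.minor_diag_lower hm
  have h2 := h.minor_off_le hj hmj
  have h3 := h.c₀_pos
  have h0 := h.φ_pos
  rw [minorRatio, norm_div]
  calc _ ≤ ((1 + 2 / c₀) * φ) / (c₀ / 2) := by gcongr
    _ = _ := by field_simp

/-- To first order in φ the ratio does not depend on `l`, so it can be taken out of sums over `l`.
-/
theorem minorRatio_sub_le {l m j : ι} (hj : j ≠ l) (hm : m ≠ l) (hmj : m ≠ j) :
    ‖minorRatio w l m j H - res w H m j / res w H m m‖ ≤ 4 * (2 / c₀) ^ 3 * φ ^ 2 := by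
  have h1 := h.minor_diag_lower hm
  have h2 := h.diag_lower' m
  have h3 := h.c₀_pos
  have h0 := h.φ_pos
  have hn1 : res w (del l H) m m ≠ 0 := res_diag_ne_zero h.im_pos (del_symm h.symm l) m
  have hn2 : res w H m m ≠ 0 := res_diag_ne_zero h.im_pos h.symm m
  have e : minorRatio w l m j H - res w H m j / res w H m m
      = ((res w (del l H) m j - res w H m j) * res w H m m
          - res w H m j * (res w (del l H) m m - res w H m m))
        / (res w (del l H) m m * res w H m m) := by
    rw [minorRatio]; field_simp; ring
  rw [e, norm_div, norm_mul]
  have h4 : ‖(res w (del l H) m j - res w H m j) * res w H m m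
      - res w H m j * (res w (del l H) m m - res w H m m)‖
      ≤ 2 / c₀ * φ ^ 2 * 3 + 1 * (2 / c₀ * φ ^ 2) := by
    refine (norm_sub_le _ _).trans ?_
    rw [norm_mul, norm_mul]
    have := h.minor_sub_le hj hm
    have := h.minor_sub_le hm hm
    have := h.diag_upper m
    have := (h.off hmj).trans (h.φ_le_one.trans (by norm_num : (1 / 8 : ℝ) ≤ 1))
    gcongr
  calc _ ≤ (2 / c₀ * φ ^ 2 * 3 + 1 * (2 / c₀ * φ ^ 2)) / (c₀ / 2 * (c₀ / 2)) := by gcongr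
    _ = _ := by field_simp; ring

variable {S : Matrix ι ι ℝ} {B : ℝ} (hB : 1 ≤ B) (hS : ∀ i j, 0 ≤ S i j)
  (hrow : ∀ i, ∑ j, S i j ≤ 1) (hSφ : ∀ i j, S i j ≤ B * φ ^ 2)
include hB hS hrow hSφ

/-- The off-diagonal entries are O(φ) and the weights sum to at most 1. The one entry of order one,
at `x = j`, has weight at most Bφ², and similarly for `k`. -/
theorem rowCov_le {l j k : ι} (hj : j ≠ l) (hk : k ≠ l) :
    ‖rowCov w S l j k H‖ ≤ ((1 + 2 / c₀) ^ 2 + (3 + 2 / c₀) ^ 2 * B) * φ ^ 2 := by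
  have h3 := h.c₀_pos
  have h0 := h.φ_pos
  have key : ∀ j, j ≠ l → ∑ x, S l x * ‖res w (del l H) x j‖ ^ 2
      ≤ ((1 + 2 / c₀) ^ 2 + (3 + 2 / c₀) ^ 2 * B) * φ ^ 2 := by
    intro j hj
    calc ∑ x, S l x * ‖res w (del l H) x j‖ ^ 2
        ≤ ∑ x, (S l x * ((1 + 2 / c₀) * φ) ^ 2
            + if x = j then B * φ ^ 2 * (3 + 2 / c₀) ^ 2 else 0) := by
          refine Finset.sum_le_sum fun x _ => ?_
          split_ifs with hx
          · have h1 : S l x * ‖res w (del l H) x j‖ ^ 2 ≤ B * φ ^ 2 * (3 + 2 / c₀) ^ 2 := by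
              have := h.minor_upper_le hj x
              have := hSφ l x
              gcongr
            have h2 : 0 ≤ S l x * ((1 + 2 / c₀) * φ) ^ 2 := mul_nonneg (hS l x) (sq_nonneg _)
            linarith
          · rw [add_zero]
            have := h.minor_off_le hj hx
            have := hS l x
            gcongr
      _ = (∑ x, S l x) * ((1 + 2 / c₀) * φ) ^ 2 + B * φ ^ 2 * (3 + 2 / c₀) ^ 2 := by
          rw [Finset.sum_add_distrib, Finset.sum_mul, Finset.sum_ite_eq' Finset.univ j]
          simp
      _ ≤ 1 * ((1 + 2 / c₀) * φ) ^ 2 + B * φ ^ 2 * (3 + 2 / c₀) ^ 2 := by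
          gcongr; exact hrow l
      _ = _ := by ring
  have h1 := key j hj
  have h2 := key k hk
  have h4 : ‖rowCov w S l j k H‖ ≤ ∑ x, (S l x * ‖res w (del l H) x j‖ ^ 2 / 2
      + S l x * ‖res w (del l H) x k‖ ^ 2 / 2) := by
    refine (norm_sum_le _ _).trans (Finset.sum_le_sum fun x _ => ?_)
    rw [norm_mul, norm_mul, RCLike.norm_conj, Complex.norm_real, Real.norm_of_nonneg (hS l x)]
    nlinarith [mul_nonneg (hS l x)
      (sq_nonneg (‖res w (del l H) x j‖ - ‖res w (del l H) x k‖))]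
  rw [Finset.sum_add_distrib, ← Finset.sum_div, ← Finset.sum_div] at h4
  linarith

theorem fluct_le {l j k : ι} (hj : j ≠ l) (hk : k ≠ l) :
    ‖fluct w S l j k H‖
      ≤ ((2 / c₀) ^ 2 + ((1 + 2 / c₀) ^ 2 + (3 + 2 / c₀) ^ 2 * B)) * φ ^ 2 := by
  have h3 := h.c₀_pos
  have h0 := h.φ_pos
  refine (norm_sub_le _ _).trans ?_
  rw [norm_mul, RCLike.norm_conj]
  have h1 := h.rowCov_le hB hS hrow hSφ hj hk
  have h2 : ‖rowMinor w l j H‖ * ‖rowMinor w l k H‖ ≤ 2 / c₀ * φ * (2 / c₀ * φ) :=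
    mul_le_mul (h.rowMinor_le hj) (h.rowMinor_le hk) (norm_nonneg _) (by positivity)
  calc _ ≤ 2 / c₀ * φ * (2 / c₀ * φ) + _ := add_le_add h2 h1
    _ = _ := by ring

end GoodResolvent

set_option maxHeartbeats 1000000 in
/-- The effect of removing the row `m` on the averaged fluctuations. -/
theorem exists_fluctSum_sub_le (c₀ B : ℝ) (hc₀ : 0 < c₀) (hB : 1 ≤ B) :
    ∃ C : ℝ, 1 ≤ C ∧ ∀ {ι : Type} [Fintype ι] [DecidableEq ι] {w M : ι → ℂ} {φ : ℝ}
      {H : Matrix ι ι ℝ}, GoodResolvent w M c₀ φ H → ∀ {S : Matrix ι ι ℝ}, (∀ i j, 0 ≤ S i j) →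
      (∀ i, ∑ j, S i j ≤ 1) → (∀ i j, S i j ≤ B * φ ^ 2) → ∀ {b : ι → ℝ}, (∀ l, 0 ≤ b l) →
      (∀ l, b l ≤ B * φ ^ 2) → ∑ l, b l ≤ B →
      (∀ l j k, l ≠ j → l ≠ k → ‖fluct w S l j k H‖ ≤ C * φ ^ 2) ∧
      ∀ m j k, m ≠ j → m ≠ k → ‖fluctSum w S b j k H - fluctSumDel w S b m j k H‖
        ≤ C * φ * (‖fluctSum w S b m k H‖ + ‖fluctSum w S b j m H‖ + ‖fluctSum w S b m m H‖
          + φ ^ 3) := by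
  set κ := 2 / c₀ with hκ
  have hκ0 : 0 < κ := by positivity
  set F₀ := κ ^ 2 + ((1 + κ) ^ 2 + (3 + κ) ^ 2 * B) with hF₀
  have hF₀1 : 1 ≤ F₀ := by
    have : 1 ≤ (1 + κ) ^ 2 := by nlinarith
    have : 0 ≤ (3 + κ) ^ 2 * B := by positivity
    nlinarith [sq_nonneg κ]
  set C₁ := κ * (1 + κ) with hC₁
  have hC₁0 : 0 < C₁ := by positivity
  set C₂ := 4 * κ ^ 3 with hC₂
  have hC₂0 : 0 < C₂ := by positivity
  refine ⟨F₀ + (C₁ + C₂) + (C₁ + C₂) ^ 2 + B * F₀ + 6 * ((C₁ + C₂) + (C₁ + C₂) ^ 2) * (B * F₀)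
    + 3 * (C₂ + 2 * C₂ * (C₁ + C₂)) * F₀ * B, ?_, ?_⟩
  · have : 0 ≤ (C₁ + C₂) + (C₁ + C₂) ^ 2 + B * F₀ + 6 * ((C₁ + C₂) + (C₁ + C₂) ^ 2) * (B * F₀)
      + 3 * (C₂ + 2 * C₂ * (C₁ + C₂)) * F₀ * B := by positivity
    linarith
  intro ι _ _ w M φ H h S hS hrow hSφ b hb hbφ hbB
  have h0 := h.φ_pos
  have hφ1 : φ ≤ 1 := h.φ_le_one.trans (by norm_num)
  have hfl : ∀ l j k, l ≠ j → l ≠ k → ‖fluct w S l j k H‖ ≤ F₀ * φ ^ 2 := fun l j k hj hk =>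
    h.fluct_le hB hS hrow hSφ hj.symm hk.symm
  refine ⟨fun l j k hj hk => (hfl l j k hj hk).trans ?_, ?_⟩
  · gcongr
    have : 0 ≤ (C₁ + C₂) + (C₁ + C₂) ^ 2 + B * F₀ + 6 * ((C₁ + C₂) + (C₁ + C₂) ^ 2) * (B * F₀)
      + 3 * (C₂ + 2 * C₂ * (C₁ + C₂)) * F₀ * B := by positivity
    linarith
  intro m j k hmj hmk
  set T := Finset.univ.filter (fun l => (l ≠ j ∧ l ≠ k) ∧ l ≠ m) with hT
  have hTmem : ∀ l, l ∈ T ↔ (l ≠ j ∧ l ≠ k) ∧ l ≠ m := fun l => by simp [hT]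
  -- The summand `l = m` is lost; in the others `fluct_sub_del` puts `m` in place of `j`, of `k`, or
  -- of both, with a `minorRatio` for each replacement.
  have e1 : fluctSum w S b j k H - fluctSumDel w S b m j k H
      = b m * fluct w S m j k H
        + ∑ l ∈ T, (b l : ℂ) * (minorRatio w l m j H * fluct w S l m k H)
        + ∑ l ∈ T, (b l : ℂ) * ((starRingEnd ℂ) (minorRatio w l m k H) * fluct w S l j m H)
        - ∑ l ∈ T, (b l : ℂ) * ((minorRatio w l m j H * (starRingEnd ℂ) (minorRatio w l m k H))
            * fluct w S l m m H) := by
    have e2 : fluctSum w S b j k H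
        = b m * fluct w S m j k H + ∑ l ∈ T, (b l : ℂ) * fluct w S l j k H := by
      have : Finset.univ.filter (fun l => l ≠ j ∧ l ≠ k) = insert m T := by
        ext l
        simp only [Finset.mem_filter, Finset.mem_univ, true_and, Finset.mem_insert, hT]
        constructor
        · intro hl
          by_cases hlm : l = m
          · exact Or.inl hlm
          · exact Or.inr ⟨hl, hlm⟩
        · rintro (rfl | hl)
          · exact ⟨hmj, hmk⟩
          · exact hl.1
      rw [fluctSum, this, Finset.sum_insert (by simp [hT])]
    rw [e2, fluctSumDel, ← hT, add_sub_assoc, ← Finset.sum_sub_distrib, add_assoc,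
      add_sub_assoc, ← Finset.sum_add_distrib, ← Finset.sum_sub_distrib]
    congr 1
    refine Finset.sum_congr rfl fun l hl => ?_
    rw [hTmem] at hl
    rw [← mul_sub, fluct_sub_del h.im_pos h.symm S hl.2 hmj.symm hmk.symm]
    ring
  -- The ratios of the full resolvent do not depend on `l` and serve as the constants γ₀ in
  -- `norm_sum_weight_le`.
  set γj := res w H m j / res w H m m with hγj
  set γk := res w H m k / res w H m m with hγk
  have hr : ∀ l ∈ T, ∀ x, (x = j ∨ x = k) → ‖minorRatio w l m x H‖ ≤ (C₁ + C₂) * φ := by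
    intro l hl x hx
    rw [hTmem] at hl
    have h1 := h.minorRatio_le (l := l) (m := m) (j := x)
      (by rcases hx with rfl | rfl; exacts [hl.1.1.symm, hl.1.2.symm]) hl.2.symm
      (by rcases hx with rfl | rfl; exacts [hmj, hmk])
    refine h1.trans ?_
    rw [← hκ, ← mul_assoc, ← hC₁]
    gcongr
    linarith
  have hd : ∀ l ∈ T, ∀ x, (x = j ∨ x = k) →
      ‖minorRatio w l m x H - res w H m x / res w H m m‖ ≤ C₂ * φ ^ 2 := by
    intro l hl x hx
    rw [hTmem] at hl
    exact h.minorRatio_sub_le (l := l) (m := m) (j := x)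
      (by rcases hx with rfl | rfl; exacts [hl.1.1.symm, hl.1.2.symm]) hl.2.symm
      (by rcases hx with rfl | rfl; exacts [hmj, hmk])
  have hγ : ∀ x, (x = j ∨ x = k) → ‖res w H m x / res w H m m‖ ≤ (C₁ + C₂) * φ := by
    intro x hx
    have h1 := h.norm_div_diag_le m (h.off (x := m) (y := x)
      (by rcases hx with rfl | rfl; exacts [hmj, hmk]))
    refine h1.trans ?_
    rw [← hκ]
    gcongr
    nlinarith
  have hφ2 : φ ^ 2 ≤ φ := by nlinarith
  have hcard : ∀ (U : Finset ι) (x y : ι), (∀ l ∈ U, l ∉ T → l = x ∨ l = y) →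
      (U \ T).card ≤ 2 := by
    intro U x y hU
    refine (Finset.card_le_card (t := {x, y}) fun l hl => ?_).trans Finset.card_le_two
    rw [Finset.mem_sdiff] at hl
    simpa using hU l hl.1 hl.2
  have b1 := norm_sum_weight_le (T := T)
    (U := Finset.univ.filter (fun l => l ≠ m ∧ l ≠ k)) (b := b)
    (γ := fun l => minorRatio w l m j H) (F := fun l => fluct w S l m k H) (γ₀ := γj)
    (ε := C₂ * φ ^ 2) (β := B * φ ^ 2) (K := F₀ * φ ^ 2) (B := B)
    (fun l hl => by
      rw [hTmem] at hl
      simp [hl.2, hl.1.2])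
    (hcard _ j j fun l hl hlT => by
      simp only [Finset.mem_filter, Finset.mem_univ, true_and] at hl
      rw [hTmem] at hlT
      tauto) hb hbφ hbB
    (fun l hl => hd l hl j (Or.inl rfl))
    (fun l hl => by
      simp only [Finset.mem_filter, Finset.mem_univ, true_and] at hl
      exact hfl l m k hl.1 hl.2) (by positivity) (by positivity) (by positivity)
  have b2 := norm_sum_weight_le (T := T)
    (U := Finset.univ.filter (fun l => l ≠ j ∧ l ≠ m)) (b := b)
    (γ := fun l => (starRingEnd ℂ) (minorRatio w l m k H)) (F := fun l => fluct w S l j m H)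
    (γ₀ := (starRingEnd ℂ) γk)
    (ε := C₂ * φ ^ 2) (β := B * φ ^ 2) (K := F₀ * φ ^ 2) (B := B)
    (fun l hl => by
      rw [hTmem] at hl
      simp [hl.2, hl.1.1])
    (hcard _ k k fun l hl hlT => by
      simp only [Finset.mem_filter, Finset.mem_univ, true_and] at hl
      rw [hTmem] at hlT
      tauto) hb hbφ hbB
    (fun l hl => by
      rw [← map_sub, RCLike.norm_conj]
      exact hd l hl k (Or.inr rfl))
    (fun l hl => by
      simp only [Finset.mem_filter, Finset.mem_univ, true_and] at hl
      exact hfl l j m hl.1 hl.2) (by positivity) (by positivity) (by positivity)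
  have b3 := norm_sum_weight_le (T := T)
    (U := Finset.univ.filter (fun l => l ≠ m ∧ l ≠ m)) (b := b)
    (γ := fun l => minorRatio w l m j H * (starRingEnd ℂ) (minorRatio w l m k H))
    (F := fun l => fluct w S l m m H)
    (γ₀ := γj * (starRingEnd ℂ) γk)
    (ε := 2 * C₂ * (C₁ + C₂) * φ ^ 2) (β := B * φ ^ 2) (K := F₀ * φ ^ 2) (B := B)
    (fun l hl => by
      rw [hTmem] at hl
      simp [hl.2])
    (hcard _ j k fun l hl hlT => by
      simp only [Finset.mem_filter, Finset.mem_univ, true_and] at hl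
      rw [hTmem] at hlT
      tauto) hb hbφ hbB
    (fun l hl => by
      have e : minorRatio w l m j H * (starRingEnd ℂ) (minorRatio w l m k H)
          - γj * (starRingEnd ℂ) γk
          = (minorRatio w l m j H - γj) * (starRingEnd ℂ) (minorRatio w l m k H)
            + γj * (starRingEnd ℂ) (minorRatio w l m k H - γk) := by
        rw [map_sub]; ring
      rw [e]
      refine (norm_add_le _ _).trans ?_
      rw [norm_mul, norm_mul, RCLike.norm_conj, RCLike.norm_conj]
      have q1 := hd l hl j (Or.inl rfl)
      have q2 := hd l hl k (Or.inr rfl)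
      have q3 := hr l hl k (Or.inr rfl)
      have q4 := hγ j (Or.inl rfl)
      calc _ ≤ C₂ * φ ^ 2 * ((C₁ + C₂) * φ) + (C₁ + C₂) * φ * (C₂ * φ ^ 2) := by gcongr
        _ = 2 * C₂ * (C₁ + C₂) * φ ^ 2 * φ := by ring
        _ ≤ 2 * C₂ * (C₁ + C₂) * φ ^ 2 * 1 := by gcongr
        _ = _ := by ring)
    (fun l hl => by
      simp only [Finset.mem_filter, Finset.mem_univ, true_and] at hl
      exact hfl l m m hl.1 hl.2) (by positivity) (by positivity) (by positivity)
  have b0 : ‖(b m : ℂ) * fluct w S m j k H‖ ≤ B * φ ^ 2 * (F₀ * φ ^ 2) := by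
    rw [norm_mul, Complex.norm_real, Real.norm_of_nonneg (hb m)]
    exact mul_le_mul (hbφ m) (hfl m j k hmj hmk) (norm_nonneg _) (by positivity)
  rw [RCLike.norm_conj] at b2
  rw [norm_mul, RCLike.norm_conj] at b3
  have g1 := hγ j (Or.inl rfl)
  have g2 := hγ k (Or.inr rfl)
  have g3 : ‖γj‖ * ‖γk‖ ≤ (C₁ + C₂) ^ 2 * φ := by
    calc ‖γj‖ * ‖γk‖ ≤ (C₁ + C₂) * φ * ((C₁ + C₂) * φ) := by gcongr
      _ = (C₁ + C₂) ^ 2 * φ ^ 2 := by ring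
      _ ≤ _ := by gcongr
  rw [e1]
  refine (norm_sub_le _ _).trans ?_
  refine (add_le_add (norm_add₃_le) le_rfl).trans ?_
  set X1 := ‖fluctSum w S b m k H‖ with hX1
  set X2 := ‖fluctSum w S b j m H‖ with hX2
  set X3 := ‖fluctSum w S b m m H‖ with hX3
  have c1 : ‖∑ l ∈ T, (b l : ℂ) * (minorRatio w l m j H * fluct w S l m k H)‖
      ≤ (C₁ + C₂) * φ * (X1 + 2 * (B * φ ^ 2 * (F₀ * φ ^ 2)))
        + C₂ * φ ^ 2 * (F₀ * φ ^ 2) * B := by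
    exact b1.trans (add_le_add (mul_le_mul_of_nonneg_right g1
      (add_nonneg (norm_nonneg _) (by positivity))) le_rfl)
  have c2 : ‖∑ l ∈ T, (b l : ℂ) * ((starRingEnd ℂ) (minorRatio w l m k H) * fluct w S l j m H)‖
      ≤ (C₁ + C₂) * φ * (X2 + 2 * (B * φ ^ 2 * (F₀ * φ ^ 2)))
        + C₂ * φ ^ 2 * (F₀ * φ ^ 2) * B := by
    exact b2.trans (add_le_add (mul_le_mul_of_nonneg_right g2
      (add_nonneg (norm_nonneg _) (by positivity))) le_rfl)
  have c3 : ‖∑ l ∈ T, (b l : ℂ) * ((minorRatio w l m j H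
      * (starRingEnd ℂ) (minorRatio w l m k H)) * fluct w S l m m H)‖
      ≤ (C₁ + C₂) ^ 2 * φ * (X3 + 2 * (B * φ ^ 2 * (F₀ * φ ^ 2)))
        + 2 * C₂ * (C₁ + C₂) * φ ^ 2 * (F₀ * φ ^ 2) * B := by
    exact b3.trans (add_le_add (mul_le_mul_of_nonneg_right g3
      (add_nonneg (norm_nonneg _) (by positivity))) le_rfl)
  have hfin := fluct_arith (zero_lt_one.trans_le hF₀1) (add_pos hC₁0 hC₂0) hC₂0
    (zero_lt_one.trans_le hB) h0 hφ1 (norm_nonneg _) (norm_nonneg _) (norm_nonneg _) b0 c1 c2 c3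
  exact hfin

end Fluctuation

/-! ### The T-equation and the equation for G - M on the good event. -/

section TEquation

variable {ι : Type*} [Fintype ι] [DecidableEq ι]

theorem fluct_self_re (w : ι → ℂ) (S : Matrix ι ι ℝ) (l j : ι) (H : Matrix ι ι ℝ) :
    (fluct w S l j j H).re
      = ‖rowMinor w l j H‖ ^ 2 - ∑ x, S l x * ‖res w (del l H) x j‖ ^ 2 := by
  have e : fluct w S l j j H = ((‖rowMinor w l j H‖ ^ 2
      - ∑ x, S l x * ‖res w (del l H) x j‖ ^ 2 : ℝ) : ℂ) := by
    rw [fluct, rowCov, Complex.mul_conj']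
    push_cast
    congr 1
    exact Finset.sum_congr rfl fun x _ => by rw [Complex.mul_conj']
  rw [e, Complex.ofReal_re]

theorem abs_sq_sub_sq_le {a b : ℂ} {d s : ℝ} (hd : ‖a - b‖ ≤ d) (hs : ‖a‖ + ‖b‖ ≤ s) :
    |‖a‖ ^ 2 - ‖b‖ ^ 2| ≤ d * s := by
  have h0 : 0 ≤ d := (norm_nonneg _).trans hd
  have e : ‖a‖ ^ 2 - ‖b‖ ^ 2 = (‖a‖ - ‖b‖) * (‖a‖ + ‖b‖) := by ring
  rw [e, abs_mul, abs_of_nonneg (by positivity : 0 ≤ ‖a‖ + ‖b‖)]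
  exact mul_le_mul ((abs_norm_sub_norm_le a b).trans hd) hs (by positivity) h0

namespace GoodResolvent

variable {w M : ι → ℂ} {c₀ φ : ℝ} {H : Matrix ι ι ℝ} (h : GoodResolvent w M c₀ φ H)
include h

variable {S : Matrix ι ι ℝ} {B : ℝ} (hB : 1 ≤ B) (hS : ∀ i j, 0 ≤ S i j)
  (hrow : ∀ i, ∑ j, S i j ≤ 1) (hSφ : ∀ i j, S i j ≤ B * φ ^ 2)
include hS hrow

theorem sum_sq_le (l j : ι) : ∑ x, S l x * ‖res w H x j‖ ^ 2 ≤ 9 := by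
  calc ∑ x, S l x * ‖res w H x j‖ ^ 2 ≤ ∑ x, S l x * 9 := by
        refine Finset.sum_le_sum fun x _ => mul_le_mul_of_nonneg_left ?_ (hS l x)
        nlinarith [h.upper_all x j, norm_nonneg (res w H x j)]
    _ = (∑ x, S l x) * 9 := by rw [Finset.sum_mul]
    _ ≤ 1 * 9 := by gcongr; exact hrow l
    _ = 9 := by norm_num

include hB hSφ in
-- For generic `x` a change of order φ² multiplies a size of order φ. For `x = l` or `x = j` this
-- count fails, but the weight S_lx ≤ Bφ² makes up for it.
theorem sum_sq_minor_sub_le {l j : ι} (hj : j ≠ l) :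
    |∑ x, S l x * ‖res w (del l H) x j‖ ^ 2 - ∑ x, S l x * ‖res w H x j‖ ^ 2|
      ≤ (2 / c₀ * (2 + 2 / c₀) + B + B * (2 / c₀ * (6 + 2 / c₀))) * φ ^ 3 := by
  have h3 := h.c₀_pos
  have h0 := h.φ_pos
  have hφ1 := h.φ_le_one
  set κ := 2 / c₀ with hκ
  have hκ0 : 0 < κ := by positivity
  have hB0 : 0 < B := by linarith
  have hφ43 : φ ^ 4 ≤ φ ^ 3 := by
    calc φ ^ 4 = φ ^ 3 * φ := by ring
      _ ≤ φ ^ 3 * 1 := by gcongr; linarith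
      _ = _ := mul_one _
  have term : ∀ x, S l x * |‖res w (del l H) x j‖ ^ 2 - ‖res w H x j‖ ^ 2|
      ≤ S l x * (κ * (2 + κ) * φ ^ 3) + (if x = l then B * φ ^ 3 else 0)
        + (if x = j then B * (κ * (6 + κ)) * φ ^ 3 else 0) := by
    intro x
    have t1 : 0 ≤ S l x * (κ * (2 + κ) * φ ^ 3) := mul_nonneg (hS l x) (by positivity)
    have t2 : 0 ≤ if x = l then B * φ ^ 3 else 0 := by positivity
    have t3 : 0 ≤ if x = j then B * (κ * (6 + κ)) * φ ^ 3 else 0 := by positivity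
    by_cases hxl : x = l
    · subst hxl
      rw [res_del_row h.im_pos h.symm hj, norm_zero, if_pos rfl]
      have h1 := h.off hj.symm
      have h2 : |(0 : ℝ) ^ 2 - ‖res w H x j‖ ^ 2| ≤ φ ^ 2 := by
        rw [zero_pow two_ne_zero, zero_sub, abs_neg, abs_of_nonneg (sq_nonneg _)]
        gcongr
      have h4 : S x x * |(0 : ℝ) ^ 2 - ‖res w H x j‖ ^ 2| ≤ B * φ ^ 2 * φ ^ 2 :=
        mul_le_mul (hSφ x x) h2 (abs_nonneg _) (by positivity)
      have h5 : B * φ ^ 2 * φ ^ 2 = B * φ ^ 4 := by ring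
      have h6 : B * φ ^ 4 ≤ B * φ ^ 3 := by gcongr
      linarith
    · have hsub := h.minor_sub_le hj hxl
      rw [← hκ] at hsub
      by_cases hxj : x = j
      · subst hxj
        rw [if_pos rfl]
        have h1 := h.upper_all x x
        have h2 := h.minor_upper_le hj x
        rw [← hκ] at h2
        have h4 := abs_sq_sub_sq_le hsub (s := 6 + κ) (by linarith)
        have h5 : S l x * |‖res w (del l H) x x‖ ^ 2 - ‖res w H x x‖ ^ 2|
            ≤ B * φ ^ 2 * (κ * φ ^ 2 * (6 + κ)) :=
          mul_le_mul (hSφ l x) h4 (abs_nonneg _) (by positivity)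
        have h6 : B * φ ^ 2 * (κ * φ ^ 2 * (6 + κ)) = B * (κ * (6 + κ)) * φ ^ 4 := by ring
        have h7 : B * (κ * (6 + κ)) * φ ^ 4 ≤ B * (κ * (6 + κ)) * φ ^ 3 := by gcongr
        linarith
      · have h1 := h.off hxj
        have h2 := h.minor_off_le hj hxj
        rw [← hκ] at h2
        have h4 := abs_sq_sub_sq_le hsub (s := (2 + κ) * φ) (by linarith)
        have h5 : S l x * |‖res w (del l H) x j‖ ^ 2 - ‖res w H x j‖ ^ 2|
            ≤ S l x * (κ * φ ^ 2 * ((2 + κ) * φ)) := mul_le_mul_of_nonneg_left h4 (hS l x)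
        have h6 : κ * φ ^ 2 * ((2 + κ) * φ) = κ * (2 + κ) * φ ^ 3 := by ring
        rw [h6] at h5
        linarith
  rw [← Finset.sum_sub_distrib]
  refine (Finset.abs_sum_le_sum_abs _ _).trans ?_
  calc ∑ x, |S l x * ‖res w (del l H) x j‖ ^ 2 - S l x * ‖res w H x j‖ ^ 2|
      ≤ ∑ x, (S l x * (κ * (2 + κ) * φ ^ 3) + (if x = l then B * φ ^ 3 else 0)
        + (if x = j then B * (κ * (6 + κ)) * φ ^ 3 else 0)) := by
        refine Finset.sum_le_sum fun x _ => ?_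
        rw [← mul_sub, abs_mul, abs_of_nonneg (hS l x)]
        exact term x
    _ = (∑ x, S l x) * (κ * (2 + κ) * φ ^ 3) + B * φ ^ 3 + B * (κ * (6 + κ)) * φ ^ 3 := by
        rw [Finset.sum_add_distrib, Finset.sum_add_distrib, Finset.sum_mul,
          Finset.sum_ite_eq' Finset.univ l, Finset.sum_ite_eq' Finset.univ j]
        simp
    _ ≤ 1 * (κ * (2 + κ) * φ ^ 3) + B * φ ^ 3 + B * (κ * (6 + κ)) * φ ^ 3 := by
        gcongr; exact hrow l
    _ = _ := by ring

include hB hSφ in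
/-- The `T`-equation on the good event. -/
theorem T_equation (i j : ι) :
    |∑ l, S i l * ‖res w H l j‖ ^ 2
        - ∑ l, S i l * (‖M l‖ ^ 2 * ∑ x, S l x * ‖res w H x j‖ ^ 2)
        - (‖res w H j j‖ ^ 2 - ‖M j‖ ^ 2 * ∑ x, S j x * ‖res w H x j‖ ^ 2) * S i j|
      ≤ ‖fluctSum w S (fun l => S i l * ‖M l‖ ^ 2) j j H‖
        + (4 * (2 / c₀ * (2 + 2 / c₀) + B + B * (2 / c₀ * (6 + 2 / c₀)))
          + 5 * (2 / c₀) ^ 2) * φ ^ 3 := by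
  have h3 := h.c₀_pos
  have h0 := h.φ_pos
  have hφ1 := h.φ_le_one
  set κ := 2 / c₀ with hκ
  have hκ0 : 0 < κ := by positivity
  set Q := (κ * (2 + κ) + B + B * (κ * (6 + κ))) * φ ^ 3 with hQ
  set t : ι → ℝ := fun l => ∑ x, S l x * ‖res w H x j‖ ^ 2 with ht
  set U := Finset.univ.filter (fun l => l ≠ j ∧ l ≠ j) with hU
  have hUe : U = Finset.univ.erase j := by
    ext l; simp [hU]
  -- The summand `l = j` is set apart: G_jj is of order one and produces the source term.
  have e1 : ∑ l, S i l * ‖res w H l j‖ ^ 2 - ∑ l, S i l * (‖M l‖ ^ 2 * t l)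
      - (‖res w H j j‖ ^ 2 - ‖M j‖ ^ 2 * t j) * S i j
      = ∑ l ∈ U, S i l * (‖res w H l j‖ ^ 2 - ‖M l‖ ^ 2 * t l) := by
    rw [hUe, ← Finset.sum_sub_distrib, ← Finset.add_sum_erase _ _ (Finset.mem_univ j)]
    have : ∀ l, S i l * ‖res w H l j‖ ^ 2 - S i l * (‖M l‖ ^ 2 * t l)
        = S i l * (‖res w H l j‖ ^ 2 - ‖M l‖ ^ 2 * t l) := fun l => by ring
    simp only [this]
    ring
  have e2 : (fluctSum w S (fun l => S i l * ‖M l‖ ^ 2) j j H).re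
      = ∑ l ∈ U, S i l * ‖M l‖ ^ 2 * (‖rowMinor w l j H‖ ^ 2
          - ∑ x, S l x * ‖res w (del l H) x j‖ ^ 2) := by
    rw [fluctSum, Complex.re_sum]
    refine Finset.sum_congr rfl fun l _ => ?_
    rw [Complex.re_ofReal_mul, fluct_self_re]
  have e3 : ∑ l ∈ U, S i l * (‖res w H l j‖ ^ 2 - ‖M l‖ ^ 2 * t l)
      = (fluctSum w S (fun l => S i l * ‖M l‖ ^ 2) j j H).re
        + ∑ l ∈ U, S i l * (‖M l‖ ^ 2 * (∑ x, S l x * ‖res w (del l H) x j‖ ^ 2 - t l)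
          + (‖res w H l l‖ ^ 2 - ‖M l‖ ^ 2) * ‖rowMinor w l j H‖ ^ 2) := by
    rw [e2, ← Finset.sum_add_distrib]
    refine Finset.sum_congr rfl fun l hl => ?_
    have hlj : l ≠ j := by simp only [hU, Finset.mem_filter] at hl; exact hl.2.1
    -- With G_lj = -G_ll h_lj, replacing |G_ll|² by |M_l|² costs O(φ) times |h_lj|² = O(φ²).
    have e4 : ‖res w H l j‖ ^ 2 = ‖res w H l l‖ ^ 2 * ‖rowMinor w l j H‖ ^ 2 := by
      rw [rowMinor, row_mul_minor h.im_pos h.symm hlj.symm, norm_neg, norm_div, div_pow]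
      have : ‖res w H l l‖ ≠ 0 := norm_ne_zero_iff.mpr (res_diag_ne_zero h.im_pos h.symm l)
      field_simp
    rw [e4]; ring
  rw [e1, e3]
  refine (abs_add_le _ _).trans (add_le_add (Complex.abs_re_le_norm _) ?_)
  refine (Finset.abs_sum_le_sum_abs _ _).trans ?_
  have hQ0 : 0 ≤ Q := by
    have : 0 < B := by linarith
    positivity
  have hfin : ∀ l ∈ U, |S i l * (‖M l‖ ^ 2 * (∑ x, S l x * ‖res w (del l H) x j‖ ^ 2 - t l)
          + (‖res w H l l‖ ^ 2 - ‖M l‖ ^ 2) * ‖rowMinor w l j H‖ ^ 2)|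
      ≤ S i l * (4 * Q + 5 * κ ^ 2 * φ ^ 3) := by
    intro l hl
    have hlj : l ≠ j := by simp only [hU, Finset.mem_filter] at hl; exact hl.2.1
    rw [abs_mul, abs_of_nonneg (hS i l)]
    refine mul_le_mul_of_nonneg_left ?_ (hS i l)
    refine (abs_add_le _ _).trans (add_le_add ?_ ?_)
    · rw [abs_mul, abs_of_nonneg (sq_nonneg _)]
      have h1 := h.sum_sq_minor_sub_le hB hS hrow hSφ hlj.symm
      have h2 : ‖M l‖ ^ 2 ≤ 4 := by nlinarith [h.upper l, norm_nonneg (M l)]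
      exact mul_le_mul h2 h1 (abs_nonneg _) (by norm_num)
    · rw [abs_mul, abs_of_nonneg (sq_nonneg ‖rowMinor w l j H‖)]
      have h1 := abs_sq_sub_sq_le (h.diag_sub l) (s := 5) (by linarith [h.upper l, h.diag_upper l])
      have h2 := h.rowMinor_le hlj.symm
      rw [← hκ] at h2
      calc _ ≤ φ * 5 * (κ * φ) ^ 2 := by gcongr
        _ = _ := by ring
  refine (Finset.sum_le_sum hfin).trans ?_
  rw [← Finset.sum_mul]
  have h5 : ∑ l ∈ U, S i l ≤ 1 :=
    (Finset.sum_le_sum_of_subset_of_nonneg (Finset.subset_univ U) (fun l _ _ => hS i l)).trans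
      (hrow i)
  calc _ ≤ 1 * (4 * Q + 5 * κ ^ 2 * φ ^ 3) := by gcongr
    _ = _ := by rw [hQ]; ring

theorem abs_diag_coeff_le (j : ι) :
    |‖res w H j j‖ ^ 2 - ‖M j‖ ^ 2 * ∑ x, S j x * ‖res w H x j‖ ^ 2| ≤ 45 := by
  have h1 := h.sum_sq_le hS hrow j j
  have h2 : 0 ≤ ∑ x, S j x * ‖res w H x j‖ ^ 2 :=
    Finset.sum_nonneg fun x _ => mul_nonneg (hS j x) (sq_nonneg _)
  have h3 : ‖M j‖ ^ 2 ≤ 4 := by nlinarith [h.upper j, norm_nonneg (M j)]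
  have h4 : ‖res w H j j‖ ^ 2 ≤ 9 := by nlinarith [h.diag_upper j, norm_nonneg (res w H j j)]
  have h5 : ‖M j‖ ^ 2 * ∑ x, S j x * ‖res w H x j‖ ^ 2 ≤ 4 * 9 := by gcongr
  have h6 : 0 ≤ ‖M j‖ ^ 2 * ∑ x, S j x * ‖res w H x j‖ ^ 2 := by positivity
  rw [abs_le]
  constructor <;> nlinarith [sq_nonneg ‖res w H j j‖]

/-- The variance of a row of the minor is controlled by the `T` matrix. -/
theorem sum_sq_minor_le {K : ℝ} (hK : ∀ l j, ∑ x, S l x * ‖res w H x j‖ ^ 2 ≤ K) {l j : ι}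
    (hj : j ≠ l) :
    ∑ x, S l x * ‖res w (del l H) x j‖ ^ 2 ≤ (2 + 2 * (2 / c₀) ^ 2) * K := by
  have h3 := h.c₀_pos
  have h0 := h.φ_pos
  calc ∑ x, S l x * ‖res w (del l H) x j‖ ^ 2
      ≤ ∑ x, (2 * (S l x * ‖res w H x j‖ ^ 2)
          + 2 * (2 / c₀) ^ 2 * (S l x * ‖res w H x l‖ ^ 2)) := by
        refine Finset.sum_le_sum fun x _ => ?_
        rw [res_del h.im_pos h.symm hj]
        have h1 : ‖res w H l j / res w H l l‖ ≤ 2 / c₀ * 1 :=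
          h.norm_div_diag_le l ((h.off hj.symm).trans (h.φ_le_one.trans (by norm_num)))
        rw [mul_one] at h1
        have h2 : ‖res w H x j - res w H x l * (res w H l j / res w H l l)‖
            ≤ ‖res w H x j‖ + ‖res w H x l‖ * (2 / c₀) := by
          refine (norm_sub_le _ _).trans ?_
          rw [norm_mul]
          gcongr
        have h4 : ‖res w H x j - res w H x l * (res w H l j / res w H l l)‖ ^ 2
            ≤ 2 * ‖res w H x j‖ ^ 2 + 2 * (2 / c₀) ^ 2 * ‖res w H x l‖ ^ 2 := by
          calc _ ≤ (‖res w H x j‖ + ‖res w H x l‖ * (2 / c₀)) ^ 2 := by gcongr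
            _ ≤ _ := by nlinarith [sq_nonneg (‖res w H x j‖ - ‖res w H x l‖ * (2 / c₀))]
        have h5 := mul_le_mul_of_nonneg_left h4 (hS l x)
        linarith
    _ = 2 * ∑ x, S l x * ‖res w H x j‖ ^ 2
          + 2 * (2 / c₀) ^ 2 * ∑ x, S l x * ‖res w H x l‖ ^ 2 := by
        rw [Finset.sum_add_distrib, ← Finset.mul_sum, ← Finset.mul_sum]
    _ ≤ 2 * K + 2 * (2 / c₀) ^ 2 * K := by
        gcongr
        · exact hK l j
        · exact hK l l
    _ = _ := by ring

end GoodResolvent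

/-- The centered quadratic form in Schur's formula. -/
def quadMinor (w : ι → ℂ) (S : Matrix ι ι ℝ) (l : ι) (H : Matrix ι ι ℝ) : ℂ :=
  ∑ x ∈ Finset.univ.erase l, ∑ y ∈ Finset.univ.erase l,
      (H l x : ℂ) * res w (del l H) x y * H l y
    - ∑ x ∈ Finset.univ.erase l, (S l x : ℂ) * res w (del l H) x x

end TEquation

/-- Deterministic bound on `G - M` from large deviation estimates. -/
theorem GoodResolvent.close_of_large_deviation {N : ℕ} [NeZero N] {w M : ZMod N → ℂ} {c₀ φ : ℝ}
    {H S : Matrix (ZMod N) (ZMod N) ℝ} (h : GoodResolvent w M c₀ φ H) (hS : ∀ i j, 0 ≤ S i j)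
    {Cst : ℝ} (hst : SupStable Cst (oneSubDiag M S)) (hCst : 1 ≤ Cst)
    (hM : ∀ i, (M i)⁻¹ = -w i - ∑ j, (S i j : ℂ) * M j)
    (hrow : ∀ i, ∑ j, S i j ≤ 1) (hφst : Cst * φ ≤ 1 / 8) {K β r₁ r₂ r₃ : ℝ} (hβ : ∀ i, S i i ≤ β)
    (hK : ∀ l, ∑ x, S l x * ‖res w H x l‖ ^ 2 ≤ K)
    (h₁ : ∀ l j, j ≠ l → ‖rowMinor w l j H‖ ≤ r₁) (h₂ : ∀ l, |H l l| ≤ r₂)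
    (h₃ : ∀ l, ‖quadMinor w S l H‖ ≤ r₃) (hr₁ : 0 ≤ r₁) (i j : ZMod N) :
    ‖(res w H - Matrix.diagonal M) i j‖
      ≤ 3 * r₁ + 12 * Cst * (r₂ + r₃ + 2 / c₀ * K + 3 * β) := by
  have hc := h.c₀_pos
  have h0 := h.φ_pos
  have hr₂ : 0 ≤ r₂ := (abs_nonneg _).trans (h₂ 0)
  have hr₃ : 0 ≤ r₃ := (norm_nonneg _).trans (h₃ 0)
  have hβ0 : 0 ≤ β := (hS 0 0).trans (hβ 0)
  have hK0 : 0 ≤ K :=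
    (Finset.sum_nonneg fun x _ => mul_nonneg (hS 0 x) (sq_nonneg _)).trans (hK 0)
  set R := r₂ + r₃ + 2 / c₀ * K + 3 * β with hR
  have hR0 : 0 ≤ R := by positivity
  by_cases hij : i = j
  · subst hij
    set v : ZMod N → ℂ := fun l => res w H l l - M l with hv
    have hvφ : ∀ l, ‖v l‖ ≤ φ := h.diag_sub
    have key : ∀ l, ‖(oneSubDiag M S).mulVec v l‖ ≤ 2 * φ * ‖v‖ + 6 * R := by
      intro l
      have hG0 := res_diag_ne_zero h.im_pos h.symm l
      have hM0 : M l ≠ 0 := by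
        intro h1
        have := h.lower l
        rw [h1, norm_zero] at this
        linarith
      -- Υ measures how far Schur's formula is from the self-consistent equation: the diagonal
      -- entry, the centered quadratic form, the change from the minor to G, and the term `x = l`
      -- missing from the minor.
      set Υ : ℂ := H l l - quadMinor w S l H
        - ∑ x ∈ Finset.univ.erase l, (S l x : ℂ) * (res w (del l H) x x - res w H x x)
        + S l l * res w H l l with hΥ
      have hinv : (res w H l l)⁻¹ = -w l - ∑ x, (S l x : ℂ) * res w H x x + Υ := by
        rw [inv_res_diag h.im_pos h.symm l, hΥ, quadMinor,
          ← Finset.add_sum_erase _ _ (Finset.mem_univ l)]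
        simp only [mul_sub, Finset.sum_sub_distrib]
        ring
      have hsumv : ∑ x, (S l x : ℂ) * v x
          = ∑ x, (S l x : ℂ) * res w H x x - ∑ x, (S l x : ℂ) * M x := by
        rw [← Finset.sum_sub_distrib]
        exact Finset.sum_congr rfl fun x _ => by rw [hv]; ring
      -- The difference of the equations for 1/G_ll and 1/M_l, multiplied by G_ll M_l. Apart from Υ
      -- the remainder is quadratic in G - M and will be absorbed.
      have hid : (oneSubDiag M S).mulVec v l
          = v l * M l * ∑ x, (S l x : ℂ) * v x - res w H l l * M l * Υ := by
        rw [oneSubDiag_mulVec]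
        have e1 : (res w H l l)⁻¹ - (M l)⁻¹ = -∑ x, (S l x : ℂ) * v x + Υ := by
          rw [hinv, hM l, hsumv]; ring
        have e2 : M l - res w H l l
            = res w H l l * M l * (-∑ x, (S l x : ℂ) * v x + Υ) := by
          rw [← e1]; field_simp
        have e3 : v l = res w H l l - M l := rfl
        have e4 : res w H l l = v l + M l := by rw [e3]; ring
        rw [e4] at e2 ⊢
        linear_combination -e2
      have hΥR : ‖Υ‖ ≤ R := by
        have t1 : ‖∑ x ∈ Finset.univ.erase l,
            (S l x : ℂ) * (res w (del l H) x x - res w H x x)‖ ≤ 2 / c₀ * K := by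
          calc _ ≤ ∑ x ∈ Finset.univ.erase l, 2 / c₀ * (S l x * ‖res w H x l‖ ^ 2) := by
                refine (norm_sum_le _ _).trans (Finset.sum_le_sum fun x hx => ?_)
                have hxl := Finset.ne_of_mem_erase hx
                rw [norm_mul, Complex.norm_real, Real.norm_of_nonneg (hS l x),
                  res_del h.im_pos h.symm hxl, sub_sub_cancel_left, norm_neg,
                  res_symm w h.symm l x, mul_div_assoc', ← mul_assoc, mul_comm (2 / c₀), mul_assoc]
                refine mul_le_mul_of_nonneg_left (h.norm_div_diag_le l ?_) (hS l x)
                rw [norm_mul, pow_two]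
            _ ≤ ∑ x, 2 / c₀ * (S l x * ‖res w H x l‖ ^ 2) :=
                Finset.sum_le_sum_of_subset_of_nonneg (Finset.subset_univ _)
                  (fun x _ _ => mul_nonneg (by positivity) (mul_nonneg (hS l x) (sq_nonneg _)))
            _ ≤ 2 / c₀ * K := by
                rw [← Finset.mul_sum]
                exact mul_le_mul_of_nonneg_left (hK l) (by positivity)
        have t2 : ‖(S l l : ℂ) * res w H l l‖ ≤ 3 * β := by
          rw [norm_mul, Complex.norm_real, Real.norm_of_nonneg (hS l l), mul_comm]
          exact mul_le_mul (h.diag_upper l) (hβ l) (hS l l) (by norm_num)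
        have t3 : ‖(H l l : ℂ)‖ ≤ r₂ := by rw [Complex.norm_real]; exact h₂ l
        rw [hΥ, hR]
        refine (norm_add_le _ _).trans (add_le_add ?_ t2)
        refine (norm_sub_le _ _).trans (add_le_add ?_ t1)
        exact (norm_sub_le _ _).trans (add_le_add t3 (h₃ l))
      rw [hid]
      refine (norm_sub_le _ _).trans (add_le_add ?_ ?_)
      · rw [norm_mul, norm_mul]
        have := norm_sum_mul_le_of_row hS hrow v l
        have := hvφ l
        have := h.upper l
        calc _ ≤ φ * 2 * ‖v‖ := by gcongr
          _ = _ := by ring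
      · rw [norm_mul, norm_mul]
        have := h.diag_upper l
        have := h.upper l
        calc _ ≤ 3 * 2 * R := by gcongr
          _ = _ := by ring
    have h5 : ‖(oneSubDiag M S).mulVec v‖ ≤ 2 * φ * ‖v‖ + 6 * R :=
      (pi_norm_le_iff_of_nonneg (by positivity)).mpr key
    have h6 := hst v
    have h7 : Cst * ‖(oneSubDiag M S).mulVec v‖ ≤ Cst * (2 * φ * ‖v‖ + 6 * R) := by gcongr
    have h8 : Cst * φ * ‖v‖ ≤ 1 / 8 * ‖v‖ := by gcongr
    have h9 : 0 ≤ Cst * R := by positivity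
    have h10 : ‖v‖ ≤ 12 * Cst * R := by nlinarith [norm_nonneg v]
    rw [Matrix.sub_apply, Matrix.diagonal_apply_eq]
    have := (norm_le_pi_norm v i).trans h10
    linarith
  · rw [Matrix.sub_apply, Matrix.diagonal_apply_ne _ hij, sub_zero]
    have h1 := h₁ i j (Ne.symm hij)
    rw [rowMinor, row_mul_minor h.im_pos h.symm (Ne.symm hij), norm_neg, norm_div,
      div_le_iff₀ (norm_pos_iff.mpr (res_diag_ne_zero h.im_pos h.symm i))] at h1
    have h2 := h.diag_upper i
    have h3 : 0 ≤ 12 * Cst * R := by positivity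
    nlinarith

/-! ### Moments of averaged fluctuations. -/

section Moment

/-- The function `conj x * |x| ^ n`. -/
def conjPow (n : ℕ) (x : ℂ) : ℂ := (starRingEnd ℂ) x * ((‖x‖ ^ n : ℝ) : ℂ)

theorem continuous_conjPow (n : ℕ) : Continuous (conjPow n) := by
  unfold conjPow
  fun_prop

theorem mul_conjPow (n : ℕ) (x : ℂ) : x * conjPow n x = ((‖x‖ ^ (n + 2) : ℝ) : ℂ) := by
  rw [conjPow, ← mul_assoc, Complex.mul_conj, Complex.normSq_eq_norm_sq]
  push_cast; ring

theorem norm_conjPow (n : ℕ) (x : ℂ) : ‖conjPow n x‖ = ‖x‖ ^ (n + 1) := by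
  rw [conjPow, norm_mul, RCLike.norm_conj, Complex.norm_real, Real.norm_of_nonneg (by positivity)]
  ring

theorem norm_conjPow_sub_le (n : ℕ) {x y : ℂ} {K : ℝ} (hx : ‖x‖ ≤ K) (hy : ‖y‖ ≤ K) :
    ‖conjPow n x - conjPow n y‖ ≤ (n + 1) * ‖x - y‖ * K ^ n := by
  have hK : 0 ≤ K := (norm_nonneg x).trans hx
  have h : conjPow n x - conjPow n y = (starRingEnd ℂ) (x - y) * ((‖x‖ ^ n : ℝ) : ℂ)
      + (starRingEnd ℂ) y * ((‖x‖ ^ n - ‖y‖ ^ n : ℝ) : ℂ) := by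
    simp only [conjPow, map_sub]; push_cast; ring
  have h2 : |‖x‖ ^ n - ‖y‖ ^ n| ≤ |‖x‖ - ‖y‖| * n * max |‖x‖| |‖y‖| ^ (n - 1) :=
    abs_pow_sub_pow_le _ _ _
  have h3 : |‖x‖ - ‖y‖| ≤ ‖x - y‖ := abs_norm_sub_norm_le x y
  have h4 : max |‖x‖| |‖y‖| ≤ K := by simp [abs_of_nonneg, hx, hy]
  have h5 : |‖x‖ ^ n - ‖y‖ ^ n| ≤ ‖x - y‖ * n * K ^ (n - 1) := by
    refine h2.trans ?_
    gcongr
  have h6 : K * (n * K ^ (n - 1)) = n * K ^ n := by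
    rcases n with _ | n
    · simp
    · simp only [Nat.add_sub_cancel]; ring
  calc ‖conjPow n x - conjPow n y‖
      ≤ ‖x - y‖ * ‖x‖ ^ n + ‖y‖ * |‖x‖ ^ n - ‖y‖ ^ n| := by
        rw [h]
        refine (norm_add_le _ _).trans (le_of_eq ?_)
        rw [norm_mul, norm_mul, RCLike.norm_conj, RCLike.norm_conj, Complex.norm_real,
          Complex.norm_real, Real.norm_of_nonneg (by positivity), Real.norm_eq_abs]
    _ ≤ ‖x - y‖ * K ^ n + K * (‖x - y‖ * n * K ^ (n - 1)) := by gcongr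
    _ = (n + 1) * ‖x - y‖ * K ^ n := by
        linear_combination ‖x - y‖ * h6

/-- Weighted Young inequality with integer exponents only, by comparing a with θZ. -/
theorem young_pow {a Z θ : ℝ} (ha : 0 ≤ a) (hZ : 0 ≤ Z) (hθ : 0 < θ) (n : ℕ) :
    a * Z ^ n ≤ θ * Z ^ (n + 1) + a ^ (n + 1) / θ ^ n := by
  rcases le_total a (θ * Z) with h | h
  · have : a * Z ^ n ≤ θ * Z * Z ^ n := by gcongr
    have h2 : 0 ≤ a ^ (n + 1) / θ ^ n := by positivity
    calc _ ≤ θ * Z * Z ^ n := this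
      _ = θ * Z ^ (n + 1) := by ring
      _ ≤ _ := by linarith
  · have h1 : Z ≤ a / θ := by rw [le_div_iff₀ hθ]; linarith
    have : a * Z ^ n ≤ a * (a / θ) ^ n := by gcongr
    have h2 : 0 ≤ θ * Z ^ (n + 1) := by positivity
    calc _ ≤ a * (a / θ) ^ n := this
      _ = a ^ (n + 1) / θ ^ n := by rw [div_pow]; ring
      _ ≤ _ := by linarith

theorem sum_five_pow_le {a b c d e : ℝ} (ha : 0 ≤ a) (hb : 0 ≤ b) (hc : 0 ≤ c) (hd : 0 ≤ d)
    (he : 0 ≤ e) (n : ℕ) :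
    (a + b + c + d + e) ^ n ≤ 5 ^ n * (a ^ n + b ^ n + c ^ n + d ^ n + e ^ n) := by
  obtain ⟨s, hs, h⟩ : ∃ s, 0 ≤ s ∧ a + b + c + d + e ≤ 5 * s ∧
      s ^ n ≤ a ^ n + b ^ n + c ^ n + d ^ n + e ^ n := by
    refine ⟨max (max (max a b) (max c d)) e, le_max_of_le_right he, ?_, ?_⟩
    · have h1 : a ≤ max (max (max a b) (max c d)) e := by simp
      have h2 : b ≤ max (max (max a b) (max c d)) e := by simp
      have h3 : c ≤ max (max (max a b) (max c d)) e := by simp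
      have h4 : d ≤ max (max (max a b) (max c d)) e := by simp
      have h5 : e ≤ max (max (max a b) (max c d)) e := by simp
      linarith
    · have := pow_nonneg ha n
      have := pow_nonneg hb n
      have := pow_nonneg hc n
      have := pow_nonneg hd n
      have := pow_nonneg he n
      rcases max_choice (max (max a b) (max c d)) e with h | h <;> rw [h]
      · rcases max_choice (max a b) (max c d) with h | h <;> rw [h]
        · rcases max_choice a b with h | h <;> rw [h] <;> linarith
        · rcases max_choice c d with h | h <;> rw [h] <;> linarith
      · linarith
  calc (a + b + c + d + e) ^ n ≤ (5 * s) ^ n := by gcongr; exact h.1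
    _ = 5 ^ n * s ^ n := by ring
    _ ≤ _ := by gcongr; exact h.2

variable {Ω : Type*} [MeasurableSpace Ω] {P : Measure Ω} [IsProbabilityMeasure P]
variable {ι : Type*} [Fintype ι] [DecidableEq ι]

/-- Pointwise bound for one term of the moment expansion. -/
theorem fluct_term_le (n : ℕ) {C φ θ t U : ℝ} (hC : 1 ≤ C) (hφ : 0 < φ) (hφ1 : φ ≤ 1) (hθ : 0 < θ)
    (ht : 0 < t)
    {F X X' : ℂ} {x1 x2 x3 : ℝ} (h1 : 0 ≤ x1) (h2 : 0 ≤ x2) (h3 : 0 ≤ x3) {χ : ℝ}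
    (hχ : χ = 0 ∨ χ = 1)
    (hgood : χ = 0 → ‖F‖ ≤ C * φ ^ 2 ∧ ‖X - X'‖ ≤ C * φ * (x1 + x2 + x3 + φ ^ 3))
    (hF : ‖F‖ ≤ U) (hX : ‖X‖ ≤ U) (hX' : ‖X'‖ ≤ U) :
    ‖F * (conjPow n X - conjPow n X')‖ ≤
      θ * (5 ^ (n + 2) * C ^ (n + 2)) * (‖X‖ ^ (n + 2) + x1 ^ (n + 2) + x2 ^ (n + 2) + x3 ^ (n + 2)
        + φ ^ (3 * (n + 2)))
      + (C ^ 2 * (n + 1)) ^ (n + 2) / θ ^ (n + 1) * φ ^ (3 * (n + 2))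
      + (t * χ + 4 * U ^ (2 * (n + 2)) / t) := by
  have hU : 0 ≤ U := (norm_nonneg _).trans hF
  have hφ3 : 0 ≤ φ ^ 3 := by positivity
  rw [norm_mul]
  rcases hχ with hχ | hχ
  · obtain ⟨hF, hXX⟩ := hgood hχ
    set Q := x1 + x2 + x3 + φ ^ 3 with hQ
    have hQ0 : 0 ≤ Q := by positivity
    have hXX2 : ‖X - X'‖ ≤ C * Q := hXX.trans (by
      have : C * φ * Q ≤ C * 1 * Q := by gcongr
      linarith)
    have hX'2 : ‖X'‖ ≤ ‖X‖ + C * Q := by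
      have := norm_sub_norm_le X' X
      rw [norm_sub_rev] at this
      linarith
    set Z := ‖X‖ + C * Q with hZ
    have hZ0 : 0 ≤ Z := by positivity
    have hQZ : Q ≤ Z := by
      have : 1 * Q ≤ C * Q := by gcongr
      have := norm_nonneg X
      linarith
    have hXZ : ‖X‖ ≤ Z := by
      have : 0 ≤ C * Q := by positivity
      linarith
    have e1 := norm_conjPow_sub_le n hXZ hX'2
    -- F gives φ² and X - X' gives φ: together φ³, the size aimed at.
    have e2 : ‖F‖ * ‖conjPow n X - conjPow n X'‖ ≤ (C ^ 2 * (n + 1) * φ ^ 3) * Z ^ (n + 1) := by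
      calc ‖F‖ * ‖conjPow n X - conjPow n X'‖
          ≤ (C * φ ^ 2) * ((n + 1) * (C * φ * Z) * Z ^ n) := by
            refine mul_le_mul hF (e1.trans ?_) (norm_nonneg _) (by positivity)
            have : ‖X - X'‖ ≤ C * φ * Z := hXX.trans (by gcongr)
            gcongr
        _ = _ := by ring
    have e3 := young_pow (a := C ^ 2 * (n + 1) * φ ^ 3) (Z := Z) (by positivity) hZ0 hθ (n + 1)
    have e4 : Z ^ (n + 2) ≤ 5 ^ (n + 2) * C ^ (n + 2) * (‖X‖ ^ (n + 2) + x1 ^ (n + 2) + x2 ^ (n + 2)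
        + x3 ^ (n + 2) + φ ^ (3 * (n + 2))) := by
      calc Z ^ (n + 2) ≤ (C * (‖X‖ + x1 + x2 + x3 + φ ^ 3)) ^ (n + 2) := by
            gcongr
            rw [hZ, hQ]
            have : 1 * ‖X‖ ≤ C * ‖X‖ := by gcongr
            linarith
        _ = C ^ (n + 2) * (‖X‖ + x1 + x2 + x3 + φ ^ 3) ^ (n + 2) := by rw [mul_pow]
        _ ≤ C ^ (n + 2) * (5 ^ (n + 2) * (‖X‖ ^ (n + 2) + x1 ^ (n + 2) + x2 ^ (n + 2) + x3 ^ (n + 2)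
              + (φ ^ 3) ^ (n + 2))) := by
            gcongr
            exact sum_five_pow_le (norm_nonneg _) h1 h2 h3 hφ3 _
        _ = _ := by rw [← pow_mul]; ring
    have e5 : θ * Z ^ (n + 2) ≤ θ * (5 ^ (n + 2) * C ^ (n + 2)) * (‖X‖ ^ (n + 2) + x1 ^ (n + 2)
        + x2 ^ (n + 2) + x3 ^ (n + 2) + φ ^ (3 * (n + 2))) := by
      rw [mul_assoc]; gcongr
    have e6 : (C ^ 2 * (n + 1) * φ ^ 3) ^ (n + 1 + 1) / θ ^ (n + 1)
        = (C ^ 2 * (n + 1)) ^ (n + 2) / θ ^ (n + 1) * φ ^ (3 * (n + 2)) := by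
      rw [mul_pow, ← pow_mul]; ring
    have e7 : 0 ≤ t * χ + 4 * U ^ (2 * (n + 2)) / t := by rw [hχ]; positivity
    rw [e6] at e3
    have e8 : θ * Z ^ (n + 1 + 1) = θ * Z ^ (n + 2) := rfl
    linarith
  -- On the exceptional event only the envelope U is available. V ≤ t + V²/t separates the
  -- probability of the event from the moments of U.
  · have e1 : ‖F‖ * ‖conjPow n X - conjPow n X'‖ ≤ 2 * U ^ (n + 2) := by
      have : ‖conjPow n X - conjPow n X'‖ ≤ U ^ (n + 1) + U ^ (n + 1) := by
        refine (norm_sub_le _ _).trans ?_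
        rw [norm_conjPow, norm_conjPow]
        gcongr
      calc _ ≤ U * (U ^ (n + 1) + U ^ (n + 1)) := by gcongr
        _ = _ := by ring
    have e2 : 2 * U ^ (n + 2) ≤ t + 4 * U ^ (2 * (n + 2)) / t := by
      have h : 4 * U ^ (2 * (n + 2)) = (2 * U ^ (n + 2)) ^ 2 := by
        rw [mul_pow, ← pow_mul]; ring
      rw [h]
      set V := 2 * U ^ (n + 2)
      have hV : 0 ≤ V := by positivity
      rcases le_total V t with h | h
      · have : 0 ≤ V ^ 2 / t := by positivity
        linarith
      · have : V ≤ V ^ 2 / t := by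
          rw [le_div_iff₀ ht, pow_two]; gcongr
        linarith
    have e3 : 0 ≤ θ * (5 ^ (n + 2) * C ^ (n + 2)) * (‖X‖ ^ (n + 2) + x1 ^ (n + 2) + x2 ^ (n + 2)
        + x3 ^ (n + 2) + φ ^ (3 * (n + 2)))
      + (C ^ 2 * (n + 1)) ^ (n + 2) / θ ^ (n + 1) * φ ^ (3 * (n + 2)) := by positivity
    rw [hχ, mul_one]
    linarith

/-- High moments of averaged fluctuations. -/
theorem fluct_moment_le (n : ℕ) {C φ t ε B : ℝ} (hC : 1 ≤ C) (hφ : 0 < φ) (hφ1 : φ ≤ 1)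
    (ht : 0 < t) (hB : 1 ≤ B)
    {b : ι → ℝ} (hb0 : ∀ l, 0 ≤ b l) (hb : ∑ l, b l ≤ B)
    {X : ι → ι → Ω → ℂ} {F X' : ι → ι → ι → Ω → ℂ} {U : Ω → ℝ} {E : Set Ω}
    (hE : MeasurableSet E) (hEε : P.real E ≤ ε)
    (mX : ∀ j k, Measurable (X j k)) (mF : ∀ l j k, Measurable (F l j k))
    (mX' : ∀ l j k, Measurable (X' l j k))
    (hX : ∀ j k ω, X j k ω = ∑ l ∈ Finset.univ.filter (fun l => l ≠ j ∧ l ≠ k), b l * F l j k ω)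
    (hU : Integrable (fun ω => U ω ^ (2 * (n + 2))) P) (hU1 : ∀ ω, 1 ≤ U ω)
    (hXU : ∀ j k ω, ‖X j k ω‖ ≤ U ω) (hFU : ∀ l j k ω, ‖F l j k ω‖ ≤ U ω)
    (hX'U : ∀ l j k ω, ‖X' l j k ω‖ ≤ U ω)
    (hgood : ∀ ω ∉ E, ∀ l j k, l ≠ j → l ≠ k → ‖F l j k ω‖ ≤ C * φ ^ 2 ∧ ‖X j k ω - X' l j k ω‖
      ≤ C * φ * (‖X l k ω‖ + ‖X j l ω‖ + ‖X l l ω‖ + φ ^ 3))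
    (hzero : ∀ l j k, l ≠ j → l ≠ k → ∫ ω, F l j k ω * conjPow n (X' l j k ω) ∂P = 0) (j k : ι) :
    ∫ ω, ‖X j k ω‖ ^ (n + 2) ∂P ≤
      2 * B * ((1 + (C ^ 2 * (n + 1)) ^ (n + 2) * (8 * B * (5 ^ (n + 2) * C ^ (n + 2))) ^ (n + 1))
          * φ ^ (3 * (n + 2)) + t * ε + 4 / t * ∫ ω, U ω ^ (2 * (n + 2)) ∂P) := by
  set Q := 5 ^ (n + 2) * C ^ (n + 2) with hQ
  have hQ1 : 1 ≤ Q := by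
    have h1 : (1 : ℝ) ≤ 5 ^ (n + 2) := one_le_pow₀ (by norm_num)
    have h2 : (1 : ℝ) ≤ C ^ (n + 2) := one_le_pow₀ hC
    nlinarith
  -- With this θ the four moments come back with total factor 4BθQ = 1/2, so they can be absorbed.
  set θ := 1 / (8 * B * Q) with hθ
  have hθ0 : 0 < θ := by positivity
  have hU0 : ∀ ω, 0 ≤ U ω := fun ω => zero_le_one.trans (hU1 ω)
  have hUn : ∀ ω, U ω ^ (n + 2) ≤ U ω ^ (2 * (n + 2)) := fun ω =>
    pow_le_pow_right₀ (hU1 ω) (by omega)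
  have dom : ∀ {f : Ω → ℝ}, Measurable f → (∀ ω, ‖f ω‖ ≤ U ω ^ (n + 2)) → Integrable f P := by
    intro f mf hf
    exact hU.mono' mf.aestronglyMeasurable (ae_of_all _ fun ω => (hf ω).trans (hUn ω))
  have domC : ∀ {f : Ω → ℂ}, Measurable f → (∀ ω, ‖f ω‖ ≤ U ω ^ (n + 2)) → Integrable f P := by
    intro f mf hf
    exact hU.mono' mf.aestronglyMeasurable (ae_of_all _ fun ω => (hf ω).trans (hUn ω))
  have iX : ∀ j k, Integrable (fun ω => ‖X j k ω‖ ^ (n + 2)) P := by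
    intro j k
    refine dom ((mX j k).norm.pow_const _) fun ω => ?_
    rw [Real.norm_of_nonneg (by positivity)]
    have := hXU j k ω
    gcongr
  have iFψ : ∀ l j k (Y : Ω → ℂ), Measurable Y → (∀ ω, ‖Y ω‖ ≤ U ω) →
      Integrable (fun ω => F l j k ω * conjPow n (Y ω)) P := by
    intro l j k Y mY hY
    refine domC ((mF l j k).mul ((continuous_conjPow n).measurable.comp mY)) fun ω => ?_
    rw [norm_mul, norm_conjPow]
    calc _ ≤ U ω * U ω ^ (n + 1) := by
          have := hU0 ω
          have := hFU l j k ω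
          have := hY ω
          gcongr
      _ = _ := by ring
  -- the maximal moment
  have : Nonempty ι := ⟨j⟩
  obtain ⟨p, hp⟩ := Finite.exists_max (fun p : ι × ι => ∫ ω, ‖X p.1 p.2 ω‖ ^ (n + 2) ∂P)
  set Ξ := ∫ ω, ‖X p.1 p.2 ω‖ ^ (n + 2) ∂P with hΞ
  have hΞ' : ∀ j k, ∫ ω, ‖X j k ω‖ ^ (n + 2) ∂P ≤ Ξ := fun j k => hp (j, k)
  have hΞ0 : 0 ≤ Ξ := integral_nonneg fun ω => by positivity
  set A := ∫ ω, U ω ^ (2 * (n + 2)) ∂P with hA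
  have hA0 : 0 ≤ A := integral_nonneg fun ω => by have := hU0 ω; positivity
  set R := θ * Q * (4 * Ξ + φ ^ (3 * (n + 2)))
      + (C ^ 2 * (n + 1)) ^ (n + 2) / θ ^ (n + 1) * φ ^ (3 * (n + 2))
      + (t * ε + 4 * A / t) with hR
  have hε0 : 0 ≤ ε := measureReal_nonneg.trans hEε
  have hR0 : 0 ≤ R := by positivity
  have key : ∀ l j k, l ≠ j → l ≠ k → ‖∫ ω, F l j k ω * conjPow n (X j k ω) ∂P‖ ≤ R := by
    intro l j k hlj hlk
    -- The term with X' has mean zero, so only the change from X' to X counts.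
    have e1 : ∫ ω, F l j k ω * conjPow n (X j k ω) ∂P
        = ∫ ω, F l j k ω * (conjPow n (X j k ω) - conjPow n (X' l j k ω)) ∂P := by
      simp only [mul_sub]
      rw [integral_sub (iFψ l j k _ (mX j k) (hXU j k)) (iFψ l j k _ (mX' l j k) (hX'U l j k)),
        hzero l j k hlj hlk, sub_zero]
    rw [e1]
    have iχ : Integrable (E.indicator (fun _ => (1 : ℝ))) P := (integrable_const 1).indicator hE
    have hsum : Integrable (fun ω => ‖X j k ω‖ ^ (n + 2) + ‖X l k ω‖ ^ (n + 2)
        + ‖X j l ω‖ ^ (n + 2) + ‖X l l ω‖ ^ (n + 2)) P :=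
      (((iX j k).add (iX l k)).add (iX j l)).add (iX l l)
    have hint1 : Integrable (fun ω => θ * Q * (‖X j k ω‖ ^ (n + 2) + ‖X l k ω‖ ^ (n + 2)
        + ‖X j l ω‖ ^ (n + 2) + ‖X l l ω‖ ^ (n + 2) + φ ^ (3 * (n + 2)))) P :=
      (hsum.add (integrable_const _)).const_mul _
    have hint2 : Integrable (fun ω => t * E.indicator (fun _ => (1 : ℝ)) ω
        + 4 * U ω ^ (2 * (n + 2)) / t) P := (iχ.const_mul t).add ((hU.const_mul 4).div_const t)
    have hint12 : Integrable (fun ω => θ * Q * (‖X j k ω‖ ^ (n + 2) + ‖X l k ω‖ ^ (n + 2)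
        + ‖X j l ω‖ ^ (n + 2) + ‖X l l ω‖ ^ (n + 2) + φ ^ (3 * (n + 2)))
        + (C ^ 2 * (n + 1)) ^ (n + 2) / θ ^ (n + 1) * φ ^ (3 * (n + 2))) P :=
      hint1.add (integrable_const _)
    -- Besides (j, k) the pairs (l, k), (j, l), (l, l) occur; this is why the argument closes only
    -- for the maximum over all pairs.
    have hI : ∫ ω, ‖X j k ω‖ ^ (n + 2) + ‖X l k ω‖ ^ (n + 2)
        + ‖X j l ω‖ ^ (n + 2) + ‖X l l ω‖ ^ (n + 2) ∂P ≤ 4 * Ξ := by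
      have h2 : Integrable (fun ω => ‖X j k ω‖ ^ (n + 2) + ‖X l k ω‖ ^ (n + 2)) P :=
        (iX j k).add (iX l k)
      have h3 : Integrable (fun ω => ‖X j k ω‖ ^ (n + 2) + ‖X l k ω‖ ^ (n + 2)
        + ‖X j l ω‖ ^ (n + 2)) P := h2.add (iX j l)
      rw [integral_add h3 (iX l l), integral_add h2 (iX j l), integral_add (iX j k) (iX l k)]
      linarith [hΞ' j k, hΞ' l k, hΞ' j l, hΞ' l l]
    refine (norm_integral_le_of_norm_le (hint12.add hint2) (ae_of_all _ fun ω => ?_)).trans ?_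
    · refine fluct_term_le n hC hφ hφ1 hθ0 ht (norm_nonneg (X l k ω)) (norm_nonneg (X j l ω))
        (norm_nonneg (X l l ω)) (χ := E.indicator (fun _ => (1 : ℝ)) ω) ?_ ?_ (hFU l j k ω)
        (hXU j k ω) (hX'U l j k ω)
      · by_cases h : ω ∈ E <;> simp [h]
      · intro h
        refine hgood ω (fun hω => ?_) l j k hlj hlk
        simp [hω] at h
    · simp only [Pi.add_apply]
      rw [integral_add hint12 hint2, integral_add hint1 (integrable_const _),
        integral_const_mul, integral_add hsum (integrable_const _),
        integral_add (iχ.const_mul t) ((hU.const_mul 4).div_const t), integral_const_mul,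
        integral_div, integral_const_mul, integral_indicator hE]
      simp only [integral_const, probReal_univ, smul_eq_mul, one_mul, MeasurableSet.univ,
        measureReal_restrict_apply, Set.univ_inter, mul_one]
      rw [hR]
      gcongr
      rw [integral_const_mul]
  have expand : ∀ j k, ((∫ ω, ‖X j k ω‖ ^ (n + 2) ∂P : ℝ) : ℂ)
      = ∑ l ∈ Finset.univ.filter (fun l => l ≠ j ∧ l ≠ k),
          b l * ∫ ω, F l j k ω * conjPow n (X j k ω) ∂P := by
    intro j k
    rw [← integral_complex_ofReal]
    have : ∀ ω, ((‖X j k ω‖ ^ (n + 2) : ℝ) : ℂ)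
        = ∑ l ∈ Finset.univ.filter (fun l => l ≠ j ∧ l ≠ k),
          (b l : ℂ) * (F l j k ω * conjPow n (X j k ω)) := by
      intro ω
      rw [← mul_conjPow, ← Finset.sum_congr rfl fun l _ => mul_assoc _ _ _, ← Finset.sum_mul, ← hX]
    simp_rw [this]
    rw [integral_finsetSum _ fun l _ => (iFψ l j k _ (mX j k) (hXU j k)).const_mul _]
    refine Finset.sum_congr rfl fun l _ => ?_
    rw [integral_const_mul]
  have hΞR : Ξ ≤ B * R := by
    have h1 : Ξ = ‖((Ξ : ℝ) : ℂ)‖ := by rw [Complex.norm_real, Real.norm_of_nonneg hΞ0]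
    rw [h1, hΞ, expand]
    refine (norm_sum_le _ _).trans ?_
    calc _ ≤ ∑ l ∈ Finset.univ.filter (fun l => l ≠ p.1 ∧ l ≠ p.2), b l * R := by
          refine Finset.sum_le_sum fun l hl => ?_
          rw [Finset.mem_filter] at hl
          rw [norm_mul, Complex.norm_real, Real.norm_of_nonneg (hb0 l)]
          exact mul_le_mul_of_nonneg_left (key l _ _ hl.2.1 hl.2.2) (hb0 l)
      _ ≤ ∑ l, b l * R := Finset.sum_le_sum_of_subset_of_nonneg (Finset.filter_subset _ _)
          fun l _ _ => mul_nonneg (hb0 l) hR0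
      _ ≤ B * R := by rw [← Finset.sum_mul]; gcongr
  have hθQ : B * (θ * Q) = 1 / 8 := by rw [hθ]; field_simp
  have hθQ' : θ * Q ≤ 1 := by
    have : θ * Q * 1 ≤ θ * Q * B := by gcongr
    linarith
  have hθinv : (C ^ 2 * (n + 1)) ^ (n + 2) / θ ^ (n + 1)
      = (C ^ 2 * (n + 1)) ^ (n + 2) * (8 * B * Q) ^ (n + 1) := by
    rw [hθ, one_div, inv_pow, div_inv_eq_mul]
  refine (hΞ' j k).trans ?_
  have hΞR2 : Ξ ≤ 1 / 2 * Ξ + B * (θ * Q * φ ^ (3 * (n + 2))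
      + (C ^ 2 * (n + 1)) ^ (n + 2) * (8 * B * Q) ^ (n + 1) * φ ^ (3 * (n + 2))
      + (t * ε + 4 * A / t)) := by
    calc Ξ ≤ B * R := hΞR
      _ = 4 * (B * (θ * Q)) * Ξ + B * (θ * Q * φ ^ (3 * (n + 2))
      + (C ^ 2 * (n + 1)) ^ (n + 2) * (8 * B * Q) ^ (n + 1) * φ ^ (3 * (n + 2))
      + (t * ε + 4 * A / t)) := by rw [hR, hθinv]; ring
      _ = _ := by rw [hθQ]; ring
  have hlast : B * (θ * Q * φ ^ (3 * (n + 2))) ≤ B * (1 * φ ^ (3 * (n + 2))) := by gcongr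
  have : 4 / t * A = 4 * A / t := by ring
  rw [this]
  linarith

end Moment

/-! ### Measurability, independence of a row from its minor, crude moments. -/

section Ensemble

variable {Ω : Type*} [MeasurableSpace Ω] {P : Measure Ω} [IsProbabilityMeasure P]
variable {ι : Type*} [Fintype ι] [DecidableEq ι]

instance measurableSpaceMatrix {κ : Type*} : MeasurableSpace (Matrix κ κ ℝ) :=
  inferInstanceAs (MeasurableSpace (κ → κ → ℝ))

theorem measurable_matrix_of_entry {α : Type*} [MeasurableSpace α] {A : α → Matrix ι ι ℝ}
    (hA : ∀ i j, Measurable fun a => A a i j) : Measurable A := by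
  refine measurable_pi_iff.2 fun i => measurable_pi_iff.2 fun j => hA i j

theorem measurable_entry (i j : ι) : Measurable fun A : Matrix ι ι ℝ => A i j :=
  (measurable_pi_apply j).comp (measurable_pi_apply i)

theorem measurable_det {α : Type*} [MeasurableSpace α] {A : α → Matrix ι ι ℂ}
    (hA : ∀ i j, Measurable fun a => A a i j) : Measurable fun a => (A a).det := by
  simp only [Matrix.det_apply']
  exact Finset.measurable_sum _ fun σ _ => measurable_const.mul
    (Finset.measurable_prod _ fun i _ => hA _ _)

/-- Cramer's rule: each entry is a quotient of polynomials in the matrix entries. -/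
theorem measurable_res (w : ι → ℂ) (i j : ι) : Measurable fun H : Matrix ι ι ℝ => res w H i j := by
  have hs : ∀ i j, Measurable fun H : Matrix ι ι ℝ => shifted w H i j := by
    intro i j
    simp only [shifted, Matrix.sub_apply, Matrix.map_apply]
    exact (Complex.measurable_ofReal.comp (measurable_entry i j)).sub measurable_const
  have : (fun H : Matrix ι ι ℝ => res w H i j) = fun H =>
      ((shifted w H).det)⁻¹ * (Matrix.updateRow (shifted w H) j (Pi.single i 1)).det := by
    funext H
    rw [res, Matrix.inv_def, Matrix.smul_apply, Ring.inverse_eq_inv', Matrix.adjugate_apply,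
      smul_eq_mul]
  rw [this]
  refine (measurable_det hs).inv.mul (measurable_det fun x y => ?_)
  by_cases h : x = j
  · subst h
    simp only [Matrix.updateRow_self]; exact measurable_const
  · simp only [Matrix.updateRow_ne h]
    exact hs x y

theorem measurable_del (l : ι) : Measurable fun H : Matrix ι ι ℝ => del l H := by
  refine measurable_matrix_of_entry fun i j => ?_
  unfold del
  split_ifs
  · exact measurable_const
  · exact measurable_entry i j

theorem measurable_res_del (w : ι → ℂ) (l i j : ι) :
    Measurable fun H : Matrix ι ι ℝ => res w (del l H) i j :=
  (measurable_res w i j).comp (measurable_del l)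

theorem measurable_rowMinor (w : ι → ℂ) (l j : ι) :
    Measurable fun H : Matrix ι ι ℝ => rowMinor w l j H :=
  Finset.measurable_sum _ fun x _ => (Complex.measurable_ofReal.comp (measurable_entry l x)).mul
    (measurable_res_del w l x j)

theorem measurable_rowCov (w : ι → ℂ) (S : Matrix ι ι ℝ) (l j k : ι) :
    Measurable fun H : Matrix ι ι ℝ => rowCov w S l j k H :=
  Finset.measurable_sum _ fun x _ => measurable_const.mul ((measurable_res_del w l x j).mul
    (Complex.continuous_conj.measurable.comp (measurable_res_del w l x k)))

theorem measurable_fluct (w : ι → ℂ) (S : Matrix ι ι ℝ) (l j k : ι) :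
    Measurable fun H : Matrix ι ι ℝ => fluct w S l j k H :=
  ((measurable_rowMinor w l j).mul (Complex.continuous_conj.measurable.comp
    (measurable_rowMinor w l k))).sub (measurable_rowCov w S l j k)

theorem measurable_fluctSum (w : ι → ℂ) (S : Matrix ι ι ℝ) (b : ι → ℝ) (j k : ι) :
    Measurable fun H : Matrix ι ι ℝ => fluctSum w S b j k H :=
  Finset.measurable_sum _ fun l _ => measurable_const.mul (measurable_fluct w S l j k)

/-- `fluctSumDel` as a function of the matrix with row and column `m` removed. -/
def fluctSumOff (w : ι → ℂ) (S : Matrix ι ι ℝ) (b : ι → ℝ) (m j k : ι) (A : Matrix ι ι ℝ) : ℂ :=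
  ∑ l ∈ Finset.univ.filter (fun l => (l ≠ j ∧ l ≠ k) ∧ l ≠ m), (b l : ℂ) * fluct w S l j k A

theorem measurable_fluctSumOff (w : ι → ℂ) (S : Matrix ι ι ℝ) (b : ι → ℝ) (m j k : ι) :
    Measurable fun A : Matrix ι ι ℝ => fluctSumOff w S b m j k A :=
  Finset.measurable_sum _ fun l _ => measurable_const.mul (measurable_fluct w S l j k)

/-- The probabilistic input on the random matrix. -/
structure RowEnsemble (P : Measure Ω) (ν : ℕ → ℝ) (S : Matrix ι ι ℝ) (H : Ω → Matrix ι ι ℝ) :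
    Prop where
  measurable : Measurable H
  symm : ∀ ω i j, H ω i j = H ω j i
  indep_row : ∀ l, IndepFun (fun ω => H ω l) (fun ω => del l (H ω)) P
  iIndep_row : ∀ l, iIndepFun (fun x ω => H ω l x) P
  integrable : ∀ i j, ∀ p : ℕ, Integrable (fun ω => |H ω i j| ^ p) P
  centered : ∀ i j, ∫ ω, H ω i j ∂P = 0
  variance : ∀ i j, ∫ ω, H ω i j ^ 2 ∂P = S i j
  one_le : ∀ p, 1 ≤ ν p
  moments : ∀ i j, ∀ p : ℕ, ∫ ω, |H ω i j| ^ p ∂P ≤ ν p * √(S i j) ^ p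

/-- The constants in the moment bounds of a `RowEnsemble`. -/
def momentConst (μ : ℕ → ℝ) (p : ℕ) : ℝ := max 1 (|μ p| ^ p)

theorem IsSymmEnsemble.rowEnsemble {N : ℕ} [NeZero N] {μ : ℕ → ℝ}
    {S : Matrix (ZMod N) (ZMod N) ℝ} {H : Ω → Matrix (ZMod N) (ZMod N) ℝ}
    (h : IsSymmEnsemble P μ S H) : RowEnsemble P (momentConst μ) S H := by
  classical
  let I := {p : ZMod N × ZMod N // p.1.val ≤ p.2.val}
  -- `srt` orders an index pair, so that every entry is read off from the independent half of the
  -- matrix.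
  let srt : ZMod N → ZMod N → I := fun i j =>
    if hij : i.val ≤ j.val then ⟨(i, j), hij⟩ else ⟨(j, i), le_of_not_ge hij⟩
  have hsrt : ∀ ω i j, H ω i j = H ω (srt i j).1.1 (srt i j).1.2 := by
    intro ω i j
    simp only [srt]
    split_ifs
    · rfl
    · exact h.symm ω i j
  have hmem : ∀ i j, ((srt i j).1.1 = i ∧ (srt i j).1.2 = j) ∨
      ((srt i j).1.1 = j ∧ (srt i j).1.2 = i) := by
    intro i j
    simp only [srt]
    split_ifs
    · exact Or.inl ⟨rfl, rfl⟩
    · exact Or.inr ⟨rfl, rfl⟩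
  have mX : ∀ p : I, Measurable fun ω => H ω p.1.1 p.1.2 := fun p => h.measurable _ _
  refine ⟨measurable_matrix_of_entry h.measurable, h.symm, fun l => ?_, fun l => ?_, fun i j p => ?_,
    h.centered, h.variance, fun p => le_max_left _ _, fun i j p => ?_⟩
  -- Pairs containing `l` and pairs avoiding `l` are disjoint groups; row `l` is a function of the
  -- first, `del l H` of the second.
  · let T : Finset I := Finset.univ.filter fun p => p.1.1 = l ∨ p.1.2 = l
    have hT := h.indep.indepFun_finset T Tᶜ disjoint_compl_right mX
    have m1 : ∀ x, srt l x ∈ T := by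
      intro x
      simp only [T, Finset.mem_filter, Finset.mem_univ, true_and]
      rcases hmem l x with h | h
      · exact Or.inl h.1
      · exact Or.inr h.2
    have m2 : ∀ i j, ¬(i = l ∨ j = l) → srt i j ∈ Tᶜ := by
      intro i j hij
      simp only [T, Finset.mem_compl, Finset.mem_filter, Finset.mem_univ, true_and]
      rcases hmem i j with h | h <;> rw [h.1, h.2]
      · exact hij
      · rwa [or_comm]
    let φ : (T → ℝ) → ZMod N → ℝ := fun v x => v ⟨srt l x, m1 x⟩
    let ψ : ((Tᶜ : Finset I) → ℝ) → Matrix (ZMod N) (ZMod N) ℝ := fun v i j =>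
      if hij : i = l ∨ j = l then 0 else v ⟨srt i j, m2 i j hij⟩
    have hφ : Measurable φ := measurable_pi_iff.2 fun x => measurable_pi_apply _
    have hψ : Measurable ψ := measurable_matrix_of_entry fun i j => by
      simp only [ψ]
      split_ifs
      · exact measurable_const
      · exact measurable_pi_apply _
    have := hT.comp hφ hψ
    convert this using 1
    · funext ω x
      exact hsrt ω l x
    · funext ω i j
      simp only [del, Function.comp, ψ]
      split_ifs
      · rfl
      · exact hsrt ω i j
  -- An unordered pair {l, x} determines x.
  · have hinj : Function.Injective (srt l) := by
      intro x y hxy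
      have h1 := hmem l x
      have h2 := hmem l y
      rw [hxy] at h1
      rcases h1 with h1 | h1 <;> rcases h2 with h2 | h2
      · rw [← h1.2, h2.2]
      · rw [← h1.2, h2.2, ← h1.1, h2.1]
      · rw [← h1.1, h2.1, ← h1.2, h2.2]
      · rw [← h1.1, h2.1]
    have := h.indep.precomp hinj
    convert this using 2 with x
    funext ω
    exact hsrt ω l x
  · rcases Nat.eq_zero_or_pos p with hp | hp
    · subst hp; simp
    · exact h.integrable i j p hp
  · rcases Nat.eq_zero_or_pos p with hp | hp
    · subst hp; simp [momentConst]
    · have h1 := h.moments i j p hp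
      have h0 : 0 ≤ ∫ ω, |H ω i j| ^ p ∂P := integral_nonneg fun ω => by positivity
      have h2 : ((∫ ω, |H ω i j| ^ p ∂P) ^ (1 / (p : ℝ))) ^ p = ∫ ω, |H ω i j| ^ p ∂P := by
        rw [← Real.rpow_natCast, ← Real.rpow_mul h0, one_div, inv_mul_cancel₀ (by positivity),
          Real.rpow_one]
      rw [← h2]
      calc _ ≤ (|μ p| * √(S i j)) ^ p := by
            gcongr
            refine h1.trans ?_
            gcongr
            exact le_abs_self _
        _ = |μ p| ^ p * √(S i j) ^ p := mul_pow _ _ _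
        _ ≤ _ := by
            gcongr
            exact le_max_right _ _

namespace RowEnsemble

variable {ν : ℕ → ℝ} {S : Matrix ι ι ℝ} {H : Ω → Matrix ι ι ℝ} (h : RowEnsemble P ν S H)
include h

theorem var_nonneg (i j : ι) : 0 ≤ S i j := by
  rw [← h.variance i j]
  exact integral_nonneg fun ω => sq_nonneg _

theorem measurable_apply (i j : ι) : Measurable fun ω => H ω i j :=
  (measurable_entry i j).comp h.measurable

theorem integral_mul (l : ι) {x y : ι} (hxy : x ≠ y) : ∫ ω, H ω l x * H ω l y ∂P = 0 := by
  rw [((h.iIndep_row l).indepFun hxy).integral_fun_mul_eq_mul_integral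
    (h.measurable_apply l x).aestronglyMeasurable (h.measurable_apply l y).aestronglyMeasurable,
    h.centered, zero_mul]

end RowEnsemble

/-- One plus the sum of the absolute values of all entries. -/
def absSum (H : Matrix ι ι ℝ) : ℝ := 1 + ∑ p : ι × ι, |H p.1 p.2|

theorem one_le_absSum (H : Matrix ι ι ℝ) : 1 ≤ absSum H :=
  le_add_of_nonneg_right (Finset.sum_nonneg fun _ _ => abs_nonneg _)

theorem abs_le_absSum (H : Matrix ι ι ℝ) (i j : ι) : |H i j| ≤ absSum H := by
  have := Finset.single_le_sum (f := fun p : ι × ι => |H p.1 p.2|) (fun _ _ => abs_nonneg _)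
    (Finset.mem_univ (i, j))
  unfold absSum
  linarith

theorem row_le_absSum (H : Matrix ι ι ℝ) (l : ι) : ∑ x, |H l x| ≤ absSum H := by
  have h1 : ∑ x, |H l x| ≤ ∑ i, ∑ x, |H i x| :=
    Finset.single_le_sum (f := fun i => ∑ x, |H i x|)
      (fun _ _ => Finset.sum_nonneg fun _ _ => abs_nonneg _) (Finset.mem_univ l)
  unfold absSum
  rw [Fintype.sum_prod_type]
  linarith

theorem absSum_del_le (H : Matrix ι ι ℝ) (l : ι) : absSum (del l H) ≤ absSum H := by
  unfold absSum
  exact add_le_add le_rfl (Finset.sum_le_sum fun p _ => abs_del_le H l _ _)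

theorem measurable_absSum : Measurable (absSum : Matrix ι ι ℝ → ℝ) :=
  measurable_const.add (Finset.measurable_sum _ fun p _ => (measurable_entry p.1 p.2).abs)

/-- Power mean inequality for card² + 1 summands; `none` stands for the summand 1. -/
theorem absSum_pow_le (H : Matrix ι ι ℝ) (n : ℕ) :
    absSum H ^ (n + 1) ≤ ((Fintype.card ι : ℝ) ^ 2 + 1) ^ n *
      (1 + ∑ p : ι × ι, |H p.1 p.2| ^ (n + 1)) := by
  have h1 := pow_sum_div_card_le_sum_pow (s := (Finset.univ : Finset (Option (ι × ι))))
    (f := fun o => o.elim 1 (fun p => |H p.1 p.2|)) (n := n) (fun o _ => by cases o <;> simp)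
  rw [Fintype.sum_option, Fintype.sum_option] at h1
  simp only [Option.elim, one_pow, Finset.card_univ, Fintype.card_option, Fintype.card_prod] at h1
  rw [div_le_iff₀ (by positivity)] at h1
  push_cast at h1
  unfold absSum
  calc _ ≤ _ := h1
    _ = _ := by ring

theorem RowEnsemble.integrable_absSum_pow {ν : ℕ → ℝ} {S : Matrix ι ι ℝ} {H : Ω → Matrix ι ι ℝ}
    (h : RowEnsemble P ν S H) (n : ℕ) : Integrable (fun ω => absSum (H ω) ^ (n + 1)) P := by
  refine Integrable.mono' (((integrable_const (1 : ℝ)).add (integrable_finsetSum Finset.univ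
    fun (p : ι × ι) _ => h.integrable p.1 p.2 (n + 1))).const_mul
    (((Fintype.card ι : ℝ) ^ 2 + 1) ^ n))
    (((measurable_absSum.comp h.measurable).pow_const _).aestronglyMeasurable)
    (ae_of_all _ fun ω => ?_)
  have := one_le_absSum (H ω)
  rw [Real.norm_of_nonneg (by positivity)]
  refine (absSum_pow_le (H ω) n).trans (le_of_eq ?_)
  simp

theorem RowEnsemble.integral_absSum_pow_le {ν : ℕ → ℝ} {S : Matrix ι ι ℝ} {H : Ω → Matrix ι ι ℝ}
    (h : RowEnsemble P ν S H) (hS : ∀ i j, S i j ≤ 1) (n : ℕ) :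
    ∫ ω, absSum (H ω) ^ (n + 1) ∂P ≤ ((Fintype.card ι : ℝ) ^ 2 + 1) ^ (n + 1) * ν (n + 1) := by
  have hi : Integrable (fun ω => ∑ p : ι × ι, |H ω p.1 p.2| ^ (n + 1)) P :=
    integrable_finsetSum _ fun p _ => h.integrable p.1 p.2 (n + 1)
  have hν := h.one_le (n + 1)
  calc ∫ ω, absSum (H ω) ^ (n + 1) ∂P ≤ ∫ ω, ((Fintype.card ι : ℝ) ^ 2 + 1) ^ n *
      (1 + ∑ p : ι × ι, |H ω p.1 p.2| ^ (n + 1)) ∂P :=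
        integral_mono (h.integrable_absSum_pow n) (((integrable_const _).add hi).const_mul _)
          fun ω => absSum_pow_le (H ω) n
    _ = ((Fintype.card ι : ℝ) ^ 2 + 1) ^ n *
      (1 + ∑ p : ι × ι, ∫ ω, |H ω p.1 p.2| ^ (n + 1) ∂P) := by
        rw [integral_const_mul, integral_add (integrable_const _) hi,
          integral_finsetSum _ fun p _ => h.integrable p.1 p.2 (n + 1)]
        simp
    _ ≤ ((Fintype.card ι : ℝ) ^ 2 + 1) ^ n * (ν (n + 1) + ∑ p : ι × ι, ν (n + 1)) := by
        gcongr with p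
        refine (h.moments p.1 p.2 (n + 1)).trans ?_
        have : √(S p.1 p.2) ≤ 1 := by rw [Real.sqrt_le_one]; exact hS _ _
        have : √(S p.1 p.2) ^ (n + 1) ≤ 1 := pow_le_one₀ (Real.sqrt_nonneg _) this
        nlinarith
    _ = _ := by
        simp only [Finset.sum_const, Finset.card_univ, Fintype.card_prod, nsmul_eq_mul]
        push_cast; ring

section Envelope

variable {w : ι → ℂ} {S : Matrix ι ι ℝ} {L : ℝ}

/-- This and the next two bounds use no good event, only the a priori bound `L` on the resolvent of
the minor. They supply the envelope for the moment method. -/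
theorem norm_rowMinor_le (hL : 0 ≤ L) {H : Matrix ι ι ℝ} {l : ι}
    (hres : ∀ i j, ‖res w (del l H) i j‖ ≤ L) (j : ι) :
    ‖rowMinor w l j H‖ ≤ absSum H * L := by
  refine (norm_sum_le _ _).trans ?_
  calc _ ≤ ∑ x, |H l x| * L := by
        refine Finset.sum_le_sum fun x _ => ?_
        rw [norm_mul, Complex.norm_real, Real.norm_eq_abs]
        gcongr
        exact hres x j
    _ ≤ _ := by rw [← Finset.sum_mul]; gcongr; exact row_le_absSum H l

theorem norm_fluct_le_absSum (hL : 0 ≤ L) (hS : ∀ i j, 0 ≤ S i j) (hrow : ∀ i, ∑ j, S i j ≤ 1)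
    {H : Matrix ι ι ℝ} {l : ι} (hres : ∀ i j, ‖res w (del l H) i j‖ ≤ L) (j k : ι) :
    ‖fluct w S l j k H‖ ≤ 2 * L ^ 2 * absSum H ^ 2 := by
  have h1 := norm_rowMinor_le hL hres j
  have h2 := norm_rowMinor_le hL hres k
  have h3 : ‖rowCov w S l j k H‖ ≤ L ^ 2 := by
    refine (norm_sum_le _ _).trans ?_
    calc _ ≤ ∑ x, S l x * L ^ 2 := by
          refine Finset.sum_le_sum fun x _ => ?_
          rw [norm_mul, norm_mul, RCLike.norm_conj, Complex.norm_real, Real.norm_of_nonneg (hS l x),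
            pow_two]
          have := hS l x
          have := hres x j
          have := hres x k
          gcongr
      _ ≤ 1 * L ^ 2 := by rw [← Finset.sum_mul]; gcongr; exact hrow l
      _ = _ := one_mul _
  have h4 := one_le_absSum H
  calc ‖fluct w S l j k H‖ ≤ ‖rowMinor w l j H‖ * ‖rowMinor w l k H‖ + ‖rowCov w S l j k H‖ := by
        refine (norm_sub_le _ _).trans ?_
        rw [norm_mul, RCLike.norm_conj]
    _ ≤ (absSum H * L) * (absSum H * L) + L ^ 2 := by gcongr
    _ ≤ _ := by
        have : L ^ 2 * 1 ≤ L ^ 2 * absSum H ^ 2 := by gcongr; exact one_le_pow₀ h4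
        nlinarith

theorem norm_weighted_fluct_le (hL : 0 ≤ L) (hS : ∀ i j, 0 ≤ S i j)
    (hrow : ∀ i, ∑ j, S i j ≤ 1) {H : Matrix ι ι ℝ}
    (hres : ∀ l i j, ‖res w (del l H) i j‖ ≤ L) {b : ι → ℝ} {B : ℝ}
    (hb0 : ∀ l, 0 ≤ b l) (hb : ∑ l, b l ≤ B) (s : Finset ι) (j k : ι) :
    ‖∑ l ∈ s, (b l : ℂ) * fluct w S l j k H‖ ≤ B * (2 * L ^ 2 * absSum H ^ 2) := by
  refine (norm_sum_le _ _).trans ?_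
  calc _ ≤ ∑ l ∈ s, b l * (2 * L ^ 2 * absSum H ^ 2) := by
        refine Finset.sum_le_sum fun l _ => ?_
        rw [norm_mul, Complex.norm_real, Real.norm_of_nonneg (hb0 l)]
        exact mul_le_mul_of_nonneg_left (norm_fluct_le_absSum hL hS hrow (hres l) j k) (hb0 l)
    _ ≤ ∑ l, b l * (2 * L ^ 2 * absSum H ^ 2) :=
        Finset.sum_le_sum_of_subset_of_nonneg (Finset.subset_univ _)
          fun l _ _ => mul_nonneg (hb0 l) (by positivity)
    _ ≤ _ := by rw [← Finset.sum_mul]; gcongr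

end Envelope

/-- The fluctuation at `l` is centered given the minor. -/
theorem RowEnsemble.integral_fluct_mul {ν : ℕ → ℝ} {S : Matrix ι ι ℝ} {H : Ω → Matrix ι ι ℝ}
    (h : RowEnsemble P ν S H) (hS1 : ∀ i j, S i j ≤ 1)
    {w : ι → ℂ} {L : ℝ} (hL : 1 ≤ L) {l : ι} (hres : ∀ ω i j, ‖res w (del l (H ω)) i j‖ ≤ L)
    {ψ : Matrix ι ι ℝ → ℂ} (mψ : Measurable ψ) {n : ℕ} {K : ℝ}
    (hψ : ∀ ω, ‖ψ (del l (H ω))‖ ≤ K * absSum (H ω) ^ n) (j k : ι) :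
    ∫ ω, fluct w S l j k (H ω) * ψ (del l (H ω)) ∂P = 0 := by
  let Θ : ι → ι → Matrix ι ι ℝ → ℂ := fun x y A =>
    res w A x j * (starRingEnd ℂ) (res w A y k) * ψ A
  let q : ι → ι → (ι → ℝ) → ℂ := fun x y v =>
    ((v x * v y - if x = y then S l x else 0 : ℝ) : ℂ)
  have mΘ : ∀ x y, Measurable (Θ x y) := fun x y =>
    ((measurable_res w x j).mul (Complex.continuous_conj.measurable.comp
      (measurable_res w y k))).mul mψ
  have mq : ∀ x y, Measurable (q x y) := fun x y =>
    Complex.measurable_ofReal.comp (((measurable_pi_apply x).mul (measurable_pi_apply y)).sub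
      measurable_const)
  have mrow : Measurable fun ω => H ω l := measurable_pi_iff.2 fun x => h.measurable_apply l x
  have mdel : Measurable fun ω => del l (H ω) := (measurable_del l).comp h.measurable
  -- Expansion into products of a centered quadratic monomial `q` in row `l` and a function `Θ` of
  -- the minor; independence makes each product have mean zero.
  have expand : ∀ ω, fluct w S l j k (H ω) * ψ (del l (H ω))
      = ∑ x, ∑ y, q x y (H ω l) * Θ x y (del l (H ω)) := by
    intro ω
    have e1 : rowCov w S l j k (H ω) = ∑ x, ∑ y, (((if x = y then S l x else 0 : ℝ) : ℂ) *
        (res w (del l (H ω)) x j * (starRingEnd ℂ) (res w (del l (H ω)) y k))) := by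
      unfold rowCov
      refine Finset.sum_congr rfl fun x _ => ?_
      rw [Finset.sum_eq_single x]
      · simp
      · intro y _ hy
        simp [Ne.symm hy]
      · simp
    rw [fluct, e1, rowMinor, rowMinor, map_sum, Finset.sum_mul_sum, ← Finset.sum_sub_distrib,
      Finset.sum_mul]
    refine Finset.sum_congr rfl fun x _ => ?_
    rw [← Finset.sum_sub_distrib, Finset.sum_mul]
    refine Finset.sum_congr rfl fun y _ => ?_
    simp only [q, Θ, map_mul, Complex.conj_ofReal]
    push_cast
    ring
  have hq : ∀ x y ω, ‖q x y (H ω l)‖ ≤ 2 * absSum (H ω) ^ 2 := by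
    intro x y ω
    have h1 := one_le_absSum (H ω)
    have h2 := abs_le_absSum (H ω) l x
    have h3 := abs_le_absSum (H ω) l y
    rw [Complex.norm_real, Real.norm_eq_abs]
    refine (abs_sub _ _).trans ?_
    rw [abs_mul]
    have h4 : |if x = y then S l x else 0| ≤ 1 := by
      split_ifs
      · rw [abs_of_nonneg (h.var_nonneg _ _)]; exact hS1 _ _
      · simp
    have h5 : |H ω l x| * |H ω l y| ≤ absSum (H ω) * absSum (H ω) := by gcongr
    nlinarith
  have hint : ∀ x y, Integrable (fun ω => q x y (H ω l) * Θ x y (del l (H ω))) P := by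
    intro x y
    refine Integrable.mono' ((h.integrable_absSum_pow (n + 1)).const_mul (2 * L ^ 2 * K))
      ((((mq x y).comp mrow).mul ((mΘ x y).comp mdel)).aestronglyMeasurable)
      (ae_of_all _ fun ω => ?_)
    have h1 := one_le_absSum (H ω)
    simp only [Θ, norm_mul, RCLike.norm_conj]
    calc _ ≤ (2 * absSum (H ω) ^ 2) * (L * L * (K * absSum (H ω) ^ n)) := by
          have := hq x y ω
          have := hres ω x j
          have := hres ω y k
          have := hψ ω
          gcongr
      _ = _ := by ring
  simp_rw [expand]
  rw [integral_finsetSum _ fun x _ => integrable_finsetSum _ fun y _ => hint x y]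
  refine Finset.sum_eq_zero fun x _ => ?_
  rw [integral_finsetSum _ fun y _ => hint x y]
  refine Finset.sum_eq_zero fun y _ => ?_
  have hind : IndepFun (fun ω => q x y (H ω l)) (fun ω => Θ x y (del l (H ω))) P :=
    (h.indep_row l).comp (mq x y) (mΘ x y)
  rw [hind.integral_fun_mul_eq_mul_integral ((mq x y).comp mrow).aestronglyMeasurable
    ((mΘ x y).comp mdel).aestronglyMeasurable]
  have : ∫ ω, q x y (H ω l) ∂P = 0 := by
    simp only [q]
    rw [integral_complex_ofReal]
    norm_cast
    by_cases hxy : x = y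
    · subst hxy
      simp only [if_true, ← pow_two]
      have hi : Integrable (fun ω => H ω l x ^ 2) P := by
        simpa using h.integrable l x 2
      rw [integral_sub hi (integrable_const _), h.variance]
      simp
    · simp only [hxy, if_false, sub_zero]
      exact h.integral_mul l hxy
  rw [this, zero_mul]

end Ensemble

/-! ### Tail bound for averaged fluctuations. -/

section FluctuationAveraging

universe u

/-- This is `fluct_moment_le` with envelope a multiple of L² `absSum`². The mean zero condition is
`integral_fluct_mul`, since `fluctSumDel` is a function of the minor. -/
theorem exists_fluctSum_moment (c₀ B : ℝ) (hc₀ : 0 < c₀) (hB : 1 ≤ B) (n : ℕ) :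
    ∃ K : ℝ, 1 ≤ K ∧ ∀ {Ω : Type u} [MeasurableSpace Ω] {P : Measure Ω} [IsProbabilityMeasure P]
      {ι : Type} [Fintype ι] [DecidableEq ι] {ν : ℕ → ℝ} {S : Matrix ι ι ℝ}
      {H : Ω → Matrix ι ι ℝ}, RowEnsemble P ν S H →
      ∀ {w M : ι → ℂ} {φ L : ℝ}, 1 ≤ L → (∀ i, 0 < (w i).im) → 0 < φ → φ ≤ 1 →
      (∀ A : Matrix ι ι ℝ, (∀ i j, A i j = A j i) → ∀ i j, ‖res w A i j‖ ≤ L) →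
      (∀ i, ∑ j, S i j ≤ 1) → (∀ i j, S i j ≤ 1) → (∀ i j, S i j ≤ B * φ ^ 2) →
      ∀ {E : Set Ω} {ε : ℝ}, MeasurableSet E → (∀ ω ∉ E, GoodResolvent w M c₀ φ (H ω)) →
      P.real E ≤ ε →
      ∀ {b : ι → ℝ}, (∀ l, 0 ≤ b l) → (∀ l, b l ≤ B * φ ^ 2) → ∑ l, b l ≤ B → ∀ t > 0, ∀ j k,
      ∫ ω, ‖fluctSum w S b j k (H ω)‖ ^ (n + 2) ∂P ≤ K * (φ ^ (3 * (n + 2)) + t * ε +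
        (L ^ (4 * (n + 2)) * (((Fintype.card ι : ℝ) ^ 2 + 1) ^ (4 * (n + 2)) * ν (4 * (n + 2))))
          / t) := by
  obtain ⟨C, hC, key⟩ := exists_fluctSum_sub_le c₀ B hc₀ hB
  set K₀ := 1 + (C ^ 2 * (n + 1)) ^ (n + 2) * (8 * B * (5 ^ (n + 2) * C ^ (n + 2))) ^ (n + 1)
  have hK₀ : 1 ≤ K₀ := le_add_of_nonneg_right (by positivity)
  set K₁ := 4 * (2 * B) ^ (2 * (n + 2)) with hK₁
  have hK₁1 : 1 ≤ K₁ := by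
    have : (1 : ℝ) ≤ (2 * B) ^ (2 * (n + 2)) := one_le_pow₀ (by linarith)
    linarith
  refine ⟨2 * B * (K₀ + K₁), by nlinarith, ?_⟩
  intro Ω _ P _ ι _ _ ν S H h w M φ L hL hw hφ hφ1 hres hrow hS1 hSφ E ε hE hgood hEε b hb0 hbφ hb
    t ht j k
  have hS0 := h.var_nonneg
  have hdel : ∀ ω l i j, ‖res w (del l (H ω)) i j‖ ≤ L := fun ω l =>
    hres _ (del_symm (h.symm ω) l)
  have hdel2 : ∀ ω m l i j, ‖res w (del l (del m (H ω))) i j‖ ≤ L := fun ω m l =>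
    hres _ (del_symm (del_symm (h.symm ω) m) l)
  have hL0 : 0 ≤ L := by linarith
  let U : Ω → ℝ := fun ω => B * (2 * L ^ 2 * absSum (H ω) ^ 2)
  have hU1 : ∀ ω, 1 ≤ U ω := by
    intro ω
    have h1 : 1 ≤ absSum (H ω) ^ 2 := one_le_pow₀ (one_le_absSum _)
    have h2 : 1 ≤ L ^ 2 := one_le_pow₀ hL
    have h3 : 1 ≤ L ^ 2 * absSum (H ω) ^ 2 := by nlinarith
    simp only [U]
    nlinarith
  have hUpow : ∀ ω, U ω ^ (2 * (n + 2)) = ((2 * B) ^ (2 * (n + 2)) * L ^ (4 * (n + 2)))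
      * absSum (H ω) ^ (4 * n + 7 + 1) := by
    intro ω
    have e1 : 4 * n + 7 + 1 = 2 * (2 * (n + 2)) := by ring
    have e2 : 4 * (n + 2) = 2 * (2 * (n + 2)) := by ring
    rw [e1, e2, pow_mul L 2, pow_mul (absSum _) 2, ← mul_pow, ← mul_pow]
    simp only [U]
    congr 1; ring
  have hUint : Integrable (fun ω => U ω ^ (2 * (n + 2))) P := by
    simp_rw [hUpow]
    exact (h.integrable_absSum_pow _).const_mul _
  have hUI : ∫ ω, U ω ^ (2 * (n + 2)) ∂P ≤ (2 * B) ^ (2 * (n + 2)) * (L ^ (4 * (n + 2)) *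
      (((Fintype.card ι : ℝ) ^ 2 + 1) ^ (4 * (n + 2)) * ν (4 * (n + 2)))) := by
    simp_rw [hUpow]
    rw [integral_const_mul, mul_assoc]
    gcongr
    exact h.integral_absSum_pow_le hS1 (4 * n + 7)
  have hXU : ∀ (s : Finset ι) j k ω, ‖∑ l ∈ s, (b l : ℂ) * fluct w S l j k (H ω)‖ ≤ U ω :=
    fun s j k ω => norm_weighted_fluct_le hL0 hS0 hrow (hdel ω) hb0 hb s j k
  have hmain := fluct_moment_le (P := P) n hC hφ hφ1 ht hB hb0 hb
    (X := fun j k ω => fluctSum w S b j k (H ω))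
    (F := fun l j k ω => fluct w S l j k (H ω))
    (X' := fun l j k ω => fluctSumDel w S b l j k (H ω)) (U := U) hE hEε
    (fun j k => (measurable_fluctSum w S b j k).comp h.measurable)
    (fun l j k => (measurable_fluct w S l j k).comp h.measurable)
    (fun l j k => (measurable_fluctSumOff w S b l j k).comp
      ((measurable_del l).comp h.measurable))
    (fun j k ω => rfl) hUint hU1 (fun j k ω => hXU _ j k ω)
    (fun l j k ω => by
      have h1 := norm_fluct_le_absSum hL0 hS0 hrow (hdel ω l) j k
      have h2 : 1 * (2 * L ^ 2 * absSum (H ω) ^ 2) ≤ U ω := by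
        simp only [U]
        gcongr
      linarith)
    (fun l j k ω => by
      have h1 := norm_weighted_fluct_le hL0 hS0 hrow (hdel2 ω l) hb0 hb
        (Finset.univ.filter (fun x => (x ≠ j ∧ x ≠ k) ∧ x ≠ l)) j k
      refine h1.trans ?_
      simp only [U]
      have := absSum_del_le (H ω) l
      have := one_le_absSum (del l (H ω))
      gcongr)
    (fun ω hω l j k hlj hlk => by
      obtain ⟨h1, h2⟩ := key (hgood ω hω) hS0 hrow hSφ hb0 hbφ hb
      exact ⟨h1 l j k hlj hlk, h2 l j k hlj hlk⟩)
    (fun l j k hlj hlk => by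
      refine h.integral_fluct_mul hS1 hL (hdel · l)
        (ψ := fun A => conjPow n (fluctSumOff w S b l j k A)) (n := 2 * (n + 1))
        (K := (B * (2 * L ^ 2)) ^ (n + 1))
        ((continuous_conjPow n).measurable.comp (measurable_fluctSumOff w S b l j k)) ?_ j k
      intro ω
      rw [norm_conjPow, pow_mul, ← mul_pow]
      have h1 := norm_weighted_fluct_le hL0 hS0 hrow (hdel2 ω l) hb0 hb
        (Finset.univ.filter (fun x => (x ≠ j ∧ x ≠ k) ∧ x ≠ l)) j k
      have := absSum_del_le (H ω) l
      have := one_le_absSum (del l (H ω))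
      refine pow_le_pow_left₀ (norm_nonneg _) (h1.trans ?_) _
      calc B * (2 * L ^ 2 * absSum (del l (H ω)) ^ 2) ≤ B * (2 * L ^ 2 * absSum (H ω) ^ 2) := by
            gcongr
        _ = _ := by ring) j k
  refine hmain.trans ?_
  set V := L ^ (4 * (n + 2)) *
      (((Fintype.card ι : ℝ) ^ 2 + 1) ^ (4 * (n + 2)) * ν (4 * (n + 2))) with hV
  have hν := h.one_le (4 * (n + 2))
  have hV0 : 0 ≤ V := by positivity
  have hε0 : 0 ≤ ε := measureReal_nonneg.trans hEε
  have e1 : 4 / t * ∫ ω, U ω ^ (2 * (n + 2)) ∂P ≤ K₁ * (V / t) := by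
    calc _ ≤ 4 / t * ((2 * B) ^ (2 * (n + 2)) * V) := by gcongr
      _ = _ := by rw [hK₁]; ring
  have e2 : 0 ≤ V / t := by positivity
  have e3 : 0 ≤ φ ^ (3 * (n + 2)) := by positivity
  have e4 : 0 ≤ t * ε := by positivity
  rw [mul_assoc (2 * B)]
  refine mul_le_mul_of_nonneg_left ?_ (by linarith)
  nlinarith

/-- Take L = N^10 and t = N^(60(n+2)). An exceptional event of probability at most N^(-70(n+2)) then
costs at most N^(-10(n+2)), and the envelope costs a constant times N^((40+12-60)(n+2)). Both powers
are below φ^(3(n+2)) because N²φ³ ≥ 1. Markov's inequality gives the tail. -/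
theorem exists_fluctSum_tail (c₀ B : ℝ) (hc₀ : 0 < c₀) (hB : 1 ≤ B) (n : ℕ) (ν : ℕ → ℝ) :
    ∃ K : ℝ, 1 ≤ K ∧ ∀ {Ω : Type u} [MeasurableSpace Ω] {P : Measure Ω} [IsProbabilityMeasure P]
      {ι : Type} [Fintype ι] [DecidableEq ι] {S : Matrix ι ι ℝ}
      {H : Ω → Matrix ι ι ℝ}, RowEnsemble P ν S H → 2 ≤ (Fintype.card ι : ℝ) →
      ∀ {w M : ι → ℂ} {φ : ℝ}, (∀ i, 0 < (w i).im) → 0 < φ → φ ≤ 1 →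
      1 ≤ Fintype.card ι * φ ^ 2 →
      (∀ A : Matrix ι ι ℝ, (∀ i j, A i j = A j i) → ∀ i j,
        ‖res w A i j‖ ≤ (Fintype.card ι : ℝ) ^ 10) →
      (∀ i, ∑ j, S i j ≤ 1) → (∀ i j, S i j ≤ 1) → (∀ i j, S i j ≤ B * φ ^ 2) →
      ∀ {E : Set Ω}, MeasurableSet E → (∀ ω ∉ E, GoodResolvent w M c₀ φ (H ω)) →
      P.real E * (Fintype.card ι : ℝ) ^ (70 * (n + 2)) ≤ 1 →
      ∀ {b : ι → ℝ}, (∀ l, 0 ≤ b l) → (∀ l, b l ≤ B * φ ^ 2) → ∑ l, b l ≤ B → ∀ s > 0, ∀ j k,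
      P.real {ω | s * φ ^ 3 ≤ ‖fluctSum w S b j k (H ω)‖} ≤ K / s ^ (n + 2) := by
  obtain ⟨K, hK, key⟩ := exists_fluctSum_moment.{u} c₀ B hc₀ hB n
  have hν1 : 1 ≤ max 1 (ν (4 * (n + 2))) := le_max_left _ _
  refine ⟨K * (2 + max 1 (ν (4 * (n + 2)))), by nlinarith, ?_⟩
  intro Ω _ P _ ι _ _ S H h hN w M φ hw hφ hφ1 hNφ hres hrow hS1 hSφ E hE hgood hEε b hb0 hbφ hb
    s hs j k
  set N : ℝ := (Fintype.card ι : ℝ) with hNdef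
  have hN0 : 0 < N := by linarith
  have hN1 : 1 ≤ N := by linarith
  have hmom := key h (one_le_pow₀ hN1) hw hφ hφ1 hres hrow hS1 hSφ hE hgood le_rfl hb0 hbφ hb
    (N ^ (60 * (n + 2))) (by positivity) j k
  have hφN : ∀ {x : ℝ}, x * N ^ (2 * (n + 2)) ≤ 1 → x ≤ φ ^ (3 * (n + 2)) := by
    intro x hx
    have h1 : 1 ≤ (N ^ 2 * φ ^ 3) ^ (n + 2) := by
      refine one_le_pow₀ ?_
      have h2 : 1 ≤ N * φ := by
        calc (1 : ℝ) ≤ N * φ ^ 2 := hNφ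
          _ ≤ N * φ := by rw [pow_two]; gcongr; nlinarith
      have : N ^ 2 * φ ^ 3 = (N * φ) * (N * φ ^ 2) := by ring
      rw [this]; nlinarith
    rw [mul_pow, ← pow_mul, ← pow_mul] at h1
    have h2 : 0 < N ^ (2 * (n + 2)) := by positivity
    nlinarith
  have e1 : N ^ (60 * (n + 2)) * P.real E ≤ φ ^ (3 * (n + 2)) := by
    refine hφN ?_
    calc _ = P.real E * N ^ (62 * (n + 2)) := by ring
      _ ≤ P.real E * N ^ (70 * (n + 2)) := by
          have := measureReal_nonneg (μ := P) (s := E)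
          gcongr
          norm_num
      _ ≤ 1 := hEε
  have e2 : (N ^ 10) ^ (4 * (n + 2)) * ((N ^ 2 + 1) ^ (4 * (n + 2)) * ν (4 * (n + 2)))
      / N ^ (60 * (n + 2)) ≤ max 1 (ν (4 * (n + 2))) * φ ^ (3 * (n + 2)) := by
    have h1 : N ^ 2 + 1 ≤ N ^ 3 := by nlinarith [mul_nonneg hN0.le hN0.le]
    have h2 : (N ^ 2 + 1) ^ (4 * (n + 2)) ≤ N ^ (12 * (n + 2)) := by
      calc _ ≤ (N ^ 3) ^ (4 * (n + 2)) := by gcongr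
        _ = _ := by rw [← pow_mul]; congr 1; ring
    have h3 : N ^ (52 * (n + 2)) / N ^ (60 * (n + 2)) ≤ φ ^ (3 * (n + 2)) := by
      refine hφN ?_
      rw [div_mul_eq_mul_div, div_le_one (by positivity), ← pow_add]
      exact pow_le_pow_right₀ hN1 (by omega)
    have hν0 : 0 ≤ ν (4 * (n + 2)) := zero_le_one.trans (h.one_le _)
    calc _ ≤ (N ^ 10) ^ (4 * (n + 2)) * (N ^ (12 * (n + 2)) * max 1 (ν (4 * (n + 2))))
            / N ^ (60 * (n + 2)) := by
          gcongr
          exact le_max_right _ _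
      _ = max 1 (ν (4 * (n + 2))) * (N ^ (52 * (n + 2)) / N ^ (60 * (n + 2))) := by
          rw [← pow_mul, ← mul_assoc, ← pow_add]
          have : 10 * (4 * (n + 2)) + 12 * (n + 2) = 52 * (n + 2) := by ring
          rw [this]; ring
      _ ≤ _ := by gcongr
  have e3 : ∫ ω, ‖fluctSum w S b j k (H ω)‖ ^ (n + 2) ∂P
      ≤ K * (2 + max 1 (ν (4 * (n + 2)))) * φ ^ (3 * (n + 2)) := by
    refine hmom.trans ?_
    rw [mul_assoc]
    refine mul_le_mul_of_nonneg_left ?_ (by linarith)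
    linarith
  have hint : Integrable (fun ω => ‖fluctSum w S b j k (H ω)‖ ^ (n + 2)) P := by
    refine Integrable.mono' ((h.integrable_absSum_pow (2 * n + 3)).const_mul
      ((B * (2 * (N ^ 10) ^ 2)) ^ (n + 2)))
      ((((measurable_fluctSum w S b j k).comp h.measurable).norm.pow_const _).aestronglyMeasurable)
      (ae_of_all _ fun ω => ?_)
    rw [Real.norm_of_nonneg (by positivity)]
    have e : 2 * n + 3 + 1 = 2 * (n + 2) := by ring
    rw [e, pow_mul, ← mul_pow]
    refine pow_le_pow_left₀ (norm_nonneg _) ?_ _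
    refine (norm_weighted_fluct_le (by positivity) h.var_nonneg hrow (fun l => hres _
      (del_symm (h.symm ω) l)) hb0 hb _ j k).trans (le_of_eq ?_)
    ring
  have hmk := mul_meas_ge_le_integral_of_nonneg (μ := P)
    (f := fun ω => ‖fluctSum w S b j k (H ω)‖ ^ (n + 2))
    (ae_of_all _ fun ω => by positivity) hint ((s * φ ^ 3) ^ (n + 2))
  have hsub : {ω | s * φ ^ 3 ≤ ‖fluctSum w S b j k (H ω)‖} ⊆
      {ω | (s * φ ^ 3) ^ (n + 2) ≤ ‖fluctSum w S b j k (H ω)‖ ^ (n + 2)} := by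
    intro ω hω
    exact pow_le_pow_left₀ (a := s * φ ^ 3) (by positivity) hω _
  have h4 := measureReal_mono (μ := P) hsub
  rw [le_div_iff₀ (by positivity)]
  have h5 : 0 < φ ^ (3 * (n + 2)) := by positivity
  have h6 : (s * φ ^ 3) ^ (n + 2) = s ^ (n + 2) * φ ^ (3 * (n + 2)) := by rw [mul_pow, ← pow_mul]
  rw [h6] at hmk h4
  refine le_of_mul_le_mul_right ?_ h5
  calc _ ≤ P.real {ω | s ^ (n + 2) * φ ^ (3 * (n + 2)) ≤ ‖fluctSum w S b j k (H ω)‖ ^ (n + 2)}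
          * s ^ (n + 2) * φ ^ (3 * (n + 2)) := by gcongr
    _ = s ^ (n + 2) * φ ^ (3 * (n + 2)) * P.real {ω | s ^ (n + 2) * φ ^ (3 * (n + 2))
          ≤ ‖fluctSum w S b j k (H ω)‖ ^ (n + 2)} := by ring
    _ ≤ _ := hmk.trans e3

end FluctuationAveraging

/-! ### Moments of linear and quadratic forms in independent variables. -/

section LargeDeviation

variable {Ω : Type*} [MeasurableSpace Ω] {P : Measure Ω} [IsProbabilityMeasure P]
variable {ι : Type*} [Fintype ι] [DecidableEq ι]

/-- Second order Taylor estimate for powers. -/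
theorem abs_add_pow_sub_le {y d M : ℝ} (hy : |y| ≤ M) (hd : |d| ≤ M) (m : ℕ) :
    |(y + d) ^ (m + 2) - y ^ (m + 2) - (m + 2) * y ^ (m + 1) * d| ≤ 4 ^ (m + 2) * d ^ 2 * M ^ m := by
  have hM : 0 ≤ M := (abs_nonneg y).trans hy
  induction m with
  | zero =>
    have : (y + d) ^ (0 + 2) - y ^ (0 + 2) - ((0 : ℕ) + 2) * y ^ (0 + 1) * d = d ^ 2 := by
      push_cast; ring
    rw [this, abs_of_nonneg (sq_nonneg d), pow_zero, mul_one]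
    exact le_mul_of_one_le_left (sq_nonneg d) (one_le_pow₀ (by norm_num))
  | succ m ih =>
    have e : (y + d) ^ (m + 1 + 2) - y ^ (m + 1 + 2) - ((m + 1 : ℕ) + 2) * y ^ (m + 1 + 1) * d
        = (y + d) * ((y + d) ^ (m + 2) - y ^ (m + 2) - (m + 2) * y ^ (m + 1) * d)
          + (m + 2) * (y ^ (m + 1) * d ^ 2) := by push_cast; ring
    rw [e]
    have h1 : |y + d| ≤ 2 * M := (abs_add_le _ _).trans (by linarith)
    have h2 : |y ^ (m + 1) * d ^ 2| ≤ M ^ (m + 1) * d ^ 2 := by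
      rw [abs_mul, abs_pow, abs_of_nonneg (sq_nonneg d)]
      gcongr
    have h3 : ((m : ℝ) + 2) ≤ 2 * 4 ^ (m + 2) := by
      have : ((m + 2 : ℕ) : ℝ) < 4 ^ (m + 2) := by
        exact_mod_cast Nat.lt_pow_self (by norm_num : 1 < 4)
      push_cast at this
      linarith [pow_pos (by norm_num : (0 : ℝ) < 4) (m + 2)]
    calc _ ≤ |y + d| * |(y + d) ^ (m + 2) - y ^ (m + 2) - (m + 2) * y ^ (m + 1) * d|
          + (m + 2) * |y ^ (m + 1) * d ^ 2| := by
          refine (abs_add_le _ _).trans (le_of_eq ?_)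
          rw [abs_mul, abs_mul ((m : ℝ) + 2), abs_of_nonneg (by positivity : (0 : ℝ) ≤ (m : ℝ) + 2)]
      _ ≤ 2 * M * (4 ^ (m + 2) * d ^ 2 * M ^ m) + 2 * 4 ^ (m + 2) * (M ^ (m + 1) * d ^ 2) := by
          gcongr
      _ = 4 ^ (m + 1 + 2) * d ^ 2 * M ^ (m + 1) := by ring

/-- The term linear in `d` is kept exactly, since it will have mean zero. The gain `r` in front of
y^(2n+2) can be small at the price of r^(-n) on the increment. -/
theorem add_even_pow_le (y d : ℝ) (n : ℕ) {r : ℝ} (hr : 0 < r) (hr1 : r ≤ 1) :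
    (y + d) ^ (2 * n + 2) ≤ (1 + 4 ^ (2 * n + 2) * r) * y ^ (2 * n + 2)
      + (2 * n + 2) * (y ^ (2 * n + 1) * d) + 4 ^ (2 * n + 2) * (2 / r ^ n) * d ^ (2 * n + 2) := by
  have h1 := abs_add_pow_sub_le (le_max_left |y| |d|) (le_max_right |y| |d|) (2 * n)
  have h2 : max |y| |d| ^ (2 * n) ≤ y ^ (2 * n) + d ^ (2 * n) := by
    have ha : |y| ^ (2 * n) = y ^ (2 * n) := by rw [pow_mul, sq_abs, ← pow_mul]
    have hb : |d| ^ (2 * n) = d ^ (2 * n) := by rw [pow_mul, sq_abs, ← pow_mul]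
    have hy : 0 ≤ y ^ (2 * n) := by rw [pow_mul]; positivity
    have hd : 0 ≤ d ^ (2 * n) := by rw [pow_mul]; positivity
    rcases max_choice |y| |d| with h | h <;> rw [h]
    · rw [ha]; linarith
    · rw [hb]; linarith
  have h3 : d ^ 2 * y ^ (2 * n) ≤ r * y ^ (2 * n + 2) + d ^ (2 * n + 2) / r ^ n := by
    have := young_pow (sq_nonneg d) (sq_nonneg y) hr n
    calc _ = d ^ 2 * (y ^ 2) ^ n := by rw [← pow_mul]
      _ ≤ _ := this
      _ = _ := by rw [← pow_mul, ← pow_mul]; rfl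
  have h4 : d ^ (2 * n + 2) ≤ d ^ (2 * n + 2) / r ^ n := by
    have hd : 0 ≤ d ^ (2 * n + 2) := by
      have : d ^ (2 * n + 2) = (d ^ 2) ^ (n + 1) := by rw [← pow_mul]; rfl
      rw [this]; positivity
    rw [le_div_iff₀ (by positivity)]
    exact mul_le_of_le_one_right hd (pow_le_one₀ hr.le hr1)
  have h5 : 4 ^ (2 * n + 2) * d ^ 2 * max |y| |d| ^ (2 * n) ≤
      4 ^ (2 * n + 2) * (r * y ^ (2 * n + 2) + 2 * (d ^ (2 * n + 2) / r ^ n)) := by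
    calc _ ≤ 4 ^ (2 * n + 2) * d ^ 2 * (y ^ (2 * n) + d ^ (2 * n)) :=
          mul_le_mul_of_nonneg_left h2 (by positivity)
      _ = 4 ^ (2 * n + 2) * (d ^ 2 * y ^ (2 * n) + d ^ (2 * n + 2)) := by ring
      _ ≤ _ := mul_le_mul_of_nonneg_left (by linarith) (by positivity)
  have h6 := (abs_le.1 (h1.trans h5)).2
  push_cast at h6
  have e : 4 ^ (2 * n + 2) * (2 / r ^ n) * d ^ (2 * n + 2)
      = 4 ^ (2 * n + 2) * (2 * (d ^ (2 * n + 2) / r ^ n)) := by ring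
  rw [e]
  linarith

/-- A measurable random variable with finite moments of all orders. -/
def AllMoments (P : Measure Ω) (X : Ω → ℝ) : Prop :=
  Measurable X ∧ ∀ p : ℕ, Integrable (fun ω => |X ω| ^ p) P

namespace AllMoments

variable {X Y : Ω → ℝ}

theorem integrable_pow (h : AllMoments P X) (p : ℕ) : Integrable (fun ω => X ω ^ p) P := by
  refine (h.2 p).mono' (h.1.pow_const p).aestronglyMeasurable (ae_of_all _ fun ω => ?_)
  rw [Real.norm_eq_abs, abs_pow]

theorem integrable (h : AllMoments P X) : Integrable X P := by
  simpa using h.integrable_pow 1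

theorem const (c : ℝ) : AllMoments P (fun _ : Ω => c) := ⟨measurable_const, fun _ =>
  integrable_const _⟩

theorem mul (hX : AllMoments P X) (hY : AllMoments P Y) : AllMoments P (fun ω => X ω * Y ω) := by
  refine ⟨hX.1.mul hY.1, fun p => ?_⟩
  refine ((hX.2 (2 * p)).add (hY.2 (2 * p))).mono'
    (((hX.1.mul hY.1).abs.pow_const p).aestronglyMeasurable) (ae_of_all _ fun ω => ?_)
  simp only [Pi.add_apply]
  rw [Real.norm_of_nonneg (by positivity), abs_mul, mul_pow, mul_comm 2 p, pow_mul, pow_mul]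
  nlinarith [sq_nonneg (|X ω| ^ p - |Y ω| ^ p), sq_nonneg (|X ω| ^ p), sq_nonneg (|Y ω| ^ p)]

theorem add (hX : AllMoments P X) (hY : AllMoments P Y) : AllMoments P (fun ω => X ω + Y ω) := by
  refine ⟨hX.1.add hY.1, fun p => ?_⟩
  refine (((hX.2 p).add (hY.2 p)).const_mul (2 ^ p)).mono'
    (((hX.1.add hY.1).abs.pow_const p).aestronglyMeasurable) (ae_of_all _ fun ω => ?_)
  simp only [Pi.add_apply]
  rw [Real.norm_of_nonneg (by positivity)]
  have h1 : |X ω + Y ω| ≤ 2 * max |X ω| |Y ω| := (abs_add_le _ _).trans (by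
    linarith [le_max_left |X ω| |Y ω|, le_max_right |X ω| |Y ω|])
  calc _ ≤ (2 * max |X ω| |Y ω|) ^ p := by gcongr
    _ = 2 ^ p * max |X ω| |Y ω| ^ p := mul_pow _ _ _
    _ ≤ _ := by
      gcongr
      have := pow_nonneg (abs_nonneg (X ω)) p
      have := pow_nonneg (abs_nonneg (Y ω)) p
      rcases max_choice |X ω| |Y ω| with h | h <;> rw [h] <;> linarith

theorem pow (hX : AllMoments P X) (n : ℕ) : AllMoments P (fun ω => X ω ^ n) := by
  refine ⟨hX.1.pow_const n, fun p => ?_⟩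
  simp only [abs_pow, ← pow_mul]
  exact hX.2 _

theorem sum {α : Type*} (s : Finset α) {X : α → Ω → ℝ} (h : ∀ a ∈ s, AllMoments P (X a)) :
    AllMoments P (fun ω => ∑ a ∈ s, X a ω) := by
  classical
  induction s using Finset.induction_on with
  | empty => simpa using const 0
  | insert a s ha ih =>
    simp only [Finset.sum_insert ha]
    exact (h a (Finset.mem_insert_self _ _)).add (ih fun b hb => h b (Finset.mem_insert_of_mem hb))

theorem const_mul (hX : AllMoments P X) (c : ℝ) : AllMoments P (fun ω => c * X ω) :=
  (const c).mul hX

theorem mul_const (hX : AllMoments P X) (c : ℝ) : AllMoments P (fun ω => X ω * c) :=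
  hX.mul (const c)

theorem sub_const (hX : AllMoments P X) (c : ℝ) : AllMoments P (fun ω => X ω - c) := by
  simpa [sub_eq_add_neg] using hX.add (const (-c))

end AllMoments

/-- Moment bound for sums whose increments are centered given the past. -/
theorem moment_chain_le (n : ℕ) {C β : ℝ} (hC : 1 ≤ C) (hβ : 0 < β) {Y : Finset ι → Ω → ℝ}
    {Δ : ι → Finset ι → Ω → ℝ} {v : ι → ℝ} (hv : ∀ x, 0 ≤ v x) (hvβ : ∑ x, v x ≤ β) (t : Finset ι)
    (hY0 : Y ∅ = 0) (hYi : ∀ s, ∀ a ∉ s, Y (insert a s) = Y s + Δ a s)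
    (mY : ∀ s, AllMoments P (Y s)) (mΔ : ∀ a s, AllMoments P (Δ a s))
    (hzero : ∀ s, ∀ a ∉ s, ∫ ω, Y s ω ^ (2 * n + 1) * Δ a s ω ∂P = 0)
    (hΔ : ∀ s ⊆ t, ∀ a ∈ t, a ∉ s → ∫ ω, Δ a s ω ^ (2 * n + 2) ∂P ≤ C * v a ^ (n + 1)) :
    ∫ ω, Y t ω ^ (2 * n + 2) ∂P
      ≤ Real.exp (4 ^ (2 * n + 2) * (2 ^ (n + 2) * C)) * β ^ (n + 1) := by
  rcases t.eq_empty_or_nonempty with rfl | ⟨x₀, hx₀⟩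
  · simp [hY0]; positivity
  set A : ℝ := 4 ^ (2 * n + 2) with hA
  have hA0 : 0 < A := by positivity
  -- Weights proportional to `v`, averaged with the uniform weight so that all are positive. They
  -- sum to at most 1, and v ≤ 2rβ makes r^(-n) v^(n+1) at most a constant times r β^(n+1).
  set r : ι → ℝ := fun x => (v x / β + 1 / t.card) / 2 with hr
  have hcard : 0 < (t.card : ℝ) := by exact_mod_cast Finset.card_pos.2 ⟨x₀, hx₀⟩
  have hr0 : ∀ x, 0 < r x := fun x => by
    have := hv x
    simp only [hr]; positivity
  have hsum : ∑ x ∈ t, r x ≤ 1 := by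
    have h1 : ∑ x ∈ t, v x ≤ β := (Finset.sum_le_sum_of_subset_of_nonneg (Finset.subset_univ _)
      fun x _ _ => hv x).trans hvβ
    simp only [hr]
    rw [← Finset.sum_div, Finset.sum_add_distrib, ← Finset.sum_div, Finset.sum_const, nsmul_eq_mul,
      mul_one_div_cancel hcard.ne']
    have : (∑ x ∈ t, v x) / β ≤ 1 := (div_le_one hβ).2 h1
    linarith
  have hr1 : ∀ x ∈ t, r x ≤ 1 := fun x hx =>
    (Finset.single_le_sum (fun y _ => (hr0 y).le) hx).trans hsum
  have hvr : ∀ x, v x ≤ 2 * r x * β := by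
    intro x
    simp only [hr]
    have : 0 ≤ 1 / (t.card : ℝ) := by positivity
    have e : 2 * ((v x / β + 1 / t.card) / 2) * β = v x + 1 / t.card * β := by field_simp
    rw [e]
    have : 0 ≤ 1 / (t.card : ℝ) * β := by positivity
    linarith
  -- With β^(n+1) added to the moment, each new index multiplies the bound by at most 1 + q r_a ≤
  -- exp(q r_a); the exponents add up to at most q.
  have hex : ∀ s ⊆ t, ∫ ω, Y s ω ^ (2 * n + 2) ∂P + β ^ (n + 1)
      ≤ β ^ (n + 1) * Real.exp (A * (2 ^ (n + 2) * C) * ∑ x ∈ s, r x) := by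
    intro s
    induction s using Finset.induction_on with
    | empty => intro _; simp [hY0]
    | insert a s ha ih =>
      intro hst
      have hs : s ⊆ t := (Finset.subset_insert a s).trans hst
      have hat : a ∈ t := hst (Finset.mem_insert_self _ _)
      have ih := ih hs
      have hra := hr0 a
      have i1 := ((mY s).integrable_pow (2 * n + 2)).const_mul (1 + A * r a)
      have i2 := ((((mY s).pow (2 * n + 1)).mul (mΔ a s)).integrable).const_mul (2 * (n : ℝ) + 2)
      have i3 := ((mΔ a s).integrable_pow (2 * n + 2)).const_mul (A * (2 / r a ^ n))
      have h12 : Integrable (fun ω => (1 + A * r a) * Y s ω ^ (2 * n + 2)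
        + (2 * n + 2) * (Y s ω ^ (2 * n + 1) * Δ a s ω)) P := i1.add i2
      have step : ∫ ω, Y (insert a s) ω ^ (2 * n + 2) ∂P
          ≤ (1 + A * r a) * ∫ ω, Y s ω ^ (2 * n + 2) ∂P
            + A * (2 / r a ^ n) * ∫ ω, Δ a s ω ^ (2 * n + 2) ∂P := by
        calc _ ≤ ∫ ω, ((1 + A * r a) * Y s ω ^ (2 * n + 2)
            + (2 * n + 2) * (Y s ω ^ (2 * n + 1) * Δ a s ω))
            + A * (2 / r a ^ n) * Δ a s ω ^ (2 * n + 2) ∂P := by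
              refine integral_mono ((mY _).integrable_pow _) (h12.add i3) fun ω => ?_
              rw [hYi s a ha]
              exact add_even_pow_le (Y s ω) (Δ a s ω) n (hr0 a) (hr1 a hat)
          _ = _ := by
              rw [integral_add h12 i3, integral_add i1 i2, integral_const_mul, integral_const_mul,
                integral_const_mul, hzero s a ha]
              ring
      have h2 : A * (2 / r a ^ n) * ∫ ω, Δ a s ω ^ (2 * n + 2) ∂P
          ≤ A * (2 ^ (n + 2) * C) * r a * β ^ (n + 1) := by
        calc _ ≤ A * (2 / r a ^ n) * (C * (2 * r a * β) ^ (n + 1)) := by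
              have := hv a
              have := hvr a
              have h3 := hΔ s hs a hat ha
              have : C * v a ^ (n + 1) ≤ C * (2 * r a * β) ^ (n + 1) := by gcongr
              have := h3.trans this
              gcongr
          _ = _ := by
              rw [mul_pow, mul_pow]
              field_simp
              ring
      have h3 : A * r a * ∫ ω, Y s ω ^ (2 * n + 2) ∂P
          ≤ A * (2 ^ (n + 2) * C) * r a * ∫ ω, Y s ω ^ (2 * n + 2) ∂P := by
        have h4 : 0 ≤ ∫ ω, Y s ω ^ (2 * n + 2) ∂P := integral_nonneg fun ω => by
          have : Y s ω ^ (2 * n + 2) = (Y s ω ^ (n + 1)) ^ 2 := by rw [← pow_mul]; congr 1; ring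
          simp only [this, Pi.zero_apply]
          positivity
        have h5 : (1 : ℝ) ≤ 2 ^ (n + 2) * C := by
          have : (1 : ℝ) ≤ 2 ^ (n + 2) := one_le_pow₀ (by norm_num)
          nlinarith
        have h6 : A * r a ≤ A * (2 ^ (n + 2) * C) * r a := by
          have : A * r a * 1 ≤ A * r a * (2 ^ (n + 2) * C) := by gcongr
          linarith
        gcongr
      set q := A * (2 ^ (n + 2) * C) with hq
      calc _ ≤ (1 + q * r a) * (∫ ω, Y s ω ^ (2 * n + 2) ∂P + β ^ (n + 1)) := by linarith
        _ ≤ Real.exp (q * r a) * (β ^ (n + 1) * Real.exp (q * ∑ x ∈ s, r x)) := by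
            have e := Real.add_one_le_exp (q * r a)
            have hp : 0 < β ^ (n + 1) := by positivity
            have h8 : 0 ≤ ∫ ω, Y s ω ^ (2 * n + 2) ∂P + β ^ (n + 1) :=
              add_nonneg (integral_nonneg fun ω => by
                have : Y s ω ^ (2 * n + 2) = (Y s ω ^ (n + 1)) ^ 2 := by
                  rw [← pow_mul]; congr 1; ring
                simp only [this, Pi.zero_apply]
                positivity) hp.le
            have e' : 1 + q * r a ≤ Real.exp (q * r a) := by linarith
            exact mul_le_mul e' ih h8 (Real.exp_pos _).le
        _ = _ := by
            rw [Finset.sum_insert ha, mul_add, Real.exp_add]; ring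
  have h1 := hex t subset_rfl
  have h2 : β ^ (n + 1) * Real.exp (A * (2 ^ (n + 2) * C) * ∑ x ∈ t, r x)
      ≤ β ^ (n + 1) * Real.exp (A * (2 ^ (n + 2) * C)) := by
    have : 0 ≤ A * (2 ^ (n + 2) * C) := by positivity
    have : A * (2 ^ (n + 2) * C) * ∑ x ∈ t, r x ≤ A * (2 ^ (n + 2) * C) * 1 := by gcongr
    rw [mul_one] at this
    gcongr
  have h3 : 0 < β ^ (n + 1) := by positivity
  have h4 := h1.trans h2
  linarith [mul_comm (β ^ (n + 1)) (Real.exp (A * (2 ^ (n + 2) * C)))]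

/-- Independent centered random variables with variances `S x` and comparable moments. -/
structure RowVector (P : Measure Ω) (ν : ℕ → ℝ) (S : ι → ℝ) (ξ : ι → Ω → ℝ) : Prop where
  allMoments : ∀ x, AllMoments P (ξ x)
  indep : iIndepFun ξ P
  centered : ∀ x, ∫ ω, ξ x ω ∂P = 0
  variance : ∀ x, ∫ ω, ξ x ω ^ 2 ∂P = S x
  nonneg : ∀ x, 0 ≤ S x
  one_le : ∀ p, 1 ≤ ν p
  moments : ∀ x, ∀ p : ℕ, ∫ ω, ξ x ω ^ (2 * p) ∂P ≤ ν (2 * p) * S x ^ p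

theorem RowEnsemble.rowVector {ν : ℕ → ℝ} {S : Matrix ι ι ℝ} {H : Ω → Matrix ι ι ℝ}
    (h : RowEnsemble P ν S H) (l : ι) : RowVector P ν (S l) (fun x ω => H ω l x) where
  allMoments x := ⟨h.measurable_apply l x, h.integrable l x⟩
  indep := h.iIndep_row l
  centered := h.centered l
  variance := h.variance l
  nonneg := h.var_nonneg l
  one_le := h.one_le
  moments x p := by
    have := h.moments l x (2 * p)
    rw [pow_mul √(S l x), Real.sq_sqrt (h.var_nonneg l x)] at this
    refine le_trans (le_of_eq ?_) this
    congr 1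
    funext ω
    rw [pow_mul, pow_mul, sq_abs]

namespace RowVector

variable {ν : ℕ → ℝ} {S : ι → ℝ} {ξ : ι → Ω → ℝ} (h : RowVector P ν S ξ)
include h

/-- Independence of the groups `s` and `{a}`; it provides the centering of increments required by
`moment_chain_le`. -/
theorem indep_past {s : Finset ι} {a : ι} (ha : a ∉ s) {f : (s → ℝ) → ℝ} (hf : Measurable f)
    {q : ℝ → ℝ} (hq : Measurable q) :
    ∫ ω, f (fun x => ξ x ω) * q (ξ a ω) ∂P
      = (∫ ω, f (fun x => ξ x ω) ∂P) * ∫ ω, q (ξ a ω) ∂P := by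
  have mξ : ∀ x, Measurable (ξ x) := fun x => (h.allMoments x).1
  have h1 := h.indep.indepFun_finset s {a} (Finset.disjoint_singleton_right.2 ha) mξ
  have h2 := h1.comp hf (hq.comp (measurable_pi_apply (⟨a, Finset.mem_singleton_self a⟩ :
    ({a} : Finset ι))))
  exact h2.integral_fun_mul_eq_mul_integral
    ((hf.comp (measurable_pi_iff.2 fun x => mξ x)).aestronglyMeasurable)
    ((hq.comp (mξ a)).aestronglyMeasurable)

/-- `moment_chain_le` with increments c_a ξ_a and variances S_a c_a². -/
theorem linear_moment_le (n : ℕ) {β : ℝ} (hβ : 0 < β) (s : Finset ι) (c : ι → ℝ)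
    (hc : ∑ x ∈ s, S x * c x ^ 2 ≤ β) :
    ∫ ω, (∑ x ∈ s, c x * ξ x ω) ^ (2 * n + 2) ∂P
      ≤ Real.exp (4 ^ (2 * n + 2) * (2 ^ (n + 2) * ν (2 * n + 2))) * β ^ (n + 1) := by
  have mΔ : ∀ a, AllMoments P (fun ω => c a * ξ a ω) := fun a => (h.allMoments a).const_mul _
  refine moment_chain_le (P := P) n (h.one_le _) hβ (Y := fun s ω => ∑ x ∈ s, c x * ξ x ω)
    (Δ := fun a _ ω => c a * ξ a ω) (v := fun x => if x ∈ s then S x * c x ^ 2 else 0)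
    (fun x => ?_) ?_ s ?_ ?_ (fun s => AllMoments.sum s fun a _ => mΔ a) (fun a _ => mΔ a) ?_ ?_
  · have := h.nonneg x
    split_ifs <;> positivity
  · simpa [Finset.sum_ite_mem] using hc
  · funext ω; simp
  · intro s a ha
    funext ω
    simp only [Finset.sum_insert ha, Pi.add_apply]
    ring
  · intro s a ha
    have h1 := h.indep_past ha
      (f := fun v => (∑ x : s, c x * v x) ^ (2 * n + 1)) (q := fun x => c a * x)
      (by fun_prop) (by fun_prop)
    have e : ∀ ω, ∑ x ∈ s, c x * ξ x ω = ∑ x : s, c x * ξ x ω := fun ω =>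
      (Finset.sum_coe_sort s (fun x => c x * ξ x ω)).symm
    simp only [e]
    rw [h1, integral_const_mul, h.centered]
    simp
  · intro s' _ a ha _
    simp only [ha, if_true, mul_pow]
    rw [integral_const_mul]
    have h1 := h.moments a (n + 1)
    have h2 : 0 ≤ c a ^ (2 * n + 2) := by
      have : c a ^ (2 * n + 2) = (c a ^ (n + 1)) ^ 2 := by rw [← pow_mul]; congr 1; ring
      rw [this]; positivity
    calc _ ≤ c a ^ (2 * n + 2) * (ν (2 * (n + 1)) * S a ^ (n + 1)) := by
          exact mul_le_mul_of_nonneg_left h1 h2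
      _ = _ := by
          rw [← pow_mul]
          have : 2 * (n + 1) = 2 * n + 2 := by ring
          rw [this]; ring

/-- The centered quadratic form. -/
def _root_.BandMatrix.centeredForm (S : ι → ℝ) (B : ι → ι → ℝ) (s : Finset ι) (v : ι → ℝ) : ℝ :=
  ∑ x ∈ s, ∑ y ∈ s, v x * B x y * v y - ∑ x ∈ s, S x * B x x

omit h in
theorem _root_.BandMatrix.centeredForm_insert {B : ι → ι → ℝ} (hB : ∀ x y, B x y = B y x)
    {s : Finset ι} {a : ι} (ha : a ∉ s) (v : ι → ℝ) :
    centeredForm S B (insert a s) v = centeredForm S B s v +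
      (2 * v a * ∑ y ∈ s, B a y * v y + (v a ^ 2 - S a) * B a a) := by
  simp only [centeredForm, Finset.sum_insert ha, Finset.sum_add_distrib]
  have e1 : ∑ x ∈ s, v x * B x a * v a = v a * ∑ y ∈ s, B a y * v y := by
    rw [Finset.mul_sum]
    exact Finset.sum_congr rfl fun x _ => by rw [hB x a]; ring
  have e2 : ∑ x ∈ s, v a * B a x * v x = v a * ∑ y ∈ s, B a y * v y := by
    rw [Finset.mul_sum]
    exact Finset.sum_congr rfl fun x _ => by ring
  rw [e1, e2]
  ring

/-- The off-diagonal part is ξ_a times an independent linear form of variance at most K, treated by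
`linear_moment_le`. The diagonal part uses S_a B_aa² ≤ K, a single term of the assumption on row
`a`. -/
theorem quadratic_increment_le (n : ℕ) {K : ℝ} (hK : 0 < K) {s t : Finset ι} (hst : s ⊆ t)
    {B : ι → ι → ℝ} (hBK : ∀ x ∈ t, ∑ y ∈ t, S y * B x y ^ 2 ≤ K) {a : ι} (hat : a ∈ t)
    (ha : a ∉ s) :
    ∫ ω, (2 * ξ a ω * ∑ y ∈ s, B a y * ξ y ω + (ξ a ω ^ 2 - S a) * B a a) ^ (2 * n + 2) ∂P ≤
      (4 ^ (2 * n + 2) * (ν (2 * n + 2) * Real.exp (4 ^ (2 * n + 2) * (2 ^ (n + 2) *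
        ν (2 * n + 2))) + (ν (4 * n + 4) + 1))) * (S a * K) ^ (n + 1) := by
  have mξ : ∀ x, Measurable (ξ x) := fun x => (h.allMoments x).1
  have hSa := h.nonneg a
  have ev : ∀ x : ℝ, x ^ (2 * n + 2) = (x ^ 2) ^ (n + 1) := fun x => by rw [← pow_mul]; rfl
  have ev0 : ∀ x : ℝ, 0 ≤ x ^ (2 * n + 2) := fun x => by rw [ev]; positivity
  have two : ∀ x y : ℝ, (x + y) ^ (2 * n + 2) ≤ 2 ^ (2 * n + 2) * (x ^ (2 * n + 2)
      + y ^ (2 * n + 2)) := by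
    intro x y
    have h1 : (x + y) ^ (2 * n + 2) ≤ (|x| + |y|) ^ (2 * n + 2) := by
      rw [ev, ev]
      refine pow_le_pow_left₀ (sq_nonneg _) ?_ _
      rw [sq_le_sq, abs_of_nonneg (by positivity : 0 ≤ |x| + |y|)]
      exact abs_add_le x y
    have h2 : (|x| + |y|) ^ (2 * n + 2) ≤ (2 * max |x| |y|) ^ (2 * n + 2) := by
      refine pow_le_pow_left₀ (by positivity) ?_ _
      linarith [le_max_left |x| |y|, le_max_right |x| |y|]
    have h3 : max |x| |y| ^ (2 * n + 2) ≤ x ^ (2 * n + 2) + y ^ (2 * n + 2) := by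
      have hx := ev0 x
      have hy := ev0 y
      rcases max_choice |x| |y| with h | h <;> rw [h, ev, sq_abs, ← ev] <;> linarith
    calc _ ≤ _ := h1.trans h2
      _ = 2 ^ (2 * n + 2) * max |x| |y| ^ (2 * n + 2) := mul_pow _ _ _
      _ ≤ _ := by gcongr
  set V : Ω → ℝ := fun ω => ∑ y ∈ s, B a y * ξ y ω with hV
  have mV : AllMoments P V := AllMoments.sum s fun y _ => (h.allMoments y).const_mul _
  have hVlin : ∫ ω, V ω ^ (2 * n + 2) ∂P
      ≤ Real.exp (4 ^ (2 * n + 2) * (2 ^ (n + 2) * ν (2 * n + 2))) * K ^ (n + 1) :=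
    h.linear_moment_le n hK s (B a) ((Finset.sum_le_sum_of_subset_of_nonneg hst
      fun x _ _ => mul_nonneg (h.nonneg x) (sq_nonneg _)).trans (hBK a hat))
  set R := Real.exp (4 ^ (2 * n + 2) * (2 ^ (n + 2) * ν (2 * n + 2))) with hR
  have hBa : S a * B a a ^ 2 ≤ K :=
    (Finset.single_le_sum (f := fun y => S y * B a y ^ 2)
      (fun x _ => mul_nonneg (h.nonneg x) (sq_nonneg _)) hat).trans (hBK a hat)
  -- the off-diagonal part
  have e1 : ∫ ω, V ω ^ (2 * n + 2) * ξ a ω ^ (2 * n + 2) ∂P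
      ≤ ν (2 * n + 2) * R * (S a * K) ^ (n + 1) := by
    have h1 := h.indep_past ha (f := fun v => (∑ x : s, B a x * v x) ^ (2 * n + 2))
      (q := fun x => x ^ (2 * n + 2)) (by fun_prop) (by fun_prop)
    have e : ∀ ω, V ω = ∑ x : s, B a x * ξ x ω := fun ω =>
      (Finset.sum_coe_sort s (fun x => B a x * ξ x ω)).symm
    simp only [e] at hVlin ⊢
    rw [h1]
    have h2 := h.moments a (n + 1)
    have h3 : ∫ ω, ξ a ω ^ (2 * n + 2) ∂P ≤ ν (2 * n + 2) * S a ^ (n + 1) := h2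
    have h4 : 0 ≤ ∫ ω, ξ a ω ^ (2 * n + 2) ∂P := integral_nonneg fun ω => ev0 _
    calc _ ≤ (R * K ^ (n + 1)) * (ν (2 * n + 2) * S a ^ (n + 1)) :=
          mul_le_mul hVlin h3 h4 (by positivity)
      _ = _ := by rw [mul_pow]; ring
  -- the diagonal part
  have e2 : ∫ ω, (ξ a ω ^ 2 - S a) ^ (2 * n + 2) ∂P
      ≤ 2 ^ (2 * n + 2) * ((ν (4 * n + 4) + 1) * S a ^ (2 * n + 2)) := by
    have i1 := (h.allMoments a).integrable_pow (4 * n + 4)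
    calc _ ≤ ∫ ω, 2 ^ (2 * n + 2) * (ξ a ω ^ (4 * n + 4) + S a ^ (2 * n + 2)) ∂P := by
          refine integral_mono ((((h.allMoments a).pow 2).sub_const (S a)).integrable_pow _)
            ((i1.add (integrable_const _)).const_mul _) fun ω => ?_
          have := two (ξ a ω ^ 2) (-S a)
          have e3 : (-S a) ^ (2 * n + 2) = S a ^ (2 * n + 2) := by rw [ev, neg_sq, ← ev]
          rw [e3, ← pow_mul] at this
          have e4 : 2 * (2 * n + 2) = 4 * n + 4 := by ring
          rw [e4] at this
          simpa [sub_eq_add_neg] using this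
      _ = 2 ^ (2 * n + 2) * (∫ ω, ξ a ω ^ (4 * n + 4) ∂P + S a ^ (2 * n + 2)) := by
          rw [integral_const_mul, integral_add i1 (integrable_const _)]
          simp
      _ ≤ 2 ^ (2 * n + 2) * (ν (4 * n + 4) * S a ^ (2 * n + 2) + S a ^ (2 * n + 2)) := by
          gcongr
          have := h.moments a (2 * n + 2)
          have e4 : 2 * (2 * n + 2) = 4 * n + 4 := by ring
          rwa [e4] at this
      _ = _ := by ring
  have i1 : Integrable (fun ω => V ω ^ (2 * n + 2) * ξ a ω ^ (2 * n + 2)) P :=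
    ((mV.pow _).mul ((h.allMoments a).pow _)).integrable
  have i2 : Integrable (fun ω => (ξ a ω ^ 2 - S a) ^ (2 * n + 2)) P :=
    (((h.allMoments a).pow 2).sub_const (S a)).integrable_pow _
  have iL : AllMoments P (fun ω => 2 * ξ a ω * V ω + (ξ a ω ^ 2 - S a) * B a a) :=
    (((h.allMoments a).const_mul 2).mul mV).add
      ((((h.allMoments a).pow 2).sub_const (S a)).mul_const _)
  have hν1 := h.one_le (4 * n + 4)
  calc _ ≤ ∫ ω, 2 ^ (2 * n + 2) * (2 ^ (2 * n + 2) * (V ω ^ (2 * n + 2) * ξ a ω ^ (2 * n + 2))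
          + (ξ a ω ^ 2 - S a) ^ (2 * n + 2) * B a a ^ (2 * n + 2)) ∂P := by
        refine integral_mono (iL.integrable_pow _) (((i1.const_mul _).add
          (i2.mul_const _)).const_mul _) fun ω => ?_
        refine (two _ _).trans (le_of_eq ?_)
        simp only [mul_pow]
        ring
    _ = 2 ^ (2 * n + 2) * (2 ^ (2 * n + 2) * ∫ ω, V ω ^ (2 * n + 2) * ξ a ω ^ (2 * n + 2) ∂P
          + (∫ ω, (ξ a ω ^ 2 - S a) ^ (2 * n + 2) ∂P) * B a a ^ (2 * n + 2)) := by
        rw [integral_const_mul, integral_add (i1.const_mul _) (i2.mul_const _),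
          integral_const_mul, integral_mul_const]
    _ ≤ 2 ^ (2 * n + 2) * (2 ^ (2 * n + 2) * (ν (2 * n + 2) * R * (S a * K) ^ (n + 1))
          + (2 ^ (2 * n + 2) * ((ν (4 * n + 4) + 1) * S a ^ (2 * n + 2))) * B a a ^ (2 * n + 2)) := by
        have := ev0 (B a a)
        gcongr
    _ = 4 ^ (2 * n + 2) * (ν (2 * n + 2) * R * (S a * K) ^ (n + 1)
          + (ν (4 * n + 4) + 1) * (S a * (S a * B a a ^ 2)) ^ (n + 1)) := by
        have : (4 : ℝ) ^ (2 * n + 2) = 2 ^ (2 * n + 2) * 2 ^ (2 * n + 2) := by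
          rw [← mul_pow]; norm_num
        rw [this, ev (S a), ev (B a a), mul_pow (S a), mul_pow (S a), mul_pow (S a), pow_two (S a),
          mul_pow (S a)]
        ring
    _ ≤ 4 ^ (2 * n + 2) * (ν (2 * n + 2) * R * (S a * K) ^ (n + 1)
          + (ν (4 * n + 4) + 1) * (S a * K) ^ (n + 1)) := by gcongr
    _ = _ := by ring

/-- Adding one index at a time makes the centered form a martingale (`centeredForm_insert`); its
increments have size S_a K, which sums to at most K. -/
theorem quadratic_moment_le (n : ℕ) {K : ℝ} (hK : 0 < K) (t : Finset ι)
    (hS : ∑ x, S x ≤ 1) {B : ι → ι → ℝ} (hB : ∀ x y, B x y = B y x)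
    (hBK : ∀ x ∈ t, ∑ y ∈ t, S y * B x y ^ 2 ≤ K) :
    ∫ ω, centeredForm S B t (fun x => ξ x ω) ^ (2 * n + 2) ∂P
      ≤ Real.exp (4 ^ (2 * n + 2) * (2 ^ (n + 2) * (4 ^ (2 * n + 2) * (ν (2 * n + 2) *
        Real.exp (4 ^ (2 * n + 2) * (2 ^ (n + 2) * ν (2 * n + 2))) + (ν (4 * n + 4) + 1)))))
        * K ^ (n + 1) := by
  have mlin : ∀ a s, AllMoments P (fun ω => ∑ y ∈ s, B a y * ξ y ω) := fun a s =>
    AllMoments.sum s fun y _ => (h.allMoments y).const_mul _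
  have mΔ : ∀ a s, AllMoments P (fun ω => 2 * ξ a ω * ∑ y ∈ s, B a y * ξ y ω
      + (ξ a ω ^ 2 - S a) * B a a) := fun a s =>
    (((h.allMoments a).const_mul 2).mul (mlin a s)).add
      ((((h.allMoments a).pow 2).sub_const (S a)).mul_const _)
  have mY : ∀ s, AllMoments P (fun ω => centeredForm S B s (fun x => ξ x ω)) := by
    intro s
    unfold centeredForm
    exact (AllMoments.sum s fun x _ => AllMoments.sum s fun y _ =>
      ((h.allMoments x).mul_const _).mul (h.allMoments y)).sub_const _
  refine moment_chain_le (P := P) n ?_ hK (Y := fun s ω => centeredForm S B s (fun x => ξ x ω))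
    (Δ := fun a s ω => 2 * ξ a ω * ∑ y ∈ s, B a y * ξ y ω + (ξ a ω ^ 2 - S a) * B a a)
    (v := fun x => S x * K) (fun x => mul_nonneg (h.nonneg x) hK.le) ?_ t ?_ ?_ mY mΔ ?_ ?_
  · have h1 := h.one_le (2 * n + 2)
    have h2 := h.one_le (4 * n + 4)
    have h3 : (1 : ℝ) ≤ 4 ^ (2 * n + 2) := one_le_pow₀ (by norm_num)
    have h4 : 0 ≤ ν (2 * n + 2) * Real.exp (4 ^ (2 * n + 2) * (2 ^ (n + 2) * ν (2 * n + 2))) := by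
      positivity
    nlinarith
  · rw [← Finset.sum_mul]
    nlinarith
  · funext ω; simp [centeredForm]
  · intro s a ha
    funext ω
    exact centeredForm_insert hB ha _
  · intro s a ha
    set F : (s → ℝ) → ℝ := fun v => ∑ x : s, ∑ y : s, v x * B x y * v y - ∑ x : s, S x * B x x
    have mF : Measurable F := by fun_prop
    have eF : ∀ ω, centeredForm S B s (fun x => ξ x ω) = F (fun x => ξ x ω) := by
      intro ω
      simp only [centeredForm, F]
      rw [← Finset.sum_coe_sort s (fun x => S x * B x x),
        ← Finset.sum_coe_sort s (fun x => ∑ y ∈ s, ξ x ω * B x y * ξ y ω)]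
      congr 1
      refine Finset.sum_congr rfl fun x _ => ?_
      rw [← Finset.sum_coe_sort s (fun y => ξ x ω * B x y * ξ y ω)]
    have eV : ∀ ω, ∑ y ∈ s, B a y * ξ y ω = ∑ x : s, B a x * ξ x ω := fun ω =>
      (Finset.sum_coe_sort s (fun x => B a x * ξ x ω)).symm
    have h1 := h.indep_past ha (f := fun v => F v ^ (2 * n + 1) * ∑ x : s, B a x * v x)
      (q := fun x => 2 * x) (by fun_prop) (by fun_prop)
    have h2 := h.indep_past ha (f := fun v => F v ^ (2 * n + 1))
      (q := fun x => (x ^ 2 - S a) * B a a) (by fun_prop) (by fun_prop)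
    have z1 : ∫ ω, 2 * ξ a ω ∂P = 0 := by rw [integral_const_mul, h.centered, mul_zero]
    have z2 : ∫ ω, (ξ a ω ^ 2 - S a) * B a a ∂P = 0 := by
      rw [integral_mul_const, integral_sub ((h.allMoments a).integrable_pow 2)
        (integrable_const _), h.variance]
      simp
    rw [z1, mul_zero] at h1
    rw [z2, mul_zero] at h2
    simp only [← eF, ← eV] at h1 h2
    have i1 : Integrable (fun ω => centeredForm S B s (fun x => ξ x ω) ^ (2 * n + 1)
        * (∑ y ∈ s, B a y * ξ y ω) * (2 * ξ a ω)) P :=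
      ((((mY s).pow _).mul (mlin a s)).mul ((h.allMoments a).const_mul 2)).integrable
    have i2 : Integrable (fun ω => centeredForm S B s (fun x => ξ x ω) ^ (2 * n + 1)
        * ((ξ a ω ^ 2 - S a) * B a a)) P :=
      (((mY s).pow _).mul ((((h.allMoments a).pow 2).sub_const (S a)).mul_const _)).integrable
    calc _ = ∫ ω, (centeredForm S B s (fun x => ξ x ω) ^ (2 * n + 1)
        * (∑ y ∈ s, B a y * ξ y ω) * (2 * ξ a ω)) + centeredForm S B s (fun x => ξ x ω) ^ (2 * n + 1)
        * ((ξ a ω ^ 2 - S a) * B a a) ∂P := by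
          congr 1; funext ω; ring
      _ = 0 := by rw [integral_add i1 i2, h1, h2, add_zero]
  · intro s hs a hat ha
    exact h.quadratic_increment_le n hK hs hBK hat ha

end RowVector

end LargeDeviation

/-! ### Tail bounds given the minor. -/

section Tails

variable {Ω : Type*} [MeasurableSpace Ω] {P : Measure Ω} [IsProbabilityMeasure P]
variable {ι : Type*} [Fintype ι] [DecidableEq ι]

/-- A bound on probabilities that is uniform in the value of an independent variable. -/
theorem measureReal_le_of_indepFun {α β : Type*} [MeasurableSpace α] [MeasurableSpace β]
    {X : Ω → α} {Y : Ω → β} (hXY : IndepFun X Y P) (mX : Measurable X) (mY : Measurable Y)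
    {s : Set (α × β)} (hs : MeasurableSet s) {c : ℝ} (hc0 : 0 ≤ c)
    (hc : ∀ y, P.real {ω | (X ω, y) ∈ s} ≤ c) : P.real {ω | (X ω, Y ω) ∈ s} ≤ c := by
  have h1 := (indepFun_iff_map_prod_eq_prod_map_map mX.aemeasurable mY.aemeasurable).1 hXY
  have h2 : P {ω | (X ω, Y ω) ∈ s} = ((P.map X).prod (P.map Y)) s := by
    rw [← h1, Measure.map_apply (mX.prodMk mY) hs]
    rfl
  have := Measure.isProbabilityMeasure_map (μ := P) mX.aemeasurable
  have := Measure.isProbabilityMeasure_map (μ := P) mY.aemeasurable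
  have h3 : P {ω | (X ω, Y ω) ∈ s} ≤ ENNReal.ofReal c := by
    rw [h2, Measure.prod_apply_symm hs]
    calc _ ≤ ∫⁻ _, ENNReal.ofReal c ∂(P.map Y) := by
          refine lintegral_mono fun y => ?_
          rw [Measure.map_apply mX (measurable_prodMk_right hs)]
          rw [← ofReal_measureReal]
          exact ENNReal.ofReal_le_ofReal (hc y)
      _ = ENNReal.ofReal c := by simp
  exact ENNReal.toReal_le_of_le_ofReal hc0 h3

/-- |Z|² is at most twice the larger of the squared real and imaginary parts; Markov's inequality at
power 2n + 2. -/
theorem markov_complex (n : ℕ) {R K s : ℝ} (hs : 0 < s) (hK : 0 < K) {Z : Ω → ℂ}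
    (mre : AllMoments P (fun ω => (Z ω).re)) (mim : AllMoments P (fun ω => (Z ω).im))
    (hre : ∫ ω, (Z ω).re ^ (2 * n + 2) ∂P ≤ R * K ^ (n + 1))
    (him : ∫ ω, (Z ω).im ^ (2 * n + 2) ∂P ≤ R * K ^ (n + 1)) :
    P.real {ω | s * √K ≤ ‖Z ω‖} ≤ 2 ^ (n + 2) * R / s ^ (2 * n + 2) := by
  have i1 := mre.integrable_pow (2 * n + 2)
  have i2 := mim.integrable_pow (2 * n + 2)
  have ev : ∀ x : ℝ, x ^ (2 * n + 2) = (x ^ 2) ^ (n + 1) := fun x => by rw [← pow_mul]; rfl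
  have hmk := mul_meas_ge_le_integral_of_nonneg (μ := P)
    (f := fun ω => 2 ^ (n + 1) * ((Z ω).re ^ (2 * n + 2) + (Z ω).im ^ (2 * n + 2)))
    (ae_of_all _ fun ω => by
      have := ev (Z ω).re
      have := ev (Z ω).im
      simp only [ev, Pi.zero_apply]; positivity) ((i1.add i2).const_mul _) ((s ^ 2 * K) ^ (n + 1))
  have hsub : {ω | s * √K ≤ ‖Z ω‖} ⊆ {ω | (s ^ 2 * K) ^ (n + 1)
      ≤ 2 ^ (n + 1) * ((Z ω).re ^ (2 * n + 2) + (Z ω).im ^ (2 * n + 2))} := by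
    intro ω hω
    simp only [Set.mem_ofPred_eq] at hω ⊢
    have h1 : (s * √K) ^ 2 ≤ ‖Z ω‖ ^ 2 := pow_le_pow_left₀ (by positivity) hω 2
    rw [mul_pow, Real.sq_sqrt hK.le, ← Complex.normSq_eq_norm_sq, Complex.normSq_apply, ← pow_two,
      ← pow_two] at h1
    have h2 : (Z ω).re ^ 2 + (Z ω).im ^ 2 ≤ 2 * max ((Z ω).re ^ 2) ((Z ω).im ^ 2) := by
      linarith [le_max_left ((Z ω).re ^ 2) ((Z ω).im ^ 2),
        le_max_right ((Z ω).re ^ 2) ((Z ω).im ^ 2)]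
    calc _ ≤ (2 * max ((Z ω).re ^ 2) ((Z ω).im ^ 2)) ^ (n + 1) := by
          exact pow_le_pow_left₀ (by positivity) (h1.trans h2) _
      _ = 2 ^ (n + 1) * max ((Z ω).re ^ 2) ((Z ω).im ^ 2) ^ (n + 1) := mul_pow _ _ _
      _ ≤ _ := by
        rw [ev, ev]
        have a1 : 0 ≤ ((Z ω).re ^ 2) ^ (n + 1) := by positivity
        have a2 : 0 ≤ ((Z ω).im ^ 2) ^ (n + 1) := by positivity
        refine mul_le_mul_of_nonneg_left ?_ (by positivity)
        rcases max_choice ((Z ω).re ^ 2) ((Z ω).im ^ 2) with h | h <;> rw [h] <;> linarith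
  have h4 := measureReal_mono (μ := P) hsub
  rw [integral_const_mul, integral_add i1 i2] at hmk
  rw [le_div_iff₀ (by positivity)]
  have h5 : 0 < K ^ (n + 1) := by positivity
  refine le_of_mul_le_mul_right ?_ h5
  have h6 : (s ^ 2 * K) ^ (n + 1) = s ^ (2 * n + 2) * K ^ (n + 1) := by rw [mul_pow, ev]
  rw [h6] at hmk h4
  set p := P.real {ω | s ^ (2 * n + 2) * K ^ (n + 1)
      ≤ 2 ^ (n + 1) * ((Z ω).re ^ (2 * n + 2) + (Z ω).im ^ (2 * n + 2))}
  calc _ ≤ p * s ^ (2 * n + 2) * K ^ (n + 1) := by gcongr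
    _ = s ^ (2 * n + 2) * K ^ (n + 1) * p := by ring
    _ ≤ _ := hmk
    _ ≤ 2 ^ (n + 1) * (R * K ^ (n + 1) + R * K ^ (n + 1)) := by gcongr
    _ = _ := by ring

/-- The constant in the large deviation estimates. -/
def tailConst (ν : ℕ → ℝ) (n : ℕ) : ℝ :=
  2 ^ (n + 2) * Real.exp (4 ^ (2 * n + 2) * (2 ^ (n + 2) * (4 ^ (2 * n + 2) * (ν (2 * n + 2) *
        Real.exp (4 ^ (2 * n + 2) * (2 ^ (n + 2) * ν (2 * n + 2))) + (ν (4 * n + 4) + 1)))))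

theorem tailConst_pos (ν : ℕ → ℝ) (n : ℕ) : 0 < tailConst ν n := by
  unfold tailConst; positivity

/-- One constant then serves for linear and quadratic forms. -/
theorem exp_le_tailConst {ν : ℕ → ℝ} (hν : ∀ p, 1 ≤ ν p) (n : ℕ) :
    2 ^ (n + 2) * Real.exp (4 ^ (2 * n + 2) * (2 ^ (n + 2) * ν (2 * n + 2))) ≤ tailConst ν n := by
  unfold tailConst
  set X := Real.exp (4 ^ (2 * n + 2) * (2 ^ (n + 2) * ν (2 * n + 2)))
  have h1 := hν (2 * n + 2)
  have h2 := hν (4 * n + 4)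
  have h3 : (1 : ℝ) ≤ 4 ^ (2 * n + 2) := one_le_pow₀ (by norm_num)
  have hX : 1 ≤ X := Real.one_le_exp (by positivity)
  have h4 : ν (2 * n + 2) * 1 ≤ ν (2 * n + 2) * X := by gcongr
  have h5 : ν (2 * n + 2) ≤ 4 ^ (2 * n + 2) * (ν (2 * n + 2) * X + (ν (4 * n + 4) + 1)) := by
    nlinarith
  refine mul_le_mul_of_nonneg_left (Real.exp_le_exp.2 ?_) (by positivity)
  gcongr

namespace RowVector

variable {ν : ℕ → ℝ} {S : ι → ℝ} {ξ : ι → Ω → ℝ} (h : RowVector P ν S ξ)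
include h

theorem linear_tail (n : ℕ) {K s : ℝ} (hs : 0 < s) (hK : 0 < K) (a : ι → ℂ)
    (ha : ∑ x, S x * ‖a x‖ ^ 2 ≤ K) :
    P.real {ω | s * √K ≤ ‖∑ x, (ξ x ω : ℂ) * a x‖} ≤ tailConst ν n / s ^ (2 * n + 2) := by
  have ere : ∀ ω, (∑ x, (ξ x ω : ℂ) * a x).re = ∑ x, (a x).re * ξ x ω := fun ω => by
    rw [Complex.re_sum]; exact Finset.sum_congr rfl fun x _ => by simp [mul_comm]
  have eim : ∀ ω, (∑ x, (ξ x ω : ℂ) * a x).im = ∑ x, (a x).im * ξ x ω := fun ω => by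
    rw [Complex.im_sum]; exact Finset.sum_congr rfl fun x _ => by simp [mul_comm]
  have hre : ∀ z : ℂ, z.re ^ 2 ≤ ‖z‖ ^ 2 := fun z => by
    rw [← Complex.normSq_eq_norm_sq, Complex.normSq_apply]; nlinarith [sq_nonneg z.im]
  have him : ∀ z : ℂ, z.im ^ 2 ≤ ‖z‖ ^ 2 := fun z => by
    rw [← Complex.normSq_eq_norm_sq, Complex.normSq_apply]; nlinarith [sq_nonneg z.re]
  refine (markov_complex (P := P) n (R := Real.exp (4 ^ (2 * n + 2) * (2 ^ (n + 2) *
    ν (2 * n + 2)))) hs hK ?_ ?_ ?_ ?_).trans ?_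
  · simp only [ere]; exact AllMoments.sum _ fun x _ => (h.allMoments x).const_mul _
  · simp only [eim]; exact AllMoments.sum _ fun x _ => (h.allMoments x).const_mul _
  · simp only [ere]
    refine h.linear_moment_le n hK _ _ (le_trans (Finset.sum_le_sum fun x _ => ?_) ha)
    exact mul_le_mul_of_nonneg_left (hre _) (h.nonneg x)
  · simp only [eim]
    refine h.linear_moment_le n hK _ _ (le_trans (Finset.sum_le_sum fun x _ => ?_) ha)
    exact mul_le_mul_of_nonneg_left (him _) (h.nonneg x)
  · gcongr
    exact exp_le_tailConst h.one_le n

theorem quadratic_tail (n : ℕ) {K s : ℝ} (hs : 0 < s) (hK : 0 < K) (t : Finset ι)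
    (hS : ∑ x, S x ≤ 1) {B : ι → ι → ℂ} (hB : ∀ x y, B x y = B y x)
    (hBK : ∀ x ∈ t, ∑ y ∈ t, S y * ‖B x y‖ ^ 2 ≤ K) :
    P.real {ω | s * √K ≤ ‖∑ x ∈ t, ∑ y ∈ t, (ξ x ω : ℂ) * B x y * ξ y ω
      - ∑ x ∈ t, (S x : ℂ) * B x x‖} ≤ tailConst ν n / s ^ (2 * n + 2) := by
  have ere : ∀ ω, (∑ x ∈ t, ∑ y ∈ t, (ξ x ω : ℂ) * B x y * ξ y ω
      - ∑ x ∈ t, (S x : ℂ) * B x x).re = centeredForm S (fun x y => (B x y).re) t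
        (fun x => ξ x ω) := fun ω => by
    simp [centeredForm, Complex.re_sum]
  have eim : ∀ ω, (∑ x ∈ t, ∑ y ∈ t, (ξ x ω : ℂ) * B x y * ξ y ω
      - ∑ x ∈ t, (S x : ℂ) * B x x).im = centeredForm S (fun x y => (B x y).im) t
        (fun x => ξ x ω) := fun ω => by
    simp [centeredForm, Complex.im_sum]
  have hre : ∀ z : ℂ, z.re ^ 2 ≤ ‖z‖ ^ 2 := fun z => by
    rw [← Complex.normSq_eq_norm_sq, Complex.normSq_apply]; nlinarith [sq_nonneg z.im]
  have him : ∀ z : ℂ, z.im ^ 2 ≤ ‖z‖ ^ 2 := fun z => by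
    rw [← Complex.normSq_eq_norm_sq, Complex.normSq_apply]; nlinarith [sq_nonneg z.re]
  have mY : ∀ C : ι → ι → ℝ, AllMoments P (fun ω => centeredForm S C t (fun x => ξ x ω)) := by
    intro C
    unfold centeredForm
    exact (AllMoments.sum _ fun x _ => AllMoments.sum _ fun y _ =>
      ((h.allMoments x).mul_const _).mul (h.allMoments y)).sub_const _
  refine markov_complex (P := P) n hs hK ?_ ?_ ?_ ?_
  · simp only [ere]; exact mY _
  · simp only [eim]; exact mY _
  · simp only [ere]
    refine h.quadratic_moment_le n hK t hS (fun x y => by rw [hB]) fun x hx =>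
      (Finset.sum_le_sum fun y _ => ?_).trans (hBK x hx)
    exact mul_le_mul_of_nonneg_left (hre _) (h.nonneg y)
  · simp only [eim]
    refine h.quadratic_moment_le n hK t hS (fun x y => by rw [hB]) fun x hx =>
      (Finset.sum_le_sum fun y _ => ?_).trans (hBK x hx)
    exact mul_le_mul_of_nonneg_left (him _) (h.nonneg y)

theorem entry_tail (n : ℕ) {β s : ℝ} (hs : 0 < s) (hβ : 0 < β) {x : ι} (hx : S x ≤ β) :
    P.real {ω | s * √β ≤ |ξ x ω|} ≤ tailConst ν n / s ^ (2 * n + 2) := by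
  have hsum : ∑ y, S y * ‖(if y = x then (1 : ℂ) else 0)‖ ^ 2 ≤ β := by
    rw [Finset.sum_eq_single x]
    · simpa using hx
    · intro y _ hy
      simp [hy]
    · simp
  have := h.linear_tail n hs hβ _ hsum
  simpa using this

end RowVector

namespace RowEnsemble

variable {ν : ℕ → ℝ} {S : Matrix ι ι ℝ} {H : Ω → Matrix ι ι ℝ} (h : RowEnsemble P ν S H)
include h

theorem measurable_row (l : ι) : Measurable fun ω => H ω l :=
  measurable_pi_iff.2 fun x => h.measurable_apply l x

/-- With the minor frozen this is a linear form in row `l`. The variance bound belongs to the event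
because it depends on the minor alone. -/
theorem rowMinor_tail (n : ℕ) {K s : ℝ} (hs : 0 < s) (hK : 0 < K) (w : ι → ℂ) (l j : ι) :
    P.real {ω | ∑ x, S l x * ‖res w (del l (H ω)) x j‖ ^ 2 ≤ K ∧ s * √K ≤ ‖rowMinor w l j (H ω)‖}
      ≤ tailConst ν n / s ^ (2 * n + 2) := by
  have hc := tailConst_pos ν n
  have mr : ∀ x, Measurable fun p : (ι → ℝ) × Matrix ι ι ℝ => res w p.2 x j := fun x =>
    (measurable_res w x j).comp measurable_snd
  refine measureReal_le_of_indepFun (h.indep_row l) (h.measurable_row l)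
    ((measurable_del l).comp h.measurable) (s := {p | ∑ x, S l x * ‖res w p.2 x j‖ ^ 2 ≤ K ∧
      s * √K ≤ ‖∑ x, (p.1 x : ℂ) * res w p.2 x j‖}) ?_ (by positivity) fun A => ?_
  · refine (measurableSet_le (Finset.measurable_sum _ fun x _ =>
      ((mr x).norm.pow_const 2).const_mul _) measurable_const).inter
      (measurableSet_le measurable_const (Finset.measurable_sum _ fun x _ =>
        (Complex.measurable_ofReal.comp ((measurable_pi_apply x).comp measurable_fst)).mul
          (mr x)).norm)
  · by_cases hA : ∑ x, S l x * ‖res w A x j‖ ^ 2 ≤ K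
    · simp only [Set.mem_ofPred_eq, hA, true_and]
      exact (h.rowVector l).linear_tail n hs hK _ hA
    · simp only [Set.mem_ofPred_eq, hA, false_and, Set.ofPred_false, measureReal_empty]
      positivity

theorem quadMinor_tail (n : ℕ) {K s : ℝ} (hs : 0 < s) (hK : 0 < K) (w : ι → ℂ) (l : ι)
    (hrow : ∀ i, ∑ j, S i j ≤ 1) :
    P.real {ω | (∀ j, j ≠ l → ∑ x, S l x * ‖res w (del l (H ω)) x j‖ ^ 2 ≤ K) ∧
      s * √K ≤ ‖quadMinor w S l (H ω)‖} ≤ tailConst ν n / s ^ (2 * n + 2) := by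
  have hc := tailConst_pos ν n
  have mr : ∀ x y, Measurable fun p : (ι → ℝ) × Matrix ι ι ℝ => res w p.2 x y := fun x y =>
    (measurable_res w x y).comp measurable_snd
  have mc : ∀ x, Measurable fun p : (ι → ℝ) × Matrix ι ι ℝ => (p.1 x : ℂ) := fun x =>
    Complex.measurable_ofReal.comp ((measurable_pi_apply x).comp measurable_fst)
  -- The frozen matrix ranges over all matrices, not only symmetric ones, so the symmetry of its
  -- resolvent is made part of the event.
  have hsub : {ω | (∀ j, j ≠ l → ∑ x, S l x * ‖res w (del l (H ω)) x j‖ ^ 2 ≤ K) ∧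
      s * √K ≤ ‖quadMinor w S l (H ω)‖} ⊆ {ω | (H ω l, del l (H ω)) ∈
        {p : (ι → ℝ) × Matrix ι ι ℝ | (∀ x y, res w p.2 x y = res w p.2 y x) ∧
        (∀ j, j ≠ l → ∑ x, S l x * ‖res w p.2 x j‖ ^ 2 ≤ K) ∧
      s * √K ≤ ‖∑ x ∈ Finset.univ.erase l, ∑ y ∈ Finset.univ.erase l,
        (p.1 x : ℂ) * res w p.2 x y * p.1 y
        - ∑ x ∈ Finset.univ.erase l, (S l x : ℂ) * res w p.2 x x‖}} := by
    intro ω hω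
    exact ⟨fun x y => res_symm w (del_symm (h.symm ω) l) x y, hω.1, hω.2⟩
  refine (measureReal_mono hsub).trans ?_
  refine measureReal_le_of_indepFun (h.indep_row l) (h.measurable_row l)
    ((measurable_del l).comp h.measurable) ?_ (by positivity) fun A => ?_
  · have m1 : MeasurableSet {p : (ι → ℝ) × Matrix ι ι ℝ |
        ∀ x y, res w p.2 x y = res w p.2 y x} := by
      simp only [Set.ofPred_forall]
      exact MeasurableSet.iInter fun x => MeasurableSet.iInter fun y =>
        measurableSet_eq_fun (mr x y) (mr y x)
    have m2 : MeasurableSet {p : (ι → ℝ) × Matrix ι ι ℝ |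
        ∀ j, j ≠ l → ∑ x, S l x * ‖res w p.2 x j‖ ^ 2 ≤ K} := by
      simp only [Set.ofPred_forall]
      exact MeasurableSet.iInter fun j => MeasurableSet.iInter fun _ =>
        measurableSet_le (Finset.measurable_sum _ fun x _ =>
          ((mr x j).norm.pow_const 2).const_mul _) measurable_const
    refine m1.inter (m2.inter ?_)
    · refine measurableSet_le measurable_const (Measurable.norm (Measurable.sub ?_ ?_))
      · exact Finset.measurable_sum _ fun x _ => Finset.measurable_sum _ fun y _ =>
          ((mc x).mul (mr x y)).mul (mc y)
      · exact Finset.measurable_sum _ fun x _ => measurable_const.mul (mr x x)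
  · by_cases hA : (∀ x y, res w A x y = res w A y x) ∧
        (∀ j, j ≠ l → ∑ x, S l x * ‖res w A x j‖ ^ 2 ≤ K)
    · refine (measureReal_mono (fun ω hω => hω.2.2)).trans
        ((h.rowVector l).quadratic_tail n hs hK (Finset.univ.erase l) (hrow l) hA.1 fun x hx => ?_)
      refine le_trans ?_ (hA.2 x (Finset.ne_of_mem_erase hx))
      refine (Finset.sum_le_sum_of_subset_of_nonneg (Finset.subset_univ _) fun y _ _ =>
        mul_nonneg (h.var_nonneg l y) (sq_nonneg _)).trans (le_of_eq ?_)
      exact Finset.sum_congr rfl fun y _ => by rw [hA.1 x y]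
    · have : {ω | (H ω l, A) ∈ {p : (ι → ℝ) × Matrix ι ι ℝ |
          (∀ x y, res w p.2 x y = res w p.2 y x) ∧
          (∀ j, j ≠ l → ∑ x, S l x * ‖res w p.2 x j‖ ^ 2 ≤ K) ∧
          s * √K ≤ ‖∑ x ∈ Finset.univ.erase l, ∑ y ∈ Finset.univ.erase l,
            (p.1 x : ℂ) * res w p.2 x y * p.1 y
            - ∑ x ∈ Finset.univ.erase l, (S l x : ℂ) * res w p.2 x x‖}} = ∅ := by
        ext ω
        simp only [Set.mem_ofPred_eq, Set.mem_empty_iff_false, iff_false]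
        exact fun hω => hA ⟨hω.1, hω.2.1⟩
      rw [this, measureReal_empty]
      positivity

end RowEnsemble

end Tails

/-! ### Bounds on T and G - M outside an exceptional event. -/

section Master

universe u

/-- With s = SM this is the ground state equation of `exists_T_solver`: u = Im M/|M|² solves u = Im
w + S|M|²u. -/
theorem im_sce_identity {w M s : ℂ} (h : M⁻¹ = -w - s) :
    M.im / ‖M‖ ^ 2 = w.im + s.im := by
  have h1 := congrArg Complex.im h
  rw [Complex.inv_im, Complex.normSq_eq_norm_sq] at h1
  simp only [Complex.sub_im, Complex.neg_im] at h1
  have : M.im / ‖M‖ ^ 2 = -(-M.im / ‖M‖ ^ 2) := by ring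
  rw [this, h1]; ring

/-- The deterministic data of the model: variances, spectral parameters and the solution `M` of the
self-consistent equations, with quantitative bounds. -/
structure Regular (cs Cs c₀ c₁ Cst : ℝ) (N W : ℕ) [NeZero N] (η : ℝ)
    (S : Matrix (ZMod N) (ZMod N) ℝ) (w M : ZMod N → ℂ) : Prop where
  two_le : 2 ≤ W
  le : W ≤ N
  nonneg : ∀ i j, 0 ≤ S i j
  symm : ∀ i j, S i j = S j i
  row : ∀ i, ∑ j, S i j ≤ 1
  upper : ∀ i j, S i j ≤ Cs / W
  lower : ∀ (i : ZMod N) (t : ℕ), 1 ≤ t → t ≤ W → cs / W ≤ S i (i + (t : ZMod N))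
  η_pos : 0 < η
  im_pos : ∀ i, 0 < (w i).im
  im_block : ∀ i ∈ block N W, η ≤ (w i).im
  im_ge : ∀ i, ((N : ℝ) ^ 10)⁻¹ ≤ (w i).im
  sce : ∀ i, (M i)⁻¹ = -w i - ∑ j, (S i j : ℂ) * M j
  M_lower : ∀ i, c₀ ≤ ‖M i‖
  M_upper : ∀ i, ‖M i‖ ≤ 2
  M_im : ∀ i, c₁ ≤ (M i).im
  stable : SupStable Cst (oneSubDiag M S)

theorem Regular.norm_res_le {cs Cs c₀ c₁ Cst : ℝ} {N W : ℕ} [NeZero N] {η : ℝ}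
    {S : Matrix (ZMod N) (ZMod N) ℝ} {w M : ZMod N → ℂ} (h : Regular cs Cs c₀ c₁ Cst N W η S w M)
    (A : Matrix (ZMod N) (ZMod N) ℝ) (hA : ∀ i j, A i j = A j i) (i j : ZMod N) :
    ‖res w A i j‖ ≤ (N : ℝ) ^ 10 := by
  have hN : (0 : ℝ) < N := by exact_mod_cast NeZero.pos N
  have := BandMatrix.norm_res_le (w := w) (η := ((N : ℝ) ^ 10)⁻¹) (by positivity) h.im_ge hA i j
  simpa using this

/-- The bound on the `T` matrix on the good event. -/
theorem exists_T_bound (cs Cs c₀ c₁ Cst : ℝ) (hcs : 0 < cs) (hCs : 0 < Cs) (hc₀ : 0 < c₀)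
    (hc₁ : 0 < c₁) : ∃ C : ℝ, 1 ≤ C ∧ ∀ {N W : ℕ} [NeZero N] {η : ℝ}
      {S : Matrix (ZMod N) (ZMod N) ℝ} {w M : ZMod N → ℂ}, Regular cs Cs c₀ c₁ Cst N W η S w M →
      ∀ {φ : ℝ} {H : Matrix (ZMod N) (ZMod N) ℝ}, GoodResolvent w M c₀ φ H →
      (1 / (W : ℝ) ≤ φ ^ 2) → ∀ s₁ : ℝ, 1 ≤ s₁ →
      (∀ i j, ‖fluctSum w S (fun l => S i l * ‖M l‖ ^ 2) j j H‖ ≤ s₁ * φ ^ 3) →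
      ∀ i j, ∑ x, S i x * ‖res w H x j‖ ^ 2
        ≤ C * (s₁ * (N * (1 / (W * η) + N / (W : ℝ) ^ 2) * (φ ^ 3 + (N : ℝ)⁻¹))) := by
  obtain ⟨C, hC, key⟩ := exists_T_solver cs Cs c₁ hcs hCs hc₁
  set B := 1 + Cs with hB
  set A := 4 * (2 / c₀ * (2 + 2 / c₀) + B + B * (2 / c₀ * (6 + 2 / c₀))) + 5 * (2 / c₀) ^ 2 with hA
  have hA0 : 0 ≤ A := by positivity
  refine ⟨1 + C * (46 + A), by nlinarith [mul_nonneg hC.le (by linarith : 0 ≤ 46 + A)], ?_⟩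
  intro N W _ η S w M hR φ H hG hWφ s₁ hs₁ hfl i j
  have hN : (0 : ℝ) < N := by exact_mod_cast NeZero.pos N
  have hW0 : (0 : ℝ) < W := by exact_mod_cast (by norm_num : 0 < 2).trans_le hR.two_le
  have hη := hR.η_pos
  have hφ := hG.φ_pos
  have hSφ : ∀ i j, S i j ≤ B * φ ^ 2 := by
    intro i j
    calc S i j ≤ Cs * (1 / W) := by rw [mul_one_div]; exact hR.upper i j
      _ ≤ B * φ ^ 2 := by
        rw [hB]; gcongr; linarith
  have hM0 : ∀ i, 0 < ‖M i‖ := fun i => hc₀.trans_le (hR.M_lower i)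
  set k := ‖res w H j j‖ ^ 2 - ‖M j‖ ^ 2 * ∑ x, S j x * ‖res w H x j‖ ^ 2 with hk
  have hk45 : |k| ≤ 45 := hG.abs_diag_coeff_le hR.nonneg hR.row j
  set τ : ZMod N → ℝ := fun i => ∑ x, S i x * ‖res w H x j‖ ^ 2 with hτ
  have hT : ∀ i, |τ i - ∑ l, S i l * (‖M l‖ ^ 2 * τ l) - k * S i j| ≤ (s₁ + A) * φ ^ 3 := by
    intro i
    refine (hG.T_equation (by rw [hB]; linarith) hR.nonneg hR.row hSφ i j).trans ?_
    have := hfl i j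
    rw [add_mul]
    linarith
  have hDu : ∀ i, ‖M i‖ ^ 2 * ((M i).im / ‖M i‖ ^ 2) = (M i).im := fun i => by
    have := hM0 i
    field_simp
  -- Here D = |M|² and u = Im M/|M|², so Du = Im M lies between c₁ and 2.
  have hb := key N W hR.two_le hR.le S hR.nonneg hR.symm hR.row hR.upper hR.lower η
    (fun i => (w i).im) (fun i => ‖M i‖ ^ 2) (fun i => (M i).im / ‖M i‖ ^ 2) hη
    (fun i => (hR.im_pos i).le) hR.im_block
    (fun i => div_pos (hc₁.trans_le (hR.M_im i)) (by have := hM0 i; positivity))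
    (fun i => by nlinarith [hR.M_upper i, hM0 i])
    (fun i => by rw [hDu]; exact hR.M_im i)
    (fun i => by
      rw [hDu]
      exact ((le_abs_self _).trans (Complex.abs_im_le_norm _)).trans (hR.M_upper i))
    (fun i => by
      rw [im_sce_identity (hR.sce i), Complex.im_sum]
      congr 1
      refine Finset.sum_congr rfl fun l _ => ?_
      rw [hDu, Complex.im_ofReal_mul])
    τ (fun i => τ i - ∑ l, S i l * (‖M l‖ ^ 2 * τ l) - k * S i j) j ((s₁ + A) * φ ^ 3) k hT
    (fun i => by ring) i
  refine (le_abs_self _).trans (hb.trans ?_)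
  set Λ := 1 / (W * η) + N / (W : ℝ) ^ 2 with hΛ
  have hΛ0 : 0 < Λ := by positivity
  have hφ3 : 0 < φ ^ 3 := by positivity
  -- The N errors of size φ³ and the source with coefficient at most 45 combine to a multiple of
  -- N(φ³ + 1/N).
  have h1 : N * ((s₁ + A) * φ ^ 3) + |k| ≤ (46 + A) * (s₁ * (N * (φ ^ 3 + (N : ℝ)⁻¹))) := by
    rw [mul_add (N : ℝ), mul_inv_cancel₀ hN.ne']
    have h2 : 0 < N * φ ^ 3 := by positivity
    set q := N * φ ^ 3
    have e : N * ((s₁ + A) * φ ^ 3) = (s₁ + A) * q := by simp only [q]; ring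
    rw [e]
    have h3 : A * q ≤ A * (s₁ * q) := by
      have : 1 * q ≤ s₁ * q := by gcongr
      gcongr; linarith
    have h4 : 0 ≤ A * s₁ := by positivity
    have h5 : 0 ≤ s₁ * q := by positivity
    nlinarith
  calc C * (Λ * (N * ((s₁ + A) * φ ^ 3) + |k|))
      ≤ C * (Λ * ((46 + A) * (s₁ * (N * (φ ^ 3 + (N : ℝ)⁻¹))))) := by gcongr
    _ = C * (46 + A) * (s₁ * (N * Λ * (φ ^ 3 + (N : ℝ)⁻¹))) := by ring
    _ ≤ _ := by gcongr; linarith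

/-- The bound on `G - M` on the good event. -/
theorem exists_close_bound (cs Cs c₀ c₁ Cst : ℝ) (hCs : 0 < Cs) (hc₀ : 0 < c₀)
    (hCst : 1 ≤ Cst) : ∃ C A : ℝ, 1 ≤ C ∧ 0 < A ∧ ∀ {N W : ℕ} [NeZero N] {η : ℝ}
      {S : Matrix (ZMod N) (ZMod N) ℝ} {w M : ZMod N → ℂ}, Regular cs Cs c₀ c₁ Cst N W η S w M →
      ∀ {φ : ℝ} {H : Matrix (ZMod N) (ZMod N) ℝ}, GoodResolvent w M c₀ φ H → Cst * φ ≤ 1 / 8 →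
      ∀ K s : ℝ, 1 ≤ s → (∀ i j, ∑ x, S i x * ‖res w H x j‖ ^ 2 ≤ K) →
      (∀ l, ∀ j ≠ l, ∑ x, S l x * ‖res w (del l H) x j‖ ^ 2 ≤ A * K) ∧
      ((∀ l, ∀ j ≠ l, ‖rowMinor w l j H‖ ≤ s * √(A * K)) → (∀ l, |H l l| ≤ s * √(Cs / W)) →
      (∀ l, ‖quadMinor w S l H‖ ≤ s * √(A * K)) → ∀ i j,
      ‖(res w H - Matrix.diagonal M) i j‖ ≤ C * (s * (√K + 1 / √W))) := by
  set A := 2 + 2 * (2 / c₀) ^ 2 with hA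
  have hC : 0 ≤ (3 + 12 * Cst) * √A + 12 * Cst * (6 / c₀) + 12 * Cst * (√Cs + 3 * Cs) := by
    positivity
  refine ⟨1 + ((3 + 12 * Cst) * √A + 12 * Cst * (6 / c₀) + 12 * Cst * (√Cs + 3 * Cs)), A,
    by linarith, by positivity, ?_⟩
  intro N W _ η S w M hR φ H hG hφ K s hs hK
  have hW0 : (0 : ℝ) < W := by exact_mod_cast (by norm_num : 0 < 2).trans_le hR.two_le
  have hW1 : (1 : ℝ) ≤ W := by exact_mod_cast (by norm_num : 1 ≤ 2).trans hR.two_le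
  refine ⟨fun l j hj => hG.sum_sq_minor_le hR.nonneg hR.row hK hj, fun h1 h2 h3 i j => ?_⟩
  have hT0 : ∀ l j, 0 ≤ ∑ x, S l x * ‖res w H x j‖ ^ 2 := fun l j =>
    Finset.sum_nonneg fun x _ => mul_nonneg (hR.nonneg l x) (sq_nonneg _)
  have hK0 : 0 ≤ K := (hT0 0 0).trans (hK 0 0)
  -- Schur's formula contains T to the first power. Since T ≤ 9 here, it is at most 3√K, comparable
  -- with the other errors.
  have hK3 : ∀ l, ∑ x, S l x * ‖res w H x l‖ ^ 2 ≤ 3 * √K := by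
    intro l
    have e1 := hK l l
    have e2 := hG.sum_sq_le hR.nonneg hR.row l l
    have e3 := hT0 l l
    set q := ∑ x, S l x * ‖res w H x l‖ ^ 2
    have : q / 3 ≤ √K := Real.le_sqrt_of_sq_le (by nlinarith)
    linarith
  have hmain := hG.close_of_large_deviation hR.nonneg hR.stable hCst hR.sce hR.row hφ
    (fun i => hR.upper i i) hK3 (fun l j hj => h1 l j hj) h2 h3 (by positivity) i j
  refine hmain.trans ?_
  have e1 : √(A * K) = √A * √K := Real.sqrt_mul (by positivity) _
  have e2 : √(Cs / W) = √Cs * (1 / √W) := by rw [Real.sqrt_div hCs.le, div_eq_mul_one_div]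
  have e3 : Cs / W ≤ Cs * (1 / √W) := by
    rw [div_eq_mul_one_div]
    gcongr
    rw [Real.sqrt_le_left hW0.le]
    nlinarith
  have hk := Real.sqrt_nonneg K
  have hw : 0 < 1 / √(W : ℝ) := by positivity
  rw [e1, e2]
  set k := √K
  set v := 1 / √(W : ℝ)
  have s1 : k ≤ s * k := le_mul_of_one_le_left hk hs
  have s2 : v ≤ s * v := le_mul_of_one_le_left hw.le hs
  calc 3 * (s * (√A * k)) + 12 * Cst * (s * (√Cs * v) + s * (√A * k) + 2 / c₀ * (3 * k)
        + 3 * (Cs / W))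
      ≤ 3 * (s * (√A * k)) + 12 * Cst * (s * (√Cs * v) + s * (√A * k) + 2 / c₀ * (3 * (s * k))
        + 3 * (Cs * (s * v))) := by
        gcongr
        exact e3.trans (by gcongr)
    _ = ((3 + 12 * Cst) * √A + 12 * Cst * (6 / c₀)) * (s * k)
        + 12 * Cst * (√Cs + 3 * Cs) * (s * v) := by ring
    _ ≤ (1 + ((3 + 12 * Cst) * √A + 12 * Cst * (6 / c₀) + 12 * Cst * (√Cs + 3 * Cs))) * (s * k)
        + (1 + ((3 + 12 * Cst) * √A + 12 * Cst * (6 / c₀) + 12 * Cst * (√Cs + 3 * Cs)))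
          * (s * v) := by
        have a1 : 0 ≤ (3 + 12 * Cst) * √A + 12 * Cst * (6 / c₀) := by positivity
        have a2 : 0 ≤ 12 * Cst * (√Cs + 3 * Cs) := by positivity
        have a3 : 0 ≤ s * k := by positivity
        have a4 : 0 ≤ s * v := by positivity
        exact add_le_add (mul_le_mul_of_nonneg_right (by linarith) a3)
          (mul_le_mul_of_nonneg_right (by linarith) a4)
    _ = _ := by ring

/-- Outside of an event of small probability the `T` matrix and `G - M` are controlled. -/
theorem exists_bad_event (cs Cs c₀ c₁ Cst : ℝ) (hcs : 0 < cs) (hCs : 0 < Cs) (hc₀ : 0 < c₀)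
    (hc₀1 : c₀ ≤ 1) (hc₁ : 0 < c₁) (hCst : 1 ≤ Cst) : ∃ C : ℝ, 1 ≤ C ∧
      ∀ (ν : ℕ → ℝ) (n : ℕ), ∃ R : ℝ, 1 ≤ R ∧
      ∀ {Ω : Type u} [MeasurableSpace Ω] {P : Measure Ω} [IsProbabilityMeasure P]
      {N W : ℕ} [NeZero N] {η : ℝ} {S : Matrix (ZMod N) (ZMod N) ℝ} {w M : ZMod N → ℂ},
      Regular cs Cs c₀ c₁ Cst N W η S w M →
      ∀ {H : Ω → Matrix (ZMod N) (ZMod N) ℝ}, RowEnsemble P ν S H →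
      ∀ {φ : ℝ}, 0 < φ → φ ≤ c₀ ^ 2 / 8 → Cst * φ ≤ 1 / 8 → (1 / (W : ℝ) ≤ φ ^ 2) →
      ∀ {E : Set Ω}, MeasurableSet E →
      (∀ ω ∉ E, ∀ i j, ‖(res w (H ω) - Matrix.diagonal M) i j‖ ≤ φ) →
      P.real E * (N : ℝ) ^ (70 * (n + 2)) ≤ 1 → ∀ s : ℝ, 1 ≤ s →
      ∃ 𝓑 : Set Ω, P.real 𝓑 ≤ P.real E + R * (N ^ 2 / s ^ (n + 2)) ∧ ∀ ω ∉ 𝓑,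
        (∀ i j, ∑ x, S i x * ‖res w (H ω) x j‖ ^ 2
          ≤ C * (s * (N * (1 / (W * η) + N / (W : ℝ) ^ 2) * (φ ^ 3 + (N : ℝ)⁻¹)))) ∧
        ∀ i j, ‖(res w (H ω) - Matrix.diagonal M) i j‖
          ≤ C * (s * (√(s * (N * (1 / (W * η) + N / (W : ℝ) ^ 2) * (φ ^ 3 + (N : ℝ)⁻¹)))
            + 1 / √W)) := by
  obtain ⟨C₁, hC₁, hT⟩ := exists_T_bound cs Cs c₀ c₁ Cst hcs hCs hc₀ hc₁
  obtain ⟨C₂, A, hC₂, hA, hclose⟩ := exists_close_bound cs Cs c₀ c₁ Cst hCs hc₀ hCst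
  refine ⟨C₁ * C₂, by nlinarith, fun ν n => ?_⟩
  -- The factor 4 comes from |M|² ≤ 4 in the weights S_il|M_l|².
  set B := 4 + 4 * Cs with hB
  obtain ⟨K, hK, hfl⟩ := exists_fluctSum_tail.{u} c₀ B hc₀ (by rw [hB]; linarith) n ν
  have ht := tailConst_pos ν n
  refine ⟨K + 3 * tailConst ν n, by linarith, ?_⟩
  intro Ω _ P _ N W _ η S w M hR H h φ hφ hφc hφst hWφ E hE hgood hEε s hs
  have hN : (0 : ℝ) < N := by exact_mod_cast NeZero.pos N
  have hW0 : (0 : ℝ) < W := by exact_mod_cast (by norm_num : 0 < 2).trans_le hR.two_le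
  have hWN : (W : ℝ) ≤ N := by exact_mod_cast hR.le
  have hη := hR.η_pos
  have hN1 : (1 : ℝ) ≤ N := by exact_mod_cast NeZero.one_le
  have hN2 : (2 : ℝ) ≤ N := by exact_mod_cast hR.two_le.trans hR.le
  have hcard : (Fintype.card (ZMod N) : ℝ) = N := by rw [ZMod.card]
  have hs0 : 0 < s := by linarith
  have hG : ∀ ω ∉ E, GoodResolvent w M c₀ φ (H ω) := fun ω hω =>
    ⟨hR.im_pos, h.symm ω, hc₀, hc₀1, hφ, hφc, hR.M_lower, hR.M_upper, hgood ω hω⟩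
  have hφ1 : φ ≤ 1 := by nlinarith
  have hNφ : 1 ≤ N * φ ^ 2 := by
    calc (1 : ℝ) ≤ N * (1 / W) := by rw [mul_one_div, le_div_iff₀ hW0]; linarith
      _ ≤ N * φ ^ 2 := by gcongr
  have hCsφ : Cs / W ≤ Cs * φ ^ 2 := by
    rw [div_eq_mul_one_div]; gcongr
  have hSφ : ∀ i j, S i j ≤ B * φ ^ 2 := fun i j =>
    (hR.upper i j).trans (hCsφ.trans (by gcongr; rw [hB]; linarith))
  have hS1 : ∀ i j, S i j ≤ 1 := fun i j =>
    (Finset.single_le_sum (fun x _ => hR.nonneg i x) (Finset.mem_univ j)).trans (hR.row i)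
  have hM4 : ∀ l, ‖M l‖ ^ 2 ≤ 4 := fun l => by nlinarith [hR.M_upper l, norm_nonneg (M l)]
  set Q := s * (N * (1 / (W * η) + N / (W : ℝ) ^ 2) * (φ ^ 3 + (N : ℝ)⁻¹)) with hQ
  have hQ0 : 0 < Q := by positivity
  -- the exceptional events
  let F : ZMod N × ZMod N → Set Ω := fun p =>
    {ω | s * φ ^ 3 ≤ ‖fluctSum w S (fun l => S p.1 l * ‖M l‖ ^ 2) p.2 p.2 (H ω)‖}
  let L : ZMod N × ZMod N → Set Ω := fun p =>
    {ω | ∑ x, S p.1 x * ‖res w (del p.1 (H ω)) x p.2‖ ^ 2 ≤ A * (C₁ * Q) ∧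
      s * √(A * (C₁ * Q)) ≤ ‖rowMinor w p.1 p.2 (H ω)‖}
  let D : ZMod N → Set Ω := fun l => {ω | s * √(Cs / W) ≤ |H ω l l|}
  let V : ZMod N → Set Ω := fun l =>
    {ω | (∀ j, j ≠ l → ∑ x, S l x * ‖res w (del l (H ω)) x j‖ ^ 2 ≤ A * (C₁ * Q)) ∧
      s * √(A * (C₁ * Q)) ≤ ‖quadMinor w S l (H ω)‖}
  have pF : ∀ p, P.real (F p) ≤ K / s ^ (n + 2) := by
    intro p
    refine hfl h (by rw [hcard]; exact hN2) hR.im_pos hφ hφ1 (by rw [hcard]; exact hNφ)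
      (by rw [hcard]; exact hR.norm_res_le) hR.row hS1 hSφ hE hG (by rw [hcard]; exact hEε)
      (fun l => mul_nonneg (hR.nonneg _ _) (sq_nonneg _)) (fun l => ?_) ?_ s hs0 p.2 p.2
    · calc S p.1 l * ‖M l‖ ^ 2 ≤ (Cs * φ ^ 2) * 4 := by
            have h1 := (hR.upper p.1 l).trans hCsφ
            exact mul_le_mul h1 (hM4 l) (sq_nonneg _) (by positivity)
        _ ≤ B * φ ^ 2 := by rw [hB]; nlinarith [sq_nonneg φ]
    · calc ∑ l, S p.1 l * ‖M l‖ ^ 2 ≤ ∑ l, S p.1 l * 4 :=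
            Finset.sum_le_sum fun l _ => mul_le_mul_of_nonneg_left (hM4 l) (hR.nonneg _ _)
        _ ≤ 1 * 4 := by rw [← Finset.sum_mul]; gcongr; exact hR.row _
        _ ≤ B := by rw [hB]; linarith
  have hpow : tailConst ν n / s ^ (2 * n + 2) ≤ tailConst ν n / s ^ (n + 2) := by
    refine div_le_div_of_nonneg_left ht.le (by positivity) (pow_le_pow_right₀ hs (by omega))
  have hAQ : 0 < A * (C₁ * Q) := by positivity
  have pL : ∀ p, P.real (L p) ≤ tailConst ν n / s ^ (n + 2) := fun p =>
    (h.rowMinor_tail n hs0 hAQ w p.1 p.2).trans hpow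
  have pD : ∀ l, P.real (D l) ≤ tailConst ν n / s ^ (n + 2) := fun l =>
    ((h.rowVector l).entry_tail n hs0 (by positivity) (hR.upper l l)).trans hpow
  have pV : ∀ l, P.real (V l) ≤ tailConst ν n / s ^ (n + 2) := fun l =>
    (h.quadMinor_tail n hs0 hAQ w l hR.row).trans hpow
  have union : ∀ {α : Type} [Fintype α] (X : α → Set Ω) {c : ℝ}, 0 ≤ c →
      (∀ a, P.real (X a) ≤ c) → (Fintype.card α : ℝ) ≤ N ^ 2 → P.real (⋃ a, X a) ≤ N ^ 2 * c := by
    intro α _ X c hc hX hα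
    refine (measureReal_iUnion_fintype_le X).trans ((Finset.sum_le_sum fun a _ => hX a).trans ?_)
    rw [Finset.sum_const, nsmul_eq_mul, Finset.card_univ]
    gcongr
  have c2 : (Fintype.card (ZMod N × ZMod N) : ℝ) ≤ N ^ 2 := by
    rw [Fintype.card_prod, ZMod.card]; push_cast; rw [pow_two]
  have c1 : (Fintype.card (ZMod N) : ℝ) ≤ N ^ 2 := by rw [hcard]; nlinarith
  refine ⟨E ∪ ((⋃ p, F p) ∪ ((⋃ p, L p) ∪ ((⋃ l, D l) ∪ ⋃ l, V l))), ?_, ?_⟩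
  · have u1 := union F (by positivity) pF c2
    have u2 := union L (by positivity) pL c2
    have u3 := union D (by positivity) pD c1
    have u4 := union V (by positivity) pV c1
    have v1 := measureReal_union_le (μ := P) E
      ((⋃ p, F p) ∪ ((⋃ p, L p) ∪ ((⋃ l, D l) ∪ ⋃ l, V l)))
    have v2 := measureReal_union_le (μ := P) (⋃ p, F p) ((⋃ p, L p) ∪ ((⋃ l, D l) ∪ ⋃ l, V l))
    have v3 := measureReal_union_le (μ := P) (⋃ p, L p) ((⋃ l, D l) ∪ ⋃ l, V l)
    have v4 := measureReal_union_le (μ := P) (⋃ l, D l) (⋃ l, V l)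
    have e : (K + 3 * tailConst ν n) * (N ^ 2 / s ^ (n + 2)) = N ^ 2 * (K / s ^ (n + 2))
        + 3 * (N ^ 2 * (tailConst ν n / s ^ (n + 2))) := by ring
    rw [e]
    linarith
  · intro ω hω
    simp only [Set.mem_union, Set.mem_iUnion, not_or, not_exists] at hω
    obtain ⟨hωE, hωF, hωL, hωD, hωV⟩ := hω
    have hGω := hG ω hωE
    -- The bound on T comes before the use of `L` and `V`: it yields the variance conditions
    -- contained in those events.
    have h1 : ∀ i j, ∑ x, S i x * ‖res w (H ω) x j‖ ^ 2 ≤ C₁ * Q := by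
      intro i j
      refine hT hR hGω hWφ s hs (fun i j => ?_) i j
      exact (not_le.1 (hωF (i, j))).le
    obtain ⟨h2, h3⟩ := hclose hR hGω hφst (C₁ * Q) s hs h1
    have hQC : C₁ * Q ≤ C₁ * C₂ * Q := by
      have : C₁ * 1 ≤ C₁ * C₂ := by gcongr
      have := mul_le_mul_of_nonneg_right this hQ0.le
      linarith
    refine ⟨fun i j => (h1 i j).trans hQC, fun i j => ?_⟩
    have h4 := h3
      (fun l j hj => (not_le.1 fun hc => hωL (l, j) ⟨h2 l j hj, hc⟩).le)
      (fun l => (not_le.1 (hωD l)).le)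
      (fun l => (not_le.1 fun hc => hωV l ⟨fun j hj => h2 l j hj, hc⟩).le) i j
    refine h4.trans ?_
    have h5 : √(C₁ * Q) ≤ C₁ * √Q := by
      rw [Real.sqrt_mul (by positivity)]
      gcongr
      rw [Real.sqrt_le_left (by positivity)]
      exact le_self_pow₀ hC₁ two_ne_zero
    have h6 : 0 < 1 / √(W : ℝ) := by positivity
    calc C₂ * (s * (√(C₁ * Q) + 1 / √W)) ≤ C₂ * (s * (C₁ * √Q + C₁ * (1 / √W))) := by
          gcongr
          exact le_mul_of_one_le_left h6.le hC₁
      _ = _ := by ring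

end Master

/-! ### Parameters and powers of N. -/

section Parameters

theorem resolvent_eq_res {N : ℕ} [NeZero N] (W : ℕ) (g : ZMod N → ℝ) (z z' : ℂ)
    (H : Matrix (ZMod N) (ZMod N) ℝ) :
    resolvent W g z z' H = res (fun i => g i + specParam W z z' i) H := by
  rw [resolvent, res, shifted, sub_sub, Matrix.diagonal_add]

theorem maxNorm_le {N : ℕ} [NeZero N] {𝕜 : Type*} [Norm 𝕜] {X : Matrix (ZMod N) (ZMod N) 𝕜} {K : ℝ}
    (h : ∀ i j, ‖X i j‖ ≤ K) : maxNorm X ≤ K := ciSup_le fun p => h p.1 p.2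

theorem le_maxNorm {N : ℕ} [NeZero N] {𝕜 : Type*} [Norm 𝕜] (X : Matrix (ZMod N) (ZMod N) 𝕜)
    (i j : ZMod N) : ‖X i j‖ ≤ maxNorm X :=
  le_ciSup (f := fun p : ZMod N × ZMod N => ‖X p.1 p.2‖) (Set.finite_range _).bddAbove (i, j)

/-- M is close to m_sc(z'), so the bulk bounds on |m| and Im m pass to M. -/
theorem exists_regular (κ cs Cs : ℝ) (hκ : 0 < κ) (hcs : 0 < cs) (hCs : 0 < Cs) :
    ∃ c C ε : ℝ, 0 < c ∧ 1 ≤ C ∧ 0 < ε ∧ ∀ (N : ℕ) [NeZero N] (W : ℕ), 2 ≤ W → W ≤ N →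
      ∀ f : ZMod N → ℝ, IsBandProfile cs Cs N W f → ∀ ζ : ℝ, 0 ≤ ζ →
      (∀ i j, 0 ≤ varMat W f ζ i j) →
      ∀ (g : ZMod N → ℝ) (z z' : ℂ), ((N : ℝ) ^ 10)⁻¹ ≤ z'.im → z'.im ≤ 1 → z'.im ≤ z.im →
      |z'.re| ≤ 2 - κ → ζ ≤ ε → (∀ i, |g i| ≤ ε) → ‖z - z'‖ ≤ ε →
      (∃! M : ZMod N → ℂ, IsSCESolutionNear c W (varMat W f ζ) g z z' M) ∧
      ∀ M : ZMod N → ℂ, IsSCESolutionNear c W (varMat W f ζ) g z z' M →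
        Regular (cs / 2) Cs (1 / 8) (√(κ / 32) / 2) C N W z.im (varMat W f ζ)
          (fun i => g i + specParam W z z' i) M := by
  obtain ⟨c, C, ε, hc, hC, hε, key⟩ := exists_sce_solution κ cs Cs hκ hcs hCs
  have hC0 : 0 < C := by linarith
  set q := √(κ / 32) with hq
  have hq0 : 0 < q := by positivity
  -- `ε` is for the fixed point, `cs / 4` for the lower bound on S_ζ, and the last term makes |M -
  -- m| ≤ Cε' at most 1/8 and at most half of the lower bound on Im m.
  set ε' := min (min ε (cs / 4)) (min (1 / 8) (q / 2) / C) with hε'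
  have h1 : ε' ≤ ε := (min_le_left _ _).trans (min_le_left _ _)
  have h2 : ε' ≤ cs / 4 := (min_le_left _ _).trans (min_le_right _ _)
  have h3 : C * ε' ≤ min (1 / 8) (q / 2) := by
    have : ε' ≤ min (1 / 8) (q / 2) / C := min_le_right _ _
    rw [le_div_iff₀ hC0] at this
    linarith
  refine ⟨c, C, ε', hc, hC, by positivity, ?_⟩
  intro N _ W hW hWN f hf ζ hζ hS g z z' hz' hz1 hzz hre hζε hg hzε
  have hN : (0 : ℝ) < N := by exact_mod_cast NeZero.pos N
  have hz0 : 0 < z'.im := lt_of_lt_of_le (by positivity) hz'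
  obtain ⟨hex, hall⟩ := key N W hW hWN f hf ζ hζ hS g z z' hz0 hz1 hre ε' h1 hζε hg hzε
  refine ⟨hex, fun M hM => ?_⟩
  obtain ⟨hclose, hst⟩ := hall M hM
  have hw : ∀ i, z'.im ≤ ((g i : ℂ) + specParam W z z' i).im := by
    intro i
    unfold specParam
    split_ifs <;> simp [hzz]
  have hnorm : ‖z'‖ ≤ 3 := by
    refine (Complex.norm_le_abs_re_add_abs_im z').trans ?_
    rw [abs_of_pos hz0]
    linarith
  have hm1 := norm_mSc_le_one hz0
  have hm2 := norm_mSc_ge hz0 hnorm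
  have hm3 : q ≤ (mSc z').im := by
    rw [hq, Real.sqrt_le_left (mSc_im_pos hz0).le]
    exact mSc_im_sq_ge hκ hz0 hz1 hre
  have hM8 : ∀ i, ‖M i - mSc z'‖ ≤ 1 / 8 := fun i =>
    (hclose i).trans (h3.trans (min_le_left _ _))
  have hMq : ∀ i, ‖M i - mSc z'‖ ≤ q / 2 := fun i =>
    (hclose i).trans (h3.trans (min_le_right _ _))
  exact {
    two_le := hW
    le := hWN
    nonneg := hS
    symm := varMat_symm hf
    row := sum_varMat_le hf hζ
    upper := varMat_le_div hf hCs.le hζ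
    lower := varMat_lower hf hζ (hζε.trans h2)
    η_pos := hz0.trans_le hzz
    im_pos := fun i => hz0.trans_le (hw i)
    im_block := fun i hi => by simp [specParam, hi]
    im_ge := fun i => hz'.trans (hw i)
    sce := fun i => by rw [(hM.1 i).2]; ring
    M_lower := fun i => by
      have := norm_sub_norm_le (mSc z') (M i)
      rw [norm_sub_rev] at this
      linarith [hM8 i]
    M_upper := fun i => by
      have := norm_sub_norm_le (M i) (mSc z')
      linarith [hM8 i]
    M_im := fun i => by
      have h4 := (abs_le.1 ((Complex.abs_im_le_norm (M i - mSc z')).trans (hMq i))).1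
      rw [Complex.sub_im] at h4
      linarith
    stable := hst }

theorem exists_threshold {σ b δ ε : ℝ} (hσ : 0 < σ) (hb : 0 < b) (hδ : 0 < δ) (hε : 0 < ε) (A : ℝ) :
    ∃ N₀ : ℕ, ∀ N : ℕ, N₀ ≤ N → 3 ≤ N ∧ A ≤ N ∧ A < (N : ℝ) ^ σ ∧ (N : ℝ) ^ (-b) ≤ ε ∧
      (N : ℝ) ^ (-δ) ≤ ε := by
  have hN := tendsto_natCast_atTop_atTop (R := ℝ)
  have e1 := Filter.eventually_ge_atTop 3
  have e2 := hN.eventually_ge_atTop A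
  have e3 := ((tendsto_rpow_atTop hσ).comp hN).eventually_gt_atTop A
  have e4 := ((tendsto_rpow_neg_atTop hb).comp hN).eventually (ge_mem_nhds hε)
  have e5 := ((tendsto_rpow_neg_atTop hδ).comp hN).eventually (ge_mem_nhds hε)
  obtain ⟨N₀, h⟩ := Filter.eventually_atTop.1 (e1.and (e2.and (e3.and (e4.and e5))))
  exact ⟨N₀, h⟩

theorem rpow_le_of_le_logb {N W : ℕ} (hN : 3 ≤ N) {x : ℝ} (hx : 0 < x) (h : x ≤ Real.logb N W) :
    (N : ℝ) ^ x ≤ W := by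
  have hN1 : (1 : ℝ) < N := by exact_mod_cast (by omega : 1 < N)
  have hW : 0 < W := by
    rcases Nat.eq_zero_or_pos W with h0 | h0
    · subst h0; simp at h; linarith
    · exact h0
  exact (Real.le_logb_iff_rpow_le hN1 (by exact_mod_cast hW)).1 h

/-- The right side of the `T` bound under the additional assumption on `Φ`. -/
theorem control_le {N W η Φ a b : ℝ} (hN : 0 < N) (hW : 0 < W) (hΦ : 0 < Φ)
    (hη : N ^ (-a) ≤ η) (h1 : Φ ≤ W / N ^ (1 + a + b)) (h2 : Φ ≤ W ^ 2 / N ^ (2 + b)) :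
    N * (1 / (W * η) + N / W ^ 2) * (Φ ^ 3 + N⁻¹)
      ≤ 2 * N ^ (-b) * Φ ^ 2 + 1 / (W * η) + N / W ^ 2 := by
  have e1 : N ^ (1 + a + b) = N * N ^ a * N ^ b := by
    rw [Real.rpow_add hN, Real.rpow_add hN, Real.rpow_one]
  have e2 : N ^ (2 + b) = N ^ 2 * N ^ b := by
    rw [Real.rpow_add hN]; norm_num
  rw [e1] at h1
  rw [e2] at h2
  rw [Real.rpow_neg hN.le] at hη ⊢
  have hp : 0 < N ^ b := Real.rpow_pos_of_pos hN b
  have hq : 0 < N ^ a := Real.rpow_pos_of_pos hN a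
  set p := N ^ b
  set q := N ^ a
  have hη0 : 0 < η := lt_of_lt_of_le (by positivity) hη
  rw [le_div_iff₀ (by positivity)] at h1 h2
  have hqη : 1 ≤ q * η := by
    rw [inv_le_iff_one_le_mul₀ hq] at hη
    linarith
  -- The two upper bounds on Φ are what makes NΦ(1/(Wη) + N/W²) at most 2N^(-b).
  have f1 : N * (1 / (W * η)) * Φ ≤ p⁻¹ := by
    rw [mul_one_div, div_mul_eq_mul_div, div_le_iff₀ (by positivity), inv_mul_eq_div,
      le_div_iff₀ hp]
    calc N * Φ * p ≤ N * Φ * p * (q * η) := le_mul_of_one_le_right (by positivity) hqη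
      _ = Φ * (N * q * p) * η := by ring
      _ ≤ W * η := by gcongr
  have f2 : N * (N / W ^ 2) * Φ ≤ p⁻¹ := by
    rw [mul_div_assoc', div_mul_eq_mul_div, div_le_iff₀ (by positivity), inv_mul_eq_div,
      le_div_iff₀ hp]
    calc N * N * Φ * p = Φ * (N ^ 2 * p) := by ring
      _ ≤ W ^ 2 := h2
  have e3 : N * (1 / (W * η) + N / W ^ 2) * (Φ ^ 3 + N⁻¹)
      = (N * (1 / (W * η)) * Φ + N * (N / W ^ 2) * Φ) * Φ ^ 2
        + (N * N⁻¹) * (1 / (W * η) + N / W ^ 2) := by ring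
  rw [e3, mul_inv_cancel₀ hN.ne', one_mul]
  have : (N * (1 / (W * η)) * Φ + N * (N / W ^ 2) * Φ) * Φ ^ 2 ≤ (p⁻¹ + p⁻¹) * Φ ^ 2 := by gcongr
  linarith

theorem sqrt_control_le {x p Φ u v : ℝ} (hΦ : 0 ≤ Φ) (hu : 0 ≤ u) (hv : 0 ≤ v)
    (hp : 0 ≤ p) (h : x ≤ 2 * p ^ 2 * Φ ^ 2 + u ^ 2 + v ^ 2) : √x ≤ 2 * (p * Φ) + u + v := by
  rw [Real.sqrt_le_left (by positivity)]
  have h1 : 0 ≤ p * Φ := by positivity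
  nlinarith [mul_nonneg h1 hu, mul_nonneg h1 hv, mul_nonneg hu hv, mul_nonneg h1 h1]

/-- A union over N² events of probability R N^(-σ(n+2)); one spare power of N absorbs R + 1. -/
theorem le_rpow_neg_of_le {N D R σ x y : ℝ} {n : ℕ} (hN1 : 1 < N) (hR1 : 1 ≤ R) (hNR : R + 1 ≤ N)
    (hn : D + 4 ≤ n * σ) (hσ : 0 < σ) (hx : x ≤ y + R * (N ^ 2 / (N ^ σ) ^ (n + 2)))
    (hy : y ≤ N ^ (-(D + 1 + 70 * (n + 2)))) : x ≤ N ^ (-D) := by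
  have hN0 : 0 < N := by linarith
  have h1 : N ^ 2 / (N ^ σ) ^ (n + 2) ≤ N ^ (-(D + 1)) := by
    rw [← Real.rpow_natCast, ← Real.rpow_natCast, ← Real.rpow_mul hN0.le, ← Real.rpow_sub hN0]
    refine Real.rpow_le_rpow_of_exponent_le hN1.le ?_
    push_cast
    linarith
  have h2 : N ^ (-(D + 1 + 70 * (n + 2))) ≤ N ^ (-(D + 1)) :=
    Real.rpow_le_rpow_of_exponent_le hN1.le (by
      have : (0 : ℝ) ≤ 70 * (n + 2) := by positivity
      linarith)
  have h3 : N ^ (-(D + 1)) * N = N ^ (-D) := by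
    rw [← Real.rpow_add_one hN0.ne']; congr 1; ring
  have h4 : 0 < N ^ (-(D + 1)) := Real.rpow_pos_of_pos hN0 _
  calc x ≤ N ^ (-(D + 1)) + R * N ^ (-(D + 1)) := by
        refine hx.trans (add_le_add (hy.trans h2) ?_)
        gcongr
    _ = N ^ (-(D + 1)) * (R + 1) := by ring
    _ ≤ N ^ (-(D + 1)) * N := by gcongr
    _ = _ := h3

/-- Put s = N^σ. The bound on T loses one s from the tails, s³ from φ ≤ sΦ and one s for the
constant, in all s⁵ ≤ N^τ. For G - M the loss after the square root is s⁴, and s⁴N^(-b/2) ≤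
N^(-b/3). -/
theorem weak_estimates {Ω : Type*} [MeasurableSpace Ω] {P : Measure Ω} [IsProbabilityMeasure P]
    {N W : ℕ} [NeZero N] {z : ℂ} {S : Matrix (ZMod N) (ZMod N) ℝ} {w M : ZMod N → ℂ}
    {H : Ω → Matrix (ZMod N) (ZMod N) ℝ} {C₁ σ τ τ' a b D Φ : ℝ} {𝓑 : Set Ω} (hN1 : (1 : ℝ) < N)
    (hW0 : (0 : ℝ) < W) (hz0 : 0 < z.im) (hzle1 : z.im ≤ 1) (hS : ∀ i j, 0 ≤ S i j) (hΦ : 0 < Φ)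
    (hz1 : (N : ℝ) ^ (-a) ≤ z.im) (hC₁ : 1 ≤ C₁) (hσ0 : 0 < σ) (hστ : 5 * σ ≤ τ)
    (hσb : 5 * σ ≤ b / 6) (hNC : 2 * C₁ < (N : ℝ) ^ σ) (hτ'σ : τ' ≤ σ)
    (h𝓑D : P.real 𝓑 ≤ (N : ℝ) ^ (-D))
    (hgood : ∀ ω ∉ 𝓑, (∀ i j, ∑ x, S i x * ‖res w (H ω) x j‖ ^ 2 ≤ C₁ * ((N : ℝ) ^ σ *
        (N * (1 / (W * z.im) + N / (W : ℝ) ^ 2) * (((N : ℝ) ^ τ' * Φ) ^ 3 + (N : ℝ)⁻¹)))) ∧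
      ∀ i j, ‖(res w (H ω) - Matrix.diagonal M) i j‖ ≤ C₁ * ((N : ℝ) ^ σ *
        (√((N : ℝ) ^ σ * (N * (1 / (W * z.im) + N / (W : ℝ) ^ 2) *
          (((N : ℝ) ^ τ' * Φ) ^ 3 + (N : ℝ)⁻¹))) + 1 / √W))) :
    P.real {ω | (N : ℝ) ^ τ *
        ((N / (W * z.im) + (N : ℝ) ^ 2 / (W : ℝ) ^ 2) * (Φ ^ 3 + (N : ℝ)⁻¹)) ≤
      maxNorm (tMat S (res w (H ω)))} ≤ (N : ℝ) ^ (-D) ∧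
    (Φ ≤ min (W / (N : ℝ) ^ (1 + a + b)) ((W : ℝ) ^ 2 / (N : ℝ) ^ (2 + b)) →
      1 - (N : ℝ) ^ (-D) ≤ P.real {ω | maxNorm (res w (H ω) - Matrix.diagonal M) ≤
        Φ * (N : ℝ) ^ (-(1 / 3) * b) + (N : ℝ) ^ τ * (1 / √(W * z.im) + √N / W)}) := by
  have hN0 : (0 : ℝ) < N := by linarith
  have mono : ∀ {x y : ℝ}, x ≤ y → (N : ℝ) ^ x ≤ (N : ℝ) ^ y := fun h =>
    Real.rpow_le_rpow_of_exponent_le hN1.le h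
  have hs1 : 1 ≤ (N : ℝ) ^ σ := Real.one_le_rpow hN1.le hσ0.le
  have hpow : ∀ k : ℕ, ((N : ℝ) ^ σ) ^ k = (N : ℝ) ^ (k * σ) := fun k => by
    rw [← Real.rpow_natCast, ← Real.rpow_mul hN0.le, mul_comm]
  have hNτ' : (N : ℝ) ^ τ' ≤ (N : ℝ) ^ σ := mono hτ'σ
  have hφ0 : 0 < (N : ℝ) ^ τ' * Φ := mul_pos (Real.rpow_pos_of_pos hN0 _) hΦ
  have hφs : (N : ℝ) ^ τ' * Φ ≤ (N : ℝ) ^ σ * Φ := by gcongr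
  generalize (N : ℝ) ^ τ' * Φ = φ at hgood hφ0 hφs
  generalize hs : (N : ℝ) ^ σ = s at hgood hs1 hpow hφs hNC
  have hs0 : 0 < s := by linarith
  set Q := N * (1 / (W * z.im) + N / (W : ℝ) ^ 2) * (Φ ^ 3 + (N : ℝ)⁻¹) with hQ
  have hQ0 : 0 < Q := by positivity
  have hφΦ : s * (N * (1 / (W * z.im) + N / (W : ℝ) ^ 2) * (φ ^ 3 + (N : ℝ)⁻¹)) ≤ s ^ 4 * Q := by
    have h1 : φ ^ 3 + (N : ℝ)⁻¹ ≤ s ^ 3 * (Φ ^ 3 + (N : ℝ)⁻¹) := by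
      have h3 : (N : ℝ)⁻¹ ≤ s ^ 3 * (N : ℝ)⁻¹ :=
        le_mul_of_one_le_left (by positivity) (one_le_pow₀ hs1)
      have h4 : φ ^ 3 ≤ s ^ 3 * Φ ^ 3 := by rw [← mul_pow]; gcongr
      linarith
    calc _ ≤ s * (N * (1 / (W * z.im) + N / (W : ℝ) ^ 2) * (s ^ 3 * (Φ ^ 3 + (N : ℝ)⁻¹))) := by
          gcongr
      _ = _ := by rw [hQ]; ring
  refine ⟨?_, fun hΦmin => ?_⟩
  · refine (measureReal_mono fun ω hω => ?_).trans h𝓑D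
    by_contra hcon
    obtain ⟨hT, -⟩ := hgood ω hcon
    have h1 : maxNorm (tMat S (res w (H ω))) ≤ C₁ * (s ^ 4 * Q) := by
      refine maxNorm_le fun i j => ?_
      have h2 : 0 ≤ tMat S (res w (H ω)) i j :=
        Finset.sum_nonneg fun x _ => mul_nonneg (hS i x) (sq_nonneg _)
      rw [Real.norm_of_nonneg h2]
      exact (hT i j).trans (by gcongr)
    have h3 : C₁ * (s ^ 4 * Q) < (N : ℝ) ^ τ * Q := by
      calc C₁ * (s ^ 4 * Q) < s * (s ^ 4 * Q) := by gcongr; linarith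
        _ = s ^ 5 * Q := by ring
        _ ≤ (N : ℝ) ^ τ * Q := by
          rw [hpow]
          exact mul_le_mul_of_nonneg_right (mono (by push_cast; exact hστ)) hQ0.le
    have h4 : (N / (W * z.im) + (N : ℝ) ^ 2 / (W : ℝ) ^ 2) * (Φ ^ 3 + (N : ℝ)⁻¹) = Q := by
      rw [hQ]; ring
    have h5 : (N : ℝ) ^ τ * ((N / (W * z.im) + (N : ℝ) ^ 2 / (W : ℝ) ^ 2) * (Φ ^ 3 + (N : ℝ)⁻¹))
        ≤ maxNorm (tMat S (res w (H ω))) := hω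
    rw [h4] at h5
    linarith
  · set A : Set Ω := {ω | maxNorm (res w (H ω) - Matrix.diagonal M)
      ≤ Φ * (N : ℝ) ^ (-(1 / 3) * b) + (N : ℝ) ^ τ * (1 / √(W * z.im) + √N / W)} with hA
    have hsub : 𝓑ᶜ ⊆ A := by
      intro ω hω
      obtain ⟨-, hclose⟩ := hgood ω hω
      have hp : 0 < (N : ℝ) ^ (-(b / 2)) := Real.rpow_pos_of_pos hN0 _
      have hctrl := control_le (W := W) hN0 hW0 hΦ hz1 (hΦmin.trans (min_le_left _ _))
        (hΦmin.trans (min_le_right _ _))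
      have hsq : √Q ≤ 2 * ((N : ℝ) ^ (-(b / 2)) * Φ) + 1 / √(W * z.im) + √N / W := by
        refine sqrt_control_le hΦ.le (by positivity) (by positivity) hp.le ?_
        refine hctrl.trans (le_of_eq ?_)
        rw [div_pow, div_pow, Real.sq_sqrt hN0.le, Real.sq_sqrt (by positivity), one_pow,
          ← Real.rpow_natCast ((N : ℝ) ^ (-(b / 2))), ← Real.rpow_mul hN0.le]
        congr 5
        push_cast; ring
      have hWη : 1 / √(W : ℝ) ≤ 1 / √(W * z.im) := by
        refine one_div_le_one_div_of_le (by positivity) (Real.sqrt_le_sqrt ?_)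
        exact mul_le_of_le_one_right hW0.le hzle1
      refine maxNorm_le fun i j => (hclose i j).trans ?_
      have h1 : √(s * (N * (1 / (W * z.im) + N / (W : ℝ) ^ 2) * (φ ^ 3 + (N : ℝ)⁻¹)))
          ≤ s ^ 2 * √Q := by
        refine (Real.sqrt_le_sqrt hφΦ).trans (le_of_eq ?_)
        rw [Real.sqrt_mul (by positivity)]
        congr 1
        rw [show s ^ 4 = (s ^ 2) ^ 2 by ring, Real.sqrt_sq (by positivity)]
      set u := 1 / √(W * z.im) with hu
      set v := √(N : ℝ) / W with hv
      have hu0 : 0 < u := by positivity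
      have hv0 : 0 < v := by positivity
      set p := (N : ℝ) ^ (-(b / 2)) with hpdef
      have hpΦ : 0 < p * Φ := by positivity
      have hs2 : 1 ≤ s ^ 2 := one_le_pow₀ hs1
      calc C₁ * (s * (√(s * (N * (1 / (W * z.im) + N / (W : ℝ) ^ 2) * (φ ^ 3 + (N : ℝ)⁻¹)))
            + 1 / √W)) ≤ C₁ * (s * (s ^ 2 * (2 * (p * Φ) + u + v) + s ^ 2 * u)) := by
            have h2 : 1 / √(W : ℝ) ≤ s ^ 2 * u := hWη.trans (le_mul_of_one_le_left hu0.le hs2)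
            gcongr
            exact h1.trans (by gcongr)
        _ = (2 * C₁) * s ^ 3 * (p * Φ + u + v / 2) := by ring
        _ ≤ s * s ^ 3 * (p * Φ + u + v) := by
            gcongr
            linarith
        _ = (s ^ 4 * p) * Φ + s ^ 4 * (u + v) := by ring
        _ ≤ Φ * (N : ℝ) ^ (-(1 / 3) * b) + (N : ℝ) ^ τ * (u + v) := by
            have h3 : s ^ 4 * p ≤ (N : ℝ) ^ (-(1 / 3) * b) := by
              rw [hpow, hpdef, ← Real.rpow_add hN0]
              exact mono (by push_cast; linarith)
            have h4 : s ^ 4 ≤ (N : ℝ) ^ τ := by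
              rw [hpow]
              exact mono (by push_cast; linarith)
            rw [mul_comm Φ]
            gcongr
    have h1 : 1 ≤ P.real A + P.real 𝓑 := by
      have h2 : (Set.univ : Set Ω) ⊆ A ∪ 𝓑 := fun ω _ => by
        by_cases hω : ω ∈ 𝓑
        · exact Or.inr hω
        · exact Or.inl (hsub hω)
      have h3 := (measureReal_mono (μ := P) h2).trans (measureReal_union_le A 𝓑)
      rwa [probReal_univ] at h3
    linarith

end Parameters

end BandMatrix

end

/-! ### Choice of exponents and conclusion. -/

theorem lemma2p7 (κ cs Cs : ℝ) (hκ : 0 < κ) (hcs : 0 < cs) (hCs : 0 < Cs) :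
    -- the radius of the ball around `m_sc(z')` in which `M` is the unique solution
    ∃ c : ℝ, 0 < c ∧ ∀ μ : ℕ → ℝ,
    -- `a` is `ε_*`, `b` is `ε^*`, and `z`, `z'` are the two spectral parameters
    ∃ ε₀ : ℝ, 0 < ε₀ ∧ ∀ a b : ℝ, 0 < b → b ≤ a / 20 → a ≤ ε₀ →
    ∀ δ τ D : ℝ, 0 < δ → 0 < τ → 0 < D →
    ∃ (τ' D' : ℝ) (N₀ : ℕ), 0 < τ' ∧ 0 < D' ∧
    ∀ (N : ℕ) [NeZero N], N₀ ≤ N →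
    ∀ W : ℕ, W ≤ N →
      max (3 / 4 + b) (1 / 2 + a + b) ≤ Real.logb N W →
    ∀ f : ZMod N → ℝ, BandMatrix.IsBandProfile cs Cs N W f →
    ∀ ζ : ℝ, 0 ≤ ζ → ζ ≤ (N : ℝ) ^ (-a + b) →
    ∀ g : ZMod N → ℝ, (∀ i, |g i| ≤ (W : ℝ) ^ (-(3 / 4) : ℝ)) →
    ∀ (e : ℝ) (z z' : ℂ), |e| < 2 - κ →
      |z.re - e| ≤ (N : ℝ) ^ (-a + 3 * b) →
      (N : ℝ) ^ (-a) ≤ z.im → z.im ≤ (N : ℝ) ^ (-b) →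
      z'.re = e → (N : ℝ) ^ (-10 : ℝ) ≤ z'.im → z'.im ≤ z.im →
    ∀ (Ω : Type*) [MeasurableSpace Ω] (P : Measure Ω) [IsProbabilityMeasure P]
      (H : Ω → Matrix (ZMod N) (ZMod N) ℝ),
      BandMatrix.IsSymmEnsemble P μ (BandMatrix.varMat W f ζ) H →
    -- `M` is well defined
    (∃! M : ZMod N → ℂ,
      BandMatrix.IsSCESolutionNear c W (BandMatrix.varMat W f ζ) g z z' M) ∧
    ∀ M : ZMod N → ℂ,
      BandMatrix.IsSCESolutionNear c W (BandMatrix.varMat W f ζ) g z z' M →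
    ∀ Φ : ℝ, 0 < Φ → (W : ℝ)⁻¹ ≤ Φ ^ 2 → Φ ^ 2 ≤ (N : ℝ) ^ (-δ) →
      P.real {ω | (N : ℝ) ^ τ' * Φ ≤
        BandMatrix.maxNorm (BandMatrix.resolvent W g z z' (H ω) - Matrix.diagonal M)}
          ≤ (N : ℝ) ^ (-D') →
      P.real {ω | (N : ℝ) ^ τ *
          ((N / (W * z.im) + (N : ℝ) ^ 2 / (W : ℝ) ^ 2) * (Φ ^ 3 + (N : ℝ)⁻¹)) ≤
        BandMatrix.maxNorm (BandMatrix.tMat (BandMatrix.varMat W f ζ)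
          (BandMatrix.resolvent W g z z' (H ω)))}
          ≤ (N : ℝ) ^ (-D) ∧
      (Φ ≤ min (W / (N : ℝ) ^ (1 + a + b)) ((W : ℝ) ^ 2 / (N : ℝ) ^ (2 + b)) →
        1 - (N : ℝ) ^ (-D) ≤
          P.real {ω |
            BandMatrix.maxNorm (BandMatrix.resolvent W g z z' (H ω) - Matrix.diagonal M) ≤
              Φ * (N : ℝ) ^ (-(1 / 3) * b) +
              (N : ℝ) ^ τ * (1 / √(W * z.im) + √N / W)}) := by
  open BandMatrix in
  obtain ⟨c, C, ε, hc, hC, hε, hreg⟩ := exists_regular κ cs Cs hκ hcs hCs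
  have hC0 : 0 < C := by linarith
  -- ε₀ = 1 suffices: ζ, g, and the real and imaginary parts of z - z' are at most N^(-b), which is
  -- small for large N.
  refine ⟨c, hc, fun μ => ⟨1, one_pos, fun a b hb hba ha δ τ D hδ hτ hD => ?_⟩⟩
  obtain ⟨C₁, hC₁, hbad⟩ := exists_bad_event (cs / 2) Cs (1 / 8) (√(κ / 32) / 2) C (by positivity)
    hCs (by norm_num) (by norm_num) (by positivity) hC
  -- Up to five factors N^σ are lost; they must fit into N^τ and into the gap between N^(-b/2) and
  -- N^(-b/3).
  set σ := min τ (b / 6) / 5 with hσ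
  have hσ0 : 0 < σ := by positivity
  have hστ : 5 * σ ≤ τ := by rw [hσ]; linarith [min_le_left τ (b / 6)]
  have hσb : 5 * σ ≤ b / 6 := by rw [hσ]; linarith [min_le_right τ (b / 6)]
  -- The moment order is large enough that N² N^(-σ(n+2)) ≤ N^(-D-1).
  obtain ⟨n, hn⟩ := exists_nat_ge ((D + 4) / σ)
  rw [div_le_iff₀ hσ0] at hn
  obtain ⟨R, hR1, hbad⟩ := hbad (momentConst μ) n
  -- Since Φ ≤ N^(-δ/2), this keeps N^τ' Φ ≤ N^(-δ/4), which is small.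
  set τ' := min σ (δ / 4) with hτ'
  have hτ'0 : 0 < τ' := by positivity
  obtain ⟨N₀, hN₀⟩ := exists_threshold hσ0 hb (by positivity : 0 < δ / 4)
    (by positivity : 0 < min (ε / 2) (1 / (512 * C))) (max (2 * C₁) (R + 1))
  -- The term 70(n + 2) in D' pays for the factor N^(70(n+2)) demanded by `exists_fluctSum_tail`.
  refine ⟨τ', D + 1 + 70 * (n + 2), N₀, hτ'0, by positivity, ?_⟩
  intro N _ hN W hWN hlog f hf ζ hζ hζN g hg e z z' he hze hz1 hz2 hz're hz'1 hz'2 Ω _ P _ H hH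
  obtain ⟨hN3, hNA, hNσ, hNb, hNδ⟩ := hN₀ N hN
  have hN1 : (1 : ℝ) < N := by exact_mod_cast (by omega : 1 < N)
  have hN0 : (0 : ℝ) < N := by linarith
  have hNR : R + 1 ≤ N := (le_max_right _ _).trans hNA
  have hNC : 2 * C₁ < (N : ℝ) ^ σ := (le_max_left _ _).trans_lt hNσ
  have mono : ∀ {x y : ℝ}, x ≤ y → (N : ℝ) ^ x ≤ (N : ℝ) ^ y := fun h =>
    Real.rpow_le_rpow_of_exponent_le hN1.le h
  have hW34 : (N : ℝ) ^ (3 / 4 + b) ≤ W :=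
    rpow_le_of_le_logb hN3 (by positivity) ((le_max_left _ _).trans hlog)
  have hW2 : 2 ≤ W := by
    by_contra hcon
    have h1 : (W : ℝ) ≤ 1 := by exact_mod_cast (by omega : W ≤ 1)
    have h2 : 1 < (N : ℝ) ^ (3 / 4 + b) := Real.one_lt_rpow hN1 (by positivity)
    linarith
  have hW0 : (0 : ℝ) < W := by exact_mod_cast (by omega : 0 < W)
  have hNbε : 2 * (N : ℝ) ^ (-b) ≤ ε := by linarith [hNb.trans (min_le_left _ _)]
  have hNb0 : 0 < (N : ℝ) ^ (-b) := Real.rpow_pos_of_pos hN0 _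
  have hrow := hH.rowEnsemble
  have hz0 : 0 < z.im := lt_of_lt_of_le (Real.rpow_pos_of_pos hN0 _) hz1
  have hzle1 : z.im ≤ 1 := hz2.trans (Real.rpow_le_one_of_one_le_of_nonpos hN1.le (by linarith))
  have hN10 : ((N : ℝ) ^ 10)⁻¹ ≤ z'.im := by
    rw [Real.rpow_neg hN0.le] at hz'1
    exact_mod_cast hz'1
  have hz'0 : 0 < z'.im := lt_of_lt_of_le (by positivity) hN10
  obtain ⟨hex, hregM⟩ := hreg N W hW2 hWN f hf ζ hζ hrow.var_nonneg g z z' hN10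
    (hz'2.trans hzle1) hz'2 (by rw [hz're]; exact he.le)
    (by
      have : (N : ℝ) ^ (-a + b) ≤ (N : ℝ) ^ (-b) := mono (by linarith)
      linarith)
    (fun i => by
      have h1 : (W : ℝ) ^ (-(3 / 4) : ℝ) ≤ (N : ℝ) ^ (-b) := by
        calc (W : ℝ) ^ (-(3 / 4) : ℝ) ≤ ((N : ℝ) ^ (3 / 4 + b)) ^ (-(3 / 4) : ℝ) :=
              Real.rpow_le_rpow_of_nonpos (Real.rpow_pos_of_pos hN0 _) hW34 (by norm_num)
          _ = (N : ℝ) ^ ((3 / 4 + b) * -(3 / 4)) := by rw [← Real.rpow_mul hN0.le]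
          _ ≤ _ := mono (by linarith)
      linarith [hg i])
    (by
      refine (Complex.norm_le_abs_re_add_abs_im _).trans ?_
      have h1 : |(z - z').re| ≤ (N : ℝ) ^ (-b) := by
        rw [Complex.sub_re, hz're]
        exact hze.trans (mono (by linarith))
      have h2 : |(z - z').im| ≤ (N : ℝ) ^ (-b) := by
        rw [Complex.sub_im, abs_of_nonneg (by linarith)]
        linarith
      linarith)
  refine ⟨hex, fun M hM Φ hΦ hWΦ hΦδ hprob => ?_⟩
  have hRg := hregM M hM
  simp only [resolvent_eq_res] at hprob ⊢
  set w : ZMod N → ℂ := fun i => g i + specParam W z z' i with hw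
  set S := varMat W f ζ with hS
  set φ := (N : ℝ) ^ τ' * Φ with hφ
  have hNτ' : 1 ≤ (N : ℝ) ^ τ' := Real.one_le_rpow hN1.le hτ'0.le
  have hφ0 : 0 < φ := by positivity
  have hΦφ : Φ ≤ φ := le_mul_of_one_le_left hΦ.le hNτ'
  have hφsmall : φ ≤ 1 / (512 * C) := by
    have h1 : Φ ≤ (N : ℝ) ^ (-(δ / 2)) := by
      refine (pow_le_pow_iff_left₀ hΦ.le (Real.rpow_nonneg hN0.le _) two_ne_zero).1 ?_
      rw [← Real.rpow_natCast, ← Real.rpow_natCast, ← Real.rpow_mul hN0.le, Real.rpow_natCast]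
      refine hΦδ.trans (le_of_eq ?_)
      congr 1; push_cast; ring
    calc φ ≤ (N : ℝ) ^ (δ / 4) * (N : ℝ) ^ (-(δ / 2)) := by
          rw [hφ]
          exact mul_le_mul (mono (min_le_right _ _)) h1 hΦ.le (Real.rpow_nonneg hN0.le _)
      _ = (N : ℝ) ^ (-(δ / 4)) := by rw [← Real.rpow_add hN0]; congr 1; ring
      _ ≤ _ := hNδ.trans (min_le_right _ _)
  have hCφ : C * φ ≤ 1 / 512 := by
    rw [le_div_iff₀ (by positivity)] at hφsmall
    linarith
  have hφc : φ ≤ (1 / 8) ^ 2 / 8 := by nlinarith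
  have hWφ : 1 / (W : ℝ) ≤ φ ^ 2 := by
    rw [one_div]
    exact hWΦ.trans (by gcongr)
  let E : Set Ω := ⋃ p : ZMod N × ZMod N,
    {ω | φ ≤ ‖(res w (H ω) - Matrix.diagonal M) p.1 p.2‖}
  have hE : MeasurableSet E := by
    refine MeasurableSet.iUnion fun p => measurableSet_le measurable_const ?_
    exact (((measurable_res w p.1 p.2).comp hrow.measurable).sub measurable_const).norm
  have hEprob : P.real E ≤ (N : ℝ) ^ (-(D + 1 + 70 * (n + 2))) := by
    refine (measureReal_mono ?_).trans hprob
    intro ω hω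
    obtain ⟨p, hp⟩ := Set.mem_iUnion.1 hω
    exact le_trans (α := ℝ) hp (le_maxNorm (res w (H ω) - Matrix.diagonal M) p.1 p.2)
  have hE70 : P.real E * (N : ℝ) ^ (70 * (n + 2)) ≤ 1 := by
    calc _ ≤ (N : ℝ) ^ (-(D + 1 + 70 * (n + 2))) * (N : ℝ) ^ (70 * (n + 2)) := by gcongr
      _ = (N : ℝ) ^ (-(D + 1)) := by
        rw [← Real.rpow_natCast, ← Real.rpow_add hN0]; congr 1; push_cast; ring
      _ ≤ 1 := Real.rpow_le_one_of_one_le_of_nonpos hN1.le (by linarith)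
  set s := (N : ℝ) ^ σ with hs
  have hs1 : 1 ≤ s := Real.one_le_rpow hN1.le hσ0.le
  have hs0 : 0 < s := by linarith
  obtain ⟨𝓑, h𝓑, hgood⟩ := hbad hRg hrow hφ0 hφc (by linarith) hWφ hE
    (fun ω hω i j => by
      by_contra hcon
      exact hω (Set.mem_iUnion.2 ⟨(i, j), (not_le.1 hcon).le⟩)) hE70 s hs1
  have h𝓑D : P.real 𝓑 ≤ (N : ℝ) ^ (-D) :=
    le_rpow_neg_of_le hN1 hR1 hNR hn hσ0 h𝓑 hEprob
  exact weak_estimates hN1 hW0 hz0 hzle1 hRg.nonneg hΦ hz1 hC₁ hσ0 hστ hσb hNC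
    (min_le_left _ _) h𝓑D hgood
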